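/- **Lemma 5.1 (Aubin–Nitsche, a posteriori).** *Setting.* Let $d\in\{2,3\}$ and let $\mathcal T_h$ be a finite matching simplicial mesh in $\mathbb R^d$ (any two closed $d$-simplices of it meet in the possibly empty simplex spanned by their common vertices). Let $\Omega$ be the interior of the union of its elements (for instance a Lipschitz polytopal domain meshed by $\mathcal T_h$). Let $\mathcal F_h$ be the set of faces; the set of exterior faces (those belonging to exactly one element) is split into disjoint sets $\mathcal F_h^{\rm D},\mathcal F_h^{\rm N},\mathcal F_h^{\rm R}$, which cover the boundary parts $\Gamma_{\rm D},\Gamma_{\rm N},\Gamma_{\rm R}$. Each face $F$ has a fixed unit normal $\boldsymbol n_F$, equal to the outward normal $\boldsymbol n$ if $F$ is exterior. The coefficients $\mu>0$ and $\boldsymbol A$ (real symmetric positive definite) are constant on each element $K$, with values $\mu_K,\boldsymbol A_K$, and $\gamma>0$ is constant on each $F\in\mathcal F_h^{\rm R}$, with value $\gamma_F$. Let $\omega>0$ and let $p\ge1$ be an integer. Set $\alpha_K:=\min_{|\xi|=1}\boldsymbol A_K\xi\cdot\xi$ and $\vartheta_K:=\sqrt{\alpha_K/\mu_K}$; for $F\in\mathcal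 F_h^{\rm R}$, set $\alpha_F:=\alpha_K$ for the element $K$ having $F$ as a face, and $\vartheta_F:=\alpha_F/\gamma_F$; $h_K,h_F$ are diameters. Functions are complex valued, $(\cdot,\cdot)$ denotes $L^2$ inner products (antilinear in the second argument), and $\|\cdot\|_{w}^2=(w\,\cdot,\cdot)$ for a weight $w$. *Spaces.* $H^1_{\Gamma_{\rm D}}(\Omega)$ is the set of $v\in H^1(\Omega)$ with zero trace on $\Gamma_{\rm D}$, and $H^1(\mathcal T_h)$ is the set of $v\in L^2(\Omega)$ with $v|_K\in H^1(K)$ for all $K$; on $H^1(\mathcal T_h)$, $\boldsymbol\nabla$ is the element-wise gradient. $\boldsymbol X_{\Gamma_{\rm N}}({\rm div},\Omega)$ is the set of $\boldsymbol w\in\boldsymbol H({\rm div},\Omega)$ such that $\boldsymbol w\cdot\boldsymbol n=0$ on $\Gamma_{\rm N}$ and $\boldsymbol w\cdot\boldsymbol n=g\in L^2(\Gamma_{\rm R})$ on $\Gamma_{\rm R}$, in the weak sense that $(\boldsymbol w,\boldsymbol\nabla v)_\Omega+({\rm div}\,\boldsymbol w,v)_\Omega=(g,v)_{\Gamma_{\rm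 R}}$ for all $v\in H^1_{\Gamma_{\rm D}}(\Omega)$. $\mathcal P_p(\mathcal T_h)$ is the space of functions that are polynomials of total degree at most $p$ on each element, and $\boldsymbol{\mathcal P}_p(\mathcal T_h):=[\mathcal P_p(\mathcal T_h)]^d$. *Helmholtz problem.* For $\phi,v\in H^1_{\Gamma_{\rm D}}(\Omega)$ let $$b(\phi,v):=-\omega^2(\mu\phi,v)_\Omega-i\omega(\gamma\phi,v)_{\Gamma_{\rm R}}+(\boldsymbol A\boldsymbol\nabla\phi,\boldsymbol\nabla v)_\Omega .$$ Let $|||v|||^2:=\omega^2\|v\|_\mu^2+\omega\|v\|_{\gamma,\Gamma_{\rm R}}^2+\|\boldsymbol\nabla v\|_{\boldsymbol A}^2$, and assume well-posedness: there is $\gamma_{\rm st}>0$ such that for every $\phi\in H^1_{\Gamma_{\rm D}}(\Omega)$ with $|||\phi|||=1$ there is $v\in H^1_{\Gamma_{\rm D}}(\Omega)$ with $|||v|||=1$ and ${\rm Re}\,b(\phi,v)\ge1/\gamma_{\rm st}$. Let $f\in L^2(\Omega)$ and let $u\in H^1_{\Gamma_{\rm D}}(\Omega)$ satisfy $b(u,v)=(f,v)_\Omega$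 for all $v\in H^1_{\Gamma_{\rm D}}(\Omega)$. *IPDG problem.* Let $\phi\in H^1(\mathcal T_h)$. The jump $[\![\phi]\!]_F$ is $\phi_+\boldsymbol n_+\cdot\boldsymbol n_F+\phi_-\boldsymbol n_-\cdot\boldsymbol n_F$ on interior faces (with $\phi_\pm$ the traces from the two elements sharing $F$ and $\boldsymbol n_\pm$ their outward normals), $\phi|_F$ if $F\in\mathcal F_h^{\rm D}$, and $0$ on the other exterior faces. The average $\{\!\{\boldsymbol w\}\!\}_F$ is $\frac12(\boldsymbol w_++\boldsymbol w_-)$ on interior faces and $\boldsymbol w|_F$ on exterior faces. The lifting $\mathfrak L(\phi)\in\boldsymbol{\mathcal P}_p(\mathcal T_h)$ is defined by $(\mathfrak L(\phi),\boldsymbol w_h)=\sum_{F\in\mathcal F_h}([\![\phi]\!]_F,\{\!\{\boldsymbol w_h\}\!\}_F\cdot\boldsymbol n_F)_F$ for all $\boldsymbol w_h\in\boldsymbol{\mathcal P}_p(\mathcal T_h)$, and $\mathfrak G(\phi):=\boldsymbol\nabla\phi-\mathfrak L(\phi)$. Let $s_h$ be any sesquilinear form on $H^1(\mathcal T_h)$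 with $s_h(\phi,v)=0$ whenever $\phi$ or $v$ belongs to $H^1_{\Gamma_{\rm D}}(\Omega)$, and let $$b_h(\phi,v):=-\omega^2(\mu\phi,v)-i\omega(\gamma\phi,v)_{\mathcal F_h^{\rm R}}+(\boldsymbol A\mathfrak G(\phi),\mathfrak G(v))+s_h(\phi,v).$$ Let $u_h\in\mathcal P_p(\mathcal T_h)$ be any function with $b_h(u_h,v_h)=(f,v_h)$ for all $v_h\in\mathcal P_p(\mathcal T_h)$ (no uniqueness is required). *Mesh-dependent norms.* $$\|v\|_{\dagger,1}^2:=\sum_K\Big\{\max\Big(1,\tfrac{\omega^2h_K^2}{\vartheta_K^2}\Big)\tfrac{\alpha_K}{h_K^2}\|v\|_K^2+\|\mathfrak G(v)\|_{\boldsymbol A,K}^2\Big\}+\sum_{F\in\mathcal F_h^{\rm R}}\max\Big(1,\tfrac{\omega h_F}{\vartheta_F}\Big)\tfrac{\alpha_F}{h_F}\|v\|_F^2,$$ $$\|\boldsymbol w\|_{\dagger,{\rm div}}^2:=\sum_K\Big\{\|\boldsymbol w\|_{\boldsymbol A^{-1},K}^2+\tfrac{h_K^2}{\alpha_K}\|{\rm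 div}\,\boldsymbol w\|_K^2\Big\}+\sum_{F\in\mathcal F_h^{\rm R}}\tfrac{h_F}{\alpha_F}\|\boldsymbol w\cdot\boldsymbol n\|_F^2 .$$ *Approximation factors.* For $\psi\in L^2(\Omega)$ and $\Psi\in L^2(\Gamma_{\rm R})$ let $u^\star_\psi,U^\star_\Psi\in H^1_{\Gamma_{\rm D}}(\Omega)$ solve $b(w,u^\star_\psi)=\omega(\mu w,\psi)_\Omega$ and $b(w,U^\star_\Psi)=\omega^{1/2}(\gamma w,\Psi)_{\Gamma_{\rm R}}$ for all $w\in H^1_{\Gamma_{\rm D}}(\Omega)$. For $z\in H^1_{\Gamma_{\rm D}}(\Omega)$ with $\boldsymbol A\boldsymbol\nabla z\in\boldsymbol X_{\Gamma_{\rm N}}({\rm div},\Omega)$ let $\varepsilon_{\rm g}(z)$ be the distance, in the norm $\|\cdot\|_{\dagger,1}$, from $z$ to $\mathcal P_p(\mathcal T_h)\cap H^1_{\Gamma_{\rm D}}(\Omega)$, and let $\varepsilon_{\rm d}(z)$ be the distance, in the norm $\|\cdot\|_{\dagger,{\rm div}}$, from $\boldsymbol A\boldsymbol\nabla z$ to $\boldsymbol{\mathcal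 P}_p(\mathcal T_h)\cap\boldsymbol X_{\Gamma_{\rm N}}({\rm div},\Omega)$. Then $$\check\gamma_{\rm ba}^2:=\Big(\sup_{\|\psi\|_\mu=1}\varepsilon_{\rm g}(u^\star_\psi)\Big)^2+\Big(\sup_{\|\psi\|_\mu=1}\varepsilon_{\rm d}(u^\star_\psi)\Big)^2,\qquad\tilde\gamma_{\rm ba}^2:=\Big(\sup_{\|\Psi\|_{\gamma,\Gamma_{\rm R}}=1}\varepsilon_{\rm g}(U^\star_\Psi)\Big)^2+\Big(\sup_{\|\Psi\|_{\gamma,\Gamma_{\rm R}}=1}\varepsilon_{\rm d}(U^\star_\Psi)\Big)^2$$ (suprema in $[0,\infty]$). *Estimator.* Let $${\rm R}_{\rm r}:=\sup_{v\in H^1_{\Gamma_{\rm D}}(\Omega),\ \|\boldsymbol\nabla v\|_{\boldsymbol A}=1}|b_h(u-u_h,v)|,\qquad{\rm R}_{\rm c}:=\min_{s\in H^1_{\Gamma_{\rm D}}(\Omega)}\|u_h-s\|_{\dagger,1},\qquad{\rm R}^2:={\rm R}_{\rm r}^2+{\rm R}_{\rm c}^2.$$ *Claim.* $$\omega\|u-u_h\|_{\mu}\le\check\gamma_{\rm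 ba}\,{\rm R},\qquad\omega^{1/2}\|u-u_h\|_{\gamma,\mathcal F_h^{\rm R}}\le\tilde\gamma_{\rm ba}\,{\rm R}.$$ -/

import Mathlib

open MeasureTheory Filter Topology
open scoped ENNReal Matrix

namespace IPDG

noncomputable section

open scoped Classical

/-! ### Function spaces on open sets -/

/-- The Euclidean space `ℝ^d`. -/
abbrev E (d : ℕ) := EuclideanSpace ℝ (Fin d)

variable {d : ℕ}

/-- The `i`-th partial derivative of a function on `ℝ^d`. -/
def pderiv {V : Type*} [NormedAddCommGroup V] [NormedSpace ℝ V] (i : Fin d) (φ : E d → V)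
    (x : E d) : V :=
  fderiv ℝ φ x (EuclideanSpace.single i 1)

/-- Smooth real functions with compact support in `D`. -/
def IsTest (D : Set (E d)) (φ : E d → ℝ) : Prop :=
  ContDiff ℝ ((⊤ : ℕ∞) : WithTop ℕ∞) φ ∧ HasCompactSupport φ ∧ tsupport φ ⊆ D

/-- `v ∈ L²(D)`. -/
def MemL2 (D : Set (E d)) (v : E d → ℂ) : Prop :=
  MemLp v 2 (volume.restrict D)

/-- `w ∈ L²(D)^d`. -/
def MemL2Vec (D : Set (E d)) (w : E d → Fin d → ℂ) : Prop :=
  ∀ i, MemL2 D (fun x => w x i)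

/-- `g` is the gradient of `v` in `D` in the sense of distributions. -/
def IsWeakGrad (D : Set (E d)) (v : E d → ℂ) (g : E d → Fin d → ℂ) : Prop :=
  ∀ φ, IsTest D φ → ∀ i,
    ∫ x in D, ((pderiv i φ x : ℝ) : ℂ) * v x = - ∫ x in D, (φ x : ℂ) * g x i

/-- `q` is the divergence of `w` in `D` in the sense of distributions. -/
def IsWeakDiv (D : Set (E d)) (w : E d → Fin d → ℂ) (q : E d → ℂ) : Prop :=
  ∀ φ, IsTest D φ →
    ∫ x in D, ∑ i, ((pderiv i φ x : ℝ) : ℂ) * w x i = - ∫ x in D, (φ x : ℂ) * q x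

/-- The Sobolev space `H¹(D)`. -/
def MemH1 (D : Set (E d)) (v : E d → ℂ) : Prop :=
  MemL2 D v ∧ ∃ g, MemL2Vec D g ∧ IsWeakGrad D v g

/-- The space `H(div, D)`. -/
def MemHdiv (D : Set (E d)) (w : E d → Fin d → ℂ) : Prop :=
  MemL2Vec D w ∧ ∃ q, MemL2 D q ∧ IsWeakDiv D w q

/-- The weak gradient (unique almost everywhere) of `v ∈ H¹(D)`; zero for other `v`. -/
def wgrad (D : Set (E d)) (v : E d → ℂ) : E d → Fin d → ℂ :=
  if h : ∃ g, MemL2Vec D g ∧ IsWeakGrad D v g then h.choose else 0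

/-- The weak divergence (unique almost everywhere) of `w ∈ H(div, D)`; zero for other `w`. -/
def wdiv (D : Set (E d)) (w : E d → Fin d → ℂ) : E d → ℂ :=
  if h : ∃ q, MemL2 D q ∧ IsWeakDiv D w q then h.choose else 0

/-! ### Simplices, given by their finite sets of vertices -/

/-- The closed simplex spanned by a set of vertices. -/
def body (K : Finset (E d)) : Set (E d) := convexHull ℝ (K : Set (E d))

/-- The open simplex: the interior of a `d`-dimensional simplex. -/
def cell (K : Finset (E d)) : Set (E d) := interior (body K)

/-- The `(d-1)`-dimensional faces of a `d`-simplex. -/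
def facesOf (K : Finset (E d)) : Finset (Finset (E d)) := K.powersetCard d

/-- The diameter `h_K`, `h_F` of an element or of a face. -/
def size (K : Finset (E d)) : ℝ := Metric.diam (body K)

/-- The `(d-1)`-dimensional surface measure on a face. -/
def surf (F : Finset (E d)) : Measure (E d) := (μHE[d - 1]).restrict (body F)

/-- The unit normal vector `n_K` on the face `F` of the simplex `K`, pointing outside `K`:
the normalized component orthogonal to `F` of the vector from the barycentre of `K` to the
barycentre of `F`. -/
def nrm (K F : Finset (E d)) : E d :=
  let w : E d := (vectorSpan ℝ (F : Set (E d)))ᗮ.starProjection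
    (F.centroid ℝ (id : E d → E d) - K.centroid ℝ (id : E d → E d))
  (‖w‖⁻¹ : ℝ) • w

/-- `g ∈ L²(∂K)` is the trace of `v ∈ H¹(K)`: some sequence of functions that are smooth up to
the boundary converges to `v` in `H¹(K)` and to `g` in `L²(F)` for all faces `F` of `K`. -/
def IsTrace (K : Finset (E d)) (v g : E d → ℂ) : Prop :=
  (∀ F ∈ facesOf K, MemLp g 2 (surf F)) ∧
  ∃ Φ : ℕ → E d → ℂ, (∀ n, ContDiff ℝ ((⊤ : ℕ∞) : WithTop ℕ∞) (Φ n)) ∧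
    Tendsto (fun n => eLpNorm (fun x => Φ n x - v x) 2 (volume.restrict (cell K))) atTop (𝓝 0) ∧
    (∀ i, Tendsto (fun n => eLpNorm (fun x => pderiv i (Φ n) x - wgrad (cell K) v x i) 2
      (volume.restrict (cell K))) atTop (𝓝 0)) ∧
    (∀ F ∈ facesOf K,
      Tendsto (fun n => eLpNorm (fun x => Φ n x - g x) 2 (surf F)) atTop (𝓝 0))

/-- The trace on `∂K` (unique almost everywhere) of `v ∈ H¹(K)`. -/
def trace (K : Finset (E d)) (v : E d → ℂ) : E d → ℂ :=
  if h : ∃ g, IsTrace K v g then h.choose else 0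

/-- Functions on (parts of) the skeleton of a mesh, as families `F ↦ Ψ F`: this represents
`⨁_F L²(F)`, in particular `L²(Γ_R)` when `F` runs through the Robin faces. -/
abbrev FaceFun (d : ℕ) := Finset (E d) → E d → ℂ

/-! ### Matching simplicial meshes -/

/-- A finite matching simplicial mesh; an element is given by its `d + 1` vertices. -/
structure Mesh (d : ℕ) where
  cells : Finset (Finset (E d))
  nonempty : cells.Nonempty
  card_cell : ∀ K ∈ cells, K.card = d + 1
  indep : ∀ K ∈ cells, AffineIndependent ℝ ((↑) : K → E d)
  /-- two elements meet in the simplex spanned by their common vertices (possibly empty) -/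
  matching : ∀ K ∈ cells, ∀ L ∈ cells,
    body K ∩ body L = convexHull ℝ ((K : Set (E d)) ∩ (L : Set (E d)))

namespace Mesh

variable (T : Mesh d)

/-- The open set covered by the mesh. -/
def Ω : Set (E d) := interior (⋃ K ∈ T.cells, body K)

/-- The set `𝓕_h` of all faces. -/
def faces : Finset (Finset (E d)) := T.cells.biUnion facesOf

/-- The elements having `F` as a face. -/
def cellsOf (F : Finset (E d)) : Finset (Finset (E d)) := T.cells.filter (fun K => F ⊆ K)

/-- The exterior faces, i.e. those that belong to exactly one element. -/
def extFaces : Finset (Finset (E d)) := T.faces.filter (fun F => (T.cellsOf F).card = 1)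

/-- The broken Sobolev space `H¹(𝓣_h)`. -/
def MemH1T (v : E d → ℂ) : Prop :=
  MemL2 T.Ω v ∧ ∀ K ∈ T.cells, MemH1 (cell K) v

/-- The element-wise weak gradient. -/
def bgrad (v : E d → ℂ) (x : E d) : Fin d → ℂ :=
  ∑ K ∈ T.cells, (cell K).indicator (wgrad (cell K) v) x

/-- The trace on an exterior face `F`, taken from the only element having `F` as a face. -/
def extTrace (v : E d → ℂ) : FaceFun d := fun F x => ∑ K ∈ T.cellsOf F, trace K v x

/-- The inner product `(φ, v)` of `L²(Ω)`. -/
def l2 (φ v : E d → ℂ) : ℂ := ∑ K ∈ T.cells, ∫ x in cell K, φ x * star (v x)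

/-- The inner product `(w, z)` of `L²(Ω)^d`. -/
def l2Vec (w z : E d → Fin d → ℂ) : ℂ := ∑ K ∈ T.cells, ∫ x in cell K, w x ⬝ᵥ star (z x)

/-- The polynomial space `𝓟_p(𝓣_h)`. -/
def MemP (p : ℕ) (v : E d → ℂ) : Prop :=
  ∀ K ∈ T.cells, ∃ q : MvPolynomial (Fin d) ℂ, q.totalDegree ≤ p ∧
    ∀ᵐ x ∂(volume.restrict (cell K)), v x = MvPolynomial.eval (fun i => ((x i : ℝ) : ℂ)) q

/-- The vector-valued polynomial space `𝓟_p(𝓣_h)^d`. -/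
def MemPVec (p : ℕ) (w : E d → Fin d → ℂ) : Prop := ∀ i, T.MemP p (fun x => w x i)

/-- The average of `w` on the face `F`. -/
def avg (w : E d → Fin d → ℂ) (F : Finset (E d)) (x : E d) (i : Fin d) : ℂ :=
  ((T.cellsOf F).card : ℂ)⁻¹ * ∑ K ∈ T.cellsOf F, trace K (fun y => w y i) x

end Mesh

/-! ### The Helmholtz setting -/

/-- The data of the problem: a mesh, the decomposition of the exterior faces according to the
three types of boundary conditions, an orientation of the faces, piecewise constant coefficients,
the frequency and the polynomial degree. -/
structure Setting (d : ℕ) extends Mesh d where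
  FD : Finset (Finset (E d))
  FN : Finset (Finset (E d))
  FR : Finset (Finset (E d))
  disjDN : Disjoint FD FN
  disjDR : Disjoint FD FR
  disjNR : Disjoint FN FR
  faces_union : FD ∪ FN ∪ FR = toMesh.extFaces
  /-- the fixed unit normal `n_F` -/
  nF : Finset (E d) → E d
  nF_spec : ∀ F ∈ toMesh.faces, ∃ K ∈ toMesh.cellsOf F, nF F = nrm K F
  /-- the value `μ_K` of `μ` in the element `K` -/
  μ : Finset (E d) → ℝ
  /-- the value `A_K` of `A` in the element `K` -/
  A : Finset (E d) → Matrix (Fin d) (Fin d) ℝ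
  /-- the value `γ_F` of `γ` on the Robin face `F` -/
  γ : Finset (E d) → ℝ
  μ_pos : ∀ K ∈ cells, 0 < μ K
  A_posDef : ∀ K ∈ cells, (A K).PosDef
  γ_pos : ∀ F ∈ FR, 0 < γ F
  ω : ℝ
  ω_pos : 0 < ω
  p : ℕ
  p_pos : 1 ≤ p

namespace Setting

variable (S : Setting d)

/-! #### Coefficients, weighted inner products and norms -/

/-- The complex matrix `A_K`. -/
def Ac (K : Finset (E d)) : Matrix (Fin d) (Fin d) ℂ := (S.A K).map ((↑) : ℝ → ℂ)

/-- `α_K`, the minimum of `A_K ξ · ξ` over the unit sphere. -/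
def α (K : Finset (E d)) : ℝ :=
  ⨅ ξ : Metric.sphere (0 : E d) 1, (S.A K *ᵥ (ξ : E d).ofLp) ⬝ᵥ (ξ : E d).ofLp

/-- `ϑ_K = √(α_K / μ_K)`. -/
def ϑ (K : Finset (E d)) : ℝ := √(S.α K / S.μ K)

/-- `α_F = α_K` for the only element `K` having the exterior face `F` as a face. -/
def αF (F : Finset (E d)) : ℝ := ∑ K ∈ S.cellsOf F, S.α K

/-- `ϑ_F = α_F / γ_F`. -/
def ϑF (F : Finset (E d)) : ℝ := S.αF F / S.γ F

/-- `(μ φ, v)`. -/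
def l2μ (φ v : E d → ℂ) : ℂ :=
  ∑ K ∈ S.cells, (S.μ K : ℂ) * ∫ x in cell K, φ x * star (v x)

/-- `(A w, z)`. -/
def l2A (w z : E d → Fin d → ℂ) : ℂ :=
  ∑ K ∈ S.cells, ∫ x in cell K, (S.Ac K *ᵥ w x) ⬝ᵥ star (z x)

/-- `(Φ, Ψ)` on the Robin boundary. -/
def l2R (Φ Ψ : FaceFun d) : ℂ := ∑ F ∈ S.FR, ∫ x, Φ F x * star (Ψ F x) ∂(surf F)

/-- `(γ Φ, Ψ)` on the Robin boundary. -/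
def l2γ (Φ Ψ : FaceFun d) : ℂ :=
  ∑ F ∈ S.FR, (S.γ F : ℂ) * ∫ x, Φ F x * star (Ψ F x) ∂(surf F)

/-- `Ψ ∈ L²(Γ_R)`. -/
def MemL2R (Ψ : FaceFun d) : Prop := ∀ F ∈ S.FR, MemLp (Ψ F) 2 (surf F)

/-- `‖v‖_μ`. -/
def normμ (v : E d → ℂ) : ℝ := √(∑ K ∈ S.cells, S.μ K * ∫ x in cell K, ‖v x‖ ^ 2)

/-- `‖Ψ‖_γ` on the Robin boundary. -/
def normγ (Ψ : FaceFun d) : ℝ := √(∑ F ∈ S.FR, S.γ F * ∫ x, ‖Ψ F x‖ ^ 2 ∂(surf F))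

/-- `‖w‖_A`. -/
def normA (w : E d → Fin d → ℂ) : ℝ :=
  √(∑ K ∈ S.cells, ∫ x in cell K, ((S.Ac K *ᵥ w x) ⬝ᵥ star (w x)).re)

/-- The vector field `A w`. -/
def mulA (w : E d → Fin d → ℂ) (x : E d) : Fin d → ℂ :=
  ∑ K ∈ S.cells, (cell K).indicator (fun y => S.Ac K *ᵥ w y) x

/-! #### Conforming spaces and the Helmholtz problem -/

/-- The space `H¹_{Γ_D}(Ω)`. -/
def MemH1D (v : E d → ℂ) : Prop :=
  MemH1 S.Ω v ∧ ∀ F ∈ S.FD, ∀ᵐ x ∂(surf F), S.extTrace v F x = 0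

/-- The energy norm on `H¹_{Γ_D}(Ω)`. -/
def energy (v : E d → ℂ) : ℝ :=
  √(S.ω ^ 2 * S.normμ v ^ 2 + S.ω * S.normγ (S.extTrace v) ^ 2 + S.normA (wgrad S.Ω v) ^ 2)

/-- The sesquilinear form `b` on `H¹_{Γ_D}(Ω)`. -/
def b (φ v : E d → ℂ) : ℂ :=
  -(S.ω : ℂ) ^ 2 * S.l2μ φ v - Complex.I * S.ω * S.l2γ (S.extTrace φ) (S.extTrace v)
    + S.l2A (wgrad S.Ω φ) (wgrad S.Ω v)

/-- Well-posedness of the Helmholtz problem: the inf-sup constant `1 / γ_st` of `b` in the energy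
norm is positive. -/
def WellPosed : Prop :=
  ∃ γst : ℝ, 0 < γst ∧ ∀ φ, S.MemH1D φ → S.energy φ = 1 →
    ∃ v, S.MemH1D v ∧ S.energy v = 1 ∧ 1 / γst ≤ (S.b φ v).re

/-- `u ∈ H¹_{Γ_D}(Ω)` is the weak solution with right-hand side `f`. -/
def IsSolution (f u : E d → ℂ) : Prop :=
  S.MemH1D u ∧ ∀ v, S.MemH1D v → S.b u v = S.l2 f v

/-- `z = u⋆_ψ`, the solution of the adjoint problem with volume datum `ψ`. -/
def IsDualVol (ψ z : E d → ℂ) : Prop :=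
  S.MemH1D z ∧ ∀ w, S.MemH1D w → S.b w z = S.ω * S.l2μ w ψ

/-- `z = U⋆_Ψ`, the solution of the adjoint problem with Robin boundary datum `Ψ`. -/
def IsDualBd (Ψ : FaceFun d) (z : E d → ℂ) : Prop :=
  S.MemH1D z ∧ ∀ w, S.MemH1D w → S.b w z = (√S.ω : ℝ) * S.l2γ (S.extTrace w) Ψ

/-! #### Divergence-conforming spaces -/

/-- The weak normal trace of `w ∈ H(div, Ω)`, acting on `H¹_{Γ_D}(Ω)`, is `g` on `Γ_R` and `0` on
`Γ_N`. -/
def IsNormalTrace (w : E d → Fin d → ℂ) (g : FaceFun d) : Prop :=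
  ∀ v, S.MemH1D v → S.l2Vec w (wgrad S.Ω v) + S.l2 (wdiv S.Ω w) v = S.l2R g (S.extTrace v)

/-- The space `X_{Γ_N}(div, Ω)` of the `w ∈ H(div, Ω)` whose normal trace vanishes on `Γ_N` and
is square integrable on `Γ_R`. -/
def MemX (w : E d → Fin d → ℂ) : Prop :=
  MemHdiv S.Ω w ∧ ∃ g, S.MemL2R g ∧ S.IsNormalTrace w g

/-- The normal trace `w · n` on `Γ_R` (unique almost everywhere) of `w ∈ X_{Γ_N}(div, Ω)`. -/
def normalTrace (w : E d → Fin d → ℂ) : FaceFun d :=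
  if h : ∃ g, S.MemL2R g ∧ S.IsNormalTrace w g then h.choose else 0

/-! #### Jumps, lifting, discrete gradient -/

/-- The jump of `φ` through the faces. -/
def jump (φ : E d → ℂ) : FaceFun d := fun F x =>
  if F ∈ S.extFaces then
    if F ∈ S.FD then S.extTrace φ F x else 0
  else
    ∑ K ∈ S.cellsOf F, ((inner ℝ (nrm K F) (S.nF F) : ℝ) : ℂ) * trace K φ x

/-- `L` is the lifting of `φ`. -/
def IsLift (φ : E d → ℂ) (L : E d → Fin d → ℂ) : Prop :=
  S.MemPVec S.p L ∧ ∀ w, S.MemPVec S.p w →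
    S.l2Vec L w = ∑ F ∈ S.faces, ∫ x, S.jump φ F x *
      star (S.avg w F x ⬝ᵥ (fun i => ((S.nF F i : ℝ) : ℂ))) ∂(surf F)

/-- The lifting (unique almost everywhere in `Ω`) of `φ ∈ H¹(𝓣_h)`. -/
def lift (φ : E d → ℂ) : E d → Fin d → ℂ :=
  if h : ∃ L, S.IsLift φ L then h.choose else 0

/-- The discrete gradient `𝔊(φ)`. -/
def G (φ : E d → ℂ) (x : E d) : Fin d → ℂ := S.bgrad φ x - S.lift φ x

/-- The norm `‖·‖_{†,1,𝓣_h}`. -/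
def dag1 (v : E d → ℂ) : ℝ :=
  √(∑ K ∈ S.cells,
      (max 1 (S.ω ^ 2 * size K ^ 2 / S.ϑ K ^ 2) * (S.α K / size K ^ 2)
          * (∫ x in cell K, ‖v x‖ ^ 2)
        + ∫ x in cell K, ((S.Ac K *ᵥ S.G v x) ⬝ᵥ star (S.G v x)).re)
    + ∑ F ∈ S.FR, max 1 (S.ω * size F / S.ϑF F) * (S.αF F / size F)
        * ∫ x, ‖S.extTrace v F x‖ ^ 2 ∂(surf F))

/-- The norm `‖·‖_{†,div,𝓣_h}`. -/
def dagDiv (w : E d → Fin d → ℂ) : ℝ :=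
  √(∑ K ∈ S.cells,
      ((∫ x in cell K, (((S.Ac K)⁻¹ *ᵥ w x) ⬝ᵥ star (w x)).re)
        + size K ^ 2 / S.α K * ∫ x in cell K, ‖wdiv S.Ω w x‖ ^ 2)
    + ∑ F ∈ S.FR, size F / S.αF F * ∫ x, ‖S.normalTrace w F x‖ ^ 2 ∂(surf F))

/-! #### The discrete problem -/

/-- An admissible stabilization form: sesquilinear on `H¹(𝓣_h)`, and zero as soon as one of its
arguments belongs to `H¹_{Γ_D}(Ω)`. -/
structure IsStabilization (s : (E d → ℂ) → (E d → ℂ) → ℂ) : Prop where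
  add_left : ∀ φ φ' v, S.MemH1T φ → S.MemH1T φ' → S.MemH1T v → s (φ + φ') v = s φ v + s φ' v
  smul_left : ∀ (c : ℂ) φ v, S.MemH1T φ → S.MemH1T v → s (c • φ) v = c * s φ v
  add_right : ∀ φ v v', S.MemH1T φ → S.MemH1T v → S.MemH1T v' → s φ (v + v') = s φ v + s φ v'
  smul_right : ∀ (c : ℂ) φ v, S.MemH1T φ → S.MemH1T v → s φ (c • v) = star c * s φ v
  zero_left : ∀ φ v, S.MemH1D φ → S.MemH1T v → s φ v = 0
  zero_right : ∀ φ v, S.MemH1T φ → S.MemH1D v → s φ v = 0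

/-- The IPDG approximation `a_h` of `(A ∇φ, ∇v)`. -/
def ah (s : (E d → ℂ) → (E d → ℂ) → ℂ) (φ v : E d → ℂ) : ℂ :=
  S.l2A (S.G φ) (S.G v) + s φ v

/-- The sesquilinear form `b_h` on `H¹(𝓣_h)`. -/
def bh (s : (E d → ℂ) → (E d → ℂ) → ℂ) (φ v : E d → ℂ) : ℂ :=
  -(S.ω : ℂ) ^ 2 * S.l2μ φ v - Complex.I * S.ω * S.l2γ (S.extTrace φ) (S.extTrace v)
    + S.ah s φ v

/-- `uh ∈ 𝓟_p(𝓣_h)` solves the discrete problem with right-hand side `f`. -/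
def IsDiscreteSolution (s : (E d → ℂ) → (E d → ℂ) → ℂ) (f uh : E d → ℂ) : Prop :=
  S.MemP S.p uh ∧ ∀ vh, S.MemP S.p vh → S.bh s uh vh = S.l2 f vh

/-! #### Best approximation errors and approximation factors -/

/-- `‖v - π_h^g v‖_{†,1}`: the distance from `v` to `𝓟_p(𝓣_h) ∩ H¹_{Γ_D}(Ω)`. -/
def errhg (v : E d → ℂ) : ℝ≥0∞ :=
  ⨅ (vh : E d → ℂ) (_ : S.MemP S.p vh ∧ S.MemH1D vh), ENNReal.ofReal (S.dag1 (v - vh))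

/-- `‖w - π_h^d w‖_{†,div}`: the distance from `w` to `𝓟_p(𝓣_h)^d ∩ X_{Γ_N}(div, Ω)`. -/
def errhd (w : E d → Fin d → ℂ) : ℝ≥0∞ :=
  ⨅ (wh : E d → Fin d → ℂ) (_ : S.MemPVec S.p wh ∧ S.MemX wh), ENNReal.ofReal (S.dagDiv (w - wh))

/-- `‖v - π^g v‖_{†,1}`: the distance from `v` to `H¹_{Γ_D}(Ω)`. -/
def errg (v : E d → ℂ) : ℝ≥0∞ :=
  ⨅ (z : E d → ℂ) (_ : S.MemH1D z), ENNReal.ofReal (S.dag1 (v - z))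

/-- The approximation factor for volume data, gradient-conforming part. -/
def γbaVolG : ℝ≥0∞ :=
  ⨆ (ψ : E d → ℂ) (z : E d → ℂ) (_ : MemL2 S.Ω ψ ∧ S.normμ ψ = 1 ∧ S.IsDualVol ψ z), S.errhg z

/-- The approximation factor for volume data, divergence-conforming part. -/
def γbaVolD : ℝ≥0∞ :=
  ⨆ (ψ : E d → ℂ) (z : E d → ℂ) (_ : MemL2 S.Ω ψ ∧ S.normμ ψ = 1 ∧ S.IsDualVol ψ z),
    S.errhd (S.mulA (wgrad S.Ω z))

/-- The approximation factor for Robin data, gradient-conforming part. -/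
def γbaBdG : ℝ≥0∞ :=
  ⨆ (Ψ : FaceFun d) (z : E d → ℂ) (_ : S.MemL2R Ψ ∧ S.normγ Ψ = 1 ∧ S.IsDualBd Ψ z), S.errhg z

/-- The approximation factor for Robin data, divergence-conforming part. -/
def γbaBdD : ℝ≥0∞ :=
  ⨆ (Ψ : FaceFun d) (z : E d → ℂ) (_ : S.MemL2R Ψ ∧ S.normγ Ψ = 1 ∧ S.IsDualBd Ψ z),
    S.errhd (S.mulA (wgrad S.Ω z))

/-- The approximation factor `γ̌_ba` for volume data. -/
def γbaVol : ℝ≥0∞ := (S.γbaVolG ^ 2 + S.γbaVolD ^ 2) ^ (1 / 2 : ℝ)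

/-- The approximation factor `γ̃_ba` for Robin data. -/
def γbaBd : ℝ≥0∞ := (S.γbaBdG ^ 2 + S.γbaBdD ^ 2) ^ (1 / 2 : ℝ)

/-! #### The abstract estimator -/

/-- The dual norm `R_r` of the residual functional `v ↦ b_h(e, v)`. -/
def Rr (s : (E d → ℂ) → (E d → ℂ) → ℂ) (e : E d → ℂ) : ℝ≥0∞ :=
  ⨆ (v : E d → ℂ) (_ : S.MemH1D v ∧ S.normA (wgrad S.Ω v) = 1), ENNReal.ofReal ‖S.bh s e v‖

/-- The abstract estimator `R`, with `R² = R_r² + R_c²`, where `R_c = ‖uh - π^g uh‖_{†,1}`. -/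
def R (s : (E d → ℂ) → (E d → ℂ) → ℂ) (u uh : E d → ℂ) : ℝ≥0∞ :=
  (S.Rr s (u - uh) ^ 2 + S.errg uh ^ 2) ^ (1 / 2 : ℝ)

end Setting

end

end IPDG

namespace IPDG

noncomputable section

open scoped Classical

variable {d : ℕ}

/-! ### Abstract variational problems in complete semi-normed spaces -/

section Abstract

/-! Put e = u - u_h. The proof is an Aubin–Nitsche duality argument in which the nonconformity of
u_h enters through a single functional, `Setting.defect φ τ` = (𝔊(φ), τ) + (φ, div τ) - (φ,
τ·n)_{Γ_R}, for φ in the broken space and τ in X_{Γ_N}(div, Ω). It vanishes in two situations. If φ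
is in H¹_{Γ_D}(Ω), then 𝔊(φ) = ∇φ and the vanishing is the definition of the weak normal trace
(`defect_eq_zero_of_memH1D`). If τ is piecewise polynomial, element-wise integration by parts leaves
the face terms ([φ], {τ}·n_F)_F, and these are exactly what the lifting inside 𝔊 removes
(`defect_eq_zero_of_memPVec`). Hence, for every conforming s and every discrete τ_h in X_{Γ_N},
defect(e, τ) = -defect(u_h - s, τ - τ_h), and the weighted Cauchy–Schwarz inequality bounds this by
‖u_h - s‖_{†,1} ‖τ - τ_h‖_{†,div} (`norm_defect_le`, `norm_defect_error_le`).

Let ξ solve the adjoint problem with volume density q and Robin density r. Testing its equation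
shows that the flux A∇ξ lies in X_{Γ_N}(div, Ω), with divergence -ω²μξ - q and normal trace r -
iωγξ. Inserting this in the defect gives, for every broken φ, (φ, q) + (φ, r)_{Γ_R} = b_h(φ, ξ) -
defect(φ, A∇ξ) (`defect_flux`). For φ = e and data proportional to e, the left side is the error
norm to be bounded. In the term b_h(e, ξ), a conforming discrete v_h may be subtracted from ξ,
because v_h is admissible in both the continuous and the discrete problem and s_h vanishes on it;
what remains is at most R_r ‖∇(ξ - v_h)‖_A. Taking infima bounds the error by ε_g(ξ) R_r + ε_d(ξ)
R_c (`norm_dual_le`), and the Cauchy–Schwarz inequality in ℝ² finishes.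

The adjoint solution exists because the inf-sup condition bounds φ ↦ b(φ, ·) from below, and
H¹_{Γ_D}(Ω) is complete for the energy norm (`exists_dual_solution`, `exists_energy_limit`,
`exists_adjoint_solution`).

The rest is analysis on simplices and meshes: the divergence theorem (`IsSimplex.integral_fderiv`),
approximation by smooth functions on convex sets (`exists_smooth_approx`), traces on faces
(`IsSimplex.trace_inequality`, `IsSimplex.exists_isTrace`), opposite normals on shared faces
(`Mesh.nrm_eq_neg`), and a fundamental lemma on a single face (`Mesh.ae_eq_zero_of_integral_surf`),
which turns integral identities into statements about jumps and normal components. -/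

theorem exists_factor {V W : Type*} [AddCommGroup V] [Module ℂ V] [AddCommGroup W] [Module ℂ W]
    (L : V →ₗ[ℂ] W) (m : V →ₗ[ℂ] ℂ) (h : ∀ v, L v = 0 → m v = 0) :
    ∃ k : LinearMap.range L →ₗ[ℂ] ℂ, ∀ v, k (L.rangeRestrict v) = m v := by
  obtain ⟨s, hs⟩ := L.rangeRestrict.exists_rightInverse_of_surjective L.range_rangeRestrict
  refine ⟨m ∘ₗ s, fun v => ?_⟩
  have h1 : L.rangeRestrict (s (L.rangeRestrict v)) = L.rangeRestrict v :=
    LinearMap.congr_fun hs _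
  have h2 : L (s (L.rangeRestrict v) - v) = 0 := by
    rw [map_sub, sub_eq_zero]
    exact congrArg Subtype.val h1
  simpa [sub_eq_zero] using h _ h2

variable {V : Type*} [SeminormedAddCommGroup V] [InnerProductSpace ℂ V]

-- Represent b(φ, ·) by a vector Lφ of the separated Hilbert space. The inf-sup condition says that
-- L is bounded below, so l factors through the range of L as a bounded functional. Hahn–Banach
-- extends that functional and the Riesz theorem represents the extension; a preimage of the
-- representing vector is z. The range of L need not be dense, since z is not claimed to be unique.
-- The separation quotient appears because functions that agree almost everywhere are distinct
-- vectors of V.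
open SeparationQuotient in
theorem exists_dual_solution [CompleteSpace V] (b : V →ₗ[ℂ] V →ₛₗ[starRingEnd ℂ] ℂ) (C : ℝ)
    (hb : ∀ φ v, ‖b φ v‖ ≤ C * ‖φ‖ * ‖v‖) (c : ℝ) (hc : 0 < c)
    (hinf : ∀ φ, ‖φ‖ = 1 → ∃ v, ‖v‖ = 1 ∧ c ≤ (b φ v).re)
    (l : V →ₗ[ℂ] ℂ) (M : ℝ) (hl : ∀ φ, ‖l φ‖ ≤ M * ‖φ‖) :
    ∃ z, ∀ w, b w z = l w := by
  have hb' : ∀ φ v, ‖b φ v‖ ≤ |C| * ‖φ‖ * ‖v‖ := fun φ v =>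
    (hb φ v).trans (mul_le_mul_of_nonneg_right (mul_le_mul_of_nonneg_right (le_abs_self C)
      (norm_nonneg _)) (norm_nonneg _))
  -- the linear functional `v ↦ conj (b φ v)` on the quotient
  have key : ∀ φ : V, ∃ y : SeparationQuotient V,
      ∀ v : V, inner ℂ (mk v) y = b φ v := by
    intro φ
    let f : V →ₗ[ℂ] ℂ :=
      { toFun := fun v => (starRingEnd ℂ) (b φ v)
        map_add' := fun x y => by simp
        map_smul' := fun a x => by simp }
    let F : V →L[ℂ] ℂ := f.mkContinuous (|C| * ‖φ‖) (fun v => by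
      simpa [f] using hb' φ v)
    have hF : ∀ x y, Inseparable x y → F x = F y := fun x y h => (h.map F.continuous).eq
    let Fq : StrongDual ℂ (SeparationQuotient V) := SeparationQuotient.liftCLM F hF
    refine ⟨(InnerProductSpace.toDual ℂ _).symm Fq, fun v => ?_⟩
    rw [← inner_conj_symm, InnerProductSpace.toDual_symm_apply]
    simp [Fq, F, f]
  choose T hT using key
  have ext' : ∀ y y' : SeparationQuotient V, (∀ v : V, inner ℂ (mk v) y = inner ℂ (mk v) y') →
      y = y' := by
    intro y y' h
    refine ext_inner_left ℂ fun v => ?_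
    obtain ⟨v, rfl⟩ := surjective_mk v
    exact h v
  let L : V →ₗ[ℂ] SeparationQuotient V :=
    { toFun := T
      map_add' := fun x y => ext' _ _ fun v => by rw [inner_add_right, hT, hT, hT]; simp
      map_smul' := fun a x => ext' _ _ fun v => by rw [inner_smul_right, hT, hT]; simp }
  have hlow : ∀ φ, c * ‖φ‖ ≤ ‖L φ‖ := by
    intro φ
    rcases eq_or_ne ‖φ‖ 0 with h0 | h0
    · rw [h0]; simp
    have hpos : 0 < ‖φ‖ := lt_of_le_of_ne (norm_nonneg _) (Ne.symm h0)
    obtain ⟨v, hv, hcv⟩ := hinf (((‖φ‖⁻¹ : ℝ) : ℂ) • φ) (by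
      rw [norm_smul]; simp [h0])
    have h1 : c ≤ ‖φ‖⁻¹ * (b φ v).re := by
      rw [map_smul, LinearMap.smul_apply, smul_eq_mul, Complex.re_ofReal_mul] at hcv
      exact hcv
    have h2 : (b φ v).re ≤ ‖L φ‖ := by
      calc (b φ v).re ≤ ‖b φ v‖ := Complex.re_le_norm _
        _ = ‖inner ℂ (mk v) (T φ)‖ := by rw [hT]
        _ ≤ ‖mk v‖ * ‖T φ‖ := norm_inner_le_norm _ _
        _ = ‖L φ‖ := by rw [SeparationQuotient.norm_mk, hv, one_mul]; rfl
    rw [← div_eq_inv_mul, le_div_iff₀ hpos] at h1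
    exact h1.trans h2
  have hl' : ∀ φ, ‖l φ‖ ≤ |M| / c * ‖L φ‖ := fun φ => by
    calc ‖l φ‖ ≤ M * ‖φ‖ := hl φ
      _ ≤ |M| * ‖φ‖ := by gcongr; exact le_abs_self M
      _ = |M| / c * (c * ‖φ‖) := by field_simp
      _ ≤ _ := by gcongr; exact hlow φ
  obtain ⟨k, hk⟩ := exists_factor L l (fun v hv => by
    have := hl' v
    rw [hv, norm_zero, mul_zero] at this
    exact norm_le_zero_iff.1 this)
  let kc : StrongDual ℂ (LinearMap.range L) := k.mkContinuous (|M| / c) (by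
    rintro ⟨_, φ, rfl⟩
    exact (congrArg norm (hk φ)).le.trans (hl' φ))
  obtain ⟨g, hg, -⟩ := exists_extension_norm_eq (LinearMap.range L) kc
  obtain ⟨z, hz⟩ := surjective_mk ((InnerProductSpace.toDual ℂ _).symm g)
  refine ⟨z, fun w => ?_⟩
  have h1 : g (L w) = l w := by
    have := hg ⟨L w, w, rfl⟩
    rw [this]
    exact hk w
  rw [← h1, ← hT w z, hz, ← InnerProductSpace.toDual_symm_apply]
  rfl

-- A functional that vanishes on vectors of norm zero descends to the separation quotient, which is
-- a finite-dimensional Hilbert space. This is what lets the lifting be built from polynomial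
-- coefficients without proving that the L² form on them is definite.
open SeparationQuotient in
theorem exists_riesz_of_finiteDimensional [FiniteDimensional ℂ V] (m : V →ₗ[ℂ] ℂ)
    (hm : ∀ v, ‖v‖ = 0 → m v = 0) : ∃ y, ∀ v, inner ℂ y v = m v := by
  let L : V →ₗ[ℂ] SeparationQuotient V := (SeparationQuotient.mkCLM ℂ V).toLinearMap
  have hL : Function.Surjective L := surjective_mk
  have : FiniteDimensional ℂ (SeparationQuotient V) := Module.Finite.of_surjective L hL
  have : CompleteSpace (SeparationQuotient V) := FiniteDimensional.complete ℂ _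
  obtain ⟨k, hk⟩ := exists_factor L m (fun v hv => hm v (by
    have : ‖L v‖ = ‖v‖ := SeparationQuotient.norm_mk v
    rw [← this, hv, norm_zero]))
  obtain ⟨g, hg⟩ := k.exists_extend
  obtain ⟨y, hy⟩ := surjective_mk ((InnerProductSpace.toDual ℂ _).symm
    (LinearMap.toContinuousLinearMap g))
  refine ⟨y, fun v => ?_⟩
  have h1 : inner ℂ (mk y) (mk v) = g (mk v) := by
    rw [hy, InnerProductSpace.toDual_symm_apply]; rfl
  rw [← SeparationQuotient.inner_mk_mk, h1, ← hk v, ← hg]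
  rfl

end Abstract


/-! ### Barycentric coordinates -/

/-- `K` is the set of vertices of a non-degenerate `d`-simplex. -/
def IsSimplex (K : Finset (E d)) : Prop :=
  K.card = d + 1 ∧ AffineIndependent ℝ ((↑) : K → E d)

/-- The affine basis formed by the vertices of a simplex. -/
def IsSimplex.basis {K : Finset (E d)} (h : IsSimplex K) : AffineBasis K ℝ (E d) :=
  ⟨((↑) : K → E d), h.2, by
    rw [h.2.affineSpan_eq_top_iff_card_eq_finrank_add_one]
    simp [h.1]⟩

/-- The barycentric coordinate of the simplex `K` associated with the vertex `a`. -/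
def bary (K : Finset (E d)) (a : E d) : E d →ᵃ[ℝ] ℝ :=
  if h : IsSimplex K ∧ a ∈ K then h.1.basis.coord ⟨a, h.2⟩ else 0

/-- The gradient of a barycentric coordinate. -/
def gbary (K : Finset (E d)) (a : E d) : E d :=
  (InnerProductSpace.toDual ℝ (E d)).symm (LinearMap.toContinuousLinearMap (bary K a).linear)

theorem inner_gbary (K : Finset (E d)) (a v : E d) :
    inner ℝ (gbary K a) v = (bary K a).linear v := by
  simp [gbary, InnerProductSpace.toDual_symm_apply]

theorem bary_sub (K : Finset (E d)) (a x y : E d) :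
    bary K a x - bary K a y = inner ℝ (gbary K a) (x - y) := by
  rw [inner_gbary]
  exact ((bary K a).linearMap_vsub x y).symm

theorem bary_add (K : Finset (E d)) (a x v : E d) :
    bary K a (x + v) = bary K a x + inner ℝ (gbary K a) v := by
  have := bary_sub K a (x + v) x
  simp only [add_sub_cancel_left] at this
  linarith

theorem contDiff_bary (K : Finset (E d)) (a : E d) {n : WithTop ℕ∞} :
    ContDiff ℝ n (bary K a) := by
  have : (bary K a : E d → ℝ) = fun x => bary K a 0 + inner ℝ (gbary K a) x := by
    ext x
    simpa using bary_add K a 0 x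
  rw [this]
  exact contDiff_const.add (contDiff_const.inner ℝ contDiff_id)

theorem continuous_bary (K : Finset (E d)) (a : E d) : Continuous (bary K a) :=
  (contDiff_bary K a (n := 0)).continuous

theorem hasFDerivAt_bary (K : Finset (E d)) (a x : E d) :
    HasFDerivAt (bary K a) (innerSL ℝ (gbary K a)) x := by
  have : (bary K a : E d → ℝ) = fun x => bary K a 0 + innerSL ℝ (gbary K a) x := by
    ext x
    simpa using bary_add K a 0 x
  rw [this]
  exact (ContinuousLinearMap.hasFDerivAt _).const_add _

namespace IsSimplex

variable {K : Finset (E d)}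

theorem bary_eq (h : IsSimplex K) {a : E d} (ha : a ∈ K) :
    bary K a = h.basis.coord ⟨a, ha⟩ := dif_pos ⟨h, ha⟩

theorem bary_self (h : IsSimplex K) {a : E d} (ha : a ∈ K) : bary K a a = 1 := by
  rw [h.bary_eq ha]
  exact h.basis.coord_apply_eq ⟨a, ha⟩

theorem bary_ne (h : IsSimplex K) {a b : E d} (ha : a ∈ K) (hb : b ∈ K) (hab : a ≠ b) :
    bary K a b = 0 := by
  rw [h.bary_eq ha]
  exact h.basis.coord_apply_ne (i := ⟨a, ha⟩) (j := ⟨b, hb⟩) (by simpa using hab)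

theorem sum_bary (h : IsSimplex K) (x : E d) : ∑ a ∈ K, bary K a x = 1 := by
  rw [← h.basis.sum_coord_apply_eq_one x, ← Finset.sum_coe_sort K]
  exact Finset.sum_congr rfl fun a _ => by rw [h.bary_eq a.2]

theorem sum_bary_smul (h : IsSimplex K) (x : E d) : ∑ a ∈ K, bary K a x • a = x := by
  conv_rhs => rw [← h.basis.linear_combination_coord_eq_self x]
  rw [← Finset.sum_coe_sort K]
  exact Finset.sum_congr rfl fun a _ => by rw [h.bary_eq a.2]; rfl

/-- An affine function that agrees with another one on the vertices agrees everywhere. -/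
theorem affine_eq (h : IsSimplex K) {f g : E d →ᵃ[ℝ] ℝ} (hfg : ∀ a ∈ K, f a = g a) : f = g := by
  have h1 : affineSpan ℝ (Set.range h.basis) = ⊤ := h.basis.tot
  refine AffineMap.ext_on h1 ?_
  rintro _ ⟨a, rfl⟩
  exact hfg a a.2

theorem range_basis (h : IsSimplex K) : Set.range h.basis = (K : Set (E d)) := by
  ext x
  constructor
  · rintro ⟨a, rfl⟩; exact a.2
  · intro hx; exact ⟨⟨x, hx⟩, rfl⟩

theorem mem_body (h : IsSimplex K) {x : E d} : x ∈ body K ↔ ∀ a ∈ K, 0 ≤ bary K a x := by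
  have := h.basis.convexHull_eq_nonneg_coord
  rw [h.range_basis] at this
  rw [body, this]
  constructor
  · intro hx a ha; rw [h.bary_eq ha]; exact hx ⟨a, ha⟩
  · rintro hx ⟨a, ha⟩; have := hx a ha; rwa [h.bary_eq ha] at this

theorem mem_cell (h : IsSimplex K) {x : E d} : x ∈ cell K ↔ ∀ a ∈ K, 0 < bary K a x := by
  have := h.basis.interior_convexHull
  rw [h.range_basis] at this
  rw [cell, body, this]
  constructor
  · intro hx a ha; rw [h.bary_eq ha]; exact hx ⟨a, ha⟩
  · rintro hx ⟨a, ha⟩; have := hx a ha; rwa [h.bary_eq ha] at this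

theorem cell_nonempty (h : IsSimplex K) : (cell K).Nonempty := by
  refine ⟨K.centroid ℝ id, h.mem_cell.2 fun a ha => ?_⟩
  have hK : K.Nonempty := ⟨a, ha⟩
  have h1 : K.centroid ℝ id = (∑ b ∈ K, ((K.card : ℝ)⁻¹) • b) := by
    rw [Finset.centroid_def, Finset.affineCombination_eq_linear_combination _ _ _
      (K.sum_centroidWeights_eq_one_of_nonempty ℝ hK)]
    simp
  have h2 : bary K a (K.centroid ℝ id) = (K.card : ℝ)⁻¹ := by
    rw [Finset.centroid_def, Finset.map_affineCombination _ _ _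
      (K.sum_centroidWeights_eq_one_of_nonempty ℝ hK),
      Finset.affineCombination_eq_linear_combination _ _ _
      (K.sum_centroidWeights_eq_one_of_nonempty ℝ hK), Finset.sum_eq_single a]
    · simp [h.bary_self ha]
    · intro b hb hba; simp [h.bary_ne ha hb hba.symm]
    · intro h'; exact absurd ha h'
  rw [h2]
  have : 0 < (K.card : ℝ) := by exact_mod_cast hK.card_pos
  positivity

theorem bary_centroid (h : IsSimplex K) {F : Finset (E d)} (hF : F ⊆ K) (hF0 : F.Nonempty)
    {a : E d} (ha : a ∈ K) :
    bary K a (F.centroid ℝ id) = if a ∈ F then (F.card : ℝ)⁻¹ else 0 := by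
  rw [Finset.centroid_def, Finset.map_affineCombination _ _ _
      (F.sum_centroidWeights_eq_one_of_nonempty ℝ hF0),
      Finset.affineCombination_eq_linear_combination _ _ _
      (F.sum_centroidWeights_eq_one_of_nonempty ℝ hF0)]
  have : ∀ b ∈ F, F.centroidWeights ℝ b • ((bary K a) ∘ id) b = if a = b then (F.card : ℝ)⁻¹ else 0 := by
    intro b hb
    split_ifs with hab
    · subst hab; simp [h.bary_self ha]
    · simp [h.bary_ne ha (hF hb) hab]
  rw [Finset.sum_congr rfl this]
  simp

theorem gbary_ne_zero (h : IsSimplex K) (hd : 0 < d) {a : E d} (ha : a ∈ K) : gbary K a ≠ 0 := by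
  intro h0
  have : 1 < K.card := by rw [h.1]; omega
  obtain ⟨b, hb, hba⟩ := Finset.exists_mem_ne this a
  have h1 := bary_sub K a a b
  rw [h0, inner_zero_left, h.bary_self ha, h.bary_ne ha hb hba.symm] at h1
  norm_num at h1

theorem mem_facesOf (h : IsSimplex K) {F : Finset (E d)} :
    F ∈ facesOf K ↔ ∃ a ∈ K, F = K.erase a := by
  rw [facesOf, Finset.mem_powersetCard]
  constructor
  · rintro ⟨h1, h2⟩
    have h3 : (K \ F).card = 1 := by
      rw [Finset.card_sdiff_of_subset h1, h2, h.1]; omega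
    obtain ⟨a, ha⟩ := Finset.card_eq_one.1 h3
    have haK : a ∈ K \ F := by rw [ha]; simp
    rw [Finset.mem_sdiff] at haK
    refine ⟨a, haK.1, ?_⟩
    rw [← Finset.sdiff_singleton_eq_erase, ← ha, Finset.sdiff_sdiff_eq_self h1]
  · rintro ⟨a, ha, rfl⟩
    refine ⟨Finset.erase_subset _ _, ?_⟩
    rw [Finset.card_erase_of_mem ha, h.1]; rfl

theorem body_subset_of_subset {F G : Finset (E d)} (h : F ⊆ G) : body F ⊆ body G :=
  convexHull_mono (by exact_mod_cast h)

theorem bary_eq_zero_of_mem_body (h : IsSimplex K) {F : Finset (E d)} (hF : F ⊆ K) {a : E d}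
    (ha : a ∈ K) (haF : a ∉ F) {x : E d} (hx : x ∈ body F) : bary K a x = 0 := by
  have hc : Convex ℝ {y | bary K a y = 0} := by
    have : {y | bary K a y = 0} = (bary K a) ⁻¹' {0} := rfl
    rw [this]
    exact (convex_singleton 0).affine_preimage _
  exact convexHull_min (fun b hb => h.bary_ne ha (hF hb) (by rintro rfl; exact haF hb)) hc hx

theorem mem_body_erase (h : IsSimplex K) {a : E d} (ha : a ∈ K) {x : E d} :
    x ∈ body (K.erase a) ↔ bary K a x = 0 ∧ ∀ b ∈ K, 0 ≤ bary K b x := by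
  constructor
  · intro hx
    exact ⟨h.bary_eq_zero_of_mem_body (Finset.erase_subset _ _) ha (by simp) hx,
      h.mem_body.1 (body_subset_of_subset (Finset.erase_subset _ _) hx)⟩
  · rintro ⟨h0, h1⟩
    rw [body, Finset.mem_convexHull']
    refine ⟨fun b => bary K b x, fun b hb => h1 b (Finset.mem_of_mem_erase hb), ?_, ?_⟩
    · have := h.sum_bary x
      rw [← Finset.add_sum_erase _ _ ha, h0, zero_add] at this
      exact this
    · have := h.sum_bary_smul x
      rw [← Finset.add_sum_erase _ _ ha, h0, zero_smul, zero_add] at this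
      exact this

/-- The barycentric coordinate of `a` vanishes at all the other vertices, so differences of these
are orthogonal to its gradient. Both subspaces have dimension d - 1. -/
theorem vectorSpan_erase (h : IsSimplex K) (hd : 0 < d) {a : E d} (ha : a ∈ K) :
    vectorSpan ℝ ((K.erase a : Finset (E d)) : Set (E d)) = (ℝ ∙ gbary K a)ᗮ := by
  have hle : vectorSpan ℝ ((K.erase a : Finset (E d)) : Set (E d)) ≤ (ℝ ∙ gbary K a)ᗮ := by
    rw [vectorSpan_def, Submodule.span_le]
    rintro _ ⟨x, hx, y, hy, rfl⟩
    rw [SetLike.mem_coe, Submodule.mem_orthogonal_singleton_iff_inner_right]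
    have hx' := Finset.mem_erase.1 (Finset.mem_coe.1 hx)
    have hy' := Finset.mem_erase.1 (Finset.mem_coe.1 hy)
    change inner ℝ _ (x - y) = 0
    rw [← bary_sub, h.bary_ne ha hx'.2 hx'.1.symm, h.bary_ne ha hy'.2 hy'.1.symm, sub_zero]
  refine Submodule.eq_of_le_of_finrank_eq hle ?_
  have h1 : AffineIndependent ℝ ((↑) : ((K.erase a : Finset (E d)) : Set (E d)) → E d) :=
    h.2.mono (by simp)
  have h2 : Module.finrank ℝ (vectorSpan ℝ (Set.range
      ((↑) : ((K.erase a : Finset (E d)) : Set (E d)) → E d))) + 1 = d := by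
    have := AffineIndependent.finrank_vectorSpan (k := ℝ) (n := d - 1) h1
      (by
        have : Fintype.card (K.erase a) = d - 1 + 1 := by
          rw [Fintype.card_coe, Finset.card_erase_of_mem ha, h.1]; omega
        convert this using 1; simp)
    omega
  have h3 : Module.finrank ℝ (ℝ ∙ gbary K a) = 1 := finrank_span_singleton (h.gbary_ne_zero hd ha)
  have h4 := (ℝ ∙ gbary K a).finrank_add_finrank_orthogonal
  rw [h3, finrank_euclideanSpace_fin] at h4
  have h5 : Set.range ((↑) : ((K.erase a : Finset (E d)) : Set (E d)) → E d)
    = ((K.erase a : Finset (E d)) : Set (E d)) := by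
    exact Subtype.range_coe
  rw [h5] at h2
  omega

/-- The orthogonal complement of the face directions is the line spanned by the gradient of the
coordinate of `a`. That coordinate is 0 at the barycentre of the face and 1/(d+1) at the barycentre
of the simplex, so the projected vector is a negative multiple of the gradient. -/
theorem nrm_erase (h : IsSimplex K) (hd : 0 < d) {a : E d} (ha : a ∈ K) :
    nrm K (K.erase a) = -(‖gbary K a‖⁻¹ • gbary K a) := by
  have hg := h.gbary_ne_zero hd ha
  have hFne : (K.erase a).Nonempty := by
    rw [← Finset.card_pos, Finset.card_erase_of_mem ha, h.1]; omega
  have hKne : K.Nonempty := ⟨a, ha⟩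
  set v : E d := (K.erase a).centroid ℝ (id : E d → E d) - K.centroid ℝ (id : E d → E d) with hv
  have h1 : inner ℝ (gbary K a) v = -((K.card : ℝ)⁻¹) := by
    rw [hv, ← bary_sub, h.bary_centroid (Finset.erase_subset _ _) hFne ha,
      h.bary_centroid subset_rfl hKne ha]
    simp [ha]
  have h2 : ((vectorSpan ℝ ((K.erase a : Finset (E d)) : Set (E d)))ᗮ.starProjection v)
      = (-((K.card : ℝ)⁻¹) / ‖gbary K a‖ ^ 2) • gbary K a := by
    rw [← h1]
    have h3 : (vectorSpan ℝ ((K.erase a : Finset (E d)) : Set (E d)))ᗮ = (ℝ ∙ gbary K a) := by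
      rw [h.vectorSpan_erase hd ha, Submodule.orthogonal_orthogonal]
    simp only [h3]
    exact Submodule.starProjection_singleton ℝ (v := gbary K a) v
  have hn : 0 < ‖gbary K a‖ := norm_pos_iff.2 hg
  have hK : 0 < (K.card : ℝ) := by exact_mod_cast hKne.card_pos
  rw [nrm, ← hv, h2, norm_smul, smul_smul, ← neg_smul]
  congr 1
  rw [Real.norm_eq_abs, abs_div, abs_neg, abs_of_pos (inv_pos.2 hK), abs_of_pos (pow_pos hn 2)]
  field_simp

end IsSimplex

theorem isCompact_body (K : Finset (E d)) : IsCompact (body K) :=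
  K.finite_toSet.isCompact_convexHull (𝕜 := ℝ)

theorem isOpen_cell (K : Finset (E d)) : IsOpen (cell K) := isOpen_interior

theorem cell_subset_body (K : Finset (E d)) : cell K ⊆ body K := interior_subset

theorem measure_cell_lt_top (K : Finset (E d)) : volume (cell K) < ⊤ :=
  (measure_mono (cell_subset_body K)).trans_lt (isCompact_body K).measure_lt_top

theorem convex_cell (K : Finset (E d)) : Convex ℝ (cell K) := (convex_convexHull ℝ _).interior

theorem volume_body_diff_cell (K : Finset (E d)) : volume (body K \ cell K) = 0 := by
  refine measure_mono_null ?_ ((convex_convexHull ℝ (K : Set (E d))).addHaar_frontier volume)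
  rw [frontier]
  exact Set.sdiff_subset_sdiff_left subset_closure


/-! ### Surface measures on hyperplanes -/

/-- The hyperplane through `p` orthogonal to `ν`. -/
def hplane (ν p : E d) : Set (E d) := {y | inner ℝ ν (y - p) = 0}

/-- The surface measure on the hyperplane through `p` orthogonal to `ν`. -/
def hyper (ν p : E d) : Measure (E d) := (μHE[d - 1]).restrict (hplane ν p)

/-- Translation by `p` is an isometry from the linear hyperplane onto the affine one, and it
transports Hausdorff measure. Surface measure thereby becomes Lebesgue measure on a Euclidean space,
which supplies s-finiteness, finiteness on bounded sets and negligible affine sections. -/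
theorem hyper_eq_map {ν : E d} (hν : ν ≠ 0) (p : E d) :
    hyper ν p = (volume : Measure ((ℝ ∙ ν)ᗮ : Submodule ℝ (E d))).map
      (fun y : ((ℝ ∙ ν)ᗮ : Submodule ℝ (E d)) => (y : E d) + p) := by
  have hiso : Isometry (fun y : ((ℝ ∙ ν)ᗮ : Submodule ℝ (E d)) => (y : E d) + p) :=
    (isometry_add_right p).comp isometry_subtype_coe
  have hr : Module.finrank ℝ ((ℝ ∙ ν)ᗮ : Submodule ℝ (E d)) = d - 1 := by
    have h4 := (ℝ ∙ ν).finrank_add_finrank_orthogonal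
    rw [finrank_span_singleton hν, finrank_euclideanSpace_fin] at h4
    omega
  rw [← InnerProductSpace.euclideanHausdorffMeasure_eq_volume,
    hiso.map_euclideanHausdorffMeasure, hr, hyper]
  congr 1
  ext y
  simp only [hplane, Set.mem_ofPred_eq, Set.mem_range]
  constructor
  · intro h
    exact ⟨⟨y - p, (Submodule.mem_orthogonal_singleton_iff_inner_right).2 h⟩, by simp⟩
  · rintro ⟨z, rfl⟩
    simpa using (Submodule.mem_orthogonal_singleton_iff_inner_right).1 z.2

theorem sfinite_hyper {ν : E d} (hν : ν ≠ 0) (p : E d) : SFinite (hyper ν p) := by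
  rw [hyper_eq_map hν]; infer_instance

theorem hyper_lt_top_of_isBounded {ν : E d} (hν : ν ≠ 0) (p : E d) {s : Set (E d)}
    (hs : Bornology.IsBounded s) : hyper ν p s < ⊤ := by
  obtain ⟨R, hR⟩ := hs.subset_closedBall p
  refine (measure_mono hR).trans_lt ?_
  rw [hyper_eq_map hν, Measure.map_apply (by fun_prop) Metric.isClosed_closedBall.measurableSet]
  have : (fun y : ((ℝ ∙ ν)ᗮ : Submodule ℝ (E d)) => (y : E d) + p) ⁻¹' Metric.closedBall p R
      = Metric.closedBall 0 R := by
    ext y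
    simp [dist_eq_norm]
  rw [this]
  exact measure_closedBall_lt_top

/-- A hyperplane section `{f = 0}` is negligible unless `f` vanishes on the hyperplane. -/
theorem hyper_affine_eq_zero {ν : E d} (hν : ν ≠ 0) (p : E d) (f : E d →ᵃ[ℝ] ℝ) {q : E d}
    (hq : q ∈ hplane ν p) (hfq : f q ≠ 0) : hyper ν p {y | f y = 0} = 0 := by
  have hf : Continuous f := f.continuous_of_finiteDimensional
  rw [hyper_eq_map hν, Measure.map_apply (by fun_prop)
    (isClosed_eq hf continuous_const).measurableSet]
  let g : ((ℝ ∙ ν)ᗮ : Submodule ℝ (E d)) →ᵃ[ℝ] E d :=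
    ((ℝ ∙ ν)ᗮ).subtype.toAffineMap + AffineMap.const ℝ _ p
  let A : AffineSubspace ℝ ((ℝ ∙ ν)ᗮ : Submodule ℝ (E d)) :=
    (AffineSubspace.mk' (0 : ℝ) ⊥).comap (f.comp g)
  have hA : A ≠ ⊤ := by
    intro h
    have h1 : (⟨q - p, (Submodule.mem_orthogonal_singleton_iff_inner_right).2 hq⟩ :
      ((ℝ ∙ ν)ᗮ : Submodule ℝ (E d))) ∈ A := by rw [h]; exact AffineSubspace.mem_top _ _ _
    simp [A, g, AffineSubspace.mem_comap] at h1
    exact hfq h1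
  have hset : (fun y : ((ℝ ∙ ν)ᗮ : Submodule ℝ (E d)) => (y : E d) + p) ⁻¹' {y | f y = 0} = A := by
    ext y
    simp [A, g]
  rw [hset]
  exact Measure.addHaar_affineSubspace volume A hA

/-- The orthogonal splitting of the space into the line of `ν` and its complement preserves volume.
This is the Fubini formula with slices parallel to a face that the divergence theorem needs. -/
theorem measurePreserving_hyper {ν : E d} (hν : ‖ν‖ = 1) (p : E d) :
    MeasurePreserving (fun q : ℝ × E d => q.2 + q.1 • ν) (volume.prod (hyper ν p)) volume := by
  have hν0 : ν ≠ 0 := by rintro rfl; simp at hν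
  refine ⟨by fun_prop, ?_⟩
  have h1 := ((ℝ ∙ ν).measurePreserving_measurableEquivProd p).symm
  have h2 : MeasurePreserving (LinearIsometryEquiv.toSpanUnitSingleton ν hν) volume volume :=
    (LinearIsometryEquiv.toSpanUnitSingleton ν hν).measurePreserving
  have h3 := h2.prod (MeasurePreserving.id (volume : Measure ((ℝ ∙ ν)ᗮ : Submodule ℝ (E d))))
  have h4 := (h1.comp h3).map_eq
  have h5 : (volume : Measure (E d)) = μHE[Module.finrank ℝ (E d)] :=
    InnerProductSpace.euclideanHausdorffMeasure_eq_volume.symm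
  rw [h5, ← h4, hyper_eq_map hν0]
  have h6 : (volume : Measure ℝ) = (volume : Measure ℝ).map id := Measure.map_id.symm
  conv_lhs => rw [h6]
  rw [Measure.map_prod_map _ _ measurable_id (by fun_prop), Measure.map_map (by fun_prop) (by fun_prop)]
  congr 1
  ext1 q
  simp
  abel

namespace IsSimplex

variable {K : Finset (E d)}

theorem surf_le_hyper (h : IsSimplex K) {a b : E d} (ha : a ∈ K) (hb : b ∈ K) (hab : a ≠ b) :
    surf (K.erase a) ≤ hyper (gbary K a) b := by
  refine Measure.restrict_mono ?_ le_rfl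
  intro x hx
  change inner ℝ _ (x - b) = 0
  rw [← bary_sub, ((h.mem_body_erase ha).1 hx).1, h.bary_ne ha hb hab, sub_zero]

theorem surf_eq_restrict (h : IsSimplex K) {a b : E d} (ha : a ∈ K) (hb : b ∈ K) (hab : a ≠ b) :
    surf (K.erase a) = (hyper (gbary K a) b).restrict (body (K.erase a)) := by
  rw [hyper, Measure.restrict_restrict (isCompact_body _).measurableSet, surf]
  congr 1
  refine (Set.inter_eq_left.2 ?_).symm
  intro x hx
  change inner ℝ _ (x - b) = 0
  rw [← bary_sub, ((h.mem_body_erase ha).1 hx).1, h.bary_ne ha hb hab, sub_zero]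

theorem exists_ne (h : IsSimplex K) (hd : 0 < d) (a : E d) : ∃ b ∈ K, a ≠ b := by
  have : 1 < K.card := by rw [h.1]; omega
  obtain ⟨b, hb, hba⟩ := Finset.exists_mem_ne this a
  exact ⟨b, hb, hba.symm⟩

theorem isFiniteMeasure_surf (h : IsSimplex K) (hd : 0 < d) {F : Finset (E d)}
    (hF : F ∈ facesOf K) : IsFiniteMeasure (surf F) := by
  obtain ⟨a, ha, rfl⟩ := h.mem_facesOf.1 hF
  obtain ⟨b, hb, hab⟩ := h.exists_ne hd a
  refine ⟨?_⟩
  rw [h.surf_eq_restrict ha hb hab, Measure.restrict_apply_univ]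
  exact hyper_lt_top_of_isBounded (h.gbary_ne_zero hd ha) _ (isCompact_body _).isBounded

/-- The vertex `c` lies in the hyperplane and has coordinate 1 there, so the zero set of that
coordinate is a proper section. -/
theorem hyper_ae_bary_ne_zero (h : IsSimplex K) (hd : 0 < d) {a b c : E d} (ha : a ∈ K)
    (hb : b ∈ K) (hab : a ≠ b) (hc : c ∈ K) (hac : a ≠ c) :
    ∀ᵐ x ∂(hyper (gbary K a) b), bary K c x ≠ 0 := by
  rw [ae_iff]
  simp only [not_not]
  refine hyper_affine_eq_zero (h.gbary_ne_zero hd ha) b (bary K c) (q := c) ?_ ?_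
  · change inner ℝ _ (c - b) = 0
    rw [← bary_sub, h.bary_ne ha hb hab, h.bary_ne ha hc hac, sub_zero]
  · rw [h.bary_self hc]; exact one_ne_zero

/-- Almost every point of a face is in its relative interior. -/
theorem surf_ae_bary_pos (h : IsSimplex K) (hd : 0 < d) {a c : E d} (ha : a ∈ K)
    (hc : c ∈ K) (hac : a ≠ c) :
    ∀ᵐ x ∂(surf (K.erase a)), 0 < bary K c x := by
  have h1 := ae_mono (h.surf_le_hyper ha hc hac) (h.hyper_ae_bary_ne_zero hd ha hc hac hc hac)
  have h2 : ∀ᵐ x ∂(surf (K.erase a)), x ∈ body (K.erase a) :=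
    ae_restrict_mem (isCompact_body _).measurableSet
  filter_upwards [h1, h2] with x hx1 hx2
  exact lt_of_le_of_ne (((h.mem_body_erase ha).1 hx2).2 c hc) hx1.symm

end IsSimplex


/-! ### The divergence theorem on a simplex -/

theorem hyper_smul {r : ℝ} (hr : r ≠ 0) (ν p : E d) : hyper (r • ν) p = hyper ν p := by
  have : hplane (r • ν) p = hplane ν p := by
    ext y
    simp [hplane, inner_smul_left, hr]
  rw [hyper, hyper, this]

theorem continuous_deriv_smoothTransition : Continuous (deriv Real.smoothTransition) :=
  (Real.smoothTransition.contDiff (n := 1)).continuous_deriv le_rfl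

theorem deriv_smoothTransition_of_neg {t : ℝ} (ht : t < 0) : deriv Real.smoothTransition t = 0 := by
  have : Real.smoothTransition =ᶠ[𝓝 t] fun _ => (0 : ℝ) := by
    filter_upwards [Iio_mem_nhds ht] with s hs
    exact Real.smoothTransition.zero_of_nonpos (le_of_lt hs)
  rw [this.deriv_eq, deriv_const]

theorem deriv_smoothTransition_of_one_lt {t : ℝ} (ht : 1 < t) :
    deriv Real.smoothTransition t = 0 := by
  have : Real.smoothTransition =ᶠ[𝓝 t] fun _ => (1 : ℝ) := by
    filter_upwards [Ioi_mem_nhds ht] with s hs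
    exact Real.smoothTransition.one_of_one_le (le_of_lt hs)
  rw [this.deriv_eq, deriv_const]

theorem deriv_smoothTransition_of_notMem {t : ℝ} (ht : t ∉ Set.Icc (0 : ℝ) 1) :
    deriv Real.smoothTransition t = 0 := by
  rw [Set.mem_Icc, not_and_or, not_le, not_le] at ht
  exact ht.elim deriv_smoothTransition_of_neg deriv_smoothTransition_of_one_lt

theorem integral_deriv_smoothTransition : ∫ t, deriv Real.smoothTransition t = 1 := by
  have h1 : ∫ t in Set.Ioc (0 : ℝ) 1, deriv Real.smoothTransition t
      = ∫ t, deriv Real.smoothTransition t := by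
    rw [← integral_Icc_eq_integral_Ioc]
    exact setIntegral_eq_integral_of_forall_compl_eq_zero fun t ht =>
      deriv_smoothTransition_of_notMem ht
  rw [← h1, ← intervalIntegral.integral_of_le zero_le_one,
    intervalIntegral.integral_deriv_eq_sub]
  · simp [Real.smoothTransition.one_of_one_le, Real.smoothTransition.zero_of_nonpos]
  · exact fun t _ => (Real.smoothTransition.contDiff (n := 1)).differentiable (by simp) t
  · exact continuous_deriv_smoothTransition.intervalIntegrable _ _

/-- A product of smooth cut-off functions of barycentric coordinates. -/
def cut (K G : Finset (E d)) (n : ℝ) (x : E d) : ℝ :=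
  ∏ b ∈ G, Real.smoothTransition (n * bary K b x)

theorem continuous_cut (K G : Finset (E d)) (n : ℝ) : Continuous (cut K G n) :=
  continuous_finsetProd _ fun b _ =>
    Real.smoothTransition.continuous.comp (continuous_const.mul (continuous_bary K b))

theorem contDiff_cut (K G : Finset (E d)) (n : ℝ) {k : ℕ∞} : ContDiff ℝ k (cut K G n) :=
  contDiff_prod fun b _ =>
    Real.smoothTransition.contDiff.comp (contDiff_const.mul (contDiff_bary K b))

theorem cut_nonneg (K G : Finset (E d)) (n : ℝ) (x : E d) : 0 ≤ cut K G n x :=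
  Finset.prod_nonneg fun _ _ => Real.smoothTransition.nonneg _

theorem cut_le_one (K G : Finset (E d)) (n : ℝ) (x : E d) : cut K G n x ≤ 1 :=
  Finset.prod_le_one (fun _ _ => Real.smoothTransition.nonneg _)
    fun _ _ => Real.smoothTransition.le_one _

theorem cut_eq_zero {K G : Finset (E d)} {n : ℝ} (hn : 0 ≤ n) {x b : E d} (hb : b ∈ G)
    (h : bary K b x ≤ 0) : cut K G n x = 0 :=
  Finset.prod_eq_zero hb (Real.smoothTransition.zero_of_nonpos (mul_nonpos_of_nonneg_of_nonpos hn h))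

theorem cut_eq_one {K G : Finset (E d)} {n : ℝ} {x : E d} (h : ∀ b ∈ G, 1 ≤ n * bary K b x) :
    cut K G n x = 1 :=
  Finset.prod_eq_one fun b hb => Real.smoothTransition.one_of_one_le (h b hb)

/-- In each term of the product rule one factor is differentiated; for n > 0 it lives in the slab 0
≤ nλ_a ≤ 1 next to the hyperplane of the face opposite to `a`, while the other factors cut off the
remaining directions. -/
theorem fderiv_cut (K G : Finset (E d)) (n : ℝ) (x v : E d) :
    fderiv ℝ (cut K G n) x v = ∑ a ∈ G, inner ℝ (gbary K a) v *
      (cut K (G.erase a) n x * (deriv Real.smoothTransition (n * bary K a x) * n)) := by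
  have h1 : ∀ b ∈ G, HasFDerivAt (fun x => Real.smoothTransition (n * bary K b x))
      ((deriv Real.smoothTransition (n * bary K b x)) • (n • innerSL ℝ (gbary K b))) x := by
    intro b _
    have h2 : HasDerivAt Real.smoothTransition (deriv Real.smoothTransition (n * bary K b x))
      (n * bary K b x) :=
      ((Real.smoothTransition.contDiff (n := 1)).differentiable (by simp) _).hasDerivAt
    exact h2.comp_hasFDerivAt x ((hasFDerivAt_bary K b x).const_mul n)
  have h2 := HasFDerivAt.finsetProd h1
  have h3 : cut K G n = fun x => ∏ b ∈ G, Real.smoothTransition (n * bary K b x) := rfl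
  rw [h3, h2.fderiv]
  simp only [_root_.sum_apply, _root_.smul_apply, smul_eq_mul,
    innerSL_apply_apply]
  refine Finset.sum_congr rfl fun a _ => ?_
  rw [cut]
  ring

namespace IsSimplex

variable {K : Finset (E d)}

theorem hasCompactSupport_cut (h : IsSimplex K) {n : ℝ} (hn : 0 ≤ n) :
    HasCompactSupport (cut K K n) := by
  refine HasCompactSupport.intro (isCompact_body K) fun x hx => ?_
  rw [h.mem_body] at hx
  push Not at hx
  obtain ⟨b, hb, hbx⟩ := hx
  exact cut_eq_zero hn hb hbx.le

/-- The cut-off is zero outside the open simplex, and at a point of the open simplex it equals 1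
once n exceeds the inverse of every barycentric coordinate. Dominated convergence applies on the
compact simplex. -/
theorem tendsto_integral_cut (h : IsSimplex K) {ψ : E d → ℂ} (hψ : Continuous ψ) :
    Tendsto (fun n : ℕ => ∫ x, cut K K n x • ψ x) atTop (𝓝 (∫ x in cell K, ψ x)) := by
  obtain ⟨M, hM⟩ := (isCompact_body K).exists_bound_of_continuousOn hψ.continuousOn
  rw [← integral_indicator (isOpen_cell K).measurableSet]
  refine tendsto_integral_of_dominated_convergence ((body K).indicator fun _ => M) ?_ ?_ ?_ ?_
  · exact fun n => ((continuous_cut K K n).smul hψ).aestronglyMeasurable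
  · rw [integrable_indicator_iff (isCompact_body K).measurableSet]
    exact integrableOn_const (isCompact_body K).measure_lt_top.ne
  · refine fun n => .of_forall fun x => ?_
    by_cases hx : x ∈ body K
    · rw [Set.indicator_of_mem hx, norm_smul, Real.norm_of_nonneg (cut_nonneg _ _ _ _)]
      exact (mul_le_of_le_one_left (norm_nonneg _) (cut_le_one _ _ _ _)).trans (hM x hx)
    · rw [Set.indicator_of_notMem hx]
      rw [h.mem_body] at hx
      push Not at hx
      obtain ⟨b, hb, hbx⟩ := hx
      rw [cut_eq_zero n.cast_nonneg hb hbx.le]; simp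
  · refine .of_forall fun x => ?_
    refine tendsto_const_nhds.congr' ?_
    by_cases hx : x ∈ cell K
    · have h1 : ∀ b ∈ K, ∀ᶠ n : ℕ in atTop, 1 ≤ (n : ℝ) * bary K b x := fun b hb =>
        (tendsto_natCast_atTop_atTop.atTop_mul_const (h.mem_cell.1 hx b hb)).eventually_ge_atTop 1
      filter_upwards [(Filter.eventually_all_finset K).2 h1] with n hn
      rw [Set.indicator_of_mem hx, cut_eq_one hn, one_smul]
    · refine .of_forall fun n => ?_
      rw [Set.indicator_of_notMem hx]
      rw [h.mem_cell] at hx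
      push Not at hx
      obtain ⟨b, hb, hbx⟩ := hx
      change _ = cut K K n x • ψ x
      rw [cut_eq_zero n.cast_nonneg hb hbx]; simp

/-- Write x = y + tν with y in the hyperplane of the face and ν the unit vector along the gradient g
of λ_a, so that λ_a(x) = t‖g‖. The substitution τ = n‖g‖t turns the differentiated factor into the
derivative of the transition function at τ, of integral 1, and leaves the constant ‖g‖⁻¹. As n grows
the evaluation point tends to y, and the remaining cut-off tends for almost every y to the indicator
of the face. -/
theorem tendsto_integral_cut_face (h : IsSimplex K) (hd : 0 < d) {a : E d} (ha : a ∈ K)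
    {φ : E d → ℂ} (hφ : Continuous φ) :
    Tendsto (fun n : ℕ => ∫ x, (cut K (K.erase a) n x *
      (deriv Real.smoothTransition (n * bary K a x) * n)) • φ x) atTop
      (𝓝 ((‖gbary K a‖⁻¹ : ℝ) • ∫ x, φ x ∂(surf (K.erase a)))) := by
  obtain ⟨b, hb, hab⟩ := h.exists_ne hd a
  set g := gbary K a with hg
  have hg0 : g ≠ 0 := h.gbary_ne_zero hd ha
  have hgn : 0 < ‖g‖ := norm_pos_iff.2 hg0
  set ν : E d := ‖g‖⁻¹ • g with hν
  have hν1 : ‖ν‖ = 1 := by rw [hν, norm_smul, norm_inv, norm_norm, inv_mul_cancel₀ hgn.ne']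
  have hν0 : ν ≠ 0 := by intro h0; rw [h0, norm_zero] at hν1; exact zero_ne_one hν1
  have hH : hyper ν b = hyper g b := hyper_smul (inv_ne_zero hgn.ne') g b
  have : SFinite (hyper ν b) := sfinite_hyper hν0 b
  have hgν : inner ℝ g ν = ‖g‖ := by
    rw [hν, inner_smul_right, real_inner_self_eq_norm_sq]; field_simp
  set D := deriv Real.smoothTransition with hD
  obtain ⟨M, hM⟩ := (isCompact_body K).exists_bound_of_continuousOn hφ.continuousOn
  obtain ⟨R, hR⟩ := (isCompact_body K).isBounded.subset_closedBall 0
  obtain ⟨C, hC⟩ := (isCompact_Icc (a := (0 : ℝ)) (b := 1)).exists_bound_of_continuousOn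
    continuous_deriv_smoothTransition.continuousOn
  have hbaryH : ∀ᵐ y ∂(hyper ν b), bary K a y = 0 := by
    have : ∀ᵐ y ∂(hyper ν b), y ∈ hplane ν b := by
      refine ae_restrict_mem (IsClosed.measurableSet ?_)
      exact isClosed_eq (by fun_prop) continuous_const
    filter_upwards [this] with y hy
    have h1 : inner ℝ ν (y - b) = 0 := hy
    rw [hν, inner_smul_left, mul_eq_zero, or_iff_right (by simpa using hgn.ne'), hg, ← bary_sub,
      h.bary_ne ha hb hab, sub_zero] at h1
    exact h1
  -- the transformed integrands
  let X : ℕ → ℝ × E d → E d := fun n q => q.2 + (q.1 / (n * ‖g‖)) • ν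
  let Q : ℕ → ℝ × E d → ℂ := fun n q => (cut K (K.erase a) n (X n q) * D q.1) • φ (X n q)
  let Q' : ℝ × E d → ℂ := fun q => (D q.1 : ℂ) * (body (K.erase a)).indicator φ q.2
  have hXc : ∀ n, Continuous (X n) := fun n => by fun_prop
  have hQc : ∀ n, Continuous (Q n) := fun n =>
    (((continuous_cut K (K.erase a) n).comp (hXc n)).mul
      (continuous_deriv_smoothTransition.comp continuous_fst)).smul (hφ.comp (hXc n))
  have hae : ∀ᵐ q ∂((volume : Measure ℝ).prod (hyper ν b)), bary K a q.2 = 0 := by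
    exact Measure.quasiMeasurePreserving_snd.ae hbaryH
  have haeall : ∀ᵐ q ∂((volume : Measure ℝ).prod (hyper ν b)), ∀ c ∈ K.erase a,
      bary K c q.2 ≠ 0 := by
    refine Measure.quasiMeasurePreserving_snd.ae ?_ (p := fun y => ∀ c ∈ K.erase a, bary K c y ≠ 0)
    rw [hH]
    refine (Finset.eventually_all (K.erase a)).2 fun c hc => ?_
    exact h.hyper_ae_bary_ne_zero hd ha hb hab (Finset.mem_of_mem_erase hc)
      (Finset.ne_of_mem_erase hc).symm
  have hbaryX : ∀ n : ℕ, 0 < n → ∀ q : ℝ × E d, bary K a q.2 = 0 → bary K a (X n q) = q.1 / n := by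
    intro n hn q hq
    have : (0 : ℝ) < n := by exact_mod_cast hn
    rw [bary_add, hq, inner_smul_right, ← hg, hgν]
    field_simp
    ring
  -- This bounded set contains the support of all the transformed integrands with n ≥ 1, almost
  -- everywhere: the derivative confines τ to [0, 1], the evaluation point stays in the simplex, and
  -- y differs from it by at most ‖g‖⁻¹.
  let S : Set (ℝ × E d) := Set.Icc 0 1 ×ˢ Metric.closedBall 0 (R + ‖g‖⁻¹)
  have hSm : MeasurableSet S := measurableSet_Icc.prod Metric.isClosed_closedBall.measurableSet
  have hSfin : ((volume : Measure ℝ).prod (hyper ν b)) S < ⊤ := by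
    rw [Measure.prod_prod]
    exact ENNReal.mul_lt_top measure_Icc_lt_top
      (hyper_lt_top_of_isBounded hν0 b Metric.isBounded_closedBall)
  have hbound : ∀ n : ℕ, 0 < n → ∀ᵐ q ∂((volume : Measure ℝ).prod (hyper ν b)),
      ‖Q n q‖ ≤ S.indicator (fun _ => |C| * |M|) q := by
    intro n hn
    have hn' : (0 : ℝ) < n := by exact_mod_cast hn
    filter_upwards [hae] with q hq
    by_cases hq1 : q.1 ∈ Set.Icc (0 : ℝ) 1
    swap
    · have : D q.1 = 0 := deriv_smoothTransition_of_notMem hq1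
      simp only [Q, this, mul_zero, zero_smul, norm_zero]
      exact Set.indicator_nonneg (fun _ _ => by positivity) _
    by_cases hX : X n q ∈ body K
    swap
    · have : cut K (K.erase a) n (X n q) = 0 := by
        rw [h.mem_body] at hX
        push Not at hX
        obtain ⟨c, hc, hcx⟩ := hX
        refine cut_eq_zero hn'.le (Finset.mem_erase.2 ⟨?_, hc⟩) hcx.le
        rintro rfl
        rw [hbaryX n hn q hq] at hcx
        exact absurd hcx (not_lt.2 (div_nonneg hq1.1 hn'.le))
      simp only [Q, this, zero_mul, zero_smul, norm_zero]
      exact Set.indicator_nonneg (fun _ _ => by positivity) _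
    have hqS : q ∈ S := by
      refine ⟨hq1, ?_⟩
      have h1 := hR hX
      rw [mem_closedBall_zero_iff] at h1 ⊢
      have h2 : q.2 = X n q - (q.1 / (n * ‖g‖)) • ν := by simp [X]
      rw [h2]
      refine (norm_sub_le _ _).trans (add_le_add h1 ?_)
      rw [norm_smul, hν1, mul_one, Real.norm_of_nonneg (div_nonneg hq1.1 (by positivity)),
        inv_eq_one_div]
      have h3 : (1 : ℝ) ≤ n := by exact_mod_cast hn
      gcongr
      · exact hq1.2
      · exact le_mul_of_one_le_left hgn.le h3
    rw [Set.indicator_of_mem hqS, norm_smul, norm_mul, Real.norm_of_nonneg (cut_nonneg _ _ _ _)]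
    have h1 : ‖D q.1‖ ≤ |C| := (hC _ hq1).trans (le_abs_self C)
    have h2 : ‖φ (X n q)‖ ≤ |M| := (hM _ hX).trans (le_abs_self M)
    have h3 := mul_le_mul (cut_le_one K (K.erase a) n (X n q)) h1 (norm_nonneg _) zero_le_one
    rw [one_mul] at h3
    exact mul_le_mul h3 h2 (norm_nonneg _) (abs_nonneg _)
  have hSint : Integrable (S.indicator (fun _ => |C| * |M|))
      ((volume : Measure ℝ).prod (hyper ν b)) := by
    rw [integrable_indicator_iff hSm]
    exact integrableOn_const hSfin.ne
  have hQint : ∀ n : ℕ, 0 < n → Integrable (Q n) ((volume : Measure ℝ).prod (hyper ν b)) :=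
    fun n hn => hSint.mono' (hQc n).aestronglyMeasurable (hbound n hn)
  have hlim : Tendsto (fun n : ℕ => ∫ q, Q (n + 1) q ∂((volume : Measure ℝ).prod (hyper ν b)))
      atTop (𝓝 (∫ q, Q' q ∂((volume : Measure ℝ).prod (hyper ν b)))) := by
    refine tendsto_integral_of_dominated_convergence _
      (fun n => (hQc (n + 1)).aestronglyMeasurable) hSint
      (fun n => hbound (n + 1) n.succ_pos) ?_
    filter_upwards [hae, haeall] with q hq hqall
    have hXlim : Tendsto (fun n : ℕ => X (n + 1) q) atTop (𝓝 q.2) := by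
      have h1 : Tendsto (fun n : ℕ => q.1 / (((n + 1 : ℕ) : ℝ) * ‖g‖)) atTop (𝓝 0) :=
        ((tendsto_natCast_atTop_atTop.comp (tendsto_add_atTop_nat 1)).atTop_mul_const
          hgn).const_div_atTop _
      have h2 := (h1.smul_const ν).const_add q.2
      simpa [X] using h2
    by_cases hqF : q.2 ∈ body (K.erase a)
    · have hpos : ∀ c ∈ K.erase a, 0 < bary K c q.2 := fun c hc =>
        lt_of_le_of_ne (((h.mem_body_erase ha).1 hqF).2 c (Finset.mem_of_mem_erase hc))
          (hqall c hc).symm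
      have h1 : ∀ c ∈ K.erase a, ∀ᶠ n : ℕ in atTop,
          1 ≤ ((n + 1 : ℕ) : ℝ) * bary K c (X (n + 1) q) := by
        intro c hc
        have h2 : Tendsto (fun n : ℕ => bary K c (X (n + 1) q)) atTop (𝓝 (bary K c q.2)) :=
          ((continuous_bary K c).tendsto _).comp hXlim
        exact ((tendsto_natCast_atTop_atTop.comp (tendsto_add_atTop_nat 1)).atTop_mul_pos
          (hpos c hc) h2).eventually_ge_atTop 1
      have h3 : Tendsto (fun n : ℕ => (D q.1 : ℝ) • φ (X (n + 1) q)) atTop (𝓝 (Q' q)) := by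
        have := ((hφ.tendsto _).comp hXlim).const_smul (D q.1)
        simpa [Q', Set.indicator_of_mem hqF] using this
      refine h3.congr' ?_
      filter_upwards [(Filter.eventually_all_finset _).2 h1] with n hn
      simp only [Q]
      rw [cut_eq_one hn, one_mul]
    · have h1 : ∃ c ∈ K.erase a, bary K c q.2 < 0 := by
        by_contra hcon
        push Not at hcon
        refine hqF ((h.mem_body_erase ha).2 ⟨hq, fun c hc => ?_⟩)
        rcases eq_or_ne c a with rfl | hca
        · exact hq.ge
        · exact hcon c (Finset.mem_erase.2 ⟨hca, hc⟩)
      obtain ⟨c, hc, hc0⟩ := h1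
      have h2 : Tendsto (fun n : ℕ => bary K c (X (n + 1) q)) atTop (𝓝 (bary K c q.2)) :=
        ((continuous_bary K c).tendsto _).comp hXlim
      have h3 : Q' q = 0 := by simp [Q', Set.indicator_of_notMem hqF]
      rw [h3]
      refine tendsto_const_nhds.congr' ?_
      filter_upwards [h2.eventually_lt_const hc0] with n hn
      simp only [Q]
      rw [cut_eq_zero (Nat.cast_nonneg _) hc hn.le, zero_mul, zero_smul]
  have hQ'val : ∫ q, Q' q ∂((volume : Measure ℝ).prod (hyper ν b))
      = ∫ x, φ x ∂(surf (K.erase a)) := by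
    simp only [Q']
    rw [integral_prod_mul (fun t : ℝ => (D t : ℂ)) ((body (K.erase a)).indicator φ),
      integral_complex_ofReal, integral_deriv_smoothTransition,
      integral_indicator (isCompact_body _).measurableSet, hH, ← h.surf_eq_restrict ha hb hab]
    simp
  rw [← hQ'val]
  have hlim2 := hlim.const_smul (‖g‖⁻¹ : ℝ)
  -- The index is shifted by one because the substitution divides by n.
  rw [← tendsto_add_atTop_iff_nat 1]
  refine hlim2.congr fun m => ?_
  -- the change of variables
  set n := m + 1 with hn
  have hn0 : 0 < n := Nat.succ_pos m
  have hn' : (0 : ℝ) < n := by exact_mod_cast hn0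
  let f : E d → ℂ := fun x => (cut K (K.erase a) n x * (D (n * bary K a x) * n)) • φ x
  have hfc : Continuous f :=
    ((continuous_cut K (K.erase a) n).mul ((continuous_deriv_smoothTransition.comp
      (continuous_const.mul (continuous_bary K a))).mul continuous_const)).smul hφ
  have hfs : HasCompactSupport f := by
    refine HasCompactSupport.intro (isCompact_body K) fun x hx => ?_
    rw [h.mem_body] at hx
    push Not at hx
    obtain ⟨c, hc, hcx⟩ := hx
    rcases eq_or_ne c a with rfl | hca
    · have : D (n * bary K c x) = 0 :=
        deriv_smoothTransition_of_neg (mul_neg_of_pos_of_neg hn' hcx)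
      simp [f, this]
    · simp [f, cut_eq_zero hn'.le (Finset.mem_erase.2 ⟨hca, hc⟩) hcx.le]
  have hfi : Integrable f := hfc.integrable_of_hasCompactSupport hfs
  have hmp := measurePreserving_hyper hν1 b
  have e1 : ∫ x, f x = ∫ t : ℝ, ∫ y, f (y + t • ν) ∂(hyper ν b) := by
    conv_lhs => rw [← hmp.map_eq]
    rw [integral_map hmp.measurable.aemeasurable hfc.aestronglyMeasurable]
    exact integral_prod _ ((hmp.integrable_comp hfc.aestronglyMeasurable).2 hfi)
  have e2 : ∫ τ : ℝ, ∫ y, f (y + (τ / (n * ‖g‖)) • ν) ∂(hyper ν b)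
      = (n * ‖g‖) • ∫ t : ℝ, ∫ y, f (y + t • ν) ∂(hyper ν b) := by
    rw [Measure.integral_comp_div (fun t : ℝ => ∫ y, f (y + t • ν) ∂(hyper ν b)),
      abs_of_pos (by positivity)]
  have e3 : ∫ q, Q n q ∂((volume : Measure ℝ).prod (hyper ν b))
      = ∫ τ : ℝ, (n : ℝ)⁻¹ • ∫ y, f (y + (τ / (n * ‖g‖)) • ν) ∂(hyper ν b) := by
    rw [integral_prod _ (hQint n hn0)]
    refine integral_congr_ae (.of_forall fun τ => ?_)
    simp only
    rw [← integral_smul]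
    refine integral_congr_ae ?_
    filter_upwards [hbaryH] with y hy
    have h1 := hbaryX n hn0 (τ, y) hy
    simp only [X] at h1
    simp only [Q, X, f]
    rw [h1, mul_div_cancel₀ τ hn'.ne']
    generalize y + (τ / (n * ‖g‖)) • ν = z
    rw [smul_smul]
    congr 1
    field_simp
  change (‖g‖⁻¹ : ℝ) • ∫ q, Q n q ∂((volume : Measure ℝ).prod (hyper ν b)) = ∫ x, f x
  rw [e3, integral_smul, e2, e1, smul_smul, smul_smul]
  have : ‖g‖⁻¹ * (n : ℝ)⁻¹ * (n * ‖g‖) = 1 := by field_simp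
  rw [this, one_smul]

/-- The divergence theorem on a simplex, for a scalar function and a direction. -/
theorem integral_fderiv (h : IsSimplex K) (hd : 0 < d) {φ : E d → ℂ} (hφ : ContDiff ℝ 1 φ)
    (v : E d) :
    ∫ x in cell K, fderiv ℝ φ x v =
      ∑ a ∈ K, (inner ℝ (nrm K (K.erase a)) v : ℝ) • ∫ x, φ x ∂(surf (K.erase a)) := by
  have hcφ : Continuous φ := hφ.continuous
  have hdφ : Continuous fun x => fderiv ℝ φ x v :=
    (hφ.continuous_fderiv (by simp)).clm_apply continuous_const
  have h1 := h.tendsto_integral_cut hdφ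
  have h2 : Tendsto (fun n : ℕ => -∑ a ∈ K, (inner ℝ (gbary K a) v : ℝ) •
      ∫ x, (cut K (K.erase a) n x * (deriv Real.smoothTransition (n * bary K a x) * n)) • φ x) atTop
      (𝓝 (-∑ a ∈ K, (inner ℝ (gbary K a) v : ℝ) •
        ((‖gbary K a‖⁻¹ : ℝ) • ∫ x, φ x ∂(surf (K.erase a))))) :=
    (tendsto_finsetSum _ fun a ha => (h.tendsto_integral_cut_face hd ha hcφ).const_smul _).neg
  have h3 : (∑ a ∈ K, (inner ℝ (nrm K (K.erase a)) v : ℝ) • ∫ x, φ x ∂(surf (K.erase a)))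
      = -∑ a ∈ K, (inner ℝ (gbary K a) v : ℝ) •
        ((‖gbary K a‖⁻¹ : ℝ) • ∫ x, φ x ∂(surf (K.erase a))) := by
    rw [← Finset.sum_neg_distrib]
    refine Finset.sum_congr rfl fun a ha => ?_
    rw [h.nrm_erase hd ha, inner_neg_left, inner_smul_left, smul_smul, ← neg_smul]
    congr 1
    simp [mul_comm]
  rw [h3]
  -- For fixed n the two sequences are equal, by integration by parts on the whole space: the
  -- cut-off has compact support, so no boundary term arises. The boundary appears only in the
  -- limit, through the gradient of the cut-off.
  refine tendsto_nhds_unique h1 (h2.congr fun n => ?_)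
  have hcc := h.hasCompactSupport_cut (n := n) n.cast_nonneg
  have hdc : Continuous fun x => fderiv ℝ (cut K K n) x v :=
    ((contDiff_cut K K n (k := 1)).continuous_fderiv (by simp)).clm_apply continuous_const
  have hdcc : HasCompactSupport fun x => fderiv ℝ (cut K K n) x v :=
    hcc.fderiv_apply (𝕜 := ℝ) v
  rw [integral_smul_fderiv_eq_neg_fderiv_smul_of_integrable
    ((hdc.smul hcφ).integrable_of_hasCompactSupport hdcc.smul_right)
    (((continuous_cut K K n).smul hdφ).integrable_of_hasCompactSupport hcc.smul_right)
    (((continuous_cut K K n).smul hcφ).integrable_of_hasCompactSupport hcc.smul_right)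
    (fun x _ => (contDiff_cut K K n (k := 1)).differentiable (by simp) x)
    (fun x _ => hφ.differentiable (by simp) x)]
  congr 1
  have h4 : ∀ a ∈ K, Integrable fun x => (cut K (K.erase a) n x *
      (deriv Real.smoothTransition (n * bary K a x) * n)) • φ x := by
    intro a ha
    refine Continuous.integrable_of_hasCompactSupport
      (((continuous_cut K (K.erase a) n).mul ((continuous_deriv_smoothTransition.comp
      (continuous_const.mul (continuous_bary K a))).mul continuous_const)).smul hcφ) ?_
    refine HasCompactSupport.intro (isCompact_body K) fun x hx => ?_
    rw [h.mem_body] at hx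
    push Not at hx
    obtain ⟨c, hc, hcx⟩ := hx
    rcases eq_or_ne c a with rfl | hca
    · rcases Nat.eq_zero_or_pos n with rfl | hn
      · simp
      have : deriv Real.smoothTransition (n * bary K c x) = 0 :=
        deriv_smoothTransition_of_neg (mul_neg_of_pos_of_neg (by exact_mod_cast hn) hcx)
      simp [this]
    · simp [cut_eq_zero n.cast_nonneg (Finset.mem_erase.2 ⟨hca, hc⟩) hcx.le]
  simp_rw [fderiv_cut, Finset.sum_smul, mul_smul (inner ℝ (gbary K _) v)]
  rw [integral_finsetSum]
  · exact Finset.sum_congr rfl fun a _ => (integral_smul _ _).symm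
  · exact fun a ha => (h4 a ha).smul (inner ℝ (gbary K a) v)

end IsSimplex


/-! ### Convergence of averages in `L²` -/

/-- For a probability measure the L¹ norm in y is at most the L² norm; then square and apply
Tonelli. -/
theorem eLpNorm_integral_le {α β : Type*} [MeasurableSpace α] [MeasurableSpace β]
    (μ : Measure α) [SFinite μ] (π : Measure β) [IsProbabilityMeasure π] {F : α × β → ℂ}
    (hF : AEStronglyMeasurable F (μ.prod π)) :
    eLpNorm (fun x => ∫ y, F (x, y) ∂π) 2 μ ≤ eLpNorm F 2 (μ.prod π) := by
  rw [eLpNorm_eq_lintegral_rpow_enorm_toReal two_ne_zero ENNReal.ofNat_ne_top,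
    eLpNorm_eq_lintegral_rpow_enorm_toReal two_ne_zero ENNReal.ofNat_ne_top,
    lintegral_prod _ (by fun_prop)]
  refine ENNReal.rpow_le_rpow (lintegral_mono_ae ?_) (by simp)
  filter_upwards [hF.prodMk_left] with x hx
  have h1 : ‖∫ y, F (x, y) ∂π‖ₑ ≤ eLpNorm (fun y => F (x, y)) 2 π :=
    (enorm_integral_le_lintegral_enorm _).trans (by
      rw [← eLpNorm_one_eq_lintegral_enorm]
      exact eLpNorm_le_eLpNorm_of_exponent_le one_le_two hx)
  refine (ENNReal.rpow_le_rpow h1 (by simp)).trans ?_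
  rw [eLpNorm_eq_lintegral_rpow_enorm_toReal two_ne_zero ENNReal.ofNat_ne_top, ← ENNReal.rpow_mul]
  simp

/-- The point `(1 - ε) x + ε y`. -/
def mix (ε : ℝ) (q : E d × E d) : E d := (1 - ε) • q.1 + ε • q.2

theorem continuous_mix (ε : ℝ) : Continuous (mix (d := d) ε) := by
  unfold mix; fun_prop

/-- For fixed y the map x ↦ (1 - ε)x + εy multiplies volumes by (1 - ε)^d. Since ε ≤ 1/2, its
inverse multiplies them by at most 2^d, uniformly in y. -/
theorem map_mix_le (π : Measure (E d)) [IsProbabilityMeasure π] {ε : ℝ} (h1 : ε ≤ 1 / 2) :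
    ((volume : Measure (E d)).prod π).map (mix ε) ≤ ENNReal.ofReal (2 ^ d) • volume := by
  refine Measure.le_iff.2 fun s hs => ?_
  rw [Measure.map_apply (continuous_mix ε).measurable hs,
    Measure.prod_apply_symm ((continuous_mix ε).measurable hs)]
  have h2 : (0 : ℝ) < 1 - ε := by linarith
  have h3 : ∀ y : E d, volume ((fun x => (x, y)) ⁻¹' (mix ε ⁻¹' s))
      = ENNReal.ofReal |((1 - ε) ^ d)⁻¹| * volume s := by
    intro y
    have : (fun x => (x, y)) ⁻¹' (mix ε ⁻¹' s)
        = (fun x : E d => (1 - ε) • x) ⁻¹' ((fun x => x + ε • y) ⁻¹' s) := rfl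
    rw [this, Measure.addHaar_preimage_smul _ h2.ne', measure_preimage_add_right,
      finrank_euclideanSpace_fin]
  simp_rw [h3]
  rw [lintegral_const, measure_univ, mul_one, Measure.smul_apply, smul_eq_mul]
  gcongr
  rw [abs_of_pos (by positivity), ← inv_pow]
  refine pow_le_pow_left₀ (by positivity) ?_ d
  rw [inv_le_comm₀ h2 two_pos]
  linarith

/-- The constant does not depend on ε; this uniform bound is what makes the density argument for
averages work. -/
theorem eLpNorm_comp_mix_le {h : E d → ℂ} (hh : AEStronglyMeasurable h volume)
    (μ : Measure (E d)) (hμ : μ ≤ volume) [SFinite μ] (π : Measure (E d)) [IsProbabilityMeasure π]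
    {ε : ℝ} (h1 : ε ≤ 1 / 2) :
    eLpNorm (fun q => h (mix ε q)) 2 (μ.prod π)
      ≤ ENNReal.ofReal (2 ^ d) ^ (1 / 2 : ℝ) * eLpNorm h 2 volume := by
  have hle := map_mix_le (d := d) π h1
  have hm : AEStronglyMeasurable h (((volume : Measure (E d)).prod π).map (mix ε)) :=
    (hh.smul_measure _).mono_measure hle
  calc eLpNorm (fun q => h (mix ε q)) 2 (μ.prod π)
      ≤ eLpNorm (h ∘ mix ε) 2 (volume.prod π) :=
        eLpNorm_mono_measure _ (Measure.prod_mono hμ le_rfl)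
    _ = eLpNorm h 2 ((volume.prod π).map (mix ε)) :=
        (eLpNorm_map_measure hm (continuous_mix ε).aemeasurable).symm
    _ ≤ eLpNorm h 2 (ENNReal.ofReal (2 ^ d) • volume) := eLpNorm_mono_measure _ hle
    _ = _ := by
        rw [eLpNorm_smul_measure_of_ne_top ENNReal.ofNat_ne_top]
        simp

theorem aestronglyMeasurable_comp_mix {h : E d → ℂ} (hh : AEStronglyMeasurable h volume)
    (μ : Measure (E d)) (hμ : μ ≤ volume) [SFinite μ] (π : Measure (E d)) [IsProbabilityMeasure π]
    {ε : ℝ} (h1 : ε ≤ 1 / 2) :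
    AEStronglyMeasurable (fun q => h (mix ε q)) (μ.prod π) := by
  have hle := map_mix_le (d := d) π h1
  have hm : AEStronglyMeasurable h (((volume : Measure (E d)).prod π).map (mix ε)) :=
    (hh.smul_measure _).mono_measure hle
  exact (hm.comp_aemeasurable (continuous_mix ε).aemeasurable).mono_measure
    (Measure.prod_mono hμ le_rfl)

/-- The step sizes of the averages. -/
def step (n : ℕ) : ℝ := 1 / (n + 2)

theorem step_pos (n : ℕ) : 0 < step n := by unfold step; positivity

theorem step_le (n : ℕ) : step n ≤ 1 / 2 := by
  unfold step
  have : (0 : ℝ) ≤ n := n.cast_nonneg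
  gcongr
  linarith

theorem tendsto_step : Tendsto step atTop (𝓝 0) := by
  have h : Tendsto (fun n : ℕ => (n : ℝ) + 2) atTop atTop :=
    tendsto_atTop_add_const_right _ _ tendsto_natCast_atTop_atTop
  exact h.const_div_atTop 1

/-- Approximate f in L² by a continuous function g with compact support. The two occurrences of f -
g are small uniformly in n. The middle term is small because g is uniformly continuous and the
points x and (1 - ε)x + εy of the bounded set are at distance O(ε). -/
theorem tendsto_eLpNorm_mix {f : E d → ℂ} (hf : MemLp f 2 volume) {D : Set (E d)}
    (hD : Bornology.IsBounded D) (hDm : MeasurableSet D) (π : Measure (E d))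
    [IsProbabilityMeasure π] (hπ : ∀ᵐ y ∂π, y ∈ D) :
    Tendsto (fun n => eLpNorm (fun q : E d × E d => f (mix (step n) q) - f q.1) 2
      ((volume.restrict D).prod π)) atTop (𝓝 0) := by
  obtain ⟨R, hR⟩ := hD.subset_closedBall 0
  set μ : Measure (E d) := volume.restrict D with hμ
  have hμle : μ ≤ volume := Measure.restrict_le_self
  have hμfin : IsFiniteMeasure μ := ⟨by
    rw [hμ, Measure.restrict_apply_univ]; exact hD.measure_lt_top⟩
  have hmem : ∀ᵐ q ∂(μ.prod π), q.1 ∈ D ∧ q.2 ∈ D :=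
    (Measure.quasiMeasurePreserving_fst.ae (ae_restrict_mem hDm)).and
      (Measure.quasiMeasurePreserving_snd.ae hπ)
  have hfst : ∀ h : E d → ℂ, AEStronglyMeasurable h volume →
      eLpNorm (fun q : E d × E d => h q.1) 2 (μ.prod π) ≤ eLpNorm h 2 volume := by
    intro h hh
    have h1 := (measurePreserving_fst (μ := μ) (ν := π)).map_eq
    have h2 : eLpNorm (h ∘ Prod.fst) 2 (μ.prod π) = eLpNorm h 2 μ := by
      rw [← eLpNorm_map_measure (by rw [h1]; exact hh.mono_measure hμle) (by fun_prop), h1]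
    exact h2.le.trans (eLpNorm_mono_measure _ hμle)
  have hfstm : ∀ h : E d → ℂ, AEStronglyMeasurable h volume →
      AEStronglyMeasurable (fun q : E d × E d => h q.1) (μ.prod π) := fun h hh =>
    (hh.mono_measure hμle).comp_fst
  rw [ENNReal.tendsto_nhds_zero]
  intro δ hδ
  set C : ℝ≥0∞ := ENNReal.ofReal (2 ^ d) ^ (1 / 2 : ℝ) with hC
  have hCtop : C ≠ ⊤ := ENNReal.rpow_ne_top_of_nonneg (by simp) ENNReal.ofReal_ne_top
  -- reduce to finite `δ`
  obtain ⟨δ', hδ'0, hδ'⟩ : ∃ δ' : ℝ≥0∞, δ' ≠ 0 ∧ C * δ' + δ' + δ' ≤ δ := by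
    have h1 : Tendsto (fun t : ℝ≥0∞ => C * t + t + t) (𝓝 0) (𝓝 (C * 0 + 0 + 0)) :=
      ((ENNReal.Tendsto.const_mul tendsto_id (Or.inr hCtop)).add tendsto_id).add tendsto_id
    have h2 := (h1.eventually (ge_mem_nhds (by simpa using hδ))).filter_mono
      (nhdsWithin_le_nhds (s := {0}ᶜ))
    obtain ⟨t, ht, ht0⟩ := (h2.and self_mem_nhdsWithin).exists
    exact ⟨t, ht0, ht⟩
  obtain ⟨g, hgs, hfg, hgc, hgm⟩ := hf.exists_hasCompactSupport_eLpNorm_sub_le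
    ENNReal.ofNat_ne_top hδ'0
  have hgu : UniformContinuous g := hgs.uniformContinuous_of_continuous hgc
  -- uniform smallness for `g`
  obtain ⟨r, hr0, hr⟩ : ∃ r : ℝ, 0 < r ∧
      (μ.prod π) Set.univ ^ (2 : ℝ≥0∞).toReal⁻¹ * ENNReal.ofReal r ≤ δ' := by
    have h0 : (μ.prod π) Set.univ ^ (2 : ℝ≥0∞).toReal⁻¹ ≠ ⊤ :=
      ENNReal.rpow_ne_top_of_nonneg (by simp) (measure_ne_top _ _)
    have h1 : Tendsto (fun t : ℝ => (μ.prod π) Set.univ ^ (2 : ℝ≥0∞).toReal⁻¹ * ENNReal.ofReal t)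
        (𝓝 0) (𝓝 ((μ.prod π) Set.univ ^ (2 : ℝ≥0∞).toReal⁻¹ * ENNReal.ofReal 0)) :=
      ENNReal.Tendsto.const_mul (ENNReal.tendsto_ofReal tendsto_id) (Or.inr h0)
    have h2 := (h1.eventually (ge_mem_nhds (by simpa using pos_iff_ne_zero.2 hδ'0))).filter_mono
      (nhdsWithin_le_nhds (s := Set.Ioi 0))
    obtain ⟨t, ht, ht0⟩ := (h2.and self_mem_nhdsWithin).exists
    exact ⟨t, ht0, ht⟩
  obtain ⟨ρ, hρ0, hρ⟩ := Metric.uniformContinuous_iff.1 hgu r hr0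
  have hev : ∀ᶠ n in atTop, step n * (|R| + |R|) < ρ := by
    have : Tendsto (fun n => step n * (|R| + |R|)) atTop (𝓝 (0 * (|R| + |R|))) :=
      tendsto_step.mul_const _
    exact this.eventually_lt_const (by simpa using hρ0)
  filter_upwards [hev] with n hn
  have e : (fun q : E d × E d => f (mix (step n) q) - f q.1)
      = fun q => ((f - g) (mix (step n) q) + (g (mix (step n) q) - g q.1)) + (g - f) q.1 := by
    ext q; simp
  have hsubm : AEStronglyMeasurable (f - g) volume := hf.1.sub hgm.1
  have hsubm' : AEStronglyMeasurable (g - f) volume := hgm.1.sub hf.1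
  have hgmix : AEStronglyMeasurable (fun q : E d × E d => g (mix (step n) q) - g q.1) (μ.prod π) := by
    refine Continuous.aestronglyMeasurable ?_
    exact (hgc.comp (continuous_mix _)).sub (hgc.comp continuous_fst)
  rw [e]
  have m1 := aestronglyMeasurable_comp_mix hsubm μ hμle π (step_le n)
  refine (eLpNorm_add_le (m1.add hgmix) (hfstm _ hsubm') one_le_two).trans
    (le_trans (add_le_add ((eLpNorm_add_le m1 hgmix one_le_two).trans (add_le_add ?_ ?_)) ?_) hδ')
  · exact (eLpNorm_comp_mix_le hsubm μ hμle π (step_le n)).trans (by gcongr)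
  · refine (eLpNorm_le_of_ae_bound ?_).trans hr
    filter_upwards [hmem] with q hq
    rw [← dist_eq_norm]
    refine (hρ ?_).le
    have h1 : ‖q.1‖ ≤ |R| := (mem_closedBall_zero_iff.1 (hR hq.1)).trans (le_abs_self R)
    have h2 : ‖q.2‖ ≤ |R| := (mem_closedBall_zero_iff.1 (hR hq.2)).trans (le_abs_self R)
    have h3 : mix (step n) q - q.1 = step n • (q.2 - q.1) := by
      rw [mix, sub_smul, one_smul, smul_sub]; abel
    rw [dist_eq_norm, h3, norm_smul, Real.norm_of_nonneg (step_pos n).le]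
    refine lt_of_le_of_lt ?_ hn
    exact mul_le_mul_of_nonneg_left ((norm_sub_le _ _).trans (add_le_add h2 h1)) (step_pos n).le
  · refine (hfst _ hsubm').trans ?_
    rw [← neg_sub f g, eLpNorm_neg]
    exact hfg

/-- Averages over shrinking neighbourhoods converge in `L²`. -/
theorem tendsto_eLpNorm_average {f : E d → ℂ} (hf : MemLp f 2 volume) {D : Set (E d)}
    (hD : Bornology.IsBounded D) (hDm : MeasurableSet D) (π : Measure (E d))
    [IsProbabilityMeasure π] (hπ : ∀ᵐ y ∂π, y ∈ D) :
    Tendsto (fun n => eLpNorm (fun x => ∫ y, f (mix (step n) (x, y)) ∂π - f x) 2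
      (volume.restrict D)) atTop (𝓝 0) := by
  refine tendsto_of_tendsto_of_tendsto_of_le_of_le tendsto_const_nhds
    (tendsto_eLpNorm_mix hf hD hDm π hπ) (fun _ => zero_le) fun n => ?_
  set μ : Measure (E d) := volume.restrict D with hμ
  have hμle : μ ≤ volume := Measure.restrict_le_self
  have hμfin : IsFiniteMeasure μ := ⟨by
    rw [hμ, Measure.restrict_apply_univ]; exact hD.measure_lt_top⟩
  have m1 := aestronglyMeasurable_comp_mix hf.1 μ hμle π (step_le n)
  have m2 : AEStronglyMeasurable (fun q : E d × E d => f q.1) (μ.prod π) :=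
    (hf.1.mono_measure hμle).comp_fst
  refine le_trans (le_of_eq ?_) (eLpNorm_integral_le μ π (m1.sub m2))
  refine eLpNorm_congr_ae ?_
  have hint : Integrable (fun q => f (mix (step n) q)) (μ.prod π) := by
    have : MemLp (fun q => f (mix (step n) q)) 2 (μ.prod π) :=
      ⟨m1, (eLpNorm_comp_mix_le hf.1 μ hμle π (step_le n)).trans_lt
        (ENNReal.mul_lt_top (ENNReal.rpow_lt_top_of_nonneg (by simp) ENNReal.ofReal_ne_top) hf.2)⟩
    exact this.integrable one_le_two
  filter_upwards [hint.prod_right_ae] with x hx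
  rw [integral_sub hx (integrable_const _)]
  simp


/-! ### Weak derivatives -/

theorem pderiv_hasCompactSupport {V : Type*} [NormedAddCommGroup V] [NormedSpace ℝ V]
    {φ : E d → V} (h : HasCompactSupport φ) (i : Fin d) : HasCompactSupport (pderiv i φ) :=
  h.fderiv_apply (𝕜 := ℝ) _

theorem continuous_pderiv {V : Type*} [NormedAddCommGroup V] [NormedSpace ℝ V] {φ : E d → V}
    (h : ContDiff ℝ 1 φ) (i : Fin d) : Continuous (pderiv i φ) :=
  (h.continuous_fderiv (by simp)).clm_apply continuous_const

theorem one_le_infty : (1 : WithTop ℕ∞) ≤ ((⊤ : ℕ∞) : WithTop ℕ∞) := by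
  exact_mod_cast (le_top : (1 : ℕ∞) ≤ ⊤)

namespace IsTest

variable {D : Set (E d)} {φ : E d → ℝ}

theorem contDiff_one (h : IsTest D φ) : ContDiff ℝ 1 φ := h.1.of_le one_le_infty

theorem continuous (h : IsTest D φ) : Continuous φ := h.1.continuous

theorem continuous_pderiv (h : IsTest D φ) (i : Fin d) : Continuous (pderiv i φ) :=
  IPDG.continuous_pderiv h.contDiff_one i

theorem mono (h : IsTest D φ) {D' : Set (E d)} (hD : D ⊆ D') : IsTest D' φ :=
  ⟨h.1, h.2.1, h.2.2.trans hD⟩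

theorem eq_zero (h : IsTest D φ) {x : E d} (hx : x ∉ D) : φ x = 0 :=
  image_eq_zero_of_notMem_tsupport fun h' => hx (h.2.2 h')

theorem pderiv_eq_zero (h : IsTest D φ) {x : E d} (hx : x ∉ D) (i : Fin d) : pderiv i φ x = 0 := by
  have : fderiv ℝ φ x = 0 := by
    by_contra hne
    exact hx (h.2.2 (support_fderiv_subset ℝ hne))
  simp [pderiv, this]

theorem memLp (h : IsTest D φ) (μ : Measure (E d)) [IsFiniteMeasureOnCompacts μ] :
    MemLp (fun x => (φ x : ℂ)) 2 μ :=
  (Complex.continuous_ofReal.comp h.continuous).memLp_of_hasCompactSupport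
    (h.2.1.comp_left (g := ((↑) : ℝ → ℂ)) rfl)

theorem memLp_pderiv (h : IsTest D φ) (μ : Measure (E d)) [IsFiniteMeasureOnCompacts μ]
    (i : Fin d) : MemLp (fun x => ((pderiv i φ x : ℝ) : ℂ)) 2 μ :=
  (Complex.continuous_ofReal.comp (h.continuous_pderiv i)).memLp_of_hasCompactSupport
    ((pderiv_hasCompactSupport h.2.1 i).comp_left (g := ((↑) : ℝ → ℂ)) rfl)

theorem setIntegral_mul (h : IsTest D φ) (f : E d → ℂ) :
    ∫ x in D, (φ x : ℂ) * f x = ∫ x, (φ x : ℂ) * f x :=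
  setIntegral_eq_integral_of_forall_compl_eq_zero fun x hx => by simp [h.eq_zero hx]

theorem setIntegral_pderiv_mul (h : IsTest D φ) (i : Fin d) (f : E d → ℂ) :
    ∫ x in D, ((pderiv i φ x : ℝ) : ℂ) * f x = ∫ x, ((pderiv i φ x : ℝ) : ℂ) * f x :=
  setIntegral_eq_integral_of_forall_compl_eq_zero fun x hx => by simp [h.pderiv_eq_zero hx]

end IsTest

theorem MemL2.integrable_mul {D : Set (E d)} {f g : E d → ℂ} (hf : MemL2 D f) (hg : MemL2 D g) :
    IntegrableOn (fun x => f x * g x) D :=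
  MemLp.integrable_mul hf hg

theorem MemL2.test_mul {D : Set (E d)} {φ : E d → ℝ} (hφ : IsTest D φ) {f : E d → ℂ}
    (hf : MemL2 D f) : IntegrableOn (fun x => (φ x : ℂ) * f x) D :=
  MemLp.integrable_mul (hφ.memLp _) hf

theorem MemL2.test_pderiv_mul {D : Set (E d)} {φ : E d → ℝ} (hφ : IsTest D φ) (i : Fin d)
    {f : E d → ℂ} (hf : MemL2 D f) :
    IntegrableOn (fun x => ((pderiv i φ x : ℝ) : ℂ) * f x) D :=
  MemLp.integrable_mul (hφ.memLp_pderiv _ i) hf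

theorem ae_eq_zero_of_test {D : Set (E d)} (hD : IsOpen D) {f : E d → ℂ} (hf : MemL2 D f)
    (h : ∀ φ, IsTest D φ → ∫ x in D, (φ x : ℂ) * f x = 0) :
    ∀ᵐ x ∂(volume.restrict D), f x = 0 := by
  have h1 : LocallyIntegrable f (volume.restrict D) := MemLp.locallyIntegrable hf one_le_two
  have h2 := hD.ae_eq_zero_of_integral_contDiff_smul_eq_zero (h1.locallyIntegrableOn D)
    (fun g hg hgs hgD => by simpa using h g ⟨hg, hgs, hgD⟩)
  filter_upwards [h2, ae_restrict_mem hD.measurableSet] with x hx hxD using hx hxD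

theorem IsWeakGrad.congr {D : Set (E d)} {v v' : E d → ℂ} {g g' : E d → Fin d → ℂ}
    (h : IsWeakGrad D v g) (hv : ∀ᵐ x ∂(volume.restrict D), v x = v' x)
    (hg : ∀ᵐ x ∂(volume.restrict D), g x = g' x) : IsWeakGrad D v' g' := by
  intro φ hφ i
  have h1 := h φ hφ i
  rw [integral_congr_ae (g := fun x => ((pderiv i φ x : ℝ) : ℂ) * v' x)
    (by filter_upwards [hv] with x hx; rw [hx]),
    integral_congr_ae (μ := volume.restrict D) (f := fun x => (φ x : ℂ) * g x i)
      (g := fun x => (φ x : ℂ) * g' x i)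
    (by filter_upwards [hg] with x hx; rw [hx])] at h1
  exact h1

theorem IsWeakGrad.unique {D : Set (E d)} (hD : IsOpen D) {v : E d → ℂ} {g g' : E d → Fin d → ℂ}
    (h : IsWeakGrad D v g) (h' : IsWeakGrad D v g') (hg : MemL2Vec D g) (hg' : MemL2Vec D g') :
    ∀ᵐ x ∂(volume.restrict D), g x = g' x := by
  have h1 : ∀ i, ∀ᵐ x ∂(volume.restrict D), g x i - g' x i = 0 := by
    intro i
    refine ae_eq_zero_of_test hD (MemLp.sub (hg i) (hg' i)) fun φ hφ => ?_
    have e := (h φ hφ i).symm.trans (h' φ hφ i)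
    simp_rw [mul_sub]
    rw [integral_sub ((hg i).test_mul hφ) ((hg' i).test_mul hφ), sub_eq_zero]
    exact neg_injective e
  filter_upwards [ae_all_iff.2 h1] with x hx
  ext i
  exact sub_eq_zero.1 (hx i)

theorem IsWeakDiv.unique {D : Set (E d)} (hD : IsOpen D) {w : E d → Fin d → ℂ} {q q' : E d → ℂ}
    (h : IsWeakDiv D w q) (h' : IsWeakDiv D w q') (hq : MemL2 D q) (hq' : MemL2 D q') :
    ∀ᵐ x ∂(volume.restrict D), q x = q' x := by
  have h1 : ∀ᵐ x ∂(volume.restrict D), q x - q' x = 0 := by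
    refine ae_eq_zero_of_test hD (MemLp.sub hq hq') fun φ hφ => ?_
    have e := (h φ hφ).symm.trans (h' φ hφ)
    simp_rw [mul_sub]
    rw [integral_sub (hq.test_mul hφ) (hq'.test_mul hφ), sub_eq_zero]
    exact neg_injective e
  filter_upwards [h1] with x hx using sub_eq_zero.1 hx

theorem wgrad_spec {D : Set (E d)} {v : E d → ℂ} (h : MemH1 D v) :
    MemL2Vec D (wgrad D v) ∧ IsWeakGrad D v (wgrad D v) := by
  rw [wgrad, dif_pos h.2]
  exact h.2.choose_spec

theorem wdiv_spec {D : Set (E d)} {w : E d → Fin d → ℂ} (h : MemHdiv D w) :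
    MemL2 D (wdiv D w) ∧ IsWeakDiv D w (wdiv D w) := by
  rw [wdiv, dif_pos h.2]
  exact h.2.choose_spec

theorem wgrad_ae_eq {D : Set (E d)} (hD : IsOpen D) {v : E d → ℂ} {g : E d → Fin d → ℂ}
    (hg : MemL2Vec D g) (h : IsWeakGrad D v g) :
    ∀ᵐ x ∂(volume.restrict D), wgrad D v x = g x := by
  have h2 : ∃ g, MemL2Vec D g ∧ IsWeakGrad D v g := ⟨g, hg, h⟩
  have h3 : MemL2Vec D (wgrad D v) ∧ IsWeakGrad D v (wgrad D v) := by
    rw [wgrad, dif_pos h2]; exact h2.choose_spec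
  exact IsWeakGrad.unique hD h3.2 h h3.1 hg

theorem wdiv_ae_eq {D : Set (E d)} (hD : IsOpen D) {w : E d → Fin d → ℂ} {q : E d → ℂ}
    (hq : MemL2 D q) (h : IsWeakDiv D w q) :
    ∀ᵐ x ∂(volume.restrict D), wdiv D w x = q x := by
  have h2 : ∃ q, MemL2 D q ∧ IsWeakDiv D w q := ⟨q, hq, h⟩
  have h3 : MemL2 D (wdiv D w) ∧ IsWeakDiv D w (wdiv D w) := by
    rw [wdiv, dif_pos h2]; exact h2.choose_spec
  exact IsWeakDiv.unique hD h3.2 h h3.1 hq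

theorem IsWeakGrad.mono {D D' : Set (E d)} (hDD : D' ⊆ D) {v : E d → ℂ} {g : E d → Fin d → ℂ}
    (h : IsWeakGrad D v g) : IsWeakGrad D' v g := by
  intro φ hφ i
  rw [hφ.setIntegral_mul, hφ.setIntegral_pderiv_mul, ← (hφ.mono hDD).setIntegral_mul,
    ← (hφ.mono hDD).setIntegral_pderiv_mul]
  exact h φ (hφ.mono hDD) i

theorem IsWeakDiv.mono {D D' : Set (E d)} (hDD : D' ⊆ D) {w : E d → Fin d → ℂ} {q : E d → ℂ}
    (h : IsWeakDiv D w q) : IsWeakDiv D' w q := by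
  intro φ hφ
  have e : ∀ A : Set (E d), IsTest A φ → ∫ x in A, ∑ i, ((pderiv i φ x : ℝ) : ℂ) * w x i
      = ∫ x, ∑ i, ((pderiv i φ x : ℝ) : ℂ) * w x i := fun A hA =>
    setIntegral_eq_integral_of_forall_compl_eq_zero fun x hx => by simp [hA.pderiv_eq_zero hx]
  rw [hφ.setIntegral_mul, e D' hφ, ← (hφ.mono hDD).setIntegral_mul, ← e D (hφ.mono hDD)]
  exact h φ (hφ.mono hDD)

theorem MemL2.mono {D D' : Set (E d)} (hDD : D' ⊆ D) {v : E d → ℂ} (h : MemL2 D v) : MemL2 D' v :=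
  h.mono_measure (Measure.restrict_mono hDD le_rfl)

theorem MemL2Vec.mono {D D' : Set (E d)} (hDD : D' ⊆ D) {v : E d → Fin d → ℂ} (h : MemL2Vec D v) :
    MemL2Vec D' v := fun i => (h i).mono hDD

theorem MemH1.mono {D D' : Set (E d)} (hDD : D' ⊆ D) {v : E d → ℂ} (h : MemH1 D v) : MemH1 D' v :=
  ⟨h.1.mono hDD, h.2.choose, h.2.choose_spec.1.mono hDD, h.2.choose_spec.2.mono hDD⟩

theorem wgrad_mono {D D' : Set (E d)} (hD' : IsOpen D') (hDD : D' ⊆ D) {v : E d → ℂ}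
    (h : MemH1 D v) : ∀ᵐ x ∂(volume.restrict D'), wgrad D' v x = wgrad D v x :=
  wgrad_ae_eq hD' ((wgrad_spec h).1.mono hDD) ((wgrad_spec h).2.mono hDD)

theorem IsWeakGrad.add_smul {D : Set (E d)} {v v' : E d → ℂ} {g g' : E d → Fin d → ℂ}
    (hv : MemL2 D v) (hv' : MemL2 D v') (hg : MemL2Vec D g) (hg' : MemL2Vec D g')
    (h : IsWeakGrad D v g) (h' : IsWeakGrad D v' g') (c : ℂ) :
    IsWeakGrad D (v + c • v') (g + c • g') := by
  intro φ hφ i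
  simp only [Pi.add_apply, Pi.smul_apply, smul_eq_mul, mul_add]
  have e : ∀ a b : ℂ, a * (c * b) = c * (a * b) := fun a b => by ring
  simp only [e]
  rw [integral_add (hv.test_pderiv_mul hφ i) ((hv'.test_pderiv_mul hφ i).const_mul c),
    integral_add ((hg i).test_mul hφ) (((hg' i).test_mul hφ).const_mul c),
    integral_const_mul, integral_const_mul, h φ hφ i, h' φ hφ i]
  ring

theorem MemL2.add_smul {D : Set (E d)} {v v' : E d → ℂ} (hv : MemL2 D v) (hv' : MemL2 D v') (c : ℂ) :
    MemL2 D (v + c • v') := MemLp.add hv (MemLp.const_smul hv' c)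

theorem MemL2Vec.add_smul {D : Set (E d)} {v v' : E d → Fin d → ℂ} (hv : MemL2Vec D v)
    (hv' : MemL2Vec D v') (c : ℂ) : MemL2Vec D (v + c • v') :=
  fun i => (hv i).add_smul (hv' i) c

theorem MemH1.add_smul {D : Set (E d)} {v v' : E d → ℂ} (hv : MemH1 D v) (hv' : MemH1 D v') (c : ℂ) :
    MemH1 D (v + c • v') :=
  ⟨hv.1.add_smul hv'.1 c, wgrad D v + c • wgrad D v',
    (wgrad_spec hv).1.add_smul (wgrad_spec hv').1 c,
    (wgrad_spec hv).2.add_smul hv.1 hv'.1 (wgrad_spec hv).1 (wgrad_spec hv').1 (wgrad_spec hv').2 c⟩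

theorem wgrad_add_smul {D : Set (E d)} (hD : IsOpen D) {v v' : E d → ℂ} (hv : MemH1 D v)
    (hv' : MemH1 D v') (c : ℂ) :
    ∀ᵐ x ∂(volume.restrict D), wgrad D (v + c • v') x = wgrad D v x + c • wgrad D v' x :=
  wgrad_ae_eq hD ((wgrad_spec hv).1.add_smul (wgrad_spec hv').1 c)
    ((wgrad_spec hv).2.add_smul hv.1 hv'.1 (wgrad_spec hv).1 (wgrad_spec hv').1 (wgrad_spec hv').2 c)

theorem MemL2.congr {D : Set (E d)} {v v' : E d → ℂ} (h : MemL2 D v)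
    (e : ∀ᵐ x ∂(volume.restrict D), v x = v' x) : MemL2 D v' := MemLp.ae_eq e h

theorem MemH1.congr {D : Set (E d)} {v v' : E d → ℂ} (h : MemH1 D v)
    (e : ∀ᵐ x ∂(volume.restrict D), v x = v' x) : MemH1 D v' :=
  ⟨h.1.congr e, h.2.choose, h.2.choose_spec.1,
    h.2.choose_spec.2.congr e (.of_forall fun _ => rfl)⟩

theorem wgrad_congr {D : Set (E d)} (hD : IsOpen D) {v v' : E d → ℂ} (h : MemH1 D v)
    (e : ∀ᵐ x ∂(volume.restrict D), v x = v' x) :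
    ∀ᵐ x ∂(volume.restrict D), wgrad D v' x = wgrad D v x :=
  wgrad_ae_eq hD (wgrad_spec h).1 ((wgrad_spec h).2.congr e (.of_forall fun _ => rfl))

/-- The gradient of a `C¹` function is its weak gradient. -/
theorem isWeakGrad_of_contDiff (D : Set (E d)) {v : E d → ℂ} (hv : ContDiff ℝ 1 v) :
    IsWeakGrad D v (fun x i => pderiv i v x) := by
  intro φ hφ i
  rw [hφ.setIntegral_mul, hφ.setIntegral_pderiv_mul]
  have hc := hφ.2.1
  have hcd := pderiv_hasCompactSupport hc i
  have := integral_smul_fderiv_eq_neg_fderiv_smul_of_integrable (μ := volume) (𝕜 := ℝ)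
    (f := φ) (g := v) (v := EuclideanSpace.single i 1)
    (((hφ.continuous_pderiv i).smul hv.continuous).integrable_of_hasCompactSupport hcd.smul_right)
    ((hφ.continuous.smul (continuous_pderiv hv i)).integrable_of_hasCompactSupport hc.smul_right)
    ((hφ.continuous.smul hv.continuous).integrable_of_hasCompactSupport hc.smul_right)
    (fun x _ => hφ.contDiff_one.differentiable (by simp) x)
    (fun x _ => hv.differentiable (by simp) x)
  simp only [Complex.real_smul] at this
  rw [eq_neg_iff_add_eq_zero] at this ⊢
  rw [add_comm]
  exact this

theorem memL2_of_continuous {D : Set (E d)} (hD : Bornology.IsBounded D) {v : E d → ℂ}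
    (hv : Continuous v) : MemL2 D v := by
  have h1 : MemLp v 2 (volume.restrict (closure D)) := by
    have hc : IsCompact (closure D) := hD.isCompact_closure
    obtain ⟨C, hC⟩ := hc.exists_bound_of_continuousOn hv.continuousOn
    have : IsFiniteMeasure (volume.restrict (closure D)) :=
      ⟨by rw [Measure.restrict_apply_univ]; exact hc.measure_lt_top⟩
    refine MemLp.of_bound hv.aestronglyMeasurable C ?_
    filter_upwards [ae_restrict_mem isClosed_closure.measurableSet] with x hx using hC x hx
  exact h1.mono_measure (Measure.restrict_mono subset_closure le_rfl)

theorem memH1_of_contDiff {D : Set (E d)} (hD : Bornology.IsBounded D) {v : E d → ℂ}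
    (hv : ContDiff ℝ 1 v) : MemH1 D v :=
  ⟨memL2_of_continuous hD hv.continuous, fun x i => pderiv i v x,
    fun i => memL2_of_continuous hD (continuous_pderiv hv i), isWeakGrad_of_contDiff D hv⟩

theorem wgrad_of_contDiff {D : Set (E d)} (hD : Bornology.IsBounded D) (hDo : IsOpen D)
    {v : E d → ℂ} (hv : ContDiff ℝ 1 v) :
    ∀ᵐ x ∂(volume.restrict D), wgrad D v x = fun i => pderiv i v x :=
  wgrad_ae_eq hDo (fun i => memL2_of_continuous hD (continuous_pderiv hv i))
    (isWeakGrad_of_contDiff D hv)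

theorem enorm_ofReal' (r : ℝ) : ‖(r : ℂ)‖ₑ = ‖r‖ₑ := by
  rw [← ofReal_norm, ← ofReal_norm, Complex.norm_real]

/-! ### Approximation by smooth functions -/

/-- Scalar multiplication with swapped arguments. -/
abbrev rsmul : ℂ →L[ℝ] ℝ →L[ℝ] ℂ := (ContinuousLinearMap.lsmul ℝ ℝ).flip

/-- The convolution kernel associated with a weight `η` and a step `ε`. -/
def kern (η : E d → ℝ) (ε : ℝ) (w : E d) : ℝ := (ε ^ d)⁻¹ * η (-(ε⁻¹ • w))

theorem contDiff_kern {η : E d → ℝ} {n : WithTop ℕ∞} (h : ContDiff ℝ n η) (ε : ℝ) :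
    ContDiff ℝ n (kern η ε) :=
  contDiff_const.mul (h.comp (contDiff_id.const_smul _).neg)

theorem hasCompactSupport_kern {η : E d → ℝ} (h : HasCompactSupport η) {ε : ℝ} (hε : 0 < ε) :
    HasCompactSupport (kern η ε) := by
  have h1 : HasCompactSupport (fun w => η (-(ε⁻¹ • w))) :=
    h.comp_homeomorph (((Homeomorph.smulOfNeZero ε⁻¹ (inv_ne_zero hε.ne'))).trans
      (Homeomorph.neg (E d)))
  exact h1.mul_left

/-- The substitution t = εy changes the average over y into a convolution evaluated at (1 - ε)x. The
sign in `kern` is the reflection built into the convolution. This form gives smoothness of the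
average on all of ℝ^d. -/
theorem average_eq_convolution {η : E d → ℝ} (hη0 : ∀ y, 0 ≤ η y) (hηc : Continuous η)
    {ε : ℝ} (hε : 0 < ε) (f : E d → ℂ) (x : E d) :
    ∫ y, f (mix ε (x, y)) ∂(volume.withDensity fun y => ENNReal.ofReal (η y))
      = convolution f (kern η ε) rsmul volume ((1 - ε) • x) := by
  rw [integral_withDensity_eq_integral_toReal_smul (by fun_prop) (by simp), convolution]
  simp_rw [ENNReal.toReal_ofReal (hη0 _)]
  set X := (1 - ε) • x
  have h1 : ∀ y, η y • f (mix ε (x, y)) = (fun t => η (ε⁻¹ • t) • f (X + t)) (ε • y) := by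
    intro y
    simp only [smul_smul, inv_mul_cancel₀ hε.ne', one_smul]
    rfl
  rw [integral_congr_ae (.of_forall h1),
    Measure.integral_comp_smul volume (fun t => η (ε⁻¹ • t) • f (X + t)), finrank_euclideanSpace_fin, abs_of_pos (by positivity),
    ← integral_smul]
  rw [← integral_sub_right_eq_self _ X]
  refine integral_congr_ae (.of_forall fun t => ?_)
  simp only [kern, ContinuousLinearMap.flip_apply, ContinuousLinearMap.lsmul_apply]
  rw [smul_smul, ← smul_neg, neg_sub]
  congr 2
  abel

theorem pderiv_convolution {f : E d → ℂ} (hf : LocallyIntegrable f volume) {κ : E d → ℝ}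
    (hκ : ContDiff ℝ 1 κ) (hκs : HasCompactSupport κ) (c : ℝ) (i : Fin d) (x : E d) :
    pderiv i (fun x => convolution f κ rsmul volume (c • x)) x
      = c • convolution f (pderiv i κ) rsmul volume (c • x) := by
  have h1 := hκs.hasFDerivAt_convolution_right (L := rsmul) hf hκ (c • x)
  have h2 : HasFDerivAt (fun x : E d => c • x) (c • ContinuousLinearMap.id ℝ (E d)) x :=
    (hasFDerivAt_id x).const_smul c
  have h3 := h1.comp x h2
  have h4 : fderiv ℝ (fun x => convolution f κ rsmul volume (c • x)) x = _ := h3.fderiv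
  rw [pderiv, h4]
  simp only [ContinuousLinearMap.comp_apply, _root_.smul_apply, ContinuousLinearMap.id_apply]
  rw [map_smul, convolution_precompR_apply _ hf (hκs.fderiv (𝕜 := ℝ)) (hκ.continuous_fderiv (by simp))]
  rfl

theorem exists_weight {D : Set (E d)} (hD : IsOpen D) (hne : D.Nonempty) :
    ∃ η : E d → ℝ, IsTest D η ∧ (∀ y, 0 ≤ η y) ∧ ∫ y, η y = 1 := by
  obtain ⟨x, hx⟩ := hne
  obtain ⟨r, hr, hrD⟩ := Metric.isOpen_iff.1 hD x hx
  let b : ContDiffBump x := ⟨r / 4, r / 2, by positivity, by linarith⟩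
  refine ⟨b.normed volume, ⟨b.contDiff_normed, b.hasCompactSupport_normed, ?_⟩,
    b.nonneg_normed, b.integral_normed⟩
  rw [b.tsupport_normed_eq]
  exact (Metric.closedBall_subset_ball (by change r / 2 < r; linarith)).trans hrD

/-- Functions in `H¹(D)`, `D` convex and bounded, are limits of smooth functions on `ℝ^d`. -/
theorem exists_smooth_approx {D : Set (E d)} (hD : IsOpen D) (hDb : Bornology.IsBounded D)
    (hDc : Convex ℝ D) (hDn : D.Nonempty) {v : E d → ℂ} {g : E d → Fin d → ℂ} (hv : MemL2 D v)
    (hg : MemL2Vec D g) (hvg : IsWeakGrad D v g) :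
    ∃ Φ : ℕ → E d → ℂ, (∀ n, ContDiff ℝ ((⊤ : ℕ∞) : WithTop ℕ∞) (Φ n)) ∧
      Tendsto (fun n => eLpNorm (fun x => Φ n x - v x) 2 (volume.restrict D)) atTop (𝓝 0) ∧
      (∀ i, Tendsto (fun n => eLpNorm (fun x => pderiv i (Φ n) x - g x i) 2
        (volume.restrict D)) atTop (𝓝 0)) ∧
      ((∀ᵐ x ∂(volume.restrict D), g x = 0) → ∀ n, ∀ x ∈ D, ∀ i, pderiv i (Φ n) x = 0) := by
  obtain ⟨η, hη, hη0, hη1⟩ := exists_weight hD hDn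
  set π : Measure (E d) := volume.withDensity fun y => ENNReal.ofReal (η y) with hπ
  have hηi : Integrable η := hη.continuous.integrable_of_hasCompactSupport hη.2.1
  have hπp : IsProbabilityMeasure π := ⟨by
    rw [hπ, withDensity_apply _ MeasurableSet.univ, Measure.restrict_univ,
      ← ofReal_integral_eq_lintegral_ofReal hηi (.of_forall hη0), hη1, ENNReal.ofReal_one]⟩
  have hπD : ∀ᵐ y ∂π, y ∈ D := by
    rw [hπ, ae_withDensity_iff (by have := hη.continuous; fun_prop)]
    refine .of_forall fun y hy => ?_
    by_contra hyD
    simp [hη.eq_zero hyD] at hy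
  have hmem : ∀ {f : E d → ℂ}, MemL2 D f → MemLp (D.indicator f) 2 volume := fun hf =>
    (memLp_indicator_iff_restrict hD.measurableSet).2 hf
  have hloc : ∀ {f : E d → ℂ}, MemL2 D f → LocallyIntegrable (D.indicator f) volume := fun hf =>
    (hmem hf).locallyIntegrable one_le_two
  let Av : (E d → ℂ) → ℕ → E d → ℂ := fun f n x => ∫ y, D.indicator f (mix (step n) (x, y)) ∂π
  have hAv : ∀ f n, Av f n = fun x =>
      convolution (D.indicator f) (kern η (step n)) rsmul volume ((1 - step n) • x) := by
    intro f n
    ext x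
    exact average_eq_convolution hη0 hη.continuous (step_pos n) _ x
  have hκ : ∀ n, ContDiff ℝ ((⊤ : ℕ∞) : WithTop ℕ∞) (kern η (step n)) := fun n =>
    contDiff_kern hη.1 _
  have hκs : ∀ n, HasCompactSupport (kern η (step n)) := fun n =>
    hasCompactSupport_kern hη.2.1 (step_pos n)
  have hlim : ∀ {f : E d → ℂ}, MemL2 D f →
      Tendsto (fun n => eLpNorm (fun x => Av f n x - f x) 2 (volume.restrict D)) atTop (𝓝 0) := by
    intro f hf
    refine (tendsto_eLpNorm_average (hmem hf) hDb hD.measurableSet π hπD).congr fun n => ?_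
    refine eLpNorm_congr_ae ?_
    filter_upwards [ae_restrict_mem hD.measurableSet] with x hx
    rw [Set.indicator_of_mem hx]
  -- the gradient of the averages
  have hgrad : ∀ n, ∀ x ∈ D, ∀ i, pderiv i (Av v n) x
      = ((1 - step n : ℝ) : ℂ) * Av (fun x => g x i) n x := by
    intro n x hx i
    set X := (1 - step n) • x with hX
    rw [hAv, hAv, pderiv_convolution (hloc hv) ((hκ n).of_le one_le_infty) (hκs n),
      Complex.real_smul, ← hX]
    congr 1
    have hε := step_pos n
    have hε2 := step_le n
    -- Here convexity is used: the translated kernel is supported in (1 - ε)x + ε supp η, which lies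
    -- in D when x does. So it is an admissible test function up to the boundary of D, and no
    -- extension of v is required.
    have htest : IsTest D (fun t => kern η (step n) (X - t)) := by
      refine ⟨(hκ n).comp (contDiff_const.sub contDiff_id), ?_, ?_⟩
      · exact (hκs n).comp_homeomorph (Homeomorph.subLeft X)
      · -- the support is a convex combination of points of `D`
        have hsub : tsupport (fun t => kern η (step n) (X - t))
            ⊆ (fun t => (step n)⁻¹ • (t - X)) ⁻¹' tsupport η := by
          refine closure_minimal ?_ ((isClosed_tsupport η).preimage (by fun_prop))
          intro t ht
          refine subset_tsupport η ?_
          rw [Function.mem_support] at ht ⊢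
          intro h0
          apply ht
          rw [kern, ← smul_neg, neg_sub, h0, mul_zero]
        intro t ht
        have h1 : (step n)⁻¹ • (t - X) ∈ D := hη.2.2 (hsub ht)
        have h2 := hDc hx h1 (by linarith : 0 ≤ 1 - step n) hε.le (by ring)
        have h3 : (1 - step n) • x + step n • ((step n)⁻¹ • (t - X)) = t := by
          rw [smul_smul, mul_inv_cancel₀ hε.ne', one_smul, ← hX]; abel
        rwa [h3] at h2
    have hpd : ∀ t, pderiv i (fun t => kern η (step n) (X - t)) t
        = -pderiv i (kern η (step n)) (X - t) := by
      intro t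
      have h1 : HasFDerivAt (kern η (step n)) (fderiv ℝ (kern η (step n)) (X - t)) (X - t) :=
        ((hκ n).differentiable (by simp) _).hasFDerivAt
      have h2 := h1.comp t ((hasFDerivAt_id t).const_sub X)
      have h3 : fderiv ℝ (fun t => kern η (step n) (X - t)) t = _ := h2.fderiv
      rw [pderiv, h3]
      simp [pderiv]
    have hw := hvg _ htest i
    simp_rw [hpd] at hw
    simp only [convolution]
    have e1 : ∀ t, rsmul (D.indicator v t) (pderiv i (kern η (step n)) (X - t))
        = D.indicator (fun t => ((pderiv i (kern η (step n)) (X - t) : ℝ) : ℂ) * v t) t := by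
      intro t
      by_cases ht : t ∈ D
      · simp [Set.indicator_of_mem ht]
      · simp [Set.indicator_of_notMem ht]
    have e2 : ∀ t, rsmul (D.indicator (fun x => g x i) t) (kern η (step n) (X - t))
        = D.indicator (fun t => ((kern η (step n) (X - t) : ℝ) : ℂ) * g t i) t := by
      intro t
      by_cases ht : t ∈ D
      · simp [Set.indicator_of_mem ht]
      · simp [Set.indicator_of_notMem ht]
    rw [integral_congr_ae (.of_forall e1), ← hX, integral_congr_ae (.of_forall e2)]
    rw [integral_indicator hD.measurableSet, integral_indicator hD.measurableSet]
    simp only [Complex.ofReal_neg, neg_mul] at hw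
    rw [integral_neg] at hw
    exact neg_injective hw
  have hsm : ∀ {f : E d → ℂ}, MemL2 D f → ∀ n, ContDiff ℝ ((⊤ : ℕ∞) : WithTop ℕ∞) (Av f n) := by
    intro f hf n
    rw [hAv]
    exact ((hκs n).contDiff_convolution_right (L := rsmul) (hloc hf) (hκ n)).comp
      (contDiff_id.const_smul _)
  refine ⟨Av v, hsm hv, hlim hv, fun i => ?_, fun hg0 n x hx i => ?_⟩
  -- The chain rule for x ↦ (1 - ε)x puts a factor 1 - ε in front of the averaged gradient; the
  -- deviation of this factor from 1 is the second summand.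
  · have h1 : ∀ n, eLpNorm (fun x => pderiv i (Av v n) x - g x i) 2 (volume.restrict D)
        ≤ eLpNorm (fun x => Av (fun x => g x i) n x - g x i) 2 (volume.restrict D)
          + ENNReal.ofReal (step n) * eLpNorm (fun x => g x i) 2 (volume.restrict D) := by
      intro n
      have h2 : ∀ᵐ x ∂(volume.restrict D), pderiv i (Av v n) x - g x i
          = (((1 - step n : ℝ) : ℂ) • (fun x => Av (fun x => g x i) n x - g x i)
            + ((-step n : ℝ) : ℂ) • fun x => g x i) x := by
        filter_upwards [ae_restrict_mem hD.measurableSet] with x hx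
        rw [hgrad n x hx i]
        simp only [Pi.add_apply, Pi.smul_apply, smul_eq_mul]
        push_cast
        ring
      have m1 : AEStronglyMeasurable (fun x => Av (fun x => g x i) n x - g x i)
          (volume.restrict D) := ((hsm (hg i) n).continuous.aestronglyMeasurable).sub (hg i).1
      rw [eLpNorm_congr_ae h2]
      refine (eLpNorm_add_le (m1.const_smul _) ((hg i).1.const_smul _) one_le_two).trans ?_
      rw [eLpNorm_const_smul, eLpNorm_const_smul]
      refine add_le_add (mul_le_of_le_one_left zero_le ?_) (le_of_eq ?_)
      · rw [enorm_ofReal', Real.enorm_eq_ofReal (by linarith [step_le n]),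
          ENNReal.ofReal_le_one]
        linarith [step_pos n]
      · rw [enorm_ofReal', enorm_neg, Real.enorm_eq_ofReal (step_pos n).le]
    refine tendsto_of_tendsto_of_tendsto_of_le_of_le tendsto_const_nhds ?_ (fun _ => zero_le) h1
    have h2 := (hlim (hg i)).add (ENNReal.Tendsto.mul_const (ENNReal.tendsto_ofReal tendsto_step)
      (Or.inr (hg i).2.ne))
    simpa using h2
  · rw [hgrad n x hx i]
    have : Av (fun x => g x i) n x = 0 := by
      rw [hAv]
      simp only [convolution]
      refine integral_eq_zero_of_ae ?_
      rw [ae_restrict_iff' hD.measurableSet] at hg0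
      filter_upwards [hg0] with t ht
      by_cases htD : t ∈ D
      · simp [Set.indicator_of_mem htD, ht htD]
      · simp [Set.indicator_of_notMem htD]
    rw [this, mul_zero]


/-! ### Convergence in `L²` -/

section L2

variable {α : Type*} [MeasurableSpace α] {μ : Measure α}

theorem eLpNorm_two_eq {f : α → ℂ} (hf : MemLp f 2 μ) :
    eLpNorm f 2 μ = ENNReal.ofReal √(∫ x, ‖f x‖ ^ 2 ∂μ) := by
  rw [hf.eLpNorm_eq_integral_rpow_norm two_ne_zero ENNReal.ofNat_ne_top, Real.sqrt_eq_rpow]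
  simp

theorem integrable_norm_sq {f : α → ℂ} (hf : MemLp f 2 μ) : Integrable (fun x => ‖f x‖ ^ 2) μ :=
  hf.integrable_norm_pow two_ne_zero

theorem tendsto_integral_mul {f : ℕ → α → ℂ} {g q : α → ℂ} (hf : ∀ n, MemLp (f n) 2 μ)
    (hg : MemLp g 2 μ) (hq : MemLp q 2 μ)
    (h : Tendsto (fun n => eLpNorm (fun x => f n x - g x) 2 μ) atTop (𝓝 0)) :
    Tendsto (fun n => ∫ x, q x * f n x ∂μ) atTop (𝓝 (∫ x, q x * g x ∂μ)) := by
  refine tendsto_integral_of_L1' _ (hq.1.mul hg.1)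
    (.of_forall fun n => MemLp.integrable_mul hq (hf n)) ?_
  have h1 : Tendsto (fun n => eLpNorm q 2 μ * eLpNorm (fun x => f n x - g x) 2 μ) atTop (𝓝 0) := by
    simpa using ENNReal.Tendsto.const_mul h (Or.inr hq.2.ne)
  refine tendsto_of_tendsto_of_tendsto_of_le_of_le tendsto_const_nhds h1 (fun _ => zero_le)
    fun n => ?_
  have h2 : (fun x => q x * f n x) - q * g = q • (fun x => f n x - g x) := by
    ext x; simp [mul_sub]
  rw [h2]
  exact eLpNorm_smul_le_mul_eLpNorm ((hf n).1.sub hg.1) hq.1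

theorem exists_limit_of_cauchy {f : ℕ → α → ℂ} (hf : ∀ n, MemLp (f n) 2 μ)
    (h : Tendsto (fun n : ℕ × ℕ => eLpNorm (fun x => f n.1 x - f n.2 x) 2 μ) atTop (𝓝 0)) :
    ∃ g, MemLp g 2 μ ∧ Tendsto (fun n => eLpNorm (fun x => f n x - g x) 2 μ) atTop (𝓝 0) := by
  let F : ℕ → Lp ℂ 2 μ := fun n => (hf n).toLp (f n)
  have hF : CauchySeq F := by
    rw [Lp.cauchySeq_Lp_iff_cauchySeq_eLpNorm]
    refine h.congr fun n => eLpNorm_congr_ae ?_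
    filter_upwards [(hf n.1).coeFn_toLp, (hf n.2).coeFn_toLp] with x h1 h2
    simp [F, h1, h2]
  obtain ⟨G, hG⟩ := cauchySeq_tendsto_of_complete hF
  refine ⟨G, Lp.memLp G, ?_⟩
  rw [Lp.tendsto_Lp_iff_tendsto_eLpNorm'] at hG
  refine hG.congr fun n => eLpNorm_congr_ae ?_
  filter_upwards [(hf n).coeFn_toLp] with x h1
  simp [F, h1]

end L2

theorem sqrt_add_le {a b : ℝ} (ha : 0 ≤ a) (hb : 0 ≤ b) : √(a + b) ≤ √a + √b := by
  rw [Real.sqrt_le_left (add_nonneg (Real.sqrt_nonneg _) (Real.sqrt_nonneg _))]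
  nlinarith [Real.sq_sqrt ha, Real.sq_sqrt hb, mul_nonneg (Real.sqrt_nonneg a) (Real.sqrt_nonneg b)]

/-! ### Traces on the boundary of a simplex -/

theorem pderiv_mul {f g : E d → ℂ} {x : E d} (hf : DifferentiableAt ℝ f x)
    (hg : DifferentiableAt ℝ g x) (i : Fin d) :
    pderiv i (fun x => f x * g x) x = pderiv i f x * g x + f x * pderiv i g x := by
  rw [pderiv, fderiv_fun_mul hf hg]
  simp [pderiv, mul_comm, add_comm]

theorem pderiv_sub {f g : E d → ℂ} {x : E d} (hf : DifferentiableAt ℝ f x)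
    (hg : DifferentiableAt ℝ g x) (i : Fin d) :
    pderiv i (fun x => f x - g x) x = pderiv i f x - pderiv i g x := by
  rw [pderiv, fderiv_fun_sub hf hg]
  simp [pderiv]

theorem pderiv_add_const_mul {f g : E d → ℂ} {x : E d} (hf : DifferentiableAt ℝ f x)
    (hg : DifferentiableAt ℝ g x) (c : ℂ) (i : Fin d) :
    pderiv i (fun x => f x + c * g x) x = pderiv i f x + c * pderiv i g x := by
  rw [pderiv, fderiv_fun_add hf (hg.const_mul c), fderiv_const_mul hg]
  simp [pderiv]

theorem pderiv_conj {f : E d → ℂ} {x : E d} (hf : DifferentiableAt ℝ f x) (i : Fin d) :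
    pderiv i (fun x => starRingEnd ℂ (f x)) x = starRingEnd ℂ (pderiv i f x) := by
  have h1 := (Complex.conjCLE.toContinuousLinearMap.hasFDerivAt (x := f x)).comp x hf.hasFDerivAt
  have h2 : fderiv ℝ (fun x => starRingEnd ℂ (f x)) x = _ := h1.fderiv
  rw [pderiv, h2]
  simp [pderiv]

theorem pderiv_coord (c : ℂ) (i : Fin d) (x : E d) :
    pderiv i (fun x : E d => ((x i : ℝ) : ℂ) - c) x = 1 := by
  have h1 : HasFDerivAt (fun x : E d => ((x i : ℝ) : ℂ) - c)
      (Complex.ofRealCLM.comp (EuclideanSpace.proj i)) x :=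
    ((Complex.ofRealCLM.comp (EuclideanSpace.proj i)).hasFDerivAt (x := x)).sub_const c
  rw [pderiv, h1.fderiv]
  simp

namespace IsSimplex

variable {K : Finset (E d)}

theorem sum_facesOf (h : IsSimplex K) {M : Type*} [AddCommMonoid M] (f : Finset (E d) → M) :
    ∑ F ∈ facesOf K, f F = ∑ a ∈ K, f (K.erase a) := by
  have h1 : facesOf K = K.image K.erase := by
    ext F
    rw [h.mem_facesOf, Finset.mem_image]
    simp only [eq_comm]
  rw [h1, Finset.sum_image]
  intro a ha b hb hab
  by_contra hne
  have : a ∈ K.erase b := Finset.mem_erase.2 ⟨hne, ha⟩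
  have h2 : K.erase a = K.erase b := hab
  rw [← h2] at this
  simp at this

theorem memLp_surf (h : IsSimplex K) (hd : 0 < d) {F : Finset (E d)} (hF : F ∈ facesOf K)
    {q : E d → ℂ} (hq : Continuous q) : MemLp q 2 (surf F) := by
  have := h.isFiniteMeasure_surf hd hF
  obtain ⟨C, hC⟩ := (isCompact_body F).exists_bound_of_continuousOn hq.continuousOn
  refine MemLp.of_bound hq.aestronglyMeasurable C ?_
  filter_upwards [ae_restrict_mem (isCompact_body F).measurableSet] with x hx using hC x hx

theorem memL2_cell {q : E d → ℂ} (hq : Continuous q) : MemL2 (cell K) q :=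
  memL2_of_continuous ((isCompact_body K).isBounded.subset (cell_subset_body K)) hq

theorem integral_pderiv (h : IsSimplex K) (hd : 0 < d) {φ : E d → ℂ} (hφ : ContDiff ℝ 1 φ)
    (i : Fin d) :
    ∫ x in cell K, pderiv i φ x =
      ∑ F ∈ facesOf K, ((nrm K F i : ℝ) : ℂ) * ∫ x, φ x ∂(surf F) := by
  rw [h.sum_facesOf]
  have := h.integral_fderiv hd hφ (EuclideanSpace.single i 1)
  simpa [pderiv, EuclideanSpace.inner_single_right] using this

/-- On a face that contains `a` the vector x - a is tangential; on the opposite face its normal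
component is the height of the simplex over that face, the inverse norm of the gradient of λ_a. -/
theorem inner_nrm_sub (h : IsSimplex K) (hd : 0 < d) {a b : E d} (ha : a ∈ K) (hb : b ∈ K) {x : E d}
    (hx : x ∈ body (K.erase b)) :
    inner ℝ (nrm K (K.erase b)) (x - a) = if a = b then ‖gbary K b‖⁻¹ else 0 := by
  rw [h.nrm_erase hd hb, inner_neg_left, inner_smul_left, ← bary_sub,
    ((h.mem_body_erase hb).1 hx).1]
  split_ifs with hab
  · rw [hab, h.bary_self hb]; simp
  · rw [h.bary_ne hb ha (Ne.symm hab)]; simp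

/-- Apply the divergence theorem to the field (x - a)|Φ|², where `a` is the vertex opposite to the
face. Its flux through the other faces is zero, and through this one it is the height times the
integral of |Φ|². Its divergence is d|Φ|² + 2 Re((x - a)·∇Φ conj(Φ)), and |x - a| is bounded on the
simplex by `R`. -/
theorem trace_inequality_sq (h : IsSimplex K) (hd : 0 < d) {F : Finset (E d)}
    (hF : F ∈ facesOf K) : ∃ C : ℝ, 0 ≤ C ∧ ∀ Φ : E d → ℂ, ContDiff ℝ 1 Φ →
      ∫ x, ‖Φ x‖ ^ 2 ∂(surf F) ≤ C * ((∫ x in cell K, ‖Φ x‖ ^ 2) +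
        ∑ i, ∫ x in cell K, ‖pderiv i Φ x‖ ^ 2) := by
  obtain ⟨a, ha, rfl⟩ := h.mem_facesOf.1 hF
  obtain ⟨R, hR⟩ := (isCompact_body K).isBounded.subset_closedBall a
  have hg : 0 < ‖gbary K a‖ := norm_pos_iff.2 (h.gbary_ne_zero hd ha)
  refine ⟨‖gbary K a‖ * (d + d * |R| + |R|), by positivity, fun Φ hΦ => ?_⟩
  have hdiff : ∀ x, DifferentiableAt ℝ Φ x := fun x => hΦ.differentiable (by simp) x
  let N : E d → ℂ := fun x => Φ x * starRingEnd ℂ (Φ x)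
  have hconj : ContDiff ℝ 1 fun x => starRingEnd ℂ (Φ x) :=
    Complex.conjCLE.toContinuousLinearMap.contDiff.comp hΦ
  have hN : ContDiff ℝ 1 N := hΦ.mul hconj
  have hNeq : ∀ x, N x = ((‖Φ x‖ ^ 2 : ℝ) : ℂ) := fun x => by
    simp only [N]; rw [Complex.mul_conj, Complex.normSq_eq_norm_sq]
  have hco : ∀ i : Fin d, ContDiff ℝ 1 (fun x : E d => ((x i : ℝ) : ℂ) - ((a i : ℝ) : ℂ)) := by
    intro i
    exact (Complex.ofRealCLM.contDiff.comp (EuclideanSpace.proj (𝕜 := ℝ) i).contDiff).sub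
      contDiff_const
  have hP : ∀ i : Fin d, ContDiff ℝ 1 (fun x : E d => (((x i : ℝ) : ℂ) - ((a i : ℝ) : ℂ)) * N x) :=
    fun i => (hco i).mul hN
  have hpd : ∀ i x, pderiv i (fun x : E d => (((x i : ℝ) : ℂ) - ((a i : ℝ) : ℂ)) * N x) x
      = N x + (((x i : ℝ) : ℂ) - ((a i : ℝ) : ℂ)) *
        (pderiv i Φ x * starRingEnd ℂ (Φ x) + Φ x * starRingEnd ℂ (pderiv i Φ x)) := by
    intro i x
    rw [pderiv_mul ((hco i).differentiable (by simp) x) (hN.differentiable (by simp) x),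
      pderiv_coord, one_mul]
    simp only [N]
    rw [pderiv_mul (hdiff x) (hconj.differentiable (by simp) x), pderiv_conj (hdiff x)]
  have hface : ∀ b ∈ K, ∑ i, ((nrm K (K.erase b) i : ℝ) : ℂ) *
      ∫ x, (((x i : ℝ) : ℂ) - ((a i : ℝ) : ℂ)) * N x ∂(surf (K.erase b))
      = if a = b then ((‖gbary K b‖⁻¹ : ℝ) : ℂ) * ∫ x, N x ∂(surf (K.erase b)) else 0 := by
    intro b hb
    have hbF : K.erase b ∈ facesOf K := h.mem_facesOf.2 ⟨b, hb, rfl⟩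
    have := h.isFiniteMeasure_surf hd hbF
    simp_rw [← integral_const_mul]
    rw [← integral_finsetSum]
    · have e : ∀ᵐ x ∂(surf (K.erase b)), ∑ i, ((nrm K (K.erase b) i : ℝ) : ℂ) *
          ((((x i : ℝ) : ℂ) - ((a i : ℝ) : ℂ)) * N x)
          = (if a = b then ((‖gbary K b‖⁻¹ : ℝ) : ℂ) else 0) * N x := by
        filter_upwards [ae_restrict_mem (isCompact_body (K.erase b)).measurableSet] with x hx
        have h1 := h.inner_nrm_sub hd ha hb hx
        rw [PiLp.inner_apply] at h1
        simp only [RCLike.inner_apply, conj_trivial, PiLp.sub_apply] at h1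
        simp_rw [← mul_assoc]
        rw [← Finset.sum_mul]
        congr 1
        have h2 := congrArg ((↑) : ℝ → ℂ) h1
        push_cast at h2
        split_ifs at h2 ⊢ with hab
        · rw [← h2]
          exact Finset.sum_congr rfl fun i _ => mul_comm _ _
        · rw [Complex.ofReal_zero] at h2
          rw [← h2]
          exact Finset.sum_congr rfl fun i _ => mul_comm _ _
      rw [integral_congr_ae e]
      split_ifs
      · rw [integral_const_mul]
      · simp
    · intro i _
      exact ((h.memLp_surf hd hbF (hP i).continuous).integrable one_le_two).const_mul _
  have hmain : ∑ i, ∫ x in cell K, pderiv i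
      (fun x : E d => (((x i : ℝ) : ℂ) - ((a i : ℝ) : ℂ)) * N x) x
      = ((‖gbary K a‖⁻¹ : ℝ) : ℂ) * ∫ x, N x ∂(surf (K.erase a)) := by
    simp_rw [h.integral_pderiv hd (hP _), h.sum_facesOf]
    rw [Finset.sum_comm, Finset.sum_congr rfl hface]
    simp [ha]
  have hn : ‖gbary K a‖⁻¹ * ∫ x, ‖Φ x‖ ^ 2 ∂(surf (K.erase a))
      = ‖∑ i, ∫ x in cell K, pderiv i
        (fun x : E d => (((x i : ℝ) : ℂ) - ((a i : ℝ) : ℂ)) * N x) x‖ := by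
    rw [hmain]
    simp_rw [hNeq]
    rw [integral_complex_ofReal, ← Complex.ofReal_mul, Complex.norm_real, Real.norm_of_nonneg]
    exact mul_nonneg (by positivity) (integral_nonneg fun x => by positivity)
  have hL2 : MemL2 (cell K) Φ := memL2_cell hΦ.continuous
  have hL2d : ∀ i, MemL2 (cell K) (pderiv i Φ) := fun i => memL2_cell (continuous_pderiv hΦ i)
  have hbd : ∀ i, ‖∫ x in cell K, pderiv i
        (fun x : E d => (((x i : ℝ) : ℂ) - ((a i : ℝ) : ℂ)) * N x) x‖
      ≤ (1 + |R|) * (∫ x in cell K, ‖Φ x‖ ^ 2) + |R| * ∫ x in cell K, ‖pderiv i Φ x‖ ^ 2 := by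
    intro i
    rw [← integral_const_mul, ← integral_const_mul, ← integral_add
      ((integrable_norm_sq hL2).const_mul _) ((integrable_norm_sq (hL2d i)).const_mul _)]
    refine norm_integral_le_of_norm_le (((integrable_norm_sq hL2).const_mul _).add
      ((integrable_norm_sq (hL2d i)).const_mul _)) ?_
    filter_upwards [ae_restrict_mem (isOpen_cell K).measurableSet] with x hx
    rw [hpd]
    have h1 : ‖((x i : ℝ) : ℂ) - ((a i : ℝ) : ℂ)‖ ≤ |R| := by
      rw [← Complex.ofReal_sub, Complex.norm_real]
      have h2 := hR (cell_subset_body K hx)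
      rw [mem_closedBall_iff_norm] at h2
      exact ((PiLp.norm_apply_le (x - a) i).trans h2).trans (le_abs_self R)
    have h2 : ‖N x‖ = ‖Φ x‖ ^ 2 := by rw [hNeq]; simp
    have h3 : ‖pderiv i Φ x * starRingEnd ℂ (Φ x) + Φ x * starRingEnd ℂ (pderiv i Φ x)‖
        ≤ ‖Φ x‖ ^ 2 + ‖pderiv i Φ x‖ ^ 2 := by
      refine (norm_add_le _ _).trans ?_
      simp only [norm_mul, RCLike.norm_conj]
      nlinarith [sq_nonneg (‖Φ x‖ - ‖pderiv i Φ x‖)]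
    calc _ ≤ ‖N x‖ + ‖((x i : ℝ) : ℂ) - ((a i : ℝ) : ℂ)‖ *
          ‖pderiv i Φ x * starRingEnd ℂ (Φ x) + Φ x * starRingEnd ℂ (pderiv i Φ x)‖ := by
          rw [← norm_mul]; exact norm_add_le _ _
      _ ≤ ‖Φ x‖ ^ 2 + |R| * (‖Φ x‖ ^ 2 + ‖pderiv i Φ x‖ ^ 2) := by
          rw [h2]; gcongr
      _ = _ := by ring
  have htot : ‖gbary K a‖⁻¹ * ∫ x, ‖Φ x‖ ^ 2 ∂(surf (K.erase a))
      ≤ d * ((1 + |R|) * ∫ x in cell K, ‖Φ x‖ ^ 2) +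
        |R| * ∑ i, ∫ x in cell K, ‖pderiv i Φ x‖ ^ 2 := by
    rw [hn]
    refine (norm_sum_le _ _).trans ((Finset.sum_le_sum fun i _ => hbd i).trans (le_of_eq ?_))
    rw [Finset.sum_add_distrib, ← Finset.mul_sum, ← Finset.mul_sum]
    simp
    ring
  set I := ∫ x in cell K, ‖Φ x‖ ^ 2
  set J := ∑ i, ∫ x in cell K, ‖pderiv i Φ x‖ ^ 2
  have hI : 0 ≤ I := integral_nonneg fun x => by positivity
  have hJ : 0 ≤ J := Finset.sum_nonneg fun i _ => integral_nonneg fun x => by positivity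
  rw [inv_mul_le_iff₀ hg] at htot
  refine htot.trans ?_
  rw [mul_assoc]
  refine mul_le_mul_of_nonneg_left ?_ hg.le
  have hR0 := abs_nonneg R
  have hd0 : (0 : ℝ) ≤ d := d.cast_nonneg
  nlinarith [mul_nonneg hR0 hI, mul_nonneg hd0 hJ, mul_nonneg (mul_nonneg hd0 hR0) hJ]

/-- The trace inequality for smooth functions. -/
theorem trace_inequality (h : IsSimplex K) (hd : 0 < d) {F : Finset (E d)}
    (hF : F ∈ facesOf K) : ∃ C : ℝ≥0∞, C ≠ ⊤ ∧ ∀ Φ : E d → ℂ, ContDiff ℝ 1 Φ →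
      eLpNorm Φ 2 (surf F) ≤ C * (eLpNorm Φ 2 (volume.restrict (cell K)) +
        ∑ i, eLpNorm (pderiv i Φ) 2 (volume.restrict (cell K))) := by
  obtain ⟨C, hC0, hC⟩ := h.trace_inequality_sq hd hF
  refine ⟨ENNReal.ofReal √C, ENNReal.ofReal_ne_top, fun Φ hΦ => ?_⟩
  have hL2 : MemL2 (cell K) Φ := memL2_cell hΦ.continuous
  have hL2d : ∀ i, MemL2 (cell K) (pderiv i Φ) := fun i => memL2_cell (continuous_pderiv hΦ i)
  rw [eLpNorm_two_eq (h.memLp_surf hd hF hΦ.continuous), eLpNorm_two_eq hL2,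
    Finset.sum_congr rfl fun i _ => eLpNorm_two_eq (hL2d i),
    ← ENNReal.ofReal_sum_of_nonneg fun i _ => Real.sqrt_nonneg _,
    ← ENNReal.ofReal_add (Real.sqrt_nonneg _) (Finset.sum_nonneg fun i _ => Real.sqrt_nonneg _),
    ← ENNReal.ofReal_mul (Real.sqrt_nonneg _)]
  refine ENNReal.ofReal_le_ofReal ?_
  refine (Real.sqrt_le_sqrt (hC Φ hΦ)).trans ?_
  rw [Real.sqrt_mul hC0]
  refine mul_le_mul_of_nonneg_left ?_ (Real.sqrt_nonneg _)
  have hI : 0 ≤ ∫ x in cell K, ‖Φ x‖ ^ 2 := integral_nonneg fun x => by positivity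
  have hJ : ∀ i ∈ (Finset.univ : Finset (Fin d)), 0 ≤ ∫ x in cell K, ‖pderiv i Φ x‖ ^ 2 :=
    fun i _ => integral_nonneg fun x => by positivity
  refine (sqrt_add_le hI (Finset.sum_nonneg hJ)).trans ?_
  gcongr
  rw [Real.sqrt_le_left (Finset.sum_nonneg fun i _ => Real.sqrt_nonneg _)]
  refine le_trans (Finset.sum_le_sum fun i hi => (Real.sq_sqrt (hJ i hi)).ge) ?_
  exact Finset.sum_sq_le_sq_sum_of_nonneg fun i _ => Real.sqrt_nonneg _

end IsSimplex


theorem pderiv_add_smul {f g : E d → ℂ} {x : E d} (hf : DifferentiableAt ℝ f x)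
    (hg : DifferentiableAt ℝ g x) (c : ℂ) (i : Fin d) :
    pderiv i (f + c • g) x = pderiv i f x + c * pderiv i g x :=
  pderiv_add_const_mul hf hg c i

theorem eLpNorm_sub_le_add {α : Type*} [MeasurableSpace α] {μ : Measure α} {f g h : α → ℂ}
    (hf : AEStronglyMeasurable f μ) (hg : AEStronglyMeasurable g μ)
    (hh : AEStronglyMeasurable h μ) :
    eLpNorm (fun x => f x - h x) 2 μ ≤
      eLpNorm (fun x => f x - g x) 2 μ + eLpNorm (fun x => g x - h x) 2 μ := by
  refine le_trans (le_of_eq ?_) (eLpNorm_add_le (hf.sub hg) (hg.sub hh) one_le_two)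
  congr 1
  ext x
  simp

theorem eLpNorm_sub_comm' {α : Type*} [MeasurableSpace α] {μ : Measure α} (f g : α → ℂ) :
    eLpNorm (fun x => f x - g x) 2 μ = eLpNorm (fun x => g x - f x) 2 μ :=
  eLpNorm_sub_comm f g 2 μ

namespace IsTrace

variable {K : Finset (E d)} {v v' g g' : E d → ℂ}

theorem congr (hv : MemH1 (cell K) v) (h : IsTrace K v g)
    (e : ∀ᵐ x ∂(volume.restrict (cell K)), v x = v' x) : IsTrace K v' g := by
  obtain ⟨h1, Φ, hΦ, h2, h3, h4⟩ := h
  refine ⟨h1, Φ, hΦ, h2.congr fun n => eLpNorm_congr_ae ?_, fun i => (h3 i).congr fun n =>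
    eLpNorm_congr_ae ?_, h4⟩
  · filter_upwards [e] with x hx; rw [hx]
  · filter_upwards [wgrad_congr (isOpen_cell K) hv e] with x hx; rw [hx]

theorem add_smul (hv : MemH1 (cell K) v) (hv' : MemH1 (cell K) v') (h : IsTrace K v g)
    (h' : IsTrace K v' g') (c : ℂ) : IsTrace K (v + c • v') (g + c • g') := by
  obtain ⟨h1, Φ, hΦ, h2, h3, h4⟩ := h
  obtain ⟨h1', Φ', hΦ', h2', h3', h4'⟩ := h'
  have key : ∀ {α : Type _} [MeasurableSpace α] (μ : Measure α) (A A' : ℕ → α → ℂ) (a a' : α → ℂ),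
      (∀ n, AEStronglyMeasurable (A n) μ) → (∀ n, AEStronglyMeasurable (A' n) μ) →
      AEStronglyMeasurable a μ → AEStronglyMeasurable a' μ →
      Tendsto (fun n => eLpNorm (fun x => A n x - a x) 2 μ) atTop (𝓝 0) →
      Tendsto (fun n => eLpNorm (fun x => A' n x - a' x) 2 μ) atTop (𝓝 0) →
      Tendsto (fun n => eLpNorm (fun x => (A n x + c * A' n x) - (a x + c * a' x)) 2 μ)
        atTop (𝓝 0) := by
    intro α _ μ A A' a a' mA mA' ma ma' t t'
    have t2 := t.add (ENNReal.Tendsto.const_mul (a := ‖c‖ₑ) t' (Or.inr enorm_ne_top))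
    simp only [mul_zero, add_zero] at t2
    refine tendsto_of_tendsto_of_tendsto_of_le_of_le tendsto_const_nhds t2 (fun _ => zero_le)
      fun n => ?_
    have e : (fun x => (A n x + c * A' n x) - (a x + c * a' x))
        = (fun x => A n x - a x) + c • (fun x => A' n x - a' x) := by
      ext x; simp; ring
    rw [e]
    refine (eLpNorm_add_le ((mA n).sub ma) (((mA' n).sub ma').const_smul c) one_le_two).trans ?_
    rw [eLpNorm_const_smul]
    exact le_rfl
  refine ⟨fun F hF => (h1 F hF).add ((h1' F hF).const_smul c), fun n => Φ n + c • Φ' n,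
    fun n => (hΦ n).add ((hΦ' n).const_smul c), ?_, fun i => ?_, fun F hF => ?_⟩
  · exact key _ Φ Φ' v v' (fun n => (hΦ n).continuous.aestronglyMeasurable)
      (fun n => (hΦ' n).continuous.aestronglyMeasurable) hv.1.1 hv'.1.1 h2 h2'
  · have hΦ1 := fun n => (hΦ n).of_le one_le_infty
    have hΦ1' := fun n => (hΦ' n).of_le one_le_infty
    refine (key _ _ _ _ _ (fun n => (continuous_pderiv (hΦ1 n) i).aestronglyMeasurable)
      (fun n => (continuous_pderiv (hΦ1' n) i).aestronglyMeasurable) ((wgrad_spec hv).1 i).1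
      ((wgrad_spec hv').1 i).1 (h3 i) (h3' i)).congr fun n => eLpNorm_congr_ae ?_
    filter_upwards [wgrad_add_smul (isOpen_cell K) hv hv' c] with x hx
    rw [hx, pderiv_add_smul ((hΦ1 n).differentiable (by simp) x)
      ((hΦ1' n).differentiable (by simp) x)]
    simp
  · exact key _ Φ Φ' g g' (fun n => (hΦ n).continuous.aestronglyMeasurable)
      (fun n => (hΦ' n).continuous.aestronglyMeasurable) (h1 F hF).1 (h1' F hF).1 (h4 F hF)
      (h4' F hF)

end IsTrace

namespace IsSimplex

variable {K : Finset (E d)}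

theorem isTrace_of_contDiff (h : IsSimplex K) (hd : 0 < d) {q : E d → ℂ}
    (hq : ContDiff ℝ ((⊤ : ℕ∞) : WithTop ℕ∞) q) : IsTrace K q q := by
  refine ⟨fun F hF => h.memLp_surf hd hF hq.continuous, fun _ => q, fun _ => hq, ?_, fun i => ?_,
    fun F hF => ?_⟩
  · simp
  · have e := wgrad_of_contDiff ((isCompact_body K).isBounded.subset (cell_subset_body K))
      (isOpen_cell K) (hq.of_le one_le_infty)
    refine tendsto_const_nhds.congr fun n => ?_
    rw [eLpNorm_congr_ae (g := fun _ => (0 : ℂ))]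
    · simp
    · filter_upwards [e] with x hx
      rw [hx]; simp
  · simp

/-- Existence of traces. -/
theorem exists_isTrace (h : IsSimplex K) (hd : 0 < d) {v : E d → ℂ} (hv : MemH1 (cell K) v) :
    ∃ g, IsTrace K v g := by
  obtain ⟨Φ, hΦ, h1, h2, -⟩ := exists_smooth_approx (isOpen_cell K)
    ((isCompact_body K).isBounded.subset (cell_subset_body K)) (convex_cell K) h.cell_nonempty
    hv.1 (wgrad_spec hv).1 (wgrad_spec hv).2
  have hΦ1 := fun n => (hΦ n).of_le one_le_infty
  -- Taking the limit in L² of the sum of all the surface measures yields one function g that serves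
  -- as the trace on every face simultaneously.
  let S : Measure (E d) := ∑ F ∈ facesOf K, surf F
  have hle : ∀ F ∈ facesOf K, surf F ≤ S := fun F hF =>
    Finset.single_le_sum (f := fun F => surf F) (fun _ _ => Measure.zero_le _) hF
  have hS : ∀ f : E d → ℂ, AEStronglyMeasurable f S →
      eLpNorm f 2 S ≤ ∑ F ∈ facesOf K, eLpNorm f 2 (surf F) := by
    intro f hf
    have : ∀ A : Finset (Finset (E d)), eLpNorm f 2 (∑ F ∈ A, surf F)
        ≤ ∑ F ∈ A, eLpNorm f 2 (surf F) := by
      intro A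
      induction A using Finset.induction_on with
      | empty => simp
      | insert F A hF ih =>
        rw [Finset.sum_insert hF, Finset.sum_insert hF]
        refine le_trans ?_ (add_le_add le_rfl ih)
        rw [eLpNorm_eq_lintegral_rpow_enorm_toReal two_ne_zero ENNReal.ofNat_ne_top,
          eLpNorm_eq_lintegral_rpow_enorm_toReal two_ne_zero ENNReal.ofNat_ne_top,
          eLpNorm_eq_lintegral_rpow_enorm_toReal two_ne_zero ENNReal.ofNat_ne_top,
          lintegral_add_measure]
        exact ENNReal.rpow_add_le_add_rpow _ _ (by simp) (by norm_num)
    exact this _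
  have hmemS : ∀ n, MemLp (Φ n) 2 S := fun n => by
    refine ⟨(hΦ n).continuous.aestronglyMeasurable,
      (hS _ (hΦ n).continuous.aestronglyMeasurable).trans_lt ?_⟩
    exact ENNReal.sum_lt_top.2 fun F hF => (h.memLp_surf hd hF (hΦ n).continuous).2
  have hcell : ∀ (n m : ℕ), eLpNorm (fun x => Φ n x - Φ m x) 2 (volume.restrict (cell K)) ≤
      eLpNorm (fun x => Φ n x - v x) 2 (volume.restrict (cell K)) +
      eLpNorm (fun x => Φ m x - v x) 2 (volume.restrict (cell K)) := fun n m => by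
    rw [eLpNorm_sub_comm' (Φ m) v]
    exact eLpNorm_sub_le_add (hΦ n).continuous.aestronglyMeasurable hv.1.1
      (hΦ m).continuous.aestronglyMeasurable
  have hcelld : ∀ i (n m : ℕ), eLpNorm (pderiv i fun x => Φ n x - Φ m x) 2
      (volume.restrict (cell K)) ≤
      eLpNorm (fun x => pderiv i (Φ n) x - wgrad (cell K) v x i) 2 (volume.restrict (cell K)) +
      eLpNorm (fun x => pderiv i (Φ m) x - wgrad (cell K) v x i) 2
        (volume.restrict (cell K)) := fun i n m => by
    rw [eLpNorm_sub_comm' (pderiv i (Φ m)) (fun x => wgrad (cell K) v x i)]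
    have e : (pderiv i fun x => Φ n x - Φ m x) = fun x => pderiv i (Φ n) x - pderiv i (Φ m) x := by
      ext x
      exact pderiv_sub ((hΦ1 n).differentiable (by simp) x) ((hΦ1 m).differentiable (by simp) x) i
    rw [e]
    exact eLpNorm_sub_le_add (continuous_pderiv (hΦ1 n) i).aestronglyMeasurable
      ((wgrad_spec hv).1 i).1 (continuous_pderiv (hΦ1 m) i).aestronglyMeasurable
  have hcau : ∀ F ∈ facesOf K, Tendsto (fun n : ℕ × ℕ => eLpNorm (fun x => Φ n.1 x - Φ n.2 x) 2
      (surf F)) atTop (𝓝 0) := by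
    intro F hF
    obtain ⟨C, hCt, hC⟩ := h.trace_inequality hd hF
    have a1 : Tendsto (fun n : ℕ × ℕ =>
        eLpNorm (fun x => Φ n.1 x - v x) 2 (volume.restrict (cell K)) +
        eLpNorm (fun x => Φ n.2 x - v x) 2 (volume.restrict (cell K))) atTop (𝓝 (0 + 0)) := by
      rw [← prod_atTop_atTop_eq]
      exact (h1.comp tendsto_fst).add (h1.comp tendsto_snd)
    have a2 : Tendsto (fun n : ℕ × ℕ => ∑ i,
        (eLpNorm (fun x => pderiv i (Φ n.1) x - wgrad (cell K) v x i) 2 (volume.restrict (cell K)) +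
        eLpNorm (fun x => pderiv i (Φ n.2) x - wgrad (cell K) v x i) 2
        (volume.restrict (cell K)))) atTop (𝓝 (∑ _i : Fin d, (0 + 0))) := by
      refine tendsto_finsetSum _ fun i _ => ?_
      rw [← prod_atTop_atTop_eq]
      exact ((h2 i).comp tendsto_fst).add ((h2 i).comp tendsto_snd)
    have a3 := ENNReal.Tendsto.const_mul (a := C) (a1.add a2) (Or.inr hCt)
    simp only [add_zero, Finset.sum_const_zero, mul_zero] at a3
    refine tendsto_of_tendsto_of_tendsto_of_le_of_le tendsto_const_nhds a3 (fun _ => zero_le)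
      fun n => ?_
    refine (hC _ ((hΦ1 n.1).sub (hΦ1 n.2))).trans ?_
    gcongr with i
    · exact hcell n.1 n.2
    · exact hcelld i n.1 n.2
  have hcauS : Tendsto (fun n : ℕ × ℕ => eLpNorm (fun x => Φ n.1 x - Φ n.2 x) 2 S) atTop
      (𝓝 0) := by
    have a := tendsto_finsetSum (facesOf K) hcau
    simp only [Finset.sum_const_zero] at a
    exact tendsto_of_tendsto_of_tendsto_of_le_of_le tendsto_const_nhds a (fun _ => zero_le)
      fun n => hS _ (((hΦ n.1).continuous.sub (hΦ n.2).continuous).aestronglyMeasurable)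
  obtain ⟨g, hg, hgl⟩ := exists_limit_of_cauchy hmemS hcauS
  exact ⟨g, fun F hF => hg.mono_measure (hle F hF), Φ, hΦ, h1, h2, fun F hF =>
    tendsto_of_tendsto_of_tendsto_of_le_of_le tendsto_const_nhds hgl (fun _ => zero_le)
      fun n => eLpNorm_mono_measure _ (hle F hF)⟩

theorem isTrace_trace (h : IsSimplex K) (hd : 0 < d) {v : E d → ℂ} (hv : MemH1 (cell K) v) :
    IsTrace K v (trace K v) := by
  have := h.exists_isTrace hd hv
  rw [trace, dif_pos this]
  exact this.choose_spec

/-- Traces depend continuously on the function. -/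
theorem trace_bound (h : IsSimplex K) (hd : 0 < d) {F : Finset (E d)} (hF : F ∈ facesOf K) :
    ∃ C : ℝ≥0∞, C ≠ ⊤ ∧ ∀ v v' g g' : E d → ℂ, MemH1 (cell K) v → MemH1 (cell K) v' →
      IsTrace K v g → IsTrace K v' g' →
      eLpNorm (fun x => g x - g' x) 2 (surf F) ≤
        C * (eLpNorm (fun x => v x - v' x) 2 (volume.restrict (cell K)) +
          ∑ i, eLpNorm (fun x => wgrad (cell K) v x i - wgrad (cell K) v' x i) 2
            (volume.restrict (cell K))) := by
  obtain ⟨C, hCt, hC⟩ := h.trace_inequality hd hF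
  refine ⟨C, hCt, ?_⟩
  rintro v v' g g' hv hv' ⟨g1, Φ, hΦ, g2, g3, g4⟩ ⟨g1', Φ', hΦ', g2', g3', g4'⟩
  have hΦ1 := fun n => (hΦ n).of_le one_le_infty
  have hΦ1' := fun n => (hΦ' n).of_le one_le_infty
  have t1 := (g4 F hF).add (g4' F hF)
  have t2 := ((g2.add g2').add_const
    (eLpNorm (fun x => v x - v' x) 2 (volume.restrict (cell K))))
  have t3 := tendsto_finsetSum (Finset.univ : Finset (Fin d)) fun i _ =>
    ((g3 i).add (g3' i)).add_const
      (eLpNorm (fun x => wgrad (cell K) v x i - wgrad (cell K) v' x i) 2 (volume.restrict (cell K)))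
  have t4 := t1.add (ENNReal.Tendsto.const_mul (a := C) (t2.add t3) (Or.inr hCt))
  simp only [zero_add] at t4
  refine ge_of_tendsto' t4 fun n => ?_
  have four : ∀ (μ : Measure (E d)) (A A' a a' : E d → ℂ), AEStronglyMeasurable A μ →
      AEStronglyMeasurable A' μ → AEStronglyMeasurable a μ → AEStronglyMeasurable a' μ →
      eLpNorm (fun x => a x - a' x) 2 μ ≤ eLpNorm (fun x => A x - a x) 2 μ +
        eLpNorm (fun x => A' x - a' x) 2 μ + eLpNorm (fun x => A x - A' x) 2 μ := by
    intro μ A A' a a' m1 m2 m3 m4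
    refine (eLpNorm_sub_le_add m3 m1 m4).trans ?_
    rw [eLpNorm_sub_comm' a A, add_assoc]
    gcongr
    refine (eLpNorm_sub_le_add m1 m2 m4).trans ?_
    rw [add_comm]
  have four' : ∀ (μ : Measure (E d)) (A A' a a' : E d → ℂ), AEStronglyMeasurable A μ →
      AEStronglyMeasurable A' μ → AEStronglyMeasurable a μ → AEStronglyMeasurable a' μ →
      eLpNorm (fun x => A x - A' x) 2 μ ≤ eLpNorm (fun x => A x - a x) 2 μ +
        eLpNorm (fun x => A' x - a' x) 2 μ + eLpNorm (fun x => a x - a' x) 2 μ := by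
    intro μ A A' a a' m1 m2 m3 m4
    have := four μ a a' A A' m3 m4 m1 m2
    rwa [eLpNorm_sub_comm' a A, eLpNorm_sub_comm' a' A'] at this
  refine (four (surf F) (Φ n) (Φ' n) g g' (hΦ n).continuous.aestronglyMeasurable
    (hΦ' n).continuous.aestronglyMeasurable (g1 F hF).1 (g1' F hF).1).trans ?_
  gcongr
  refine (hC _ ((hΦ1 n).sub (hΦ1' n))).trans ?_
  gcongr with i
  · exact four' _ _ _ _ _ (hΦ n).continuous.aestronglyMeasurable
      (hΦ' n).continuous.aestronglyMeasurable hv.1.1 hv'.1.1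
  · have e : (pderiv i fun x => Φ n x - Φ' n x) = fun x => pderiv i (Φ n) x - pderiv i (Φ' n) x := by
      ext x
      exact pderiv_sub ((hΦ1 n).differentiable (by simp) x) ((hΦ1' n).differentiable (by simp) x) i
    rw [e]
    exact four' _ _ _ _ _ (continuous_pderiv (hΦ1 n) i).aestronglyMeasurable
      (continuous_pderiv (hΦ1' n) i).aestronglyMeasurable
      ((wgrad_spec hv).1 i).1 ((wgrad_spec hv').1 i).1

theorem trace_ae_eq (h : IsSimplex K) (hd : 0 < d) {v g : E d → ℂ} (hv : MemH1 (cell K) v)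
    (hg : IsTrace K v g) {F : Finset (E d)} (hF : F ∈ facesOf K) :
    ∀ᵐ x ∂(surf F), trace K v x = g x := by
  obtain ⟨C, -, hC⟩ := h.trace_bound hd hF
  have ht := h.isTrace_trace hd hv
  have h1 := hC v v _ _ hv hv ht hg
  simp only [sub_self] at h1
  have h2 : eLpNorm (fun x => trace K v x - g x) 2 (surf F) = 0 := by
    refine le_antisymm (h1.trans (le_of_eq ?_)) zero_le
    simp
  have h3 := (eLpNorm_eq_zero_iff ((ht.1 F hF).1.sub (hg.1 F hF).1) two_ne_zero).1 h2
  filter_upwards [h3] with x hx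
  exact sub_eq_zero.1 hx

theorem memLp_trace (h : IsSimplex K) (hd : 0 < d) {v : E d → ℂ} (hv : MemH1 (cell K) v)
    {F : Finset (E d)} (hF : F ∈ facesOf K) : MemLp (trace K v) 2 (surf F) :=
  (h.isTrace_trace hd hv).1 F hF

theorem trace_congr (h : IsSimplex K) (hd : 0 < d) {v v' : E d → ℂ} (hv : MemH1 (cell K) v)
    (e : ∀ᵐ x ∂(volume.restrict (cell K)), v x = v' x) {F : Finset (E d)} (hF : F ∈ facesOf K) :
    ∀ᵐ x ∂(surf F), trace K v' x = trace K v x :=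
  h.trace_ae_eq hd (hv.congr e) ((h.isTrace_trace hd hv).congr hv e) hF

theorem trace_add_smul (h : IsSimplex K) (hd : 0 < d) {v v' : E d → ℂ} (hv : MemH1 (cell K) v)
    (hv' : MemH1 (cell K) v') (c : ℂ) {F : Finset (E d)} (hF : F ∈ facesOf K) :
    ∀ᵐ x ∂(surf F), trace K (v + c • v') x = trace K v x + c * trace K v' x :=
  h.trace_ae_eq hd (hv.add_smul hv' c)
    ((h.isTrace_trace hd hv).add_smul hv hv' (h.isTrace_trace hd hv') c) hF

theorem trace_of_contDiff (h : IsSimplex K) (hd : 0 < d) {q : E d → ℂ}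
    (hq : ContDiff ℝ ((⊤ : ℕ∞) : WithTop ℕ∞) q) {F : Finset (E d)} (hF : F ∈ facesOf K) :
    ∀ᵐ x ∂(surf F), trace K q x = q x :=
  h.trace_ae_eq hd (memH1_of_contDiff ((isCompact_body K).isBounded.subset (cell_subset_body K))
    (hq.of_le one_le_infty)) (h.isTrace_of_contDiff hd hq) hF

/-- Integration by parts on a simplex, between a smooth function and a function in `H¹`. -/
theorem integral_by_parts (h : IsSimplex K) (hd : 0 < d) {q v : E d → ℂ} (hq : ContDiff ℝ 1 q)
    (hv : MemH1 (cell K) v) (i : Fin d) :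
    (∫ x in cell K, pderiv i q x * v x) + ∫ x in cell K, q x * wgrad (cell K) v x i =
      ∑ F ∈ facesOf K, ((nrm K F i : ℝ) : ℂ) * ∫ x, q x * trace K v x ∂(surf F) := by
  obtain ⟨g1, Φ, hΦ, g2, g3, g4⟩ := h.isTrace_trace hd hv
  have hΦ1 := fun n => (hΦ n).of_le one_le_infty
  have hcq : MemL2 (cell K) q := memL2_cell hq.continuous
  have hcdq : MemL2 (cell K) (pderiv i q) := memL2_cell (continuous_pderiv hq i)
  have t1 := (tendsto_integral_mul (fun n => memL2_cell (K := K) (hΦ n).continuous) hv.1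
    hcdq g2).add
    (tendsto_integral_mul (fun n => memL2_cell (K := K) (continuous_pderiv (hΦ1 n) i))
      ((wgrad_spec hv).1 i) hcq (g3 i))
  have t2 := tendsto_finsetSum (facesOf K) fun F hF => (tendsto_integral_mul
    (fun n => h.memLp_surf hd hF (hΦ n).continuous) (g1 F hF) (h.memLp_surf hd hF hq.continuous)
    (g4 F hF)).const_mul ((nrm K F i : ℝ) : ℂ)
  refine tendsto_nhds_unique t1 (t2.congr fun n => ?_)
  rw [← h.integral_pderiv hd (hq.mul (hΦ1 n))]
  rw [← integral_add (MemL2.integrable_mul hcdq (memL2_cell (K := K) (hΦ n).continuous))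
    (MemL2.integrable_mul hcq (memL2_cell (K := K) (continuous_pderiv (hΦ1 n) i)))]
  refine integral_congr_ae (.of_forall fun x => ?_)
  exact pderiv_mul (hq.differentiable (by simp) x) ((hΦ1 n).differentiable (by simp) x) i

/-- A function with zero weak gradient is constant. -/
theorem ae_const_of_wgrad (h : IsSimplex K) {v : E d → ℂ} (hv : MemH1 (cell K) v)
    (h0 : ∀ᵐ x ∂(volume.restrict (cell K)), wgrad (cell K) v x = 0) :
    ∃ c : ℂ, ∀ᵐ x ∂(volume.restrict (cell K)), v x = c := by
  obtain ⟨Φ, hΦ, h1, -, h3⟩ := exists_smooth_approx (isOpen_cell K)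
    ((isCompact_body K).isBounded.subset (cell_subset_body K)) (convex_cell K) h.cell_nonempty
    hv.1 (wgrad_spec hv).1 (wgrad_spec hv).2
  obtain ⟨x0, hx0⟩ := h.cell_nonempty
  have hfin : IsFiniteMeasure (volume.restrict (cell K)) :=
    ⟨by rw [Measure.restrict_apply_univ]; exact measure_cell_lt_top K⟩
  have hdiff : ∀ n x, DifferentiableAt ℝ (Φ n) x := fun n x =>
    ((hΦ n).of_le one_le_infty).differentiable (by simp) x
  -- The smooth approximants inherit a vanishing gradient on the cell, so they are constant there,
  -- and their values at `x0` converge to the mean of v.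
  have hconst : ∀ n, ∀ x ∈ cell K, Φ n x = Φ n x0 := by
    intro n x hx
    refine (convex_cell K).is_const_of_fderivWithin_eq_zero (𝕜 := ℝ)
      (fun y _ => (hdiff n y).differentiableWithinAt) (fun y hy => ?_) hx hx0
    rw [fderivWithin_of_isOpen (isOpen_cell K) hy]
    ext w
    have hw : w = ∑ i, w i • (EuclideanSpace.single i (1 : ℝ) : E d) := by
      ext j
      simp [Finset.sum_apply, Pi.single_apply]
    rw [hw, map_sum]
    simp only [map_smul]
    refine Finset.sum_eq_zero fun i _ => ?_
    have := h3 h0 n y hy i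
    rw [pderiv] at this
    rw [this, smul_zero]
  set V : ℝ := (volume (cell K)).toReal with hV
  have hVpos : 0 < V := ENNReal.toReal_pos
    ((isOpen_cell K).measure_pos volume ⟨x0, hx0⟩).ne' (measure_cell_lt_top K).ne
  have hVc : (V : ℂ) ≠ 0 := by exact_mod_cast hVpos.ne'
  have t1 := tendsto_integral_mul (fun n => memL2_cell (K := K) (hΦ n).continuous) hv.1
    (memL2_cell (K := K) (continuous_const (y := (V : ℂ)⁻¹))) h1
  have t2 : Tendsto (fun n => Φ n x0) atTop (𝓝 (∫ x in cell K, (V : ℂ)⁻¹ * v x)) := by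
    refine t1.congr fun n => ?_
    rw [setIntegral_congr_fun (g := fun _ => (V : ℂ)⁻¹ * Φ n x0) (isOpen_cell K).measurableSet
      (fun x hx => by simp only; rw [hconst n x hx])]
    rw [integral_const, Measure.real, Measure.restrict_apply_univ, ← hV, Complex.real_smul]
    field_simp
  set c := ∫ x in cell K, (V : ℂ)⁻¹ * v x with hc
  refine ⟨c, ?_⟩
  have h5 : eLpNorm (fun x => v x - c) 2 (volume.restrict (cell K)) = 0 := by
    have t3 : Tendsto (fun n => eLpNorm (fun x => Φ n x - v x) 2 (volume.restrict (cell K)) +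
        ‖Φ n x0 - c‖ₑ * volume (cell K) ^ (1 / (2 : ℝ≥0∞).toReal)) atTop (𝓝 (0 + 0)) := by
      refine h1.add ?_
      have t4 : Tendsto (fun n => ‖Φ n x0 - c‖ₑ) atTop (𝓝 0) := by
        have := (t2.sub_const c).enorm
        simpa using this
      have := ENNReal.Tendsto.mul_const t4 (b := volume (cell K) ^ (1 / (2 : ℝ≥0∞).toReal))
        (Or.inr (ENNReal.rpow_ne_top_of_nonneg (by simp) (measure_cell_lt_top K).ne))
      simpa using this
    refine le_antisymm ?_ zero_le
    rw [add_zero] at t3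
    refine ge_of_tendsto' t3 fun n => ?_
    refine (eLpNorm_sub_le_add hv.1.1 (hΦ n).continuous.aestronglyMeasurable
      aestronglyMeasurable_const).trans ?_
    rw [eLpNorm_sub_comm']
    gcongr
    rw [eLpNorm_congr_ae (g := fun _ => Φ n x0 - c)]
    · rw [eLpNorm_const' _ two_ne_zero ENNReal.ofNat_ne_top, Measure.restrict_apply_univ]
    · filter_upwards [ae_restrict_mem (isOpen_cell K).measurableSet] with x hx
      rw [hconst n x hx]
  have h6 := (eLpNorm_eq_zero_iff (hv.1.1.sub aestronglyMeasurable_const) two_ne_zero).1 h5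
  filter_upwards [h6] with x hx
  exact sub_eq_zero.1 hx

end IsSimplex


/-! ### Geometry of faces and elements in a matching mesh. -/

/-- A sum of gradients is determined by the affine functions. -/
theorem gbary_eq_smul {K L : Finset (E d)} {a b : E d} {κ : ℝ}
    (h : ∀ x, bary K a x = κ * bary L b x) : gbary K a = κ • gbary L b := by
  refine ext_inner_right ℝ fun v => ?_
  have h1 := bary_sub K a v 0
  have h2 := bary_sub L b v 0
  rw [sub_zero] at h1 h2
  rw [← h1, inner_smul_left, ← h2, h, h]
  simp; ring

theorem memLp_add_measure_iff {μ ν : Measure (E d)} {f : E d → ℂ} :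
    MemLp f 2 (μ + ν) ↔ MemLp f 2 μ ∧ MemLp f 2 ν := by
  refine ⟨fun h => ⟨h.left_of_add_measure, h.right_of_add_measure⟩, fun h => ⟨?_, ?_⟩⟩
  · exact aestronglyMeasurable_add_measure_iff.2 ⟨h.1.1, h.2.1⟩
  · have e : ∀ ρ : Measure (E d), eLpNorm f 2 ρ < ⊤ ↔ ∫⁻ x, ‖f x‖ₑ ^ ((2 : ℝ≥0∞).toReal) ∂ρ < ⊤ :=
      fun ρ => eLpNorm_lt_top_iff_lintegral_rpow_enorm_lt_top two_ne_zero ENNReal.ofNat_ne_top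
    rw [e, lintegral_add_measure]
    exact ENNReal.add_lt_top.2 ⟨(e μ).1 h.1.2, (e ν).1 h.2.2⟩

theorem memLp_finsetSum_measure_iff {ι : Type*} {A : Finset ι} {μ : ι → Measure (E d)}
    {f : E d → ℂ} : MemLp f 2 (∑ i ∈ A, μ i) ↔ ∀ i ∈ A, MemLp f 2 (μ i) := by
  induction A using Finset.cons_induction <;> simp [*, memLp_add_measure_iff]

namespace Mesh

variable (T : Mesh d)

theorem isSimplex {K : Finset (E d)} (hK : K ∈ T.cells) : IsSimplex K :=
  ⟨T.card_cell K hK, T.indep K hK⟩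

variable {T}

theorem mem_cellsOf {F K : Finset (E d)} : K ∈ T.cellsOf F ↔ K ∈ T.cells ∧ F ⊆ K := by
  simp [cellsOf]

theorem mem_faces {F : Finset (E d)} : F ∈ T.faces ↔ ∃ K ∈ T.cells, F ∈ facesOf K := by
  simp [faces]

theorem card_face {F : Finset (E d)} (hF : F ∈ T.faces) : F.card = d := by
  obtain ⟨K, -, h⟩ := mem_faces.1 hF
  exact (Finset.mem_powersetCard.1 h).2

theorem mem_facesOf_of_mem_cellsOf {F K : Finset (E d)} (hF : F ∈ T.faces)
    (hK : K ∈ T.cellsOf F) : F ∈ facesOf K :=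
  Finset.mem_powersetCard.2 ⟨(mem_cellsOf.1 hK).2, card_face hF⟩

theorem mem_faces_of_mem_facesOf {F K : Finset (E d)} (hK : K ∈ T.cells) (hF : F ∈ facesOf K) :
    F ∈ T.faces := mem_faces.2 ⟨K, hK, hF⟩

theorem mem_cellsOf_of_mem_facesOf {F K : Finset (E d)} (hK : K ∈ T.cells) (hF : F ∈ facesOf K) :
    K ∈ T.cellsOf F := mem_cellsOf.2 ⟨hK, (Finset.mem_powersetCard.1 hF).1⟩

theorem cellsOf_nonempty {F : Finset (E d)} (hF : F ∈ T.faces) : (T.cellsOf F).Nonempty := by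
  obtain ⟨K, hK, h⟩ := mem_faces.1 hF
  exact ⟨K, mem_cellsOf_of_mem_facesOf hK h⟩

/-- Exchange of sums over elements and faces. -/
theorem sum_cells_facesOf {M : Type*} [AddCommMonoid M]
    (f : Finset (E d) → Finset (E d) → M) :
    ∑ K ∈ T.cells, ∑ F ∈ facesOf K, f K F = ∑ F ∈ T.faces, ∑ K ∈ T.cellsOf F, f K F := by
  refine Finset.sum_comm' fun K F => ⟨fun h => ?_, fun h => ?_⟩
  · exact ⟨mem_cellsOf_of_mem_facesOf h.1 h.2, mem_faces_of_mem_facesOf h.1 h.2⟩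
  · exact ⟨(mem_cellsOf.1 h.1).1, mem_facesOf_of_mem_cellsOf h.2 h.1⟩

theorem isFiniteMeasure_surf (hd : 0 < d) {F : Finset (E d)} (hF : F ∈ T.faces) :
    IsFiniteMeasure (surf F) := by
  obtain ⟨K, hK, h⟩ := mem_faces.1 hF
  exact (T.isSimplex hK).isFiniteMeasure_surf hd h

theorem mem_body_inter {K L : Finset (E d)} (hK : K ∈ T.cells) (hL : L ∈ T.cells) {x : E d}
    (hxK : x ∈ body K) (hxL : x ∈ body L) : x ∈ body (K ∩ L) := by
  have : x ∈ body K ∩ body L := ⟨hxK, hxL⟩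
  rw [T.matching K hK L hL] at this
  rw [body]
  simpa using this

/-- Different elements have disjoint interiors. -/
theorem disjoint_cell {K L : Finset (E d)} (hK : K ∈ T.cells) (hL : L ∈ T.cells) (h : K ≠ L) :
    Disjoint (cell K) (cell L) := by
  rw [Set.disjoint_left]
  intro x hxK hxL
  have hx := mem_body_inter hK hL (cell_subset_body K hxK) (cell_subset_body L hxL)
  have hne : ¬ L ⊆ K := fun hs => h
    (Finset.eq_of_subset_of_card_le hs (by rw [(T.isSimplex hK).1, (T.isSimplex hL).1])).symm
  obtain ⟨b, hbL, hbK⟩ := Finset.not_subset.1 hne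
  have h0 := (T.isSimplex hL).bary_eq_zero_of_mem_body (F := K ∩ L) Finset.inter_subset_right hbL
    (by simp [hbK]) hx
  have := (T.isSimplex hL).mem_cell.1 hxL b hbL
  linarith

/-- Almost every x of F has positive coordinates at all vertices of F. If x also lies in F', pick a
vertex b of F outside F'; it exists since the two faces have equal cardinality. By matching, x lies
in the simplex spanned by K ∩ L. If b is not in L, its coordinate in K vanishes at x. If b is in L,
its coordinates in K and in L coincide on the common simplex, and the one in L vanishes on F'. Both
contradict positivity. -/
theorem ae_notMem_body (hd : 0 < d) {F F' : Finset (E d)} (hF : F ∈ T.faces) (hF' : F' ∈ T.faces)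
    (h : F ≠ F') : ∀ᵐ x ∂(surf F), x ∉ body F' := by
  obtain ⟨K, hK, hFK⟩ := mem_faces.1 hF
  obtain ⟨L, hL, hFL⟩ := mem_faces.1 hF'
  have hsK := T.isSimplex hK
  have hsL := T.isSimplex hL
  obtain ⟨a, ha, rfl⟩ := hsK.mem_facesOf.1 hFK
  obtain ⟨a', ha', rfl⟩ := hsL.mem_facesOf.1 hFL
  have hpos : ∀ᵐ x ∂(surf (K.erase a)), ∀ c ∈ K.erase a, 0 < bary K c x := by
    refine (ae_ball_iff (Finset.countable_toSet _)).2 fun c hc => ?_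
    have := Finset.mem_erase.1 (Finset.mem_coe.1 hc)
    exact hsK.surf_ae_bary_pos hd ha this.2 this.1.symm
  have hmem : ∀ᵐ x ∂(surf (K.erase a)), x ∈ body (K.erase a) :=
    ae_restrict_mem (isCompact_body _).measurableSet
  filter_upwards [hpos, hmem] with x hx1 hx2 hx3
  have hne : ¬ K.erase a ⊆ L.erase a' := fun hs => h
    (Finset.eq_of_subset_of_card_le hs (by rw [card_face hF, card_face hF']))
  obtain ⟨b, hb, hb'⟩ := Finset.not_subset.1 hne
  have hbK := Finset.mem_of_mem_erase hb
  have hx := mem_body_inter hK hL (IsSimplex.body_subset_of_subset (Finset.erase_subset _ _) hx2)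
    (IsSimplex.body_subset_of_subset (Finset.erase_subset _ _) hx3)
  have h1 := hx1 b hb
  by_cases hbL : b ∈ L
  · have h0 := hsL.bary_eq_zero_of_mem_body (Finset.erase_subset _ _) hbL hb' hx3
    have hc : Convex ℝ {y | (bary K b - bary L b) y = 0} := by
      have : {y | (bary K b - bary L b) y = 0} = (bary K b - bary L b) ⁻¹' {0} := rfl
      rw [this]
      exact (convex_singleton 0).affine_preimage _
    have h2 : (bary K b - bary L b) x = 0 := by
      refine convexHull_min (fun c hc' => ?_) hc hx
      have hc2 := Finset.mem_inter.1 (Finset.mem_coe.1 hc')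
      change bary K b c - bary L b c = 0
      by_cases hbc : b = c
      · subst hbc
        rw [hsK.bary_self hbK, hsL.bary_self hbL, sub_self]
      · rw [hsK.bary_ne hbK hc2.1 hbc, hsL.bary_ne hbL hc2.2 hbc, sub_self]
    have h3 : bary K b x - bary L b x = 0 := h2
    linarith
  · have := hsK.bary_eq_zero_of_mem_body (F := K ∩ L) Finset.inter_subset_left hbK
      (by simp [hbL]) hx
    linarith

variable (T) in
/-- The complement of the faces other than `F`. -/
def awayFrom (F : Finset (E d)) : Set (E d) := (⋃ F' ∈ T.faces.erase F, body F')ᶜ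

theorem isOpen_awayFrom (F : Finset (E d)) : IsOpen (T.awayFrom F) := by
  rw [awayFrom, isOpen_compl_iff]
  exact Set.Finite.isClosed_biUnion (Finset.finite_toSet _) fun F' _ => (isCompact_body F').isClosed

theorem ae_mem_awayFrom (hd : 0 < d) {F : Finset (E d)} (hF : F ∈ T.faces) :
    ∀ᵐ x ∂(surf F), x ∈ T.awayFrom F := by
  have : ∀ᵐ x ∂(surf F), ∀ F' ∈ T.faces.erase F, x ∉ body F' := by
    refine (ae_ball_iff (Finset.countable_toSet _)).2 fun F' hF' => ?_
    have := Finset.mem_erase.1 (Finset.mem_coe.1 hF')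
    exact ae_notMem_body hd hF this.2 this.1.symm
  filter_upwards [this] with x hx
  simpa [awayFrom] using hx

/-- A function supported away from the other faces vanishes on these. -/
theorem eq_zero_of_tsupport {F F' : Finset (E d)} (hF' : F' ∈ T.faces) (h : F' ≠ F)
    {φ : E d → ℝ} (hφ : tsupport φ ⊆ T.awayFrom F) {x : E d} (hx : x ∈ body F') : φ x = 0 := by
  refine image_eq_zero_of_notMem_tsupport fun hx' => ?_
  have := hφ hx'
  simp only [awayFrom, Set.mem_compl_iff, Set.mem_iUnion, not_exists] at this
  exact this F' (Finset.mem_erase.2 ⟨h, hF'⟩) hx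

section Pair

variable {F K L : Finset (E d)} {a b : E d}

/-- The barycentric coordinates of two elements sharing a face have opposite signs. -/
theorem exists_bary_eq (hd : 0 < d) (hK : K ∈ T.cells) (hL : L ∈ T.cells) (hKL : K ≠ L)
    (ha : a ∈ K) (hb : b ∈ L) (hF : K.erase a = L.erase b) :
    ∃ κ < 0, ∀ x, bary K a x = κ * bary L b x := by
  have hsK := T.isSimplex hK
  have hsL := T.isSimplex hL
  have key : ∀ x, bary K a x = bary K a b * bary L b x := by
    have : bary K a = (bary K a b) • bary L b := by
      refine hsL.affine_eq fun c hc => ?_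
      change bary K a c = bary K a b * bary L b c
      by_cases hbc : b = c
      · subst hbc
        rw [hsL.bary_self hb, mul_one]
      · have hc' : c ∈ K.erase a := by rw [hF]; exact Finset.mem_erase.2 ⟨fun h => hbc h.symm, hc⟩
        rw [hsL.bary_ne hb hc hbc, mul_zero,
          hsK.bary_ne ha (Finset.mem_of_mem_erase hc') (Finset.ne_of_mem_erase hc').symm]
    intro x
    conv_lhs => rw [this]
    rfl
  refine ⟨bary K a b, ?_, key⟩
  -- If the factor were nonnegative it would be positive, as the coordinate of `a` in K is 1 at `a`.
  -- A point slightly off the barycentre of the common face in the direction of `a` would then have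
  -- positive coordinates in both elements, contradicting that the open cells are disjoint.
  by_contra hpos
  push Not at hpos
  have hκ : 0 < bary K a b := by
    refine lt_of_le_of_ne hpos fun h0 => ?_
    have := key a
    rw [← h0, hsK.bary_self ha] at this
    norm_num at this
  have hFne : (K.erase a).Nonempty := by
    rw [← Finset.card_pos, Finset.card_erase_of_mem ha, hsK.1]; omega
  set c := (K.erase a).centroid ℝ (id : E d → E d) with hc
  have hcard : (0 : ℝ) < ((K.erase a).card : ℝ)⁻¹ := by
    exact inv_pos.2 (by exact_mod_cast Finset.card_pos.2 hFne)
  have hev : ∀ᶠ x in 𝓝 c, ∀ e ∈ K.erase a, 0 < bary K e x ∧ 0 < bary L e x := by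
    refine (Finset.eventually_all _).2 fun e he => ?_
    have h1 : 0 < bary K e c := by
      rw [hsK.bary_centroid (Finset.erase_subset _ _) hFne (Finset.mem_of_mem_erase he), if_pos he]
      exact hcard
    have he' : e ∈ L.erase b := hF ▸ he
    have h2 : 0 < bary L e c := by
      rw [hc, hF, hsL.bary_centroid (Finset.erase_subset _ _) (hF ▸ hFne)
        (Finset.mem_of_mem_erase he'), if_pos he', ← hF]
      exact hcard
    exact ((continuous_bary K e).continuousAt.eventually_const_lt h1).and
      ((continuous_bary L e).continuousAt.eventually_const_lt h2)
  have htend : Tendsto (fun t : ℝ => c + t • (a - c)) (𝓝[>] 0) (𝓝 c) := by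
    have : Tendsto (fun t : ℝ => c + t • (a - c)) (𝓝 0) (𝓝 (c + (0 : ℝ) • (a - c))) := by
      refine Continuous.tendsto (by fun_prop) 0
    rw [zero_smul, add_zero] at this
    exact this.mono_left nhdsWithin_le_nhds
  obtain ⟨t, ht1, ht2⟩ := ((htend.eventually hev).and self_mem_nhdsWithin).exists
  have ht : (0 : ℝ) < t := ht2
  have hK0 : 0 < bary K a (c + t • (a - c)) := by
    rw [bary_add, inner_smul_right, ← bary_sub, hsK.bary_self ha, hc,
      hsK.bary_centroid (Finset.erase_subset _ _) hFne ha, if_neg (by simp)]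
    simpa using ht
  have hL0 : 0 < bary L b (c + t • (a - c)) := by
    rw [key] at hK0
    exact pos_of_mul_pos_right hK0 hκ.le
  have hdis := Set.disjoint_left.1 (disjoint_cell hK hL hKL)
  refine @hdis (c + t • (a - c)) (hsK.mem_cell.2 fun e he => ?_) (hsL.mem_cell.2 fun e he => ?_)
  · by_cases hea : e = a
    · rw [hea]; exact hK0
    · exact (ht1 e (Finset.mem_erase.2 ⟨hea, he⟩)).1
  · by_cases heb : e = b
    · rw [heb]; exact hL0
    · exact (ht1 e (hF ▸ Finset.mem_erase.2 ⟨heb, he⟩)).2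

theorem norm_nrm (hd : 0 < d) (hF : F ∈ T.faces) (hK : K ∈ T.cellsOf F) : ‖nrm K F‖ = 1 := by
  have hs := T.isSimplex (mem_cellsOf.1 hK).1
  obtain ⟨a, ha, rfl⟩ := hs.mem_facesOf.1 (mem_facesOf_of_mem_cellsOf hF hK)
  rw [hs.nrm_erase hd ha, norm_neg, norm_smul, norm_inv, norm_norm]
  exact inv_mul_cancel₀ (norm_ne_zero_iff.2 (hs.gbary_ne_zero hd ha))

/-- The outward normals of two elements sharing a face are opposite. -/
theorem nrm_eq_neg (hd : 0 < d) (hF : F ∈ T.faces) (hK : K ∈ T.cellsOf F) (hL : L ∈ T.cellsOf F)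
    (hKL : K ≠ L) : nrm L F = - nrm K F := by
  have hsK := T.isSimplex (mem_cellsOf.1 hK).1
  have hsL := T.isSimplex (mem_cellsOf.1 hL).1
  obtain ⟨a, ha, e1⟩ := hsK.mem_facesOf.1 (mem_facesOf_of_mem_cellsOf hF hK)
  obtain ⟨b, hb, e2⟩ := hsL.mem_facesOf.1 (mem_facesOf_of_mem_cellsOf hF hL)
  obtain ⟨κ, hκ, h⟩ := exists_bary_eq hd (mem_cellsOf.1 hK).1 (mem_cellsOf.1 hL).1 hKL ha hb
    (e1.symm.trans e2)
  conv_lhs => rw [e2]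
  rw [e1, hsK.nrm_erase hd ha, hsL.nrm_erase hd hb, gbary_eq_smul h, norm_smul, Real.norm_eq_abs,
    abs_of_neg hκ, smul_smul, neg_neg, ← neg_smul]
  congr 1
  have := norm_ne_zero_iff.2 (hsL.gbary_ne_zero hd hb)
  have := hκ.ne
  field_simp

/-- A third element would have an outward normal opposite to each of two mutually opposite normals,
which is impossible for unit vectors. -/
theorem cellsOf_eq_pair (hd : 0 < d) (hF : F ∈ T.faces) (hK : K ∈ T.cellsOf F)
    (hL : L ∈ T.cellsOf F) (hKL : K ≠ L) : T.cellsOf F = {K, L} := by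
  refine Finset.Subset.antisymm (fun M hM => ?_) (by
    intro M hM
    rcases Finset.mem_insert.1 hM with rfl | hM
    · exact hK
    · rw [Finset.mem_singleton.1 hM]; exact hL)
  by_contra hne
  simp only [Finset.mem_insert, Finset.mem_singleton, not_or] at hne
  have h1 := nrm_eq_neg hd hF hK hL hKL
  have h2 := nrm_eq_neg hd hF hM hL hne.2
  have h3 := nrm_eq_neg hd hF hM hK hne.1
  rw [h2, h3, neg_neg] at h1
  have h4 : nrm M F = 0 := by
    have : (2 : ℝ) • nrm M F = 0 := by rw [two_smul]; nth_rw 1 [← h1]; simp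
    simpa using this
  have := norm_nrm hd hF hM
  rw [h4, norm_zero] at this
  norm_num at this

/-- A face is either exterior or shared by exactly two elements. -/
theorem exists_pair_of_notMem_extFaces (hd : 0 < d) (hF : F ∈ T.faces) (hF' : F ∉ T.extFaces) :
    ∃ K L, K ≠ L ∧ T.cellsOf F = {K, L} := by
  have hne := cellsOf_nonempty hF
  have h1 : 1 < (T.cellsOf F).card := by
    have h2 : (T.cellsOf F).card ≠ 1 := fun h => hF' (Finset.mem_filter.2 ⟨hF, h⟩)
    have := Finset.card_pos.2 hne
    omega
  obtain ⟨K, hK, L, hL, hKL⟩ := Finset.one_lt_card.1 h1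
  exact ⟨K, L, hKL, cellsOf_eq_pair hd hF hK hL hKL⟩

/-- Almost all points of an interior face are in `Ω`. -/
theorem ae_mem_omega (hd : 0 < d) (hF : F ∈ T.faces) (hF' : F ∉ T.extFaces) :
    ∀ᵐ x ∂(surf F), x ∈ T.Ω := by
  obtain ⟨K, L, hKL, hc⟩ := exists_pair_of_notMem_extFaces hd hF hF'
  have hK : K ∈ T.cellsOf F := by rw [hc]; simp
  have hL : L ∈ T.cellsOf F := by rw [hc]; simp
  have hKc := (mem_cellsOf.1 hK).1
  have hLc := (mem_cellsOf.1 hL).1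
  have hsK := T.isSimplex hKc
  have hsL := T.isSimplex hLc
  obtain ⟨a, ha, e1⟩ := hsK.mem_facesOf.1 (mem_facesOf_of_mem_cellsOf hF hK)
  obtain ⟨b, hb, e2⟩ := hsL.mem_facesOf.1 (mem_facesOf_of_mem_cellsOf hF hL)
  obtain ⟨κ, hκ, h⟩ := exists_bary_eq hd hKc hLc hKL ha hb (e1.symm.trans e2)
  have hpos : ∀ᵐ x ∂(surf F), ∀ c ∈ F, 0 < bary K c x ∧ 0 < bary L c x := by
    refine (ae_ball_iff (Finset.countable_toSet F)).2 fun c hc => ?_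
    refine Filter.Eventually.and ?_ ?_
    · have := Finset.mem_erase.1 (e1 ▸ Finset.mem_coe.1 hc)
      rw [e1]
      exact hsK.surf_ae_bary_pos hd ha this.2 this.1.symm
    · have := Finset.mem_erase.1 (e2 ▸ Finset.mem_coe.1 hc)
      rw [e2]
      exact hsL.surf_ae_bary_pos hd hb this.2 this.1.symm
  filter_upwards [hpos] with x hx
  rw [Ω, mem_interior_iff_mem_nhds]
  have hev : ∀ᶠ y in 𝓝 x, ∀ e ∈ F, 0 < bary K e y ∧ 0 < bary L e y := by
    refine (Finset.eventually_all _).2 fun e he => ?_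
    exact ((continuous_bary K e).continuousAt.eventually_const_lt (hx e he).1).and
      ((continuous_bary L e).continuousAt.eventually_const_lt (hx e he).2)
  filter_upwards [hev] with y hy
  simp only [Set.mem_iUnion, exists_prop]
  -- Near x all coordinates at vertices of F are positive in both elements. The coordinates at the
  -- two opposite vertices have opposite signs, so at least one of them is nonnegative and y belongs
  -- to that element.
  rcases le_total 0 (bary K a y) with hy0 | hy0
  · refine ⟨K, hKc, hsK.mem_body.2 fun e he => ?_⟩
    by_cases hea : e = a
    · rw [hea]; exact hy0
    · exact (hy e (e1 ▸ Finset.mem_erase.2 ⟨hea, he⟩)).1.le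
  · refine ⟨L, hLc, hsL.mem_body.2 fun e he => ?_⟩
    by_cases heb : e = b
    · rw [heb]
      rw [h] at hy0
      nlinarith
    · exact (hy e (e2 ▸ Finset.mem_erase.2 ⟨heb, he⟩)).2.le

end Pair

/-! ### The domain -/

theorem isOpen_omega : IsOpen T.Ω := isOpen_interior

theorem cell_subset_omega {K : Finset (E d)} (hK : K ∈ T.cells) : cell K ⊆ T.Ω :=
  interior_mono (Set.subset_biUnion_of_mem (u := fun K => body K) hK)

theorem isBounded_omega : Bornology.IsBounded T.Ω := by
  refine Bornology.IsBounded.subset ?_ interior_subset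
  exact (Bornology.isBounded_biUnion (Finset.finite_toSet _)).2 fun K _ =>
    (isCompact_body K).isBounded

/-- The boundary of a convex set is negligible, so Ω is, up to a null set, the disjoint union of the
open cells. This transfers almost-everywhere statements and integrals between Ω and its elements. -/
theorem restrict_omega :
    volume.restrict T.Ω = ∑ K ∈ T.cells, volume.restrict (cell K) := by
  have h1 : volume.restrict T.Ω = volume.restrict (⋃ K ∈ T.cells, cell K) := by
    refine Measure.restrict_congr_set ?_
    refine Filter.EventuallyLE.antisymm ?_
      (LE.le.eventuallyLE (Set.iUnion₂_subset fun K hK => cell_subset_omega hK))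
    rw [ae_le_set]
    refine measure_mono_null (t := ⋃ K ∈ T.cells, body K \ cell K) ?_ ?_
    · rintro x ⟨hx, hx'⟩
      have := interior_subset hx
      simp only [Set.mem_iUnion, exists_prop, not_exists, not_and] at this hx' ⊢
      obtain ⟨K, hK, hxK⟩ := this
      exact ⟨K, hK, hxK, hx' K hK⟩
    · exact (measure_biUnion_null_iff (Finset.countable_toSet _)).2 fun K _ =>
        volume_body_diff_cell K
  rw [h1]
  have h2 : ∀ A : Finset (Finset (E d)), A ⊆ T.cells →
      volume.restrict (⋃ K ∈ A, cell K) = ∑ K ∈ A, volume.restrict (cell K) := by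
    intro A
    induction A using Finset.induction_on with
    | empty => simp
    | insert K A hK ih =>
      intro hA
      have hAs : A ⊆ T.cells := fun L hL => hA (Finset.mem_insert_of_mem hL)
      rw [Finset.sum_insert hK, ← ih hAs, Finset.set_biUnion_insert, Measure.restrict_union]
      · refine Set.disjoint_iUnion₂_right.2 fun L hL => disjoint_cell
          (hA (Finset.mem_insert_self _ _)) (hAs hL) ?_
        rintro rfl; exact hK hL
      · exact Finset.measurableSet_biUnion _ fun L _ => (isOpen_cell L).measurableSet
  exact h2 _ Finset.Subset.rfl

theorem ae_omega_iff {P : E d → Prop} : (∀ᵐ x ∂(volume.restrict T.Ω), P x) ↔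
    ∀ K ∈ T.cells, ∀ᵐ x ∂(volume.restrict (cell K)), P x := by
  rw [restrict_omega, ae_finsetSum_measure_iff]

theorem setIntegral_omega {V : Type*} [NormedAddCommGroup V] [NormedSpace ℝ V] {f : E d → V}
    (hf : ∀ K ∈ T.cells, IntegrableOn f (cell K)) :
    ∫ x in T.Ω, f x = ∑ K ∈ T.cells, ∫ x in cell K, f x := by
  rw [restrict_omega, integral_finsetSum_measure hf]

theorem memL2_omega_iff {v : E d → ℂ} : MemL2 T.Ω v ↔ ∀ K ∈ T.cells, MemL2 (cell K) v := by
  rw [MemL2, restrict_omega]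
  exact memLp_finsetSum_measure_iff

/-- The fundamental lemma of the calculus of variations on a face. -/
theorem ae_eq_zero_of_integral_surf (hd : 0 < d) {F : Finset (E d)} (hF : F ∈ T.faces)
    {U : Set (E d)} (hU : IsOpen U) (hFU : ∀ᵐ x ∂(surf F), x ∈ U) {h : E d → ℂ}
    (hh : MemLp h 2 (surf F))
    (h0 : ∀ φ, IsTest (T.awayFrom F ∩ U) φ → ∫ x, (φ x : ℂ) * h x ∂(surf F) = 0) :
    ∀ᵐ x ∂(surf F), h x = 0 := by
  have := isFiniteMeasure_surf hd hF
  have hi : Integrable h (surf F) := hh.integrable one_le_two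
  have h1 := ((isOpen_awayFrom F).inter hU).ae_eq_zero_of_integral_contDiff_smul_eq_zero
    (μ := surf F) (f := h) (hi.locallyIntegrable.locallyIntegrableOn _)
    (fun g hg1 hg2 hg3 => by
      have := h0 g ⟨hg1, hg2, hg3⟩
      simpa [Complex.real_smul] using this)
  filter_upwards [h1, hFU, ae_mem_awayFrom hd hF] with x hx1 hx2 hx3
  exact hx1 ⟨hx3, hx2⟩

end Mesh


/-! ### Sesquilinear integrals -/

section Integrals

variable {α : Type*} [MeasurableSpace α] {ν : Measure α} {f f' g F : α → ℂ}
  {w w' z W : α → Fin d → ℂ}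

theorem integrable_mul_star (hf : MemLp f 2 ν) (hg : MemLp g 2 ν) :
    Integrable (fun x => f x * star (g x)) ν :=
  MemLp.integrable_mul hf hg.star

theorem integral_mul_star_left (hf : MemLp f 2 ν) (hf' : MemLp f' 2 ν) (hg : MemLp g 2 ν) {c : ℂ}
    (h : ∀ᵐ x ∂ν, F x = f x + c * f' x) :
    ∫ x, F x * star (g x) ∂ν = (∫ x, f x * star (g x) ∂ν) + c * ∫ x, f' x * star (g x) ∂ν := by
  rw [← integral_const_mul, ← integral_add (integrable_mul_star hf hg)
    ((integrable_mul_star hf' hg).const_mul c)]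
  refine integral_congr_ae ?_
  filter_upwards [h] with x hx
  rw [hx]; ring

theorem integral_mul_star_conj (f g : α → ℂ) :
    star (∫ x, f x * star (g x) ∂ν) = ∫ x, g x * star (f x) ∂ν := by
  have := integral_conj (μ := ν) (f := fun x => f x * star (g x))
  rw [← starRingEnd_apply, ← this]
  refine integral_congr_ae (.of_forall fun x => ?_)
  simp [mul_comm]

theorem integrable_dot (hw : ∀ i, MemLp (fun x => w x i) 2 ν)
    (hz : ∀ i, MemLp (fun x => z x i) 2 ν) :
    Integrable (fun x => w x ⬝ᵥ star (z x)) ν :=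
  integrable_finsetSum _ fun i _ => integrable_mul_star (hw i) (hz i)

theorem integral_dot_left (hw : ∀ i, MemLp (fun x => w x i) 2 ν)
    (hw' : ∀ i, MemLp (fun x => w' x i) 2 ν) (hz : ∀ i, MemLp (fun x => z x i) 2 ν) {c : ℂ}
    (h : ∀ᵐ x ∂ν, W x = w x + c • w' x) :
    ∫ x, W x ⬝ᵥ star (z x) ∂ν =
      (∫ x, w x ⬝ᵥ star (z x) ∂ν) + c * ∫ x, w' x ⬝ᵥ star (z x) ∂ν := by
  rw [← integral_const_mul, ← integral_add (integrable_dot hw hz)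
    ((integrable_dot hw' hz).const_mul c)]
  refine integral_congr_ae ?_
  filter_upwards [h] with x hx
  rw [hx, add_dotProduct, smul_dotProduct, smul_eq_mul]

theorem integral_dot_conj (w z : α → Fin d → ℂ) :
    star (∫ x, w x ⬝ᵥ star (z x) ∂ν) = ∫ x, z x ⬝ᵥ star (w x) ∂ν := by
  have := integral_conj (μ := ν) (f := fun x => w x ⬝ᵥ star (z x))
  rw [← starRingEnd_apply, ← this]
  refine integral_congr_ae (.of_forall fun x => ?_)
  change star (w x ⬝ᵥ star (z x)) = _
  rw [← Matrix.dotProduct_star]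

/-- Young's inequality with a free weight replaces the Cauchy–Schwarz inequality from here on: such
bounds can be summed over elements and faces with one common weight, and the product form is
recovered at the end by `le_sqrt_mul_sqrt`. -/
theorem two_mul_norm_le {a b : ℂ} {c : ℝ} (hc : 0 < c) :
    ‖a * star b‖ ≤ (c * ‖a‖ ^ 2 + c⁻¹ * ‖b‖ ^ 2) / 2 := by
  rw [norm_mul, norm_star]
  have h : c * ‖a‖ ^ 2 + c⁻¹ * ‖b‖ ^ 2 - 2 * (‖a‖ * ‖b‖) = c⁻¹ * (c * ‖a‖ - ‖b‖) ^ 2 := by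
    field_simp; ring
  have := mul_nonneg (inv_pos.2 hc).le (sq_nonneg (c * ‖a‖ - ‖b‖))
  linarith

theorem norm_integral_mul_star_le (hf : MemLp f 2 ν) (hg : MemLp g 2 ν) {c : ℝ} (hc : 0 < c) :
    ‖∫ x, f x * star (g x) ∂ν‖ ≤ (c * (∫ x, ‖f x‖ ^ 2 ∂ν) + c⁻¹ * ∫ x, ‖g x‖ ^ 2 ∂ν) / 2 := by
  refine (norm_integral_le_integral_norm _).trans ?_
  have i1 := (integrable_norm_sq hf).const_mul c
  have i2 := (integrable_norm_sq hg).const_mul c⁻¹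
  rw [← integral_const_mul, ← integral_const_mul, ← integral_add i1 i2, ← integral_div]
  exact integral_mono (integrable_mul_star hf hg).norm ((i1.add i2).div_const 2)
    fun x => two_mul_norm_le hc

end Integrals

/-! ### Real matrices acting on complex vectors -/

section Matrices

variable {M : Matrix (Fin d) (Fin d) ℝ}

/-- The real part of the quadratic form of a real matrix. -/
theorem re_map_mulVec_dotProduct (M : Matrix (Fin d) (Fin d) ℝ) (v : Fin d → ℂ) :
    ((M.map ((↑) : ℝ → ℂ) *ᵥ v) ⬝ᵥ star v).re =
      (M *ᵥ (fun i => (v i).re)) ⬝ᵥ (fun i => (v i).re) +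
      (M *ᵥ (fun i => (v i).im)) ⬝ᵥ (fun i => (v i).im) := by
  simp only [dotProduct, Matrix.mulVec, Matrix.map_apply, Complex.re_sum, Complex.mul_re,
    Complex.im_sum, Pi.star_apply, RCLike.star_def, Complex.conj_re, Complex.conj_im,
    Complex.mul_im, Complex.ofReal_re, Complex.ofReal_im, zero_mul, sub_zero, add_zero]
  rw [← Finset.sum_add_distrib]
  refine Finset.sum_congr rfl fun i _ => ?_
  ring

theorem re_form_nonneg (hM : M.PosDef) (v : Fin d → ℂ) :
    0 ≤ ((M.map ((↑) : ℝ → ℂ) *ᵥ v) ⬝ᵥ star v).re := by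
  rw [re_map_mulVec_dotProduct]
  have h := fun x : Fin d → ℝ => hM.posSemidef.dotProduct_mulVec_nonneg x
  have h1 := h (fun i => (v i).re)
  have h2 := h (fun i => (v i).im)
  simp only [star_trivial] at h1 h2
  rw [dotProduct_comm] at h1 h2
  linarith

theorem form_conj (hM : M.PosDef) (v w : Fin d → ℂ) :
    star ((M.map ((↑) : ℝ → ℂ) *ᵥ v) ⬝ᵥ star w) = (M.map ((↑) : ℝ → ℂ) *ᵥ w) ⬝ᵥ star v := by
  have hT : ∀ i j, M i j = M j i := fun i j => by
    have := hM.isHermitian.apply i j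
    simpa using this.symm
  simp only [dotProduct, Matrix.mulVec, Matrix.map_apply, star_sum, star_mul', Pi.star_apply,
    star_star, Finset.sum_mul]
  rw [Finset.sum_comm]
  refine Finset.sum_congr rfl fun i _ => Finset.sum_congr rfl fun j _ => ?_
  rw [hT j i]
  simp; ring

theorem mulVec_dotProduct_star (hM : M.PosDef) (v w : Fin d → ℂ) :
    (M.map ((↑) : ℝ → ℂ) *ᵥ v) ⬝ᵥ star w = v ⬝ᵥ star (M.map ((↑) : ℝ → ℂ) *ᵥ w) := by
  rw [← form_conj hM w v, ← Matrix.dotProduct_star]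

/-- Expand the nonnegative form at cθv - w, where the unit number θ makes θ times the mixed term
equal to its modulus. -/
theorem norm_form_le (hM : M.PosDef) (v w : Fin d → ℂ) {c : ℝ} (hc : 0 < c) :
    ‖(M.map ((↑) : ℝ → ℂ) *ᵥ v) ⬝ᵥ star w‖ ≤
      (c * ((M.map ((↑) : ℝ → ℂ) *ᵥ v) ⬝ᵥ star v).re +
        c⁻¹ * ((M.map ((↑) : ℝ → ℂ) *ᵥ w) ⬝ᵥ star w).re) / 2 := by
  set N := M.map ((↑) : ℝ → ℂ)
  set t := (N *ᵥ v) ⬝ᵥ star w with ht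
  obtain ⟨θ, hθ, hθt⟩ : ∃ θ : ℂ, ‖θ‖ = 1 ∧ θ * t = ‖t‖ := by
    by_cases h0 : t = 0
    · exact ⟨1, by simp, by simp [h0]⟩
    · have hn : (‖t‖ : ℂ) ≠ 0 := by exact_mod_cast norm_ne_zero_iff.2 h0
      refine ⟨star t / ‖t‖, ?_, ?_⟩
      · rw [norm_div, norm_star]; simp [norm_ne_zero_iff.2 h0]
      · rw [div_mul_eq_mul_div, div_eq_iff hn, RCLike.star_def, Complex.conj_mul']
        ring
  have h1 := re_form_nonneg hM ((c : ℂ) • θ • v - w)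
  have hcj := form_conj hM v w
  have hθ2 : θ * star θ = 1 := by
    rw [RCLike.star_def, Complex.mul_conj']; simp [hθ]
  have e : (N *ᵥ ((c : ℂ) • θ • v - w)) ⬝ᵥ star ((c : ℂ) • θ • v - w) =
      (c : ℂ) ^ 2 * ((N *ᵥ v) ⬝ᵥ star v) - c * (θ * t) - c * star (θ * t)
        + (N *ᵥ w) ⬝ᵥ star w := by
    rw [star_mul', ht, hcj]
    simp only [Matrix.mulVec_sub, Matrix.mulVec_smul, star_sub, star_smul, sub_dotProduct,
      dotProduct_sub, smul_dotProduct, dotProduct_smul, smul_eq_mul]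
    have : star (c : ℂ) = c := by simp
    rw [this]
    linear_combination (c : ℂ) ^ 2 * ((N *ᵥ v) ⬝ᵥ star v) * hθ2
  rw [e, hθt] at h1
  have h2 : 0 ≤ c ^ 2 * ((N *ᵥ v) ⬝ᵥ star v).re - 2 * c * ‖t‖ + ((N *ᵥ w) ⬝ᵥ star w).re := by
    have : ((c : ℂ) ^ 2 * ((N *ᵥ v) ⬝ᵥ star v) - c * (‖t‖ : ℂ) - c * star (‖t‖ : ℂ)
        + (N *ᵥ w) ⬝ᵥ star w).re =
        c ^ 2 * ((N *ᵥ v) ⬝ᵥ star v).re - 2 * c * ‖t‖ + ((N *ᵥ w) ⬝ᵥ star w).re := by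
      rw [← Complex.ofReal_pow]
      simp only [Complex.add_re, Complex.sub_re, Complex.re_ofReal_mul, RCLike.star_def,
        Complex.conj_ofReal, Complex.ofReal_re]
      ring
    rwa [this] at h1
  have h3 := mul_nonneg (inv_pos.2 hc).le h2
  have h4 : c⁻¹ * (c ^ 2 * ((N *ᵥ v) ⬝ᵥ star v).re - 2 * c * ‖t‖ + ((N *ᵥ w) ⬝ᵥ star w).re) =
      c * ((N *ᵥ v) ⬝ᵥ star v).re - 2 * ‖t‖ + c⁻¹ * ((N *ᵥ w) ⬝ᵥ star w).re := by
    field_simp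
  linarith

theorem map_mul_inv (hM : M.PosDef) (v : Fin d → ℂ) :
    M.map ((↑) : ℝ → ℂ) *ᵥ ((M.map ((↑) : ℝ → ℂ))⁻¹ *ᵥ v) = v := by
  have hdet : IsUnit (M.map ((↑) : ℝ → ℂ)).det := by
    have : (M.map ((↑) : ℝ → ℂ)).det = ((M.det : ℝ) : ℂ) :=
      (RingHom.map_det Complex.ofRealHom M).symm
    rw [this, isUnit_iff_ne_zero]
    exact_mod_cast hM.det_pos.ne'
  rw [Matrix.mulVec_mulVec, Matrix.mul_nonsing_inv _ hdet, Matrix.one_mulVec]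

theorem re_inv_form_eq (hM : M.PosDef) (v : Fin d → ℂ) :
    (((M.map ((↑) : ℝ → ℂ))⁻¹ *ᵥ v) ⬝ᵥ star v).re =
      ((M.map ((↑) : ℝ → ℂ) *ᵥ ((M.map ((↑) : ℝ → ℂ))⁻¹ *ᵥ v)) ⬝ᵥ
        star ((M.map ((↑) : ℝ → ℂ))⁻¹ *ᵥ v)).re := by
  rw [mulVec_dotProduct_star hM, map_mul_inv hM]

theorem re_inv_form_nonneg (hM : M.PosDef) (v : Fin d → ℂ) :
    0 ≤ (((M.map ((↑) : ℝ → ℂ))⁻¹ *ᵥ v) ⬝ᵥ star v).re := by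
  rw [re_inv_form_eq hM]
  exact re_form_nonneg hM _

/-- The Young inequality for the dual norms associated with a positive definite matrix. -/
theorem norm_dotProduct_le (hM : M.PosDef) (v w : Fin d → ℂ) {c : ℝ} (hc : 0 < c) :
    ‖v ⬝ᵥ star w‖ ≤ (c * ((M.map ((↑) : ℝ → ℂ) *ᵥ v) ⬝ᵥ star v).re +
        c⁻¹ * (((M.map ((↑) : ℝ → ℂ))⁻¹ *ᵥ w) ⬝ᵥ star w).re) / 2 := by
  have := norm_form_le hM v ((M.map ((↑) : ℝ → ℂ))⁻¹ *ᵥ w) hc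
  rwa [← re_inv_form_eq hM, mulVec_dotProduct_star hM, map_mul_inv hM] at this

theorem memLp_mulVec {α : Type*} [MeasurableSpace α] {ν : Measure α} (N : Matrix (Fin d) (Fin d) ℂ)
    {w : α → Fin d → ℂ} (hw : ∀ i, MemLp (fun x => w x i) 2 ν) (i : Fin d) :
    MemLp (fun x => (N *ᵥ w x) i) 2 ν := by
  have := memLp_finsetSum (μ := ν) (p := 2) Finset.univ (f := fun j x => N i j * w x j)
    fun j _ => (hw j).const_mul (N i j)
  exact this

end Matrices


/-! ### Sesquilinearity, symmetry and continuity of the weighted inner products. -/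

namespace Mesh

variable {T : Mesh d} {f f' g F : E d → ℂ} {w w' z W : E d → Fin d → ℂ} {c : ℂ}

theorem ae_cell {P : E d → Prop} (h : ∀ᵐ x ∂(volume.restrict T.Ω), P x) {K : Finset (E d)}
    (hK : K ∈ T.cells) : ∀ᵐ x ∂(volume.restrict (cell K)), P x := ae_omega_iff.1 h K hK

theorem memL2_cell (h : MemL2 T.Ω f) {K : Finset (E d)} (hK : K ∈ T.cells) : MemL2 (cell K) f :=
  h.mono (cell_subset_omega hK)

theorem memL2Vec_cell (h : MemL2Vec T.Ω w) {K : Finset (E d)} (hK : K ∈ T.cells) :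
    MemL2Vec (cell K) w := h.mono (cell_subset_omega hK)

theorem l2_left (hf : MemL2 T.Ω f) (hf' : MemL2 T.Ω f') (hg : MemL2 T.Ω g)
    (h : ∀ᵐ x ∂(volume.restrict T.Ω), F x = f x + c * f' x) :
    T.l2 F g = T.l2 f g + c * T.l2 f' g := by
  rw [l2, l2, l2, Finset.mul_sum, ← Finset.sum_add_distrib]
  exact Finset.sum_congr rfl fun K hK => integral_mul_star_left (memL2_cell hf hK)
    (memL2_cell hf' hK) (memL2_cell hg hK) (ae_cell h hK)

theorem l2_conj (f g : E d → ℂ) : star (T.l2 f g) = T.l2 g f := by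
  rw [l2, l2, star_sum]
  exact Finset.sum_congr rfl fun K _ => integral_mul_star_conj f g

theorem l2Vec_left (hw : MemL2Vec T.Ω w) (hw' : MemL2Vec T.Ω w') (hz : MemL2Vec T.Ω z)
    (h : ∀ᵐ x ∂(volume.restrict T.Ω), W x = w x + c • w' x) :
    T.l2Vec W z = T.l2Vec w z + c * T.l2Vec w' z := by
  rw [l2Vec, l2Vec, l2Vec, Finset.mul_sum, ← Finset.sum_add_distrib]
  exact Finset.sum_congr rfl fun K hK => integral_dot_left (memL2Vec_cell hw hK)
    (memL2Vec_cell hw' hK) (memL2Vec_cell hz hK) (ae_cell h hK)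

theorem l2Vec_conj (w z : E d → Fin d → ℂ) : star (T.l2Vec w z) = T.l2Vec z w := by
  rw [l2Vec, l2Vec, star_sum]
  exact Finset.sum_congr rfl fun K _ => integral_dot_conj w z

theorem l2Vec_congr_left (h : ∀ᵐ x ∂(volume.restrict T.Ω), W x = w x) (z : E d → Fin d → ℂ) :
    T.l2Vec W z = T.l2Vec w z :=
  Finset.sum_congr rfl fun K hK => integral_congr_ae (by
    filter_upwards [ae_cell h hK] with x hx; rw [hx])

theorem l2Vec_congr_right (h : ∀ᵐ x ∂(volume.restrict T.Ω), W x = w x) (z : E d → Fin d → ℂ) :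
    T.l2Vec z W = T.l2Vec z w :=
  Finset.sum_congr rfl fun K hK => integral_congr_ae (by
    filter_upwards [ae_cell h hK] with x hx; rw [hx])

theorem l2_congr_right (h : ∀ᵐ x ∂(volume.restrict T.Ω), F x = f x) (g : E d → ℂ) :
    T.l2 g F = T.l2 g f :=
  Finset.sum_congr rfl fun K hK => integral_congr_ae (by
    filter_upwards [ae_cell h hK] with x hx; rw [hx])

end Mesh

namespace Setting

open Mesh

variable {S : Setting d} {f f' g F : E d → ℂ} {w w' z W : E d → Fin d → ℂ}
  {Φ Φ' Ψ Θ : FaceFun d} {c : ℂ}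

theorem mem_extFaces_of_FR {F : Finset (E d)} (hF : F ∈ S.FR) : F ∈ S.extFaces := by
  rw [← S.faces_union]; simp [hF]

theorem mem_extFaces_of_FD {F : Finset (E d)} (hF : F ∈ S.FD) : F ∈ S.extFaces := by
  rw [← S.faces_union]; simp [hF]

theorem mem_faces_of_ext {F : Finset (E d)} (hF : F ∈ S.extFaces) : F ∈ S.faces :=
  (Finset.mem_filter.1 hF).1

theorem mem_faces_of_FR {F : Finset (E d)} (hF : F ∈ S.FR) : F ∈ S.faces :=
  mem_faces_of_ext (mem_extFaces_of_FR hF)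

/-! #### The inner products -/

theorem l2μ_left (hf : MemL2 S.Ω f) (hf' : MemL2 S.Ω f') (hg : MemL2 S.Ω g)
    (h : ∀ᵐ x ∂(volume.restrict S.Ω), F x = f x + c * f' x) :
    S.l2μ F g = S.l2μ f g + c * S.l2μ f' g := by
  rw [l2μ, l2μ, l2μ, Finset.mul_sum, ← Finset.sum_add_distrib]
  refine Finset.sum_congr rfl fun K hK => ?_
  rw [integral_mul_star_left (memL2_cell hf hK)
    (memL2_cell hf' hK) (memL2_cell hg hK) (ae_cell h hK)]
  ring

theorem l2μ_conj (f g : E d → ℂ) : star (S.l2μ f g) = S.l2μ g f := by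
  rw [l2μ, l2μ, star_sum]
  refine Finset.sum_congr rfl fun K _ => ?_
  rw [star_mul', integral_mul_star_conj f g]
  simp

theorem l2A_left (hw : MemL2Vec S.Ω w) (hw' : MemL2Vec S.Ω w') (hz : MemL2Vec S.Ω z)
    (h : ∀ᵐ x ∂(volume.restrict S.Ω), W x = w x + c • w' x) :
    S.l2A W z = S.l2A w z + c * S.l2A w' z := by
  rw [l2A, l2A, l2A, Finset.mul_sum, ← Finset.sum_add_distrib]
  refine Finset.sum_congr rfl fun K hK => integral_dot_left (memLp_mulVec _ (memL2Vec_cell hw hK))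
    (memLp_mulVec _ (memL2Vec_cell hw' hK)) (memL2Vec_cell hz hK) ?_
  filter_upwards [ae_cell h hK] with x hx
  rw [hx, Matrix.mulVec_add, Matrix.mulVec_smul]

theorem l2A_conj (w z : E d → Fin d → ℂ) : star (S.l2A w z) = S.l2A z w := by
  rw [l2A, l2A, star_sum]
  refine Finset.sum_congr rfl fun K hK => ?_
  rw [integral_dot_conj]
  exact integral_congr_ae (.of_forall fun x =>
    (mulVec_dotProduct_star (S.A_posDef K hK) (z x) (w x)).symm)

theorem l2A_congr_left (h : ∀ᵐ x ∂(volume.restrict S.Ω), W x = w x) (z : E d → Fin d → ℂ) :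
    S.l2A W z = S.l2A w z :=
  Finset.sum_congr rfl fun K hK => integral_congr_ae (by
    filter_upwards [ae_cell h hK] with x hx; rw [hx])

theorem l2A_congr_right (h : ∀ᵐ x ∂(volume.restrict S.Ω), W x = w x) (z : E d → Fin d → ℂ) :
    S.l2A z W = S.l2A z w := by
  rw [← l2A_conj, l2A_congr_left h, l2A_conj]

theorem l2R_left (hΦ : S.MemL2R Φ) (hΦ' : S.MemL2R Φ') (hΨ : S.MemL2R Ψ)
    (h : ∀ F ∈ S.FR, ∀ᵐ x ∂(surf F), Θ F x = Φ F x + c * Φ' F x) :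
    S.l2R Θ Ψ = S.l2R Φ Ψ + c * S.l2R Φ' Ψ := by
  rw [l2R, l2R, l2R, Finset.mul_sum, ← Finset.sum_add_distrib]
  exact Finset.sum_congr rfl fun F hF => integral_mul_star_left (hΦ F hF) (hΦ' F hF) (hΨ F hF)
    (h F hF)

theorem l2R_conj (Φ Ψ : FaceFun d) : star (S.l2R Φ Ψ) = S.l2R Ψ Φ := by
  rw [l2R, l2R, star_sum]
  exact Finset.sum_congr rfl fun K _ => integral_mul_star_conj _ _

theorem l2R_congr_right (h : ∀ F ∈ S.FR, ∀ᵐ x ∂(surf F), Θ F x = Φ F x) (Ψ : FaceFun d) :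
    S.l2R Ψ Θ = S.l2R Ψ Φ :=
  Finset.sum_congr rfl fun F hF => integral_congr_ae (by
    filter_upwards [h F hF] with x hx; rw [hx])

theorem l2γ_left (hΦ : S.MemL2R Φ) (hΦ' : S.MemL2R Φ') (hΨ : S.MemL2R Ψ)
    (h : ∀ F ∈ S.FR, ∀ᵐ x ∂(surf F), Θ F x = Φ F x + c * Φ' F x) :
    S.l2γ Θ Ψ = S.l2γ Φ Ψ + c * S.l2γ Φ' Ψ := by
  rw [l2γ, l2γ, l2γ, Finset.mul_sum, ← Finset.sum_add_distrib]
  refine Finset.sum_congr rfl fun F hF => ?_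
  rw [integral_mul_star_left (hΦ F hF) (hΦ' F hF) (hΨ F hF) (h F hF)]
  ring

theorem l2γ_conj (Φ Ψ : FaceFun d) : star (S.l2γ Φ Ψ) = S.l2γ Ψ Φ := by
  rw [l2γ, l2γ, star_sum]
  refine Finset.sum_congr rfl fun K _ => ?_
  rw [star_mul', integral_mul_star_conj]
  simp

theorem normμ_sq (v : E d → ℂ) : S.normμ v ^ 2 = ∑ K ∈ S.cells, S.μ K * ∫ x in cell K, ‖v x‖ ^ 2 :=
  Real.sq_sqrt (Finset.sum_nonneg fun K hK => mul_nonneg (S.μ_pos K hK).le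
    (integral_nonneg fun _ => by positivity))

theorem normγ_sq (Ψ : FaceFun d) :
    S.normγ Ψ ^ 2 = ∑ F ∈ S.FR, S.γ F * ∫ x, ‖Ψ F x‖ ^ 2 ∂(surf F) :=
  Real.sq_sqrt (Finset.sum_nonneg fun F hF => mul_nonneg (S.γ_pos F hF).le
    (integral_nonneg fun _ => by positivity))

theorem normA_sq (w : E d → Fin d → ℂ) :
    S.normA w ^ 2 = ∑ K ∈ S.cells, ∫ x in cell K, ((S.Ac K *ᵥ w x) ⬝ᵥ star (w x)).re :=
  Real.sq_sqrt (Finset.sum_nonneg fun K hK =>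
    integral_nonneg fun _ => re_form_nonneg (S.A_posDef K hK) _)

theorem mul_star_self (a : ℂ) : a * star a = ((‖a‖ ^ 2 : ℝ) : ℂ) := by
  rw [RCLike.star_def, Complex.mul_conj']; norm_cast

theorem l2μ_self (v : E d → ℂ) : S.l2μ v v = ((S.normμ v ^ 2 : ℝ) : ℂ) := by
  rw [normμ_sq, l2μ]
  push_cast
  refine Finset.sum_congr rfl fun K _ => ?_
  simp_rw [mul_star_self]
  rw [integral_complex_ofReal]

theorem l2γ_self (Ψ : FaceFun d) : S.l2γ Ψ Ψ = ((S.normγ Ψ ^ 2 : ℝ) : ℂ) := by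
  rw [normγ_sq, l2γ]
  push_cast
  refine Finset.sum_congr rfl fun K _ => ?_
  simp_rw [mul_star_self]
  rw [integral_complex_ofReal]

theorem l2A_self (w : E d → Fin d → ℂ) : S.l2A w w = ((S.normA w ^ 2 : ℝ) : ℂ) := by
  rw [normA_sq, l2A]
  push_cast
  refine Finset.sum_congr rfl fun K hK => ?_
  rw [← integral_complex_ofReal]
  refine integral_congr_ae (.of_forall fun x => ?_)
  have := form_conj (S.A_posDef K hK) (w x) (w x)
  exact (Complex.conj_eq_iff_re.1 this).symm

theorem norm_l2μ_le (hf : MemL2 S.Ω f) (hg : MemL2 S.Ω g) {t : ℝ} (ht : 0 < t) :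
    ‖S.l2μ f g‖ ≤ (t * S.normμ f ^ 2 + t⁻¹ * S.normμ g ^ 2) / 2 := by
  rw [normμ_sq, normμ_sq, Finset.mul_sum, Finset.mul_sum, ← Finset.sum_add_distrib,
    Finset.sum_div, l2μ]
  refine (norm_sum_le _ _).trans (Finset.sum_le_sum fun K hK => ?_)
  rw [norm_mul, Complex.norm_real, Real.norm_of_nonneg (S.μ_pos K hK).le]
  refine (mul_le_mul_of_nonneg_left (norm_integral_mul_star_le (memL2_cell hf hK)
    (memL2_cell hg hK) ht) (S.μ_pos K hK).le).trans (le_of_eq ?_)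
  ring

theorem norm_l2γ_le (hΦ : S.MemL2R Φ) (hΨ : S.MemL2R Ψ) {t : ℝ} (ht : 0 < t) :
    ‖S.l2γ Φ Ψ‖ ≤ (t * S.normγ Φ ^ 2 + t⁻¹ * S.normγ Ψ ^ 2) / 2 := by
  rw [normγ_sq, normγ_sq, Finset.mul_sum, Finset.mul_sum, ← Finset.sum_add_distrib,
    Finset.sum_div, l2γ]
  refine (norm_sum_le _ _).trans (Finset.sum_le_sum fun F hF => ?_)
  rw [norm_mul, Complex.norm_real, Real.norm_of_nonneg (S.γ_pos F hF).le]
  refine (mul_le_mul_of_nonneg_left (norm_integral_mul_star_le (hΦ F hF) (hΨ F hF) ht)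
    (S.γ_pos F hF).le).trans (le_of_eq ?_)
  ring

theorem integrable_form (hw : MemL2Vec S.Ω w) (hz : MemL2Vec S.Ω z) (N : Matrix (Fin d) (Fin d) ℂ)
    {K : Finset (E d)} (hK : K ∈ S.cells) :
    IntegrableOn (fun x => (N *ᵥ w x) ⬝ᵥ star (z x)) (cell K) :=
  integrable_dot (memLp_mulVec _ (memL2Vec_cell hw hK)) (memL2Vec_cell hz hK)

theorem integrable_re_form (hw : MemL2Vec S.Ω w) (N : Matrix (Fin d) (Fin d) ℂ)
    {K : Finset (E d)} (hK : K ∈ S.cells) :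
    IntegrableOn (fun x => ((N *ᵥ w x) ⬝ᵥ star (w x)).re) (cell K) :=
  (integrable_form hw hw N hK).re

theorem norm_l2A_le (hw : MemL2Vec S.Ω w) (hz : MemL2Vec S.Ω z) {t : ℝ} (ht : 0 < t) :
    ‖S.l2A w z‖ ≤ (t * S.normA w ^ 2 + t⁻¹ * S.normA z ^ 2) / 2 := by
  rw [normA_sq, normA_sq, Finset.mul_sum, Finset.mul_sum, ← Finset.sum_add_distrib,
    Finset.sum_div, l2A]
  refine (norm_sum_le _ _).trans (Finset.sum_le_sum fun K hK => ?_)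
  refine (norm_integral_le_integral_norm _).trans ?_
  have i1 := (integrable_re_form hw (S.Ac K) hK).const_mul t
  have i2 := (integrable_re_form hz (S.Ac K) hK).const_mul t⁻¹
  rw [← integral_const_mul, ← integral_const_mul, ← integral_add i1 i2, ← integral_div]
  exact integral_mono (integrable_form hw hz _ hK).norm ((i1.add i2).div_const 2)
    fun x => norm_form_le (S.A_posDef K hK) _ _ ht

end Setting

/-- A bound by weighted sums of squares for all weights gives a bound by a product. -/
theorem le_sqrt_mul_sqrt {a X Y : ℝ} (hX : 0 ≤ X) (hY : 0 ≤ Y)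
    (h : ∀ t : ℝ, 0 < t → a ≤ (t * X + t⁻¹ * Y) / 2) : a ≤ √X * √Y := by
  refine le_of_forall_pos_le_add fun ε hε => ?_
  -- The optimal weight is √Y/√X; the shift by δ keeps it defined and positive when X or Y vanishes.
  have key : ∀ δ : ℝ, 0 < δ → a ≤ (√X + δ) * (√Y + δ) := by
    intro δ hδ
    have hx : 0 < √X + δ := by positivity
    have hy : 0 < √Y + δ := by positivity
    have h1 := h ((√Y + δ) / (√X + δ)) (by positivity)
    have h2 : (√Y + δ) / (√X + δ) * X ≤ (√X + δ) * (√Y + δ) := by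
      rw [div_mul_eq_mul_div, div_le_iff₀ hx]
      nlinarith [Real.sq_sqrt hX, Real.sqrt_nonneg X, mul_nonneg (Real.sqrt_nonneg X) hδ.le,
        mul_pos hδ hδ]
    have h3 : ((√Y + δ) / (√X + δ))⁻¹ * Y ≤ (√X + δ) * (√Y + δ) := by
      rw [inv_div, div_mul_eq_mul_div, div_le_iff₀ hy]
      nlinarith [Real.sq_sqrt hY, Real.sqrt_nonneg Y, mul_nonneg (Real.sqrt_nonneg Y) hδ.le,
        mul_pos hδ hδ]
    linarith
  have ht : Tendsto (fun δ : ℝ => (√X + δ) * (√Y + δ)) (𝓝[>] 0) (𝓝 (√X * √Y)) := by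
    have : Tendsto (fun δ : ℝ => (√X + δ) * (√Y + δ)) (𝓝 0) (𝓝 ((√X + 0) * (√Y + 0))) :=
      Continuous.tendsto (by fun_prop) 0
    rw [add_zero, add_zero] at this
    exact this.mono_left nhdsWithin_le_nhds
  have := ge_of_tendsto ht (by
    filter_upwards [self_mem_nhdsWithin] with δ hδ using key δ hδ)
  linarith


/-! ### Broken Sobolev functions on the mesh, their traces and jumps. -/

theorem contDiff_ofReal_comp {φ : E d → ℝ} {n : WithTop ℕ∞} (h : ContDiff ℝ n φ) :
    ContDiff ℝ n (fun x => (φ x : ℂ)) := Complex.ofRealCLM.contDiff.comp h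

theorem pderiv_ofReal {φ : E d → ℝ} {x : E d} (h : DifferentiableAt ℝ φ x) (i : Fin d) :
    pderiv i (fun x => (φ x : ℂ)) x = ((pderiv i φ x : ℝ) : ℂ) := by
  have h1 := (Complex.ofRealCLM.hasFDerivAt (x := φ x)).comp x h.hasFDerivAt
  have h2 : fderiv ℝ (fun x => (φ x : ℂ)) x = _ := h1.fderiv
  rw [pderiv, h2]
  simp [pderiv]

theorem integral_surf_eq_zero {F : Finset (E d)} {φ h : E d → ℂ} (hφ : ∀ x ∈ body F, φ x = 0) :
    ∫ x, φ x * h x ∂(surf F) = 0 := by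
  rw [surf, setIntegral_congr_fun (g := fun _ => (0 : ℂ)) (isCompact_body F).measurableSet
    (fun x hx => by simp [hφ x hx])]
  simp

/-- The function defined by a polynomial. -/
def polyFun (q : MvPolynomial (Fin d) ℂ) (x : E d) : ℂ :=
  MvPolynomial.eval (fun i => ((x i : ℝ) : ℂ)) q

theorem contDiff_polyFun (q : MvPolynomial (Fin d) ℂ) {n : WithTop ℕ∞} :
    ContDiff ℝ n (polyFun q) := by
  induction q using MvPolynomial.induction_on with
  | C a =>
    have : polyFun (MvPolynomial.C a : MvPolynomial (Fin d) ℂ) = fun _ => a := by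
      ext x; simp [polyFun]
    rw [this]; exact contDiff_const
  | add p q hp hq =>
    have : polyFun (p + q) = fun x => polyFun p x + polyFun q x := by
      ext x; simp [polyFun]
    rw [this]; exact hp.add hq
  | mul_X p i hp =>
    have : polyFun (p * MvPolynomial.X i) = fun x => polyFun p x * ((x i : ℝ) : ℂ) := by
      ext x; simp [polyFun]
    rw [this]
    exact hp.mul (Complex.ofRealCLM.contDiff.comp (EuclideanSpace.proj (𝕜 := ℝ) i).contDiff)

namespace Mesh

variable {T : Mesh d} {v v' : E d → ℂ} {K F : Finset (E d)}

theorem bgrad_apply (hK : K ∈ T.cells) {x : E d} (hx : x ∈ cell K) (v : E d → ℂ) :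
    T.bgrad v x = wgrad (cell K) v x := by
  rw [bgrad, Finset.sum_eq_single K]
  · exact Set.indicator_of_mem hx _
  · intro L hL hLK
    exact Set.indicator_of_notMem (fun hx' =>
      Set.disjoint_left.1 (disjoint_cell hL hK hLK) hx' hx) _
  · exact fun h => absurd hK h

theorem ae_bgrad (hK : K ∈ T.cells) (v : E d → ℂ) :
    ∀ᵐ x ∂(volume.restrict (cell K)), T.bgrad v x = wgrad (cell K) v x := by
  filter_upwards [ae_restrict_mem (isOpen_cell K).measurableSet] with x hx using bgrad_apply hK hx v

theorem memL2Vec_bgrad (hv : T.MemH1T v) : MemL2Vec T.Ω (T.bgrad v) := fun i => by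
  refine memL2_omega_iff.2 fun K hK => ((wgrad_spec (hv.2 K hK)).1 i).congr ?_
  filter_upwards [ae_bgrad hK v] with x hx
  rw [hx]

theorem memH1T_of_memH1 (hv : MemH1 T.Ω v) : T.MemH1T v :=
  ⟨hv.1, fun _ hK => hv.mono (cell_subset_omega hK)⟩

theorem bgrad_ae_eq (hv : MemH1 T.Ω v) :
    ∀ᵐ x ∂(volume.restrict T.Ω), T.bgrad v x = wgrad T.Ω v x := by
  refine ae_omega_iff.2 fun K hK => ?_
  filter_upwards [ae_bgrad hK v, wgrad_mono (isOpen_cell K) (cell_subset_omega hK) hv]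
    with x h1 h2
  rw [h1, h2]

theorem MemH1T.add_smul (hv : T.MemH1T v) (hv' : T.MemH1T v') (c : ℂ) :
    T.MemH1T (v + c • v') :=
  ⟨hv.1.add_smul hv'.1 c, fun K hK => (hv.2 K hK).add_smul (hv'.2 K hK) c⟩

theorem bgrad_add_smul (hv : T.MemH1T v) (hv' : T.MemH1T v') (c : ℂ) :
    ∀ᵐ x ∂(volume.restrict T.Ω), T.bgrad (v + c • v') x = T.bgrad v x + c • T.bgrad v' x := by
  refine ae_omega_iff.2 fun K hK => ?_
  filter_upwards [ae_bgrad hK v, ae_bgrad hK v', ae_bgrad hK (v + c • v'),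
    wgrad_add_smul (isOpen_cell K) (hv.2 K hK) (hv'.2 K hK) c] with x h1 h2 h3 h4
  rw [h1, h2, h3, h4]

theorem memH1T_of_memP {p : ℕ} (hv : T.MemP p v) : T.MemH1T v := by
  have h : ∀ K ∈ T.cells, MemH1 (cell K) v := fun K hK => by
    obtain ⟨q, -, hq⟩ := hv K hK
    refine (memH1_of_contDiff ((isCompact_body K).isBounded.subset (cell_subset_body K))
      (contDiff_polyFun q)).congr ?_
    filter_upwards [hq] with x hx
    exact hx.symm
  exact ⟨memL2_omega_iff.2 fun K hK => (h K hK).1, h⟩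

theorem MemP.add_smul {p : ℕ} (hv : T.MemP p v) (hv' : T.MemP p v') (c : ℂ) :
    T.MemP p (v + c • v') := by
  intro K hK
  obtain ⟨q, hq, h⟩ := hv K hK
  obtain ⟨q', hq', h'⟩ := hv' K hK
  refine ⟨q + c • q', (MvPolynomial.totalDegree_add _ _).trans (max_le hq
    ((MvPolynomial.totalDegree_smul_le _ _).trans hq')), ?_⟩
  filter_upwards [h, h'] with x h1 h2
  simp [h1, h2]

theorem memP_zero {p : ℕ} : T.MemP p 0 := fun K _ =>
  ⟨0, by simp, .of_forall fun x => by simp⟩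

theorem MemPVec.add_smul {p : ℕ} {w w' : E d → Fin d → ℂ} (hw : T.MemPVec p w)
    (hw' : T.MemPVec p w') (c : ℂ) : T.MemPVec p (w + c • w') := fun i =>
  MemP.add_smul (hw i) (hw' i) c

theorem MemPVec.memL2Vec {p : ℕ} {w : E d → Fin d → ℂ} (hw : T.MemPVec p w) : MemL2Vec T.Ω w :=
  fun i => (memH1T_of_memP (hw i)).1

/-! #### Traces on the skeleton -/

theorem memLp_trace (hd : 0 < d) (hF : F ∈ T.faces) (hK : K ∈ T.cellsOf F) (hv : T.MemH1T v) :
    MemLp (trace K v) 2 (surf F) :=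
  (T.isSimplex (mem_cellsOf.1 hK).1).memLp_trace hd (hv.2 K (mem_cellsOf.1 hK).1)
    (mem_facesOf_of_mem_cellsOf hF hK)

theorem trace_add_smul (hd : 0 < d) (hF : F ∈ T.faces) (hv : T.MemH1T v) (hv' : T.MemH1T v')
    (c : ℂ) : ∀ᵐ x ∂(surf F), ∀ K ∈ T.cellsOf F,
      trace K (v + c • v') x = trace K v x + c * trace K v' x :=
  (ae_ball_iff (Finset.countable_toSet (T.cellsOf F))).2 fun _ hK =>
    (T.isSimplex (mem_cellsOf.1 hK).1).trace_add_smul hd (hv.2 _ (mem_cellsOf.1 hK).1)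
      (hv'.2 _ (mem_cellsOf.1 hK).1) c (mem_facesOf_of_mem_cellsOf hF hK)

theorem trace_of_contDiff (hd : 0 < d) (hF : F ∈ T.faces) {q : E d → ℂ}
    (hq : ContDiff ℝ ((⊤ : ℕ∞) : WithTop ℕ∞) q) :
    ∀ᵐ x ∂(surf F), ∀ K ∈ T.cellsOf F, trace K q x = q x :=
  (ae_ball_iff (Finset.countable_toSet (T.cellsOf F))).2 fun _ hK =>
    (T.isSimplex (mem_cellsOf.1 hK).1).trace_of_contDiff hd hq (mem_facesOf_of_mem_cellsOf hF hK)

theorem memLp_extTrace (hd : 0 < d) (hF : F ∈ T.faces) (hv : T.MemH1T v) :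
    MemLp (T.extTrace v F) 2 (surf F) :=
  memLp_finsetSum _ fun _ hK => memLp_trace hd hF hK hv

theorem extTrace_add_smul (hd : 0 < d) (hF : F ∈ T.faces) (hv : T.MemH1T v) (hv' : T.MemH1T v')
    (c : ℂ) : ∀ᵐ x ∂(surf F), T.extTrace (v + c • v') F x
      = T.extTrace v F x + c * T.extTrace v' F x := by
  filter_upwards [trace_add_smul hd hF hv hv' c] with x hx
  rw [extTrace, Finset.sum_congr rfl hx, Finset.sum_add_distrib, ← Finset.mul_sum]
  rfl

theorem exists_cellsOf_eq_of_ext (hF : F ∈ T.extFaces) : ∃ K, T.cellsOf F = {K} :=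
  Finset.card_eq_one.1 (Finset.mem_filter.1 hF).2

theorem extTrace_of_contDiff (hd : 0 < d) (hF : F ∈ T.extFaces) {q : E d → ℂ}
    (hq : ContDiff ℝ ((⊤ : ℕ∞) : WithTop ℕ∞) q) :
    ∀ᵐ x ∂(surf F), T.extTrace q F x = q x := by
  obtain ⟨K, hK⟩ := exists_cellsOf_eq_of_ext hF
  filter_upwards [trace_of_contDiff hd (Finset.mem_filter.1 hF).1 hq] with x hx
  rw [extTrace, Finset.sum_congr rfl hx, hK]
  simp

/-- Almost no point of an exterior face is in `Ω`. -/
theorem ae_notMem_omega (hd : 0 < d) (hF : F ∈ T.extFaces) : ∀ᵐ x ∂(surf F), x ∉ T.Ω := by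
  have hF' := (Finset.mem_filter.1 hF).1
  obtain ⟨K, hK⟩ := exists_cellsOf_eq_of_ext hF
  have hKF : K ∈ T.cellsOf F := by simp [hK]
  have hKc := (mem_cellsOf.1 hKF).1
  have hs := T.isSimplex hKc
  obtain ⟨a, ha, e⟩ := hs.mem_facesOf.1 (mem_facesOf_of_mem_cellsOf hF' hKF)
  have hpos : ∀ᵐ x ∂(surf F), ∀ c ∈ F, 0 < bary K c x := by
    refine (ae_ball_iff (Finset.countable_toSet F)).2 fun c hc => ?_
    have := Finset.mem_erase.1 (e ▸ Finset.mem_coe.1 hc)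
    rw [e]
    exact hs.surf_ae_bary_pos hd ha this.2 this.1.symm
  have hmem : ∀ᵐ x ∂(surf F), x ∈ body F := ae_restrict_mem (isCompact_body _).measurableSet
  filter_upwards [hpos, hmem] with x hx hxF hxΩ
  have hxK : x ∈ body K := IsSimplex.body_subset_of_subset (mem_cellsOf.1 hKF).2 hxF
  have hclosed : IsClosed (⋃ L ∈ T.cells.erase K, body L) :=
    Set.Finite.isClosed_biUnion (Finset.finite_toSet _) fun L _ => (isCompact_body L).isClosed
  -- Suppose the point x of F is in Ω. Moving from x away from the opposite vertex `a` stays in Ω at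
  -- first but leaves K, so other elements cover the points x + t(x - a). Their union is closed,
  -- hence one of them contains x. By matching and the positivity of the coordinates at x, it has
  -- all vertices of F, contrary to F being exterior.
  have hx' : x ∈ ⋃ L ∈ T.cells.erase K, body L := by
    have htend : Tendsto (fun t : ℝ => x + t • (x - a)) (𝓝[>] 0) (𝓝 x) := by
      have : Tendsto (fun t : ℝ => x + t • (x - a)) (𝓝 0) (𝓝 (x + (0 : ℝ) • (x - a))) :=
        Continuous.tendsto (by fun_prop) 0
      rw [zero_smul, add_zero] at this
      exact this.mono_left nhdsWithin_le_nhds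
    refine hclosed.mem_of_tendsto htend ?_
    filter_upwards [htend.eventually (isOpen_omega.mem_nhds hxΩ), self_mem_nhdsWithin] with t h1 h2
    have ht : (0 : ℝ) < t := h2
    have h3 := interior_subset h1
    simp only [Set.mem_iUnion, exists_prop] at h3 ⊢
    obtain ⟨L, hL, hxL⟩ := h3
    refine ⟨L, Finset.mem_erase.2 ⟨?_, hL⟩, hxL⟩
    rintro rfl
    have h4 := hs.mem_body.1 hxL a ha
    rw [bary_add, inner_smul_right, ← bary_sub, hs.bary_self ha,
      ((hs.mem_body_erase ha).1 (e ▸ hxF)).1] at h4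
    linarith
  simp only [Set.mem_iUnion, exists_prop] at hx'
  obtain ⟨L, hL, hxL⟩ := hx'
  obtain ⟨hLK, hLc⟩ := Finset.mem_erase.1 hL
  have hxKL := mem_body_inter hKc hLc hxK hxL
  have hFL : F ⊆ L := by
    intro b hb
    by_contra hbL
    have := hs.bary_eq_zero_of_mem_body (F := K ∩ L) Finset.inter_subset_left
      ((mem_cellsOf.1 hKF).2 hb) (by simp [hbL]) hxKL
    exact (hx b hb).ne' this
  have : L ∈ T.cellsOf F := mem_cellsOf.2 ⟨hLc, hFL⟩
  rw [hK, Finset.mem_singleton] at this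
  exact hLK this

/-- Integration by parts on all elements. -/
theorem sum_integral_by_parts (hd : 0 < d) {q : E d → ℂ} (hq : ContDiff ℝ 1 q) (hv : T.MemH1T v)
    (i : Fin d) :
    ∑ K ∈ T.cells, ((∫ x in cell K, pderiv i q x * v x) + ∫ x in cell K, q x * T.bgrad v x i) =
      ∑ F ∈ T.faces, ∫ x, q x * ∑ K ∈ T.cellsOf F, ((nrm K F i : ℝ) : ℂ) * trace K v x
        ∂(surf F) := by
  have h1 : ∀ F ∈ T.faces, ∫ x, q x * ∑ K ∈ T.cellsOf F, ((nrm K F i : ℝ) : ℂ) * trace K v x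
      ∂(surf F) = ∑ K ∈ T.cellsOf F, ((nrm K F i : ℝ) : ℂ) * ∫ x, q x * trace K v x ∂(surf F) := by
    intro F hF
    obtain ⟨L, hL, hFL⟩ := mem_faces.1 hF
    have hqm : MemLp q 2 (surf F) := (T.isSimplex hL).memLp_surf hd hFL hq.continuous
    simp_rw [Finset.mul_sum, ← integral_const_mul]
    rw [integral_finsetSum]
    · refine Finset.sum_congr rfl fun K _ => integral_congr_ae (.of_forall fun x => ?_)
      simp only; ring
    · intro K hK
      exact MemLp.integrable_mul hqm ((memLp_trace hd hF hK hv).const_mul _)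
  rw [Finset.sum_congr rfl h1, ← sum_cells_facesOf
    (fun K F => ((nrm K F i : ℝ) : ℂ) * ∫ x, q x * trace K v x ∂(surf F))]
  refine Finset.sum_congr rfl fun K hK => ?_
  rw [← (T.isSimplex hK).integral_by_parts hd hq (hv.2 K hK) i]
  congr 1
  refine integral_congr_ae ?_
  filter_upwards [ae_bgrad hK v] with x hx
  rw [hx]

/-- For functions in `H¹(Ω)`, the normal jumps through interior faces vanish. -/
theorem sum_nrm_mul_trace_eq_zero (hd : 0 < d) (hF : F ∈ T.faces) (hF' : F ∉ T.extFaces)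
    (hv : MemH1 T.Ω v) (i : Fin d) :
    ∀ᵐ x ∂(surf F), ∑ K ∈ T.cellsOf F, ((nrm K F i : ℝ) : ℂ) * trace K v x = 0 := by
  have hvT := memH1T_of_memH1 hv
  -- With a test function supported in Ω and away from the other faces, the summed integration by
  -- parts has F as its only face term, while its volume side vanishes by the definition of the weak
  -- gradient on Ω.
  refine ae_eq_zero_of_integral_surf hd hF isOpen_omega (ae_mem_omega hd hF hF')
    (memLp_finsetSum _ fun K hK => (memLp_trace hd hF hK hvT).const_mul _) fun φ hφ => ?_
  have hφΩ : IsTest T.Ω φ := hφ.mono Set.inter_subset_right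
  have h1 := sum_integral_by_parts hd (contDiff_ofReal_comp hφ.contDiff_one) hvT i
  rw [Finset.sum_eq_single_of_mem F hF] at h1
  · rw [← h1, Finset.sum_add_distrib]
    have h2 := (wgrad_spec hv).2 φ hφΩ i
    rw [setIntegral_omega (fun K hK => ((hv.1.test_pderiv_mul hφΩ i).mono_set
        (cell_subset_omega hK))),
      setIntegral_omega (fun K hK => ((((wgrad_spec hv).1 i).test_mul hφΩ).mono_set
        (cell_subset_omega hK)))] at h2
    rw [← eq_neg_iff_add_eq_zero]
    refine Eq.trans ?_ (h2.trans ?_)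
    · refine Finset.sum_congr rfl fun K _ => integral_congr_ae (.of_forall fun x => ?_)
      simp only
      rw [pderiv_ofReal (hφ.contDiff_one.differentiable (by simp) x)]
    · congr 1
      refine Finset.sum_congr rfl fun K hK => integral_congr_ae ?_
      filter_upwards [ae_cell (bgrad_ae_eq hv) hK] with x hx
      rw [hx]
  · intro F' hF'' hne
    exact integral_surf_eq_zero fun x hx => by
      rw [eq_zero_of_tsupport hF'' hne (hφ.2.2.trans Set.inter_subset_left) hx, Complex.ofReal_zero]

end Mesh

namespace Setting

open Mesh

variable {S : Setting d} {v v' : E d → ℂ} {F : Finset (E d)}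

theorem MemH1D.memH1T (hv : S.MemH1D v) : S.MemH1T v := memH1T_of_memH1 hv.1

theorem MemH1D.add_smul (hd : 0 < d) (hv : S.MemH1D v) (hv' : S.MemH1D v') (c : ℂ) :
    S.MemH1D (v + c • v') := by
  refine ⟨hv.1.add_smul hv'.1 c, fun F hF => ?_⟩
  filter_upwards [hv.2 F hF, hv'.2 F hF, extTrace_add_smul hd
    (mem_faces_of_ext (mem_extFaces_of_FD hF)) hv.memH1T hv'.memH1T c] with x h1 h2 h3
  rw [h3, h1, h2]; simp

theorem memL2R_extTrace (hd : 0 < d) (hv : S.MemH1T v) : S.MemL2R (S.extTrace v) :=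
  fun _ hF => memLp_extTrace hd (mem_faces_of_FR hF) hv

theorem memH1D_of_contDiff (hd : 0 < d) {q : E d → ℂ}
    (hq : ContDiff ℝ ((⊤ : ℕ∞) : WithTop ℕ∞) q)
    (h : ∀ F ∈ S.FD, ∀ᵐ x ∂(surf F), q x = 0) : S.MemH1D q := by
  refine ⟨memH1_of_contDiff isBounded_omega (hq.of_le one_le_infty), fun F hF => ?_⟩
  filter_upwards [h F hF, extTrace_of_contDiff hd (mem_extFaces_of_FD hF) hq] with x h1 h2
  rw [h2, h1]

theorem memH1D_zero (hd : 0 < d) : S.MemH1D 0 :=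
  memH1D_of_contDiff hd (q := fun _ => 0) contDiff_const fun _ _ => .of_forall fun _ => rfl

/-- Dirichlet faces are exterior, so almost none of their points are in Ω and the trace is zero
there. -/
theorem memH1D_of_isTest_omega (hd : 0 < d) {φ : E d → ℝ} (hφ : IsTest S.Ω φ) :
    S.MemH1D (fun x => (φ x : ℂ)) := by
  refine memH1D_of_contDiff hd (contDiff_ofReal_comp hφ.1) fun F hF => ?_
  filter_upwards [ae_notMem_omega hd (mem_extFaces_of_FD hF)] with x hx
  rw [hφ.eq_zero hx, Complex.ofReal_zero]

/-- These functions vanish on every face except possibly F, but need not vanish on F. They localise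
the weak normal trace identity to one face outside Γ_D. -/
theorem memH1D_of_isTest_awayFrom (hd : 0 < d) {φ : E d → ℝ} (hφ : IsTest (S.awayFrom F) φ)
    (hF : F ∉ S.FD) : S.MemH1D (fun x => (φ x : ℂ)) := by
  refine memH1D_of_contDiff hd (contDiff_ofReal_comp hφ.1) fun F' hF' => ?_
  have hmem : ∀ᵐ x ∂(surf F'), x ∈ body F' := ae_restrict_mem (isCompact_body _).measurableSet
  filter_upwards [hmem] with x hx
  rw [eq_zero_of_tsupport (mem_faces_of_ext (mem_extFaces_of_FD hF'))
    (fun h : F' = F => hF (h ▸ hF')) hφ.2.2 hx, Complex.ofReal_zero]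

theorem memLp_jump (hd : 0 < d) (hF : F ∈ S.faces) (hv : S.MemH1T v) :
    MemLp (S.jump v F) 2 (surf F) := by
  unfold jump
  split_ifs
  · exact memLp_extTrace hd hF hv
  · exact MemLp.zero
  · exact memLp_finsetSum _ fun K hK => (memLp_trace hd hF hK hv).const_mul _

theorem jump_add_smul (hd : 0 < d) (hF : F ∈ S.faces) (hv : S.MemH1T v) (hv' : S.MemH1T v')
    (c : ℂ) : ∀ᵐ x ∂(surf F), S.jump (v + c • v') F x = S.jump v F x + c * S.jump v' F x := by
  unfold jump
  split_ifs
  · exact extTrace_add_smul hd hF hv hv' c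
  · simp
  · filter_upwards [trace_add_smul hd hF hv hv' c] with x hx
    rw [Finset.mul_sum, ← Finset.sum_add_distrib]
    refine Finset.sum_congr rfl fun K hK => ?_
    rw [hx K hK]; ring

/-- Functions in `H¹_{Γ_D}(Ω)` have no jumps. -/
theorem jump_eq_zero (hd : 0 < d) (hF : F ∈ S.faces) (hv : S.MemH1D v) :
    ∀ᵐ x ∂(surf F), S.jump v F x = 0 := by
  unfold jump
  split_ifs with h1 h2
  · exact hv.2 F h2
  · simp
  · have := (ae_ball_iff (Set.countable_univ (α := Fin d))).2 fun i _ =>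
      sum_nrm_mul_trace_eq_zero hd hF h1 hv.1 i
    filter_upwards [this] with x hx
    have e : ∀ K ∈ S.cellsOf F, ((inner ℝ (nrm K F) (S.nF F) : ℝ) : ℂ) * trace K v x =
        ∑ i, ((S.nF F i : ℝ) : ℂ) * (((nrm K F i : ℝ) : ℂ) * trace K v x) := fun K _ => by
      rw [PiLp.inner_apply]
      push_cast
      rw [Finset.sum_mul]
      refine Finset.sum_congr rfl fun i _ => ?_
      simp [mul_assoc]
    rw [Finset.sum_congr rfl e, Finset.sum_comm]
    refine Finset.sum_eq_zero fun i _ => ?_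
    rw [← Finset.mul_sum, hx i (Set.mem_univ i), mul_zero]

end Setting


/-! ### Existence and properties of the lifting and the discrete gradient. -/

/-- The Riesz theorem for a semi-definite Hermitian form on a finite-dimensional space. -/
theorem exists_riesz_of_core {V : Type*} [AddCommGroup V] [Module ℂ V] [FiniteDimensional ℂ V]
    (cd : PreInnerProductSpace.Core ℂ V) (m : V →ₗ[ℂ] ℂ)
    (hm : ∀ v, (cd.inner v v).re = 0 → m v = 0) : ∃ y, ∀ v, cd.inner y v = m v := by
  let _ : SeminormedAddCommGroup V := @InnerProductSpace.Core.toSeminormedAddCommGroup ℂ V _ _ _ cd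
  let _ : InnerProductSpace ℂ V := InnerProductSpace.ofCore cd
  refine exists_riesz_of_finiteDimensional m fun v hv => hm v ?_
  have h := @norm_sq_eq_re_inner ℂ V _ _ _ v
  rw [hv] at h
  have h2 : (cd.inner v v).re = 0 ^ 2 := h.symm
  simpa using h2

namespace Mesh

variable {T : Mesh d} {w w' : E d → Fin d → ℂ} {K F : Finset (E d)} {c : ℂ}

theorem ae_trace_congr (hd : 0 < d) (hF : F ∈ T.faces) {v v' : E d → ℂ} (hv : T.MemH1T v)
    (h : ∀ᵐ x ∂(volume.restrict T.Ω), v x = v' x) :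
    ∀ᵐ x ∂(surf F), ∀ K ∈ T.cellsOf F, trace K v' x = trace K v x :=
  (ae_ball_iff (Finset.countable_toSet (T.cellsOf F))).2 fun _ hK =>
    (T.isSimplex (mem_cellsOf.1 hK).1).trace_congr hd (hv.2 _ (mem_cellsOf.1 hK).1)
      (ae_cell h (mem_cellsOf.1 hK).1) (mem_facesOf_of_mem_cellsOf hF hK)

theorem ae_avg_congr (hd : 0 < d) (hF : F ∈ T.faces) (hw : ∀ i, T.MemH1T (fun x => w x i))
    (h : ∀ᵐ x ∂(volume.restrict T.Ω), w x = w' x) :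
    ∀ᵐ x ∂(surf F), T.avg w' F x = T.avg w F x := by
  have := (ae_ball_iff (Set.countable_univ (α := Fin d))).2 fun i _ =>
    ae_trace_congr hd hF (hw i) (v' := fun x => w' x i) (by
      filter_upwards [h] with x hx; rw [hx])
  filter_upwards [this] with x hx
  ext i
  rw [avg, avg, Finset.sum_congr rfl (hx i (Set.mem_univ i))]

theorem ae_avg_add_smul (hd : 0 < d) (hF : F ∈ T.faces) (hw : ∀ i, T.MemH1T (fun x => w x i))
    (hw' : ∀ i, T.MemH1T (fun x => w' x i)) (c : ℂ) :
    ∀ᵐ x ∂(surf F), T.avg (w + c • w') F x = T.avg w F x + c • T.avg w' F x := by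
  have := (ae_ball_iff (Set.countable_univ (α := Fin d))).2 fun i _ =>
    trace_add_smul hd hF (hw i) (hw' i) c
  filter_upwards [this] with x hx
  ext i
  have h1 := Finset.sum_congr rfl (hx i (Set.mem_univ i))
  rw [Finset.sum_add_distrib, ← Finset.mul_sum] at h1
  simp only [avg, Pi.add_apply, Pi.smul_apply, smul_eq_mul]
  refine (congrArg (fun a => ((T.cellsOf F).card : ℂ)⁻¹ * a) h1).trans ?_
  ring

theorem memLp_avg (hd : 0 < d) (hF : F ∈ T.faces) (hw : ∀ i, T.MemH1T (fun x => w x i))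
    (i : Fin d) : MemLp (fun x => T.avg w F x i) 2 (surf F) :=
  (memLp_finsetSum _ fun _ hK => memLp_trace hd hF hK (hw i)).const_mul _

/-- The piecewise polynomial vector field with given restrictions to the elements. -/
def pwPoly {p : ℕ} (P : T.cells → Fin d → MvPolynomial.restrictTotalDegree (Fin d) ℂ p)
    (x : E d) (i : Fin d) : ℂ :=
  ∑ K : T.cells, (cell (K : Finset (E d))).indicator (polyFun (P K i : MvPolynomial (Fin d) ℂ)) x

variable {p : ℕ}

theorem pwPoly_apply (P : T.cells → Fin d → MvPolynomial.restrictTotalDegree (Fin d) ℂ p)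
    (K : T.cells) {x : E d} (hx : x ∈ cell (K : Finset (E d))) (i : Fin d) :
    pwPoly P x i = polyFun (P K i : MvPolynomial (Fin d) ℂ) x := by
  rw [pwPoly, Finset.sum_eq_single K]
  · exact Set.indicator_of_mem hx _
  · intro L _ hLK
    exact Set.indicator_of_notMem (fun hx' => Set.disjoint_left.1
      (disjoint_cell L.2 K.2 (fun h => hLK (Subtype.ext h))) hx' hx) _
  · exact fun h => absurd (Finset.mem_univ K) h

theorem memPVec_pwPoly (P : T.cells → Fin d → MvPolynomial.restrictTotalDegree (Fin d) ℂ p) :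
    T.MemPVec p (pwPoly P) := by
  intro i K hK
  refine ⟨P ⟨K, hK⟩ i, (MvPolynomial.mem_restrictTotalDegree _ _ _).1 (P ⟨K, hK⟩ i).2, ?_⟩
  filter_upwards [ae_restrict_mem (isOpen_cell K).measurableSet] with x hx
  exact pwPoly_apply P ⟨K, hK⟩ hx i

theorem pwPoly_add_smul (P Q : T.cells → Fin d → MvPolynomial.restrictTotalDegree (Fin d) ℂ p)
    (c : ℂ) : pwPoly (P + c • Q) = pwPoly P + c • pwPoly Q := by
  ext x i
  simp only [pwPoly, Pi.add_apply, Pi.smul_apply, smul_eq_mul, Finset.mul_sum]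
  rw [← Finset.sum_add_distrib]
  refine Finset.sum_congr rfl fun K _ => ?_
  by_cases hx : x ∈ cell (K : Finset (E d))
  · simp [Set.indicator_of_mem hx, polyFun]
  · simp [Set.indicator_of_notMem hx]

theorem exists_pwPoly (hw : T.MemPVec p w) :
    ∃ P : T.cells → Fin d → MvPolynomial.restrictTotalDegree (Fin d) ℂ p,
      ∀ᵐ x ∂(volume.restrict T.Ω), w x = pwPoly P x := by
  choose q hq h using fun (K : T.cells) (i : Fin d) => hw i K K.2
  refine ⟨fun K i => ⟨q K i, (MvPolynomial.mem_restrictTotalDegree _ _ _).2 (hq K i)⟩,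
    ae_omega_iff.2 fun K hK => ?_⟩
  filter_upwards [(ae_ball_iff (Set.countable_univ (α := Fin d))).2 fun i _ => h ⟨K, hK⟩ i,
    ae_restrict_mem (isOpen_cell K).measurableSet] with x hx hxK
  ext i
  rw [pwPoly_apply _ ⟨K, hK⟩ hxK, hx i (Set.mem_univ i)]
  rfl

theorem l2Vec_self (w : E d → Fin d → ℂ) :
    T.l2Vec w w = ((∑ K ∈ T.cells, ∫ x in cell K, ∑ i, ‖w x i‖ ^ 2 : ℝ) : ℂ) := by
  rw [l2Vec]
  push_cast
  refine Finset.sum_congr rfl fun K _ => ?_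
  rw [← integral_complex_ofReal]
  refine integral_congr_ae (.of_forall fun x => ?_)
  simp only [dotProduct, Pi.star_apply, Setting.mul_star_self]
  push_cast
  rfl

theorem ae_eq_zero_of_l2Vec_self (hw : MemL2Vec T.Ω w) (h : (T.l2Vec w w).re = 0) :
    ∀ᵐ x ∂(volume.restrict T.Ω), w x = 0 := by
  rw [l2Vec_self, Complex.ofReal_re, Finset.sum_eq_zero_iff_of_nonneg
    (fun K _ => integral_nonneg fun x => Finset.sum_nonneg fun i _ => by positivity)] at h
  refine ae_omega_iff.2 fun K hK => ?_
  have h1 := h K hK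
  rw [integral_eq_zero_iff_of_nonneg (fun x => Finset.sum_nonneg fun i _ => by positivity)
    (integrable_finsetSum _ fun i _ => integrable_norm_sq (memL2Vec_cell hw hK i))] at h1
  filter_upwards [h1] with x hx
  ext i
  have := (Finset.sum_eq_zero_iff_of_nonneg (fun i _ => by positivity)).1 hx i (Finset.mem_univ i)
  simpa using this

end Mesh

namespace Setting

open Mesh

variable {S : Setting d} {v v' φ φ' : E d → ℂ} {w w' L L' : E d → Fin d → ℂ} {F : Finset (E d)}

variable (S) in
/-- The functional defining the lifting. -/
def liftForm (φ : E d → ℂ) (w : E d → Fin d → ℂ) : ℂ :=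
  ∑ F ∈ S.faces, ∫ x, S.jump φ F x *
    star (S.avg w F x ⬝ᵥ (fun i => ((S.nF F i : ℝ) : ℂ))) ∂(surf F)

theorem memLp_avg_nF (hd : 0 < d) (hF : F ∈ S.faces) (hw : ∀ i, S.MemH1T (fun x => w x i)) :
    MemLp (fun x => S.avg w F x ⬝ᵥ (fun i => ((S.nF F i : ℝ) : ℂ))) 2 (surf F) := by
  refine memLp_finsetSum _ fun i _ => ?_
  exact (memLp_avg hd hF hw i).mul_const _

theorem liftForm_congr_right (hd : 0 < d) (hw : ∀ i, S.MemH1T (fun x => w x i))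
    (h : ∀ᵐ x ∂(volume.restrict S.Ω), w x = w' x) : S.liftForm φ w' = S.liftForm φ w :=
  Finset.sum_congr rfl fun F hF => integral_congr_ae (by
    filter_upwards [ae_avg_congr hd hF hw h] with x hx
    rw [hx])

theorem liftForm_add_smul_left (hd : 0 < d) (hφ : S.MemH1T φ) (hφ' : S.MemH1T φ') (c : ℂ)
    (hw : ∀ i, S.MemH1T (fun x => w x i)) :
    S.liftForm (φ + c • φ') w = S.liftForm φ w + c * S.liftForm φ' w := by
  rw [liftForm, liftForm, liftForm, Finset.mul_sum, ← Finset.sum_add_distrib]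
  exact Finset.sum_congr rfl fun F hF => integral_mul_star_left (memLp_jump hd hF hφ)
    (memLp_jump hd hF hφ') (memLp_avg_nF hd hF hw) (jump_add_smul hd hF hφ hφ' c)

theorem star_liftForm_add_smul_right (hd : 0 < d) (hφ : S.MemH1T φ) (c : ℂ)
    (hw : ∀ i, S.MemH1T (fun x => w x i)) (hw' : ∀ i, S.MemH1T (fun x => w' x i)) :
    star (S.liftForm φ (w + c • w')) = star (S.liftForm φ w) + c * star (S.liftForm φ w') := by
  rw [liftForm, liftForm, liftForm, star_sum, star_sum, star_sum, Finset.mul_sum,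
    ← Finset.sum_add_distrib]
  refine Finset.sum_congr rfl fun F hF => ?_
  rw [integral_mul_star_conj, integral_mul_star_conj, integral_mul_star_conj]
  refine integral_mul_star_left (memLp_avg_nF hd hF hw) (memLp_avg_nF hd hF hw')
    (memLp_jump hd hF hφ) ?_
  filter_upwards [ae_avg_add_smul hd hF hw hw' c] with x hx
  rw [hx, add_dotProduct, smul_dotProduct, smul_eq_mul]

theorem memH1T_of_memPVec {p : ℕ} (hw : S.MemPVec p w) (i : Fin d) : S.MemH1T (fun x => w x i) :=
  memH1T_of_memP (hw i)

/-- Parametrise piecewise polynomial fields by their finitely many coefficients and represent the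
face functional by the Riesz theorem for the L² form pulled back to the coefficients. -/
theorem exists_isLift (hd : 0 < d) (hφ : S.MemH1T φ) : ∃ L, S.IsLift φ L := by
  let V := S.cells → Fin d → MvPolynomial.restrictTotalDegree (Fin d) ℂ S.p
  have hV : ∀ P : V, MemL2Vec S.Ω (pwPoly P) := fun P => (memPVec_pwPoly P).memL2Vec
  have hVi : ∀ (P : V) i, S.MemH1T (fun x => pwPoly P x i) := fun P =>
    memH1T_of_memPVec (memPVec_pwPoly P)
  have hadd : ∀ P Q : V, pwPoly (P + Q) = pwPoly P + (1 : ℂ) • pwPoly Q := fun P Q => by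
    rw [← pwPoly_add_smul, one_smul]
  have hzero : pwPoly (0 : V) = 0 := by
    ext x i
    refine Finset.sum_eq_zero fun K _ => ?_
    have e : polyFun (((0 : V) K i : MvPolynomial (Fin d) ℂ)) = fun _ => 0 := by
      ext y
      exact map_zero _
    rw [e]
    simp
  have hsmul : ∀ (c : ℂ) (P : V), pwPoly (c • P) = pwPoly (0 : V) + c • pwPoly P := fun c P => by
    rw [← pwPoly_add_smul, zero_add]
  let cd : PreInnerProductSpace.Core ℂ V :=
    { inner := fun P Q => S.l2Vec (pwPoly Q) (pwPoly P)
      conj_inner_symm := fun P Q => l2Vec_conj _ _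
      re_inner_nonneg := fun P => by
        change 0 ≤ (S.l2Vec (pwPoly P) (pwPoly P)).re
        rw [l2Vec_self, Complex.ofReal_re]
        exact Finset.sum_nonneg fun K _ => integral_nonneg fun x =>
          Finset.sum_nonneg fun i _ => by positivity
      add_left := fun P Q R => by
        change S.l2Vec (pwPoly R) (pwPoly (P + Q)) = _
        rw [← l2Vec_conj, l2Vec_left (c := 1) (hV P) (hV Q) (hV R)
          (.of_forall fun x => by rw [hadd]; rfl), one_mul, star_add, l2Vec_conj, l2Vec_conj]
      smul_left := fun P Q c => by
        change S.l2Vec (pwPoly Q) (pwPoly (c • P)) = _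
        rw [← l2Vec_conj, l2Vec_left (c := c) (hV 0) (hV P) (hV Q)
          (.of_forall fun x => by rw [hsmul]; rfl), star_add, star_mul', l2Vec_conj, l2Vec_conj,
          hzero]
        simp [l2Vec] }
  let m : V →ₗ[ℂ] ℂ :=
    { toFun := fun P => star (S.liftForm φ (pwPoly P))
      map_add' := fun P Q => by
        rw [hadd, star_liftForm_add_smul_right hd hφ 1 (hVi P) (hVi Q), one_mul]
      map_smul' := fun c P => by
        rw [hsmul, star_liftForm_add_smul_right hd hφ c (hVi 0) (hVi P)]
        have := star_liftForm_add_smul_right hd hφ (-1) (hVi 0) (hVi 0)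
        rw [hzero] at this ⊢
        simp only [smul_zero, add_zero] at this
        have h0 : star (S.liftForm φ 0) = 0 := by linear_combination this
        rw [h0]; simp }
  have h0 : S.liftForm φ 0 = 0 := by
    have := m.map_zero
    simp only [m, LinearMap.coe_mk, AddHom.coe_mk, hzero] at this
    simpa using this
  -- Compatibility with null vectors: coefficients of L² norm zero give a field that vanishes almost
  -- everywhere, and averages of traces depend only on almost-everywhere classes.
  obtain ⟨P, hP⟩ := exists_riesz_of_core cd m fun Q hQ => by
    have h1 := ae_eq_zero_of_l2Vec_self (hV Q) hQ
    change star (S.liftForm φ (pwPoly Q)) = 0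
    rw [← liftForm_congr_right hd (hVi Q) (w' := 0) h1, h0, star_zero]
  refine ⟨pwPoly P, memPVec_pwPoly P, fun w hw => ?_⟩
  obtain ⟨Q, hQ⟩ := exists_pwPoly hw
  have h2 : S.l2Vec (pwPoly Q) (pwPoly P) = star (S.liftForm φ (pwPoly Q)) := hP Q
  rw [l2Vec_congr_right hQ, ← l2Vec_conj, h2, star_star,
    liftForm_congr_right hd (memH1T_of_memPVec hw) hQ]
  rfl

theorem isLift_lift (hd : 0 < d) (hφ : S.MemH1T φ) : S.IsLift φ (S.lift φ) := by
  have := exists_isLift hd hφ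
  rw [lift, dif_pos this]
  exact this.choose_spec

theorem memL2Vec_lift (hd : 0 < d) (hφ : S.MemH1T φ) : MemL2Vec S.Ω (S.lift φ) :=
  (isLift_lift hd hφ).1.memL2Vec

/-- Test the difference of two liftings, itself a piecewise polynomial field, against itself. Since
the lifting is obtained by choice, its linearity and its vanishing on conforming functions rest on
this. -/
theorem IsLift.unique (h : S.IsLift φ L) (h' : S.IsLift φ L') :
    ∀ᵐ x ∂(volume.restrict S.Ω), L x = L' x := by
  have hm := h.1.add_smul h'.1 (-1)
  have h0 : S.l2Vec (L + (-1 : ℂ) • L') (L + (-1 : ℂ) • L') = 0 := by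
    rw [l2Vec_left (W := L + (-1 : ℂ) • L') (c := -1) h.1.memL2Vec h'.1.memL2Vec hm.memL2Vec (.of_forall fun x => rfl),
      h.2 _ hm, h'.2 _ hm]
    ring
  filter_upwards [ae_eq_zero_of_l2Vec_self hm.memL2Vec (by rw [h0]; rfl)] with x hx
  have : L x + (-1 : ℂ) • L' x = 0 := hx
  rw [neg_one_smul, ← sub_eq_add_neg] at this
  exact sub_eq_zero.1 this

theorem lift_add_smul (hd : 0 < d) (hφ : S.MemH1T φ) (hφ' : S.MemH1T φ') (c : ℂ) :
    ∀ᵐ x ∂(volume.restrict S.Ω), S.lift (φ + c • φ') x = S.lift φ x + c • S.lift φ' x := by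
  have h1 := isLift_lift hd hφ
  have h2 := isLift_lift hd hφ'
  refine (isLift_lift hd (hφ.add_smul hφ' c)).unique (L' := S.lift φ + c • S.lift φ')
    ⟨h1.1.add_smul h2.1 c, fun w hw => ?_⟩
  rw [l2Vec_left (W := S.lift φ + c • S.lift φ') (c := c) h1.1.memL2Vec h2.1.memL2Vec hw.memL2Vec (.of_forall fun x => rfl),
    h1.2 w hw, h2.2 w hw]
  exact (liftForm_add_smul_left hd hφ hφ' c (memH1T_of_memPVec hw)).symm

/-- A conforming function has no jumps, so the zero field satisfies the defining identity. The
discrete gradient thus coincides with the weak gradient on conforming functions. -/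
theorem lift_eq_zero (hd : 0 < d) (hv : S.MemH1D v) :
    ∀ᵐ x ∂(volume.restrict S.Ω), S.lift v x = 0 := by
  refine (isLift_lift hd hv.memH1T).unique (L' := 0) ⟨fun i => memP_zero, fun w hw => ?_⟩
  have h1 : ∀ F ∈ S.faces, ∫ x, S.jump v F x *
      star (S.avg w F x ⬝ᵥ (fun i => ((S.nF F i : ℝ) : ℂ))) ∂(surf F) = 0 := fun F hF => by
    rw [integral_congr_ae (g := fun _ => (0 : ℂ)) (by
      filter_upwards [jump_eq_zero hd hF hv] with x hx
      rw [hx, zero_mul])]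
    simp
  rw [Finset.sum_eq_zero h1]
  simp [l2Vec]

theorem memL2Vec_G (hd : 0 < d) (hφ : S.MemH1T φ) : MemL2Vec S.Ω (S.G φ) := fun i =>
  MemLp.sub (memL2Vec_bgrad hφ i) (memL2Vec_lift hd hφ i)

theorem G_add_smul (hd : 0 < d) (hφ : S.MemH1T φ) (hφ' : S.MemH1T φ') (c : ℂ) :
    ∀ᵐ x ∂(volume.restrict S.Ω), S.G (φ + c • φ') x = S.G φ x + c • S.G φ' x := by
  filter_upwards [lift_add_smul hd hφ hφ' c, bgrad_add_smul hφ hφ' c] with x h1 h2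
  rw [G, G, G, h1, h2, smul_sub]
  abel

theorem G_ae_eq (hd : 0 < d) (hv : S.MemH1D v) :
    ∀ᵐ x ∂(volume.restrict S.Ω), S.G v x = wgrad S.Ω v x := by
  filter_upwards [lift_eq_zero hd hv, bgrad_ae_eq hv.1] with x h1 h2
  rw [G, h1, h2, sub_zero]

end Setting


/-! ### The energy norm, completeness, and solvability of the adjoint problem. -/

theorem le_mul_of_forall_weight {a x y : ℝ} (hx : 0 ≤ x) (hy : 0 ≤ y)
    (h : ∀ t : ℝ, 0 < t → a ≤ (t * x ^ 2 + t⁻¹ * y ^ 2) / 2) : a ≤ x * y := by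
  have := le_sqrt_mul_sqrt (sq_nonneg x) (sq_nonneg y) h
  rwa [Real.sqrt_sq hx, Real.sqrt_sq hy] at this

theorem ae_add_smul_apply {ν : Measure (E d)} (f f' : E d → ℂ) (c : ℂ) :
    ∀ᵐ x ∂ν, (f + c • f') x = f x + c * f' x := .of_forall fun _ => rfl

theorem re_form_le (M : Matrix (Fin d) (Fin d) ℝ) : ∃ C : ℝ, 0 ≤ C ∧ ∀ v : Fin d → ℂ,
    ((M.map ((↑) : ℝ → ℂ) *ᵥ v) ⬝ᵥ star v).re ≤ C * ∑ i, ‖v i‖ ^ 2 := by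
  refine ⟨∑ i, ∑ j, |M i j|, Finset.sum_nonneg fun i _ => Finset.sum_nonneg fun j _ => abs_nonneg _,
    fun v => ?_⟩
  refine (Complex.re_le_norm _).trans ?_
  rw [dotProduct, Finset.sum_mul]
  refine (norm_sum_le _ _).trans ?_
  refine Finset.sum_le_sum fun i _ => ?_
  rw [norm_mul, Pi.star_apply, norm_star]
  have h0 : ‖(M.map ((↑) : ℝ → ℂ) *ᵥ v) i‖ ≤ ∑ j, ‖M.map ((↑) : ℝ → ℂ) i j * v j‖ :=
    norm_sum_le Finset.univ (fun j => M.map ((↑) : ℝ → ℂ) i j * v j)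
  refine (mul_le_mul_of_nonneg_right h0 (norm_nonneg _)).trans ?_
  rw [Finset.sum_mul, Finset.sum_mul]
  refine Finset.sum_le_sum fun j _ => ?_
  rw [norm_mul, Matrix.map_apply, Complex.norm_real, Real.norm_eq_abs, mul_assoc]
  refine mul_le_mul_of_nonneg_left ?_ (abs_nonneg _)
  have h1 : ∀ k, ‖v k‖ ^ 2 ≤ ∑ i, ‖v i‖ ^ 2 := fun k =>
    Finset.single_le_sum (f := fun i => ‖v i‖ ^ 2) (fun i _ => by positivity) (Finset.mem_univ k)
  nlinarith [h1 i, h1 j, sq_nonneg (‖v i‖ - ‖v j‖)]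

theorem tendsto_integral_norm_sq {α : Type*} [MeasurableSpace α] {ν : Measure α} {h : ℕ → α → ℂ}
    (hm : ∀ n, MemLp (h n) 2 ν) (ht : Tendsto (fun n => eLpNorm (h n) 2 ν) atTop (𝓝 0)) :
    Tendsto (fun n => ∫ x, ‖h n x‖ ^ 2 ∂ν) atTop (𝓝 0) := by
  have h1 := ((ENNReal.tendsto_toReal ENNReal.zero_ne_top).comp ht).pow 2
  simp only [ENNReal.toReal_zero, ne_eq, OfNat.ofNat_ne_zero, not_false_eq_true, zero_pow] at h1
  refine h1.congr fun n => ?_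
  rw [Function.comp_apply, eLpNorm_two_eq (hm n), ENNReal.toReal_ofReal (Real.sqrt_nonneg _),
    Real.sq_sqrt (integral_nonneg fun _ => by positivity)]

theorem eLpNorm_le_of_sq {α : Type*} [MeasurableSpace α] {ν : Measure α} {h : α → ℂ}
    (hm : MemLp h 2 ν) {C r : ℝ} (hC : 0 ≤ C) (hr : 0 ≤ r) (hle : ∫ x, ‖h x‖ ^ 2 ∂ν ≤ C * r ^ 2) :
    eLpNorm h 2 ν ≤ ENNReal.ofReal (√C * r) := by
  rw [eLpNorm_two_eq hm]
  refine ENNReal.ofReal_le_ofReal ?_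
  refine (Real.sqrt_le_sqrt hle).trans (le_of_eq ?_)
  rw [Real.sqrt_mul hC, Real.sqrt_sq hr]

namespace Setting

open Mesh

variable {S : Setting d} {v v' φ φ' f g : E d → ℂ} {w : E d → Fin d → ℂ} {K F : Finset (E d)}
  {Φ Ψ : FaceFun d}

/-! #### The smallest eigenvalue -/

theorem bddBelow_range_form (hK : K ∈ S.cells) : BddBelow (Set.range
    (fun ξ : Metric.sphere (0 : E d) 1 => (S.A K *ᵥ (ξ : E d).ofLp) ⬝ᵥ (ξ : E d).ofLp)) := by
  refine ⟨0, ?_⟩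
  rintro _ ⟨ξ, rfl⟩
  have h := (S.A_posDef K hK).posSemidef.dotProduct_mulVec_nonneg (ξ : E d).ofLp
  rw [star_trivial, dotProduct_comm] at h
  exact h

/-- The infimum over the compact unit sphere is attained, and the form is positive there. For d > 0
the sphere is nonempty. -/
theorem α_pos (hd : 0 < d) (hK : K ∈ S.cells) : 0 < S.α K := by
  have hne : Nonempty (Metric.sphere (0 : E d) 1) :=
    ⟨⟨EuclideanSpace.single ⟨0, hd⟩ 1, by simp⟩⟩
  have hc : Continuous fun ξ : Metric.sphere (0 : E d) 1 =>
      (S.A K *ᵥ (ξ : E d).ofLp) ⬝ᵥ (ξ : E d).ofLp := by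
    simp only [dotProduct, Matrix.mulVec]
    fun_prop
  obtain ⟨ξ, -, hξ⟩ := isCompact_univ.exists_isMinOn Set.univ_nonempty hc.continuousOn
  have hmin : ∀ η : Metric.sphere (0 : E d) 1, (S.A K *ᵥ (ξ : E d).ofLp) ⬝ᵥ (ξ : E d).ofLp ≤
      (S.A K *ᵥ (η : E d).ofLp) ⬝ᵥ (η : E d).ofLp := fun η => hξ (Set.mem_univ η)
  refine lt_of_lt_of_le ?_ (le_ciInf hmin)
  have hne0 : (ξ : E d).ofLp ≠ 0 := by
    intro h0
    have h1 : (ξ : E d) = 0 := by ext i; rw [h0]; rfl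
    have h2 := ξ.2
    rw [mem_sphere_zero_iff_norm, h1, norm_zero] at h2
    norm_num at h2
  have := (S.A_posDef K hK).dotProduct_mulVec_pos hne0
  rw [star_trivial, dotProduct_comm] at this
  exact this

/-- Both sides are homogeneous of degree two, so x may be normalised. -/
theorem α_mul_le (hK : K ∈ S.cells) (x : Fin d → ℝ) :
    S.α K * ∑ i, x i ^ 2 ≤ (S.A K *ᵥ x) ⬝ᵥ x := by
  by_cases hx : x = 0
  · simp [hx]
  set y : E d := WithLp.toLp 2 x with hy
  have hy0 : y ≠ 0 := by
    intro h0
    apply hx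
    ext i
    have := congrArg (fun z : E d => z i) h0
    simpa [hy] using this
  have hn : 0 < ‖y‖ := norm_pos_iff.2 hy0
  have h1 := ciInf_le (bddBelow_range_form hK)
    ⟨‖y‖⁻¹ • y, by rw [mem_sphere_zero_iff_norm, norm_smul, norm_inv, norm_norm,
      inv_mul_cancel₀ hn.ne']⟩
  have h2 : (S.A K *ᵥ (‖y‖⁻¹ • y).ofLp) ⬝ᵥ (‖y‖⁻¹ • y).ofLp
      = (‖y‖ ^ 2)⁻¹ * ((S.A K *ᵥ x) ⬝ᵥ x) := by
    have : (‖y‖⁻¹ • y).ofLp = ‖y‖⁻¹ • x := rfl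
    rw [this, Matrix.mulVec_smul, smul_dotProduct, dotProduct_smul, smul_eq_mul, smul_eq_mul]
    ring
  have h3 : ‖y‖ ^ 2 = ∑ i, x i ^ 2 := by
    rw [EuclideanSpace.norm_sq_eq]
    simp [hy]
  have h4 : S.α K ≤ (‖y‖ ^ 2)⁻¹ * ((S.A K *ᵥ x) ⬝ᵥ x) := h2 ▸ h1
  rw [← h3]
  have h5 := mul_le_mul_of_nonneg_right h4 (sq_nonneg ‖y‖)
  refine h5.trans (le_of_eq ?_)
  field_simp

theorem α_mul_le_re_form (hK : K ∈ S.cells) (v : Fin d → ℂ) :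
    S.α K * ∑ i, ‖v i‖ ^ 2 ≤ ((S.Ac K *ᵥ v) ⬝ᵥ star v).re := by
  rw [Ac, re_map_mulVec_dotProduct]
  have h1 := α_mul_le hK (fun i => (v i).re)
  have h2 := α_mul_le hK (fun i => (v i).im)
  have h3 : ∑ i, ‖v i‖ ^ 2 = ∑ i, (v i).re ^ 2 + ∑ i, (v i).im ^ 2 := by
    rw [← Finset.sum_add_distrib]
    refine Finset.sum_congr rfl fun i _ => ?_
    rw [← Complex.normSq_eq_norm_sq, Complex.normSq_apply]
    ring
  rw [h3, mul_add]
  linarith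

/-! #### The energy form -/

variable (S) in
/-- The inner product inducing the energy norm. -/
def energyForm (φ v : E d → ℂ) : ℂ :=
  (S.ω : ℂ) ^ 2 * S.l2μ φ v + S.ω * S.l2γ (S.extTrace φ) (S.extTrace v)
    + S.l2A (wgrad S.Ω φ) (wgrad S.Ω v)

theorem energy_sq (v : E d → ℂ) : S.energy v ^ 2 =
    S.ω ^ 2 * S.normμ v ^ 2 + S.ω * S.normγ (S.extTrace v) ^ 2 + S.normA (wgrad S.Ω v) ^ 2 :=
  Real.sq_sqrt (by have := S.ω_pos; positivity)

theorem energy_nonneg (v : E d → ℂ) : 0 ≤ S.energy v := Real.sqrt_nonneg _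

theorem energyForm_self (v : E d → ℂ) : S.energyForm v v = ((S.energy v ^ 2 : ℝ) : ℂ) := by
  rw [energyForm, l2μ_self, l2γ_self, l2A_self, energy_sq]
  push_cast
  ring

theorem energyForm_conj (φ v : E d → ℂ) : star (S.energyForm φ v) = S.energyForm v φ := by
  rw [energyForm, star_add, star_add, star_mul', star_mul', l2μ_conj, l2γ_conj, l2A_conj,
    energyForm]
  simp

theorem ae_extTrace_add_smul (hd : 0 < d) (hv : S.MemH1T v) (hv' : S.MemH1T v') (c : ℂ) :
    ∀ F ∈ S.FR, ∀ᵐ x ∂(surf F), S.extTrace (v + c • v') F x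
      = S.extTrace v F x + c * S.extTrace v' F x :=
  fun _ hF => extTrace_add_smul hd (mem_faces_of_FR hF) hv hv' c

theorem energyForm_left (hd : 0 < d) (hφ : S.MemH1D φ) (hφ' : S.MemH1D φ') (hv : S.MemH1D v)
    (c : ℂ) : S.energyForm (φ + c • φ') v = S.energyForm φ v + c * S.energyForm φ' v := by
  rw [energyForm, energyForm, energyForm,
    l2μ_left (c := c) hφ.1.1 hφ'.1.1 hv.1.1 (ae_add_smul_apply _ _ _),
    l2γ_left (memL2R_extTrace hd hφ.memH1T) (memL2R_extTrace hd hφ'.memH1T)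
      (memL2R_extTrace hd hv.memH1T) (ae_extTrace_add_smul hd hφ.memH1T hφ'.memH1T c),
    l2A_left (wgrad_spec hφ.1).1 (wgrad_spec hφ'.1).1 (wgrad_spec hv.1).1
      (wgrad_add_smul isOpen_omega hφ.1 hφ'.1 c)]
  ring

theorem b_left (hd : 0 < d) (hφ : S.MemH1D φ) (hφ' : S.MemH1D φ') (hv : S.MemH1D v)
    (c : ℂ) : S.b (φ + c • φ') v = S.b φ v + c * S.b φ' v := by
  rw [b, b, b,
    l2μ_left (c := c) hφ.1.1 hφ'.1.1 hv.1.1 (ae_add_smul_apply _ _ _),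
    l2γ_left (memL2R_extTrace hd hφ.memH1T) (memL2R_extTrace hd hφ'.memH1T)
      (memL2R_extTrace hd hv.memH1T) (ae_extTrace_add_smul hd hφ.memH1T hφ'.memH1T c),
    l2A_left (wgrad_spec hφ.1).1 (wgrad_spec hφ'.1).1 (wgrad_spec hv.1).1
      (wgrad_add_smul isOpen_omega hφ.1 hφ'.1 c)]
  ring

theorem b_right (hd : 0 < d) (hφ : S.MemH1D φ) (hv : S.MemH1D v) (hv' : S.MemH1D v')
    (c : ℂ) : S.b φ (v + c • v') = S.b φ v + star c * S.b φ v' := by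
  rw [b, b, b, ← l2μ_conj (v + c • v'), ← l2γ_conj (S.extTrace (v + c • v')),
    ← l2A_conj (wgrad S.Ω (v + c • v')),
    l2μ_left (c := c) hv.1.1 hv'.1.1 hφ.1.1 (ae_add_smul_apply _ _ _),
    l2γ_left (memL2R_extTrace hd hv.memH1T) (memL2R_extTrace hd hv'.memH1T)
      (memL2R_extTrace hd hφ.memH1T) (ae_extTrace_add_smul hd hv.memH1T hv'.memH1T c),
    l2A_left (wgrad_spec hv.1).1 (wgrad_spec hv'.1).1 (wgrad_spec hφ.1).1
      (wgrad_add_smul isOpen_omega hv.1 hv'.1 c), star_add, star_add, star_add, star_mul',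
      star_mul', star_mul', l2μ_conj, l2γ_conj, l2A_conj, l2μ_conj, l2γ_conj, l2A_conj]
  ring

theorem norm_b_le (hd : 0 < d) (hφ : S.MemH1D φ) (hv : S.MemH1D v) :
    ‖S.b φ v‖ ≤ S.energy φ * S.energy v := by
  refine le_mul_of_forall_weight (energy_nonneg _) (energy_nonneg _) fun t ht => ?_
  have h1 := norm_l2μ_le hφ.1.1 hv.1.1 ht
  have h2 := norm_l2γ_le (memL2R_extTrace hd hφ.memH1T) (memL2R_extTrace hd hv.memH1T) ht
  have h3 := norm_l2A_le (wgrad_spec hφ.1).1 (wgrad_spec hv.1).1 ht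
  have hω := S.ω_pos
  have e1 : ‖-(S.ω : ℂ) ^ 2 * S.l2μ φ v‖ = S.ω ^ 2 * ‖S.l2μ φ v‖ := by
    simp [abs_of_pos hω]
  have e2 : ‖Complex.I * S.ω * S.l2γ (S.extTrace φ) (S.extTrace v)‖ =
      S.ω * ‖S.l2γ (S.extTrace φ) (S.extTrace v)‖ := by
    simp [abs_of_pos hω]
  have h4 : ‖S.b φ v‖ ≤ S.ω ^ 2 * ‖S.l2μ φ v‖ + S.ω * ‖S.l2γ (S.extTrace φ) (S.extTrace v)‖ +
      ‖S.l2A (wgrad S.Ω φ) (wgrad S.Ω v)‖ := by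
    rw [← e1, ← e2, b]
    exact (norm_add_le _ _).trans (add_le_add (norm_sub_le _ _) le_rfl)
  have h5 := mul_le_mul_of_nonneg_left h1 (sq_nonneg S.ω)
  have h6 := mul_le_mul_of_nonneg_left h2 hω.le
  rw [energy_sq, energy_sq]
  linarith

theorem norm_l2μ_le_mul (hf : MemL2 S.Ω f) (hg : MemL2 S.Ω g) :
    ‖S.l2μ f g‖ ≤ S.normμ f * S.normμ g :=
  le_mul_of_forall_weight (Real.sqrt_nonneg _) (Real.sqrt_nonneg _) fun _ ht => norm_l2μ_le hf hg ht

theorem norm_l2γ_le_mul (hΦ : S.MemL2R Φ) (hΨ : S.MemL2R Ψ) :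
    ‖S.l2γ Φ Ψ‖ ≤ S.normγ Φ * S.normγ Ψ :=
  le_mul_of_forall_weight (Real.sqrt_nonneg _) (Real.sqrt_nonneg _) fun _ ht => norm_l2γ_le hΦ hΨ ht

theorem ω_mul_normμ_le (v : E d → ℂ) : S.ω * S.normμ v ≤ S.energy v := by
  refine Real.le_sqrt_of_sq_le ?_
  have := S.ω_pos
  have h1 : 0 ≤ S.ω * S.normγ (S.extTrace v) ^ 2 := by positivity
  have h2 : 0 ≤ S.normA (wgrad S.Ω v) ^ 2 := by positivity
  rw [mul_pow]
  linarith

theorem sqrt_ω_mul_normγ_le (v : E d → ℂ) : √S.ω * S.normγ (S.extTrace v) ≤ S.energy v := by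
  refine Real.le_sqrt_of_sq_le ?_
  have := S.ω_pos
  have h1 : 0 ≤ S.ω ^ 2 * S.normμ v ^ 2 := by positivity
  have h2 : 0 ≤ S.normA (wgrad S.Ω v) ^ 2 := by positivity
  rw [mul_pow, Real.sq_sqrt S.ω_pos.le]
  linarith

/-! #### Completeness -/

/-- On each element μ_K is a positive constant, so the squared L² norm there is at most (ω²μ_K)⁻¹
times the whole squared energy; the finitely many constants add up. -/
theorem exists_eLpNorm_le (S : Setting d) : ∃ C : ℝ, 0 ≤ C ∧ ∀ v, MemL2 S.Ω v →
    eLpNorm v 2 (volume.restrict S.Ω) ≤ ENNReal.ofReal (C * S.energy v) := by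
  refine ⟨√(∑ K ∈ S.cells, (S.ω ^ 2 * S.μ K)⁻¹), Real.sqrt_nonneg _, fun v hv => ?_⟩
  have hω := S.ω_pos
  have hpos : ∀ K ∈ S.cells, 0 < S.ω ^ 2 * S.μ K := fun K hK =>
    mul_pos (by positivity) (S.μ_pos K hK)
  refine eLpNorm_le_of_sq hv (Finset.sum_nonneg fun K hK => (inv_pos.2 (hpos K hK)).le)
    (energy_nonneg v) ?_
  rw [setIntegral_omega (fun K hK => integrable_norm_sq (memL2_cell hv hK)), Finset.sum_mul]
  refine Finset.sum_le_sum fun K hK => ?_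
  rw [le_inv_mul_iff₀ (hpos K hK), energy_sq, normμ_sq]
  have h1 := Finset.single_le_sum (f := fun K => S.μ K * ∫ x in cell K, ‖v x‖ ^ 2)
    (fun K hK => mul_nonneg (S.μ_pos K hK).le (integral_nonneg fun _ => by positivity)) hK
  have h2 : 0 ≤ S.ω * S.normγ (S.extTrace v) ^ 2 := by positivity
  have h3 : 0 ≤ S.normA (wgrad S.Ω v) ^ 2 := by positivity
  have h4 := mul_le_mul_of_nonneg_left h1 (sq_nonneg S.ω)
  rw [mul_assoc]
  linarith

/-- The same summation over elements, with α_K as the lower bound of A_K. -/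
theorem exists_eLpNorm_wgrad_le (hd : 0 < d) (S : Setting d) : ∃ C : ℝ, 0 ≤ C ∧
    ∀ v, MemH1 S.Ω v → ∀ i, eLpNorm (fun x => wgrad S.Ω v x i) 2 (volume.restrict S.Ω) ≤
      ENNReal.ofReal (C * S.energy v) := by
  refine ⟨√(∑ K ∈ S.cells, (S.α K)⁻¹), Real.sqrt_nonneg _, fun v hv i => ?_⟩
  have hω := S.ω_pos
  have hw := (wgrad_spec hv).1
  refine eLpNorm_le_of_sq (hw i) (Finset.sum_nonneg fun K hK => (inv_pos.2 (α_pos hd hK)).le)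
    (energy_nonneg v) ?_
  rw [setIntegral_omega (fun K hK => integrable_norm_sq (memL2Vec_cell hw hK i)), Finset.sum_mul]
  refine Finset.sum_le_sum fun K hK => ?_
  rw [le_inv_mul_iff₀ (α_pos hd hK), energy_sq, normA_sq, ← integral_const_mul]
  have h1 := Finset.single_le_sum
    (f := fun K => ∫ x in cell K, ((S.Ac K *ᵥ wgrad S.Ω v x) ⬝ᵥ star (wgrad S.Ω v x)).re)
    (fun K hK => integral_nonneg fun _ => re_form_nonneg (S.A_posDef K hK) _) hK
  have h2 : ∫ x in cell K, S.α K * ‖wgrad S.Ω v x i‖ ^ 2 ≤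
      ∫ x in cell K, ((S.Ac K *ᵥ wgrad S.Ω v x) ⬝ᵥ star (wgrad S.Ω v x)).re := by
    refine integral_mono ((integrable_norm_sq (memL2Vec_cell hw hK i)).const_mul _)
      (integrable_re_form hw _ hK) fun x => ?_
    refine le_trans (mul_le_mul_of_nonneg_left ?_ (α_pos hd hK).le) (α_mul_le_re_form hK _)
    exact Finset.single_le_sum (f := fun i => ‖wgrad S.Ω v x i‖ ^ 2)
      (fun i _ => by positivity) (Finset.mem_univ i)
  have h3 : 0 ≤ S.ω * S.normγ (S.extTrace v) ^ 2 := by positivity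
  have h4 : 0 ≤ S.ω ^ 2 * S.normμ v ^ 2 := by positivity
  linarith

end Setting


theorem eLpNorm_add_neg_one_smul {ν : Measure (E d)} (f g : E d → ℂ) :
    eLpNorm (f + (-1 : ℂ) • g) 2 ν = eLpNorm (fun x => f x - g x) 2 ν := by
  congr 1
  ext x
  simp [sub_eq_add_neg]

/-- Solvability of the adjoint problem for a bounded sesquilinear form that satisfies an inf-sup
condition, in a space that is complete for a Hilbertian seminorm. -/
theorem exists_dual_solution_of_core {V : Type*} [AddCommGroup V] [Module ℂ V]
    (cd : PreInnerProductSpace.Core ℂ V) (N : V → ℝ) (hN0 : ∀ v, 0 ≤ N v)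
    (hN : ∀ v, (cd.inner v v).re = N v ^ 2)
    (hcomplete : ∀ u : ℕ → V, Tendsto (fun n : ℕ × ℕ => N (u n.1 - u n.2)) atTop (𝓝 0) →
      ∃ v, Tendsto (fun n => N (u n - v)) atTop (𝓝 0))
    (b : V →ₗ[ℂ] V →ₛₗ[starRingEnd ℂ] ℂ) (hb : ∀ φ v, ‖b φ v‖ ≤ N φ * N v)
    (c : ℝ) (hc : 0 < c) (hinf : ∀ φ, N φ = 1 → ∃ v, N v = 1 ∧ c ≤ (b φ v).re)
    (l : V →ₗ[ℂ] ℂ) (M : ℝ) (hl : ∀ φ, ‖l φ‖ ≤ M * N φ) :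
    ∃ z, ∀ w, b w z = l w := by
  let _ : SeminormedAddCommGroup V := @InnerProductSpace.Core.toSeminormedAddCommGroup ℂ V _ _ _ cd
  let _ : InnerProductSpace ℂ V := InnerProductSpace.ofCore cd
  have hnorm : ∀ v : V, ‖v‖ = N v := fun v => by
    have h := @norm_eq_sqrt_re_inner ℂ V _ _ _ v
    have h2 : ‖v‖ = √(cd.inner v v).re := h
    rw [h2, hN, Real.sqrt_sq (hN0 v)]
  have : CompleteSpace V := by
    refine Metric.complete_of_cauchySeq_tendsto fun u hu => ?_
    have h1 := cauchySeq_iff_tendsto_dist_atTop_0.1 hu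
    obtain ⟨v, tv⟩ := hcomplete u (h1.congr fun n => by rw [dist_eq_norm, hnorm])
    exact ⟨v, tendsto_iff_dist_tendsto_zero.2 (tv.congr fun n => by rw [dist_eq_norm, hnorm])⟩
  refine exists_dual_solution b 1 (fun φ v => ?_) c hc (fun φ hφ => ?_) l M fun φ => ?_
  · rw [one_mul, hnorm, hnorm]; exact hb φ v
  · rw [hnorm] at hφ
    obtain ⟨v, hv⟩ := hinf φ hφ
    exact ⟨v, by rw [hnorm]; exact hv⟩
  · rw [hnorm]; exact hl φ

/-- The limit of weak gradients is the weak gradient of the limit. -/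
theorem IsWeakGrad.of_tendsto {D : Set (E d)} {f : ℕ → E d → ℂ} {v : E d → ℂ}
    {g : ℕ → E d → Fin d → ℂ} {w : E d → Fin d → ℂ} (hf : ∀ n, MemL2 D (f n)) (hv : MemL2 D v)
    (hg : ∀ n, MemL2Vec D (g n)) (hw : MemL2Vec D w) (h : ∀ n, IsWeakGrad D (f n) (g n))
    (t1 : Tendsto (fun n => eLpNorm (fun x => f n x - v x) 2 (volume.restrict D)) atTop (𝓝 0))
    (t2 : ∀ i, Tendsto (fun n => eLpNorm (fun x => g n x i - w x i) 2 (volume.restrict D))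
      atTop (𝓝 0)) : IsWeakGrad D v w := by
  intro φ hφ i
  have a1 := tendsto_integral_mul hf hv (hφ.memLp_pderiv (volume.restrict D) i) t1
  have a2 := (tendsto_integral_mul (fun n => hg n i) (hw i) (hφ.memLp (volume.restrict D))
    (t2 i)).neg
  exact tendsto_nhds_unique a1 (a2.congr fun n => (h n φ hφ i).symm)

namespace Setting

open Mesh

variable {S : Setting d} {v v' φ φ' : E d → ℂ} {K F : Finset (E d)}

/-- The converse direction: the energy is a finite sum of integrals controlled by the L² norms of
the function, its gradient and its Robin traces. Together with the two preceding bounds, it reduces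
completeness in energy to completeness of L². -/
theorem tendsto_energy {f : ℕ → E d → ℂ} (hd : 0 < d) (hf : ∀ n, S.MemH1D (f n))
    (t1 : Tendsto (fun n => eLpNorm (f n) 2 (volume.restrict S.Ω)) atTop (𝓝 0))
    (t2 : ∀ i, Tendsto (fun n => eLpNorm (fun x => wgrad S.Ω (f n) x i) 2 (volume.restrict S.Ω))
      atTop (𝓝 0))
    (t3 : ∀ F ∈ S.FR, Tendsto (fun n => eLpNorm (S.extTrace (f n) F) 2 (surf F)) atTop (𝓝 0)) :
    Tendsto (fun n => S.energy (f n)) atTop (𝓝 0) := by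
  have hcell : ∀ {h : ℕ → E d → ℂ}, (∀ n, MemL2 S.Ω (h n)) →
      Tendsto (fun n => eLpNorm (h n) 2 (volume.restrict S.Ω)) atTop (𝓝 0) →
      ∀ K ∈ S.cells, Tendsto (fun n => ∫ x in cell K, ‖h n x‖ ^ 2) atTop (𝓝 0) := by
    intro h hm ht K hK
    refine tendsto_integral_norm_sq (fun n => memL2_cell (hm n) hK) ?_
    exact tendsto_of_tendsto_of_tendsto_of_le_of_le tendsto_const_nhds ht (fun _ => zero_le)
      fun n => eLpNorm_mono_measure _ (Measure.restrict_mono (cell_subset_omega hK) le_rfl)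
  have a1 : Tendsto (fun n => S.normμ (f n) ^ 2) atTop (𝓝 0) := by
    simp_rw [normμ_sq]
    have := tendsto_finsetSum S.cells fun K hK =>
      (hcell (fun n => (hf n).1.1) t1 K hK).const_mul (S.μ K)
    simpa using this
  have a2 : Tendsto (fun n => S.normγ (S.extTrace (f n)) ^ 2) atTop (𝓝 0) := by
    simp_rw [normγ_sq]
    have := tendsto_finsetSum S.FR fun F hF =>
      (tendsto_integral_norm_sq (fun n => memL2R_extTrace hd (hf n).memH1T F hF)
        (t3 F hF)).const_mul (S.γ F)
    simpa using this
  have a3 : Tendsto (fun n => S.normA (wgrad S.Ω (f n)) ^ 2) atTop (𝓝 0) := by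
    simp_rw [normA_sq]
    have hK : ∀ K ∈ S.cells, Tendsto (fun n => ∫ x in cell K,
        ((S.Ac K *ᵥ wgrad S.Ω (f n) x) ⬝ᵥ star (wgrad S.Ω (f n) x)).re) atTop (𝓝 0) := by
      intro K hK
      obtain ⟨C, hC, hCle⟩ := re_form_le (S.A K)
      have b1 := (tendsto_finsetSum (Finset.univ : Finset (Fin d)) fun i _ =>
        hcell (fun n => (wgrad_spec (hf n).1).1 i) (t2 i) K hK).const_mul C
      simp only [Finset.sum_const_zero, mul_zero] at b1
      refine tendsto_of_tendsto_of_tendsto_of_le_of_le tendsto_const_nhds b1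
        (fun n => integral_nonneg fun _ => re_form_nonneg (S.A_posDef K hK) _) fun n => ?_
      have hm := memL2Vec_cell (wgrad_spec (hf n).1).1 hK
      simp only
      rw [← integral_finsetSum _ (fun i _ => integrable_norm_sq (hm i)), ← integral_const_mul]
      exact integral_mono (integrable_re_form (wgrad_spec (hf n).1).1 _ hK)
        ((integrable_finsetSum _ fun i _ => integrable_norm_sq (hm i)).const_mul C)
        fun x => hCle _
    simpa using tendsto_finsetSum S.cells hK
  have a4 := ((a1.const_mul (S.ω ^ 2)).add (a2.const_mul S.ω)).add a3
  simp only [mul_zero, add_zero] at a4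
  have a5 := (Real.continuous_sqrt.tendsto 0).comp a4
  rw [Real.sqrt_zero] at a5
  exact a5

/-- The space `H¹_{Γ_D}(Ω)` is complete for the energy norm. -/
theorem exists_energy_limit (hd : 0 < d) {f : ℕ → E d → ℂ} (hf : ∀ n, S.MemH1D (f n))
    (hc : Tendsto (fun n : ℕ × ℕ => S.energy (f n.1 + (-1 : ℂ) • f n.2)) atTop (𝓝 0)) :
    ∃ v, S.MemH1D v ∧ Tendsto (fun n => S.energy (f n + (-1 : ℂ) • v)) atTop (𝓝 0) := by
  have hsub : ∀ n m, S.MemH1D (f n + (-1 : ℂ) • f m) := fun n m => (hf n).add_smul hd (hf m) _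
  have hC0 : ∀ C : ℝ, Tendsto (fun n : ℕ × ℕ => ENNReal.ofReal
      (C * S.energy (f n.1 + (-1 : ℂ) • f n.2))) atTop (𝓝 0) := fun C => by
    have := ENNReal.tendsto_ofReal (hc.const_mul C)
    simpa using this
  obtain ⟨C1, -, hC1⟩ := exists_eLpNorm_le S
  obtain ⟨C2, -, hC2⟩ := exists_eLpNorm_wgrad_le hd S
  obtain ⟨v, hv, tv⟩ := exists_limit_of_cauchy (fun n => (hf n).1.1)
    (tendsto_of_tendsto_of_tendsto_of_le_of_le tendsto_const_nhds (hC0 C1) (fun _ => zero_le)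
      fun n => by
        rw [← eLpNorm_add_neg_one_smul]
        exact hC1 _ (hsub n.1 n.2).1.1)
  have hgsub : ∀ n m i, eLpNorm (fun x => wgrad S.Ω (f n) x i - wgrad S.Ω (f m) x i) 2
      (volume.restrict S.Ω) = eLpNorm (fun x => wgrad S.Ω (f n + (-1 : ℂ) • f m) x i) 2
      (volume.restrict S.Ω) := fun n m i => eLpNorm_congr_ae (by
    filter_upwards [wgrad_add_smul isOpen_omega (hf n).1 (hf m).1 (-1)] with x hx
    rw [hx]; simp [sub_eq_add_neg])
  choose g hg tg using fun i => exists_limit_of_cauchy (fun n => (wgrad_spec (hf n).1).1 i)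
    (tendsto_of_tendsto_of_tendsto_of_le_of_le tendsto_const_nhds (hC0 C2) (fun _ => zero_le)
      fun n => by
        rw [hgsub]
        exact hC2 _ (hsub n.1 n.2).1 i)
  have hwv : IsWeakGrad S.Ω v (fun x i => g i x) :=
    IsWeakGrad.of_tendsto (fun n => (hf n).1.1) hv (fun n => (wgrad_spec (hf n).1).1) hg
      (fun n => (wgrad_spec (hf n).1).2) tv tg
  have hv1 : MemH1 S.Ω v := ⟨hv, _, hg, hwv⟩
  have hvT := memH1T_of_memH1 hv1
  have tg' : ∀ i, Tendsto (fun n => eLpNorm (fun x => wgrad S.Ω (f n) x i - wgrad S.Ω v x i) 2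
      (volume.restrict S.Ω)) atTop (𝓝 0) := fun i => (tg i).congr fun n => eLpNorm_congr_ae (by
    filter_upwards [wgrad_ae_eq isOpen_omega hg hwv] with x hx
    rw [hx])
  -- Continuity of traces is needed on all exterior faces: on Dirichlet faces it passes the boundary
  -- condition to the limit, on Robin faces it gives convergence of the boundary part of the energy.
  have ttr : ∀ F ∈ S.extFaces, Tendsto (fun n => eLpNorm
      (fun x => S.extTrace (f n) F x - S.extTrace v F x) 2 (surf F)) atTop (𝓝 0) := by
    intro F hF
    have hF' := mem_faces_of_ext hF
    obtain ⟨K, hK⟩ := exists_cellsOf_eq_of_ext hF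
    have hKF : K ∈ S.cellsOf F := by rw [hK]; simp
    have hKc := (mem_cellsOf.1 hKF).1
    obtain ⟨C, hCt, hC⟩ := (S.isSimplex hKc).trace_bound hd (mem_facesOf_of_mem_cellsOf hF' hKF)
    have hle : volume.restrict (cell K) ≤ volume.restrict S.Ω :=
      Measure.restrict_mono (cell_subset_omega hKc) le_rfl
    have a := ENNReal.Tendsto.const_mul (a := C) (tv.add (tendsto_finsetSum
      (Finset.univ : Finset (Fin d)) fun i _ => tg' i)) (Or.inr hCt)
    simp only [Finset.sum_const_zero, add_zero, mul_zero] at a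
    refine tendsto_of_tendsto_of_tendsto_of_le_of_le tendsto_const_nhds a (fun _ => zero_le)
      fun n => ?_
    have e : ∀ u : E d → ℂ, S.extTrace u F = trace K u := fun u => by
      ext x; rw [extTrace, hK, Finset.sum_singleton]
    simp only [e]
    refine (hC (f n) v _ _ ((hf n).memH1T.2 K hKc) (hvT.2 K hKc)
      ((S.isSimplex hKc).isTrace_trace hd ((hf n).memH1T.2 K hKc))
      ((S.isSimplex hKc).isTrace_trace hd (hvT.2 K hKc))).trans ?_
    gcongr with i
    · refine le_trans (le_of_eq (eLpNorm_congr_ae ?_)) (eLpNorm_mono_measure _ hle)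
      filter_upwards [wgrad_mono (isOpen_cell K) (cell_subset_omega hKc) (hf n).1,
        wgrad_mono (isOpen_cell K) (cell_subset_omega hKc) hv1] with x h1 h2
      rw [h1, h2]
  have hvD : S.MemH1D v := by
    refine ⟨hv1, fun F hF => ?_⟩
    have hFe := mem_extFaces_of_FD hF
    have h0 : eLpNorm (S.extTrace v F) 2 (surf F) = 0 := by
      refine tendsto_nhds_unique (tendsto_const_nhds.congr fun n => ?_) (ttr F hFe)
      rw [← eLpNorm_neg]
      refine eLpNorm_congr_ae ?_
      filter_upwards [(hf n).2 F hF] with x hx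
      rw [hx]; simp
    exact (eLpNorm_eq_zero_iff (memLp_extTrace hd (mem_faces_of_ext hFe) hvT).1 two_ne_zero).1 h0
  refine ⟨v, hvD, tendsto_energy hd (fun n => (hf n).add_smul hd hvD _) ?_ (fun i => ?_)
    fun F hF => ?_⟩
  · simp_rw [eLpNorm_add_neg_one_smul]
    exact tv
  · refine (tg' i).congr fun n => eLpNorm_congr_ae ?_
    filter_upwards [wgrad_add_smul isOpen_omega (hf n).1 hv1 (-1)] with x hx
    rw [hx]; simp [sub_eq_add_neg]
  · refine (ttr F (mem_extFaces_of_FR hF)).congr fun n => eLpNorm_congr_ae ?_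
    filter_upwards [extTrace_add_smul hd (mem_faces_of_FR hF) (hf n).memH1T hvT (-1)] with x hx
    rw [hx]; simp [sub_eq_add_neg]

variable (S) in
/-- The space `H¹_{Γ_D}(Ω)`. -/
def H1D (hd : 0 < d) : Submodule ℂ (E d → ℂ) where
  carrier := {v | S.MemH1D v}
  zero_mem' := memH1D_zero hd
  add_mem' := fun {v v'} hv hv' => by
    have := MemH1D.add_smul hd hv hv' 1
    rwa [one_smul] at this
  smul_mem' := fun c v hv => by
    have := MemH1D.add_smul hd (memH1D_zero hd) hv c
    rwa [zero_add] at this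

/-- Well-posedness of the adjoint problem. -/
theorem exists_adjoint_solution (hd : 0 < d) (hwp : S.WellPosed) (ℓ : (E d → ℂ) → ℂ)
    (hℓ : ∀ v v' c, S.MemH1D v → S.MemH1D v' → ℓ (v + c • v') = ℓ v + c * ℓ v') (M : ℝ)
    (hM : ∀ v, S.MemH1D v → ‖ℓ v‖ ≤ M * S.energy v) :
    ∃ z, S.MemH1D z ∧ ∀ w, S.MemH1D w → S.b w z = ℓ w := by
  let V := S.H1D hd
  have h0 : S.MemH1D 0 := memH1D_zero hd
  have hadd : ∀ v v' : V, ((v + v' : V) : E d → ℂ) = (v : E d → ℂ) + (1 : ℂ) • (v' : E d → ℂ) :=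
    fun v v' => by rw [one_smul]; rfl
  have hsmul : ∀ (c : ℂ) (v : V), ((c • v : V) : E d → ℂ) = (0 : E d → ℂ) + c • (v : E d → ℂ) :=
    fun c v => by rw [zero_add]; rfl
  -- Linearity is available only in the form v + c v'; taking v = v' = 0 and c = -1 yields the value
  -- zero at 0, from which homogeneity follows.
  have add_zero_of : ∀ (q : (E d → ℂ) → ℂ), (q (0 + (-1 : ℂ) • 0) = q 0 + (-1) * q 0) → q 0 = 0 :=
    fun q hq => by
      rw [smul_zero, add_zero] at hq
      linear_combination hq
  have b0l : ∀ v, S.MemH1D v → S.b 0 v = 0 := fun v hv =>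
    add_zero_of (fun u => S.b u v) (b_left hd h0 h0 hv _)
  have b0r : ∀ v, S.MemH1D v → S.b v 0 = 0 := fun v hv =>
    add_zero_of (fun u => S.b v u) (by
      have := b_right hd hv h0 h0 (-1)
      simpa using this)
  have e0l : ∀ v, S.MemH1D v → S.energyForm 0 v = 0 := fun v hv =>
    add_zero_of (fun u => S.energyForm u v) (energyForm_left hd h0 h0 hv _)
  have ℓ0 : ℓ 0 = 0 := add_zero_of ℓ (hℓ 0 0 _ h0 h0)
  let cd : PreInnerProductSpace.Core ℂ V :=
    { inner := fun v v' => S.energyForm v' v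
      conj_inner_symm := fun v v' => energyForm_conj _ _
      re_inner_nonneg := fun v => by
        change 0 ≤ (S.energyForm v v).re
        rw [energyForm_self, Complex.ofReal_re]
        positivity
      add_left := fun v v' u => by
        change S.energyForm u (v + v' : V) = S.energyForm u v + S.energyForm u v'
        rw [← energyForm_conj, hadd, energyForm_left hd v.2 v'.2 u.2, one_mul, star_add,
          energyForm_conj, energyForm_conj]
      smul_left := fun v u c => by
        change S.energyForm u (c • v : V) = star c * S.energyForm u v
        rw [← energyForm_conj, hsmul, energyForm_left hd h0 v.2 u.2, star_add, star_mul',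
          e0l _ u.2, star_zero, zero_add, energyForm_conj] }
  have hsub : ∀ v v' : V, ((v - v' : V) : E d → ℂ) = (v : E d → ℂ) + (-1 : ℂ) • (v' : E d → ℂ) :=
    fun v v' => by rw [neg_one_smul, ← sub_eq_add_neg]; rfl
  let B : V →ₗ[ℂ] V →ₛₗ[starRingEnd ℂ] ℂ := LinearMap.mk₂'ₛₗ (RingHom.id ℂ) (starRingEnd ℂ)
    (fun φ v : V => S.b φ v)
    (fun φ φ' v => by
      change S.b (φ + φ' : V) v = _
      rw [hadd, b_left hd φ.2 φ'.2 v.2, one_mul])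
    (fun c φ v => by
      change S.b (c • φ : V) v = _
      rw [hsmul, b_left hd h0 φ.2 v.2, b0l _ v.2, zero_add]; rfl)
    (fun φ v v' => by
      change S.b φ (v + v' : V) = _
      rw [hadd, b_right hd φ.2 v.2 v'.2, star_one, one_mul])
    (fun c φ v => by
      change S.b φ (c • v : V) = _
      rw [hsmul, b_right hd φ.2 h0 v.2, b0r _ φ.2, zero_add]; rfl)
  let l : V →ₗ[ℂ] ℂ :=
    { toFun := fun v => ℓ v
      map_add' := fun v v' => by
        rw [hadd, hℓ _ _ _ v.2 v'.2, one_mul]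
      map_smul' := fun c v => by
        rw [hsmul, hℓ _ _ _ h0 v.2, ℓ0, zero_add]; rfl }
  obtain ⟨γst, hγ, hinf⟩ := hwp
  obtain ⟨z, hz⟩ := exists_dual_solution_of_core cd (fun v => S.energy v)
    (fun v => energy_nonneg _)
    (fun v => by
      change (S.energyForm v v).re = _
      rw [energyForm_self, Complex.ofReal_re])
    (fun u hu => by
      obtain ⟨v, hv, tv⟩ := exists_energy_limit hd (f := fun n => (u n : E d → ℂ))
        (fun n => (u n).2) (hu.congr fun n => by rw [hsub])
      exact ⟨⟨v, hv⟩, tv.congr fun n => by rw [hsub]⟩)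
    B (fun φ v => norm_b_le hd φ.2 v.2) (1 / γst) (by positivity)
    (fun φ hφ => by
      obtain ⟨v, hv, hv1, hv2⟩ := hinf φ φ.2 hφ
      exact ⟨⟨v, hv⟩, hv1, hv2⟩)
    l M (fun φ => hM φ φ.2)
  exact ⟨z, z.2, fun w hw => hz ⟨w, hw⟩⟩

end Setting


/-! ### Normal traces, the duality defect, and fluxes of adjoint solutions. -/

theorem IsWeakDiv.add_smul {D : Set (E d)} {w w' : E d → Fin d → ℂ} {q q' : E d → ℂ}
    (hw : MemL2Vec D w) (hw' : MemL2Vec D w') (hq : MemL2 D q) (hq' : MemL2 D q')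
    (h : IsWeakDiv D w q) (h' : IsWeakDiv D w' q') (c : ℂ) :
    IsWeakDiv D (w + c • w') (q + c • q') := by
  intro φ hφ
  have i1 : IntegrableOn (fun x => ∑ i, ((pderiv i φ x : ℝ) : ℂ) * w x i) D :=
    integrable_finsetSum _ fun i _ => (hw i).test_pderiv_mul hφ i
  have i2 : IntegrableOn (fun x => ∑ i, ((pderiv i φ x : ℝ) : ℂ) * w' x i) D :=
    integrable_finsetSum _ fun i _ => (hw' i).test_pderiv_mul hφ i
  have e1 : ∫ x in D, ∑ i, ((pderiv i φ x : ℝ) : ℂ) * (w + c • w') x i =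
      (∫ x in D, ∑ i, ((pderiv i φ x : ℝ) : ℂ) * w x i) +
        c * ∫ x in D, ∑ i, ((pderiv i φ x : ℝ) : ℂ) * w' x i := by
    rw [← integral_const_mul, ← integral_add i1 (i2.const_mul c)]
    refine integral_congr_ae (.of_forall fun x => ?_)
    simp only [Pi.add_apply, Pi.smul_apply, smul_eq_mul]
    rw [Finset.mul_sum, ← Finset.sum_add_distrib]
    refine Finset.sum_congr rfl fun i _ => by ring
  have e2 : ∫ x in D, (φ x : ℂ) * (q + c • q') x =
      (∫ x in D, (φ x : ℂ) * q x) + c * ∫ x in D, (φ x : ℂ) * q' x := by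
    rw [← integral_const_mul, ← integral_add (hq.test_mul hφ) ((hq'.test_mul hφ).const_mul c)]
    refine integral_congr_ae (.of_forall fun x => ?_)
    simp only [Pi.add_apply, Pi.smul_apply, smul_eq_mul]
    ring
  rw [e1, e2, h φ hφ, h' φ hφ]
  ring

theorem MemHdiv.add_smul {D : Set (E d)} {w w' : E d → Fin d → ℂ} (hw : MemHdiv D w)
    (hw' : MemHdiv D w') (c : ℂ) : MemHdiv D (w + c • w') :=
  ⟨hw.1.add_smul hw'.1 c, _, (wdiv_spec hw).1.add_smul (wdiv_spec hw').1 c,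
    (wdiv_spec hw).2.add_smul hw.1 hw'.1 (wdiv_spec hw).1 (wdiv_spec hw').1 (wdiv_spec hw').2 c⟩

theorem wdiv_add_smul {D : Set (E d)} (hD : IsOpen D) {w w' : E d → Fin d → ℂ} (hw : MemHdiv D w)
    (hw' : MemHdiv D w') (c : ℂ) :
    ∀ᵐ x ∂(volume.restrict D), wdiv D (w + c • w') x = wdiv D w x + c * wdiv D w' x :=
  wdiv_ae_eq hD ((wdiv_spec hw).1.add_smul (wdiv_spec hw').1 c)
    ((wdiv_spec hw).2.add_smul hw.1 hw'.1 (wdiv_spec hw).1 (wdiv_spec hw').1 (wdiv_spec hw').2 c)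

namespace Setting

open Mesh

variable {S : Setting d} {v v' φ φ' ψ ξ q f : E d → ℂ} {K F : Finset (E d)}
  {w w' τ τ' : E d → Fin d → ℂ} {g g' Ψ r : FaceFun d}

/-! #### Normal traces -/

theorem notMem_FD_of_FR (hF : F ∈ S.FR) : F ∉ S.FD := fun h =>
  Finset.disjoint_left.1 S.disjDR h hF

theorem star_ofReal_fun (a : ℝ) : star (a : ℂ) = a := Complex.conj_ofReal a

theorem l2R_extTrace_of_isTest (hd : 0 < d) {φ : E d → ℝ} (hφ : IsTest (S.awayFrom F) φ)
    (Ψ : FaceFun d) : S.l2R Ψ (S.extTrace (fun x => (φ x : ℂ))) =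
      if F ∈ S.FR then ∫ x, (φ x : ℂ) * Ψ F x ∂(surf F) else 0 := by
  have h1 : ∀ F' ∈ S.FR, ∫ x, Ψ F' x * star (S.extTrace (fun x => (φ x : ℂ)) F' x) ∂(surf F') =
      ∫ x, (φ x : ℂ) * Ψ F' x ∂(surf F') := fun F' hF' => integral_congr_ae (by
    filter_upwards [extTrace_of_contDiff hd (mem_extFaces_of_FR hF')
      (contDiff_ofReal_comp hφ.1)] with x hx
    rw [hx, star_ofReal_fun, mul_comm])
  rw [l2R, Finset.sum_congr rfl h1]
  have h2 : ∀ F' ∈ S.FR, F' ≠ F → ∫ x, (φ x : ℂ) * Ψ F' x ∂(surf F') = 0 := fun F' hF' hne =>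
    integral_surf_eq_zero fun x hx => by
      rw [eq_zero_of_tsupport (mem_faces_of_FR hF') hne hφ.2.2 hx, Complex.ofReal_zero]
  split_ifs with hF
  · exact Finset.sum_eq_single_of_mem F hF h2
  · exact Finset.sum_eq_zero fun F' hF' => h2 F' hF' (fun h => hF (h ▸ hF'))

/-- Test with smooth functions that vanish on all faces other than F; the Robin pairing then reduces
to the integral over F, and the fundamental lemma on a face applies. A Robin face is not a Dirichlet
face, so these tests are admissible. -/
theorem IsNormalTrace.unique (hd : 0 < d) (hg : S.MemL2R g) (hg' : S.MemL2R g')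
    (h : S.IsNormalTrace w g) (h' : S.IsNormalTrace w g') :
    ∀ F ∈ S.FR, ∀ᵐ x ∂(surf F), g F x = g' F x := by
  intro F hF
  have hFf := mem_faces_of_FR hF
  have hfin := isFiniteMeasure_surf hd hFf
  have key : ∀ᵐ x ∂(surf F), g F x - g' F x = 0 := by
    refine ae_eq_zero_of_integral_surf hd hFf isOpen_univ (.of_forall fun _ => Set.mem_univ _)
      ((hg F hF).sub (hg' F hF)) fun φ hφ => ?_
    have hφ' := hφ.mono Set.inter_subset_left
    have hv := memH1D_of_isTest_awayFrom (S := S) hd hφ' (notMem_FD_of_FR hF)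
    have e := (h _ hv).symm.trans (h' _ hv)
    rw [l2R_extTrace_of_isTest hd hφ', l2R_extTrace_of_isTest hd hφ', if_pos hF, if_pos hF] at e
    have i : ∀ u : E d → ℂ, MemLp u 2 (surf F) → Integrable (fun x => (φ x : ℂ) * u x) (surf F) :=
      fun u hu => MemLp.integrable_mul (hφ'.memLp (surf F)) hu
    simp only [mul_sub]
    rw [integral_sub (i _ (hg F hF)) (i _ (hg' F hF)), e, sub_self]
  filter_upwards [key] with x hx
  exact sub_eq_zero.1 hx

theorem MemX.normalTrace_spec (h : S.MemX w) :
    S.MemL2R (S.normalTrace w) ∧ S.IsNormalTrace w (S.normalTrace w) := by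
  rw [normalTrace, dif_pos h.2]
  exact h.2.choose_spec

theorem normalTrace_ae_eq (hd : 0 < d) (hg : S.MemL2R g) (h : S.IsNormalTrace w g) :
    ∀ F ∈ S.FR, ∀ᵐ x ∂(surf F), S.normalTrace w F x = g F x := by
  have h2 : ∃ g, S.MemL2R g ∧ S.IsNormalTrace w g := ⟨g, hg, h⟩
  have h3 : S.MemL2R (S.normalTrace w) ∧ S.IsNormalTrace w (S.normalTrace w) := by
    rw [normalTrace, dif_pos h2]
    exact h2.choose_spec
  exact h3.2.unique hd h3.1 hg h

theorem MemL2R.add_smul (hg : S.MemL2R g) (hg' : S.MemL2R g') (c : ℂ) : S.MemL2R (g + c • g') :=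
  fun F hF => (hg F hF).add ((hg' F hF).const_smul c)

theorem IsNormalTrace.add_smul (hd : 0 < d) (hw : MemHdiv S.Ω w) (hw' : MemHdiv S.Ω w')
    (hg : S.MemL2R g) (hg' : S.MemL2R g') (h : S.IsNormalTrace w g) (h' : S.IsNormalTrace w' g')
    (c : ℂ) : S.IsNormalTrace (w + c • w') (g + c • g') := by
  intro v hv
  rw [l2Vec_left (W := w + c • w') (c := c) hw.1 hw'.1 (wgrad_spec hv.1).1
      (.of_forall fun _ => rfl),
    l2_left (wdiv_spec hw).1 (wdiv_spec hw').1 hv.1.1 (wdiv_add_smul isOpen_omega hw hw' c),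
    l2R_left (Θ := g + c • g') (c := c) hg hg' (memL2R_extTrace hd hv.memH1T)
      (fun _ _ => .of_forall fun _ => rfl), ← h v hv, ← h' v hv]
  ring

theorem MemX.add_smul (hd : 0 < d) (hw : S.MemX w) (hw' : S.MemX w') (c : ℂ) :
    S.MemX (w + c • w') :=
  ⟨hw.1.add_smul hw'.1 c, _, hw.normalTrace_spec.1.add_smul hw'.normalTrace_spec.1 c,
    hw.normalTrace_spec.2.add_smul hd hw.1 hw'.1 hw.normalTrace_spec.1 hw'.normalTrace_spec.1
      hw'.normalTrace_spec.2 c⟩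

theorem normalTrace_add_smul (hd : 0 < d) (hw : S.MemX w) (hw' : S.MemX w') (c : ℂ) :
    ∀ F ∈ S.FR, ∀ᵐ x ∂(surf F), S.normalTrace (w + c • w') F x
      = S.normalTrace w F x + c * S.normalTrace w' F x :=
  normalTrace_ae_eq hd (hw.normalTrace_spec.1.add_smul hw'.normalTrace_spec.1 c)
    (hw.normalTrace_spec.2.add_smul hd hw.1 hw'.1 hw.normalTrace_spec.1 hw'.normalTrace_spec.1
      hw'.normalTrace_spec.2 c)

/-! #### The duality defect -/

variable (S) in
/-- The defect in the integration by parts formula for discrete gradients. -/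
def defect (φ : E d → ℂ) (τ : E d → Fin d → ℂ) : ℂ :=
  S.l2Vec (S.G φ) τ + S.l2 φ (wdiv S.Ω τ) - S.l2R (S.extTrace φ) (S.normalTrace τ)

theorem defect_left (hd : 0 < d) (hφ : S.MemH1T φ) (hφ' : S.MemH1T φ') (hτ : S.MemX τ) (c : ℂ) :
    S.defect (φ + c • φ') τ = S.defect φ τ + c * S.defect φ' τ := by
  rw [defect, defect, defect,
    l2Vec_left (memL2Vec_G hd hφ) (memL2Vec_G hd hφ') hτ.1.1 (G_add_smul hd hφ hφ' c),
    l2_left hφ.1 hφ'.1 (wdiv_spec hτ.1).1 (ae_add_smul_apply _ _ c),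
    l2R_left (memL2R_extTrace hd hφ) (memL2R_extTrace hd hφ') hτ.normalTrace_spec.1
      (ae_extTrace_add_smul hd hφ hφ' c)]
  ring

theorem defect_right (hd : 0 < d) (hφ : S.MemH1T φ) (hτ : S.MemX τ) (hτ' : S.MemX τ') (c : ℂ) :
    S.defect φ (τ + c • τ') = S.defect φ τ + star c * S.defect φ τ' := by
  rw [defect, defect, defect, ← l2Vec_conj (τ + c • τ'), ← l2_conj (wdiv S.Ω (τ + c • τ')),
    ← l2R_conj (S.normalTrace (τ + c • τ')),
    l2Vec_left (W := τ + c • τ') (c := c) hτ.1.1 hτ'.1.1 (memL2Vec_G hd hφ)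
      (.of_forall fun _ => rfl),
    l2_left (wdiv_spec hτ.1).1 (wdiv_spec hτ'.1).1 hφ.1 (wdiv_add_smul isOpen_omega hτ.1 hτ'.1 c),
    l2R_left hτ.normalTrace_spec.1 hτ'.normalTrace_spec.1 (memL2R_extTrace hd hφ)
      (normalTrace_add_smul hd hτ hτ' c), star_add, star_add, star_add, star_mul', star_mul',
      star_mul', l2Vec_conj, l2Vec_conj, l2_conj, l2_conj, l2R_conj, l2R_conj]
  ring

/-- Since 𝔊(φ) = ∇φ, this is the complex conjugate of the identity that defines the normal trace of
τ. -/
theorem defect_eq_zero_of_memH1D (hd : 0 < d) (hφ : S.MemH1D φ) (hτ : S.MemX τ) :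
    S.defect φ τ = 0 := by
  have h := congrArg star (hτ.normalTrace_spec.2 φ hφ)
  rw [star_add, l2Vec_conj, l2_conj, l2R_conj, ← l2Vec_congr_left (G_ae_eq hd hφ)] at h
  rw [defect, h, sub_self]

/-! #### Fluxes of solutions of the adjoint problem -/

variable (S) in
/-- The function `μ v`. -/
def mulμ (v : E d → ℂ) (x : E d) : ℂ :=
  ∑ K ∈ S.cells, (cell K).indicator (fun y => (S.μ K : ℂ) * v y) x

variable (S) in
/-- The function `γ Ψ`. -/
def mulγ (Ψ : FaceFun d) : FaceFun d := fun F x => (S.γ F : ℂ) * Ψ F x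

theorem mulμ_apply (hK : K ∈ S.cells) {x : E d} (hx : x ∈ cell K) (v : E d → ℂ) :
    S.mulμ v x = S.μ K * v x := by
  rw [mulμ, Finset.sum_eq_single K]
  · exact Set.indicator_of_mem hx _
  · intro L hL hLK
    exact Set.indicator_of_notMem (fun hx' =>
      Set.disjoint_left.1 (disjoint_cell hL hK hLK) hx' hx) _
  · exact fun h => absurd hK h

theorem mulA_apply (hK : K ∈ S.cells) {x : E d} (hx : x ∈ cell K) (w : E d → Fin d → ℂ) :
    S.mulA w x = S.Ac K *ᵥ w x := by
  rw [mulA, Finset.sum_eq_single K]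
  · exact Set.indicator_of_mem hx _
  · intro L hL hLK
    exact Set.indicator_of_notMem (fun hx' =>
      Set.disjoint_left.1 (disjoint_cell hL hK hLK) hx' hx) _
  · exact fun h => absurd hK h

theorem memL2_mulμ (hv : MemL2 S.Ω v) : MemL2 S.Ω (S.mulμ v) := by
  refine memL2_omega_iff.2 fun K hK => MemL2.congr
    (v := fun x => (S.μ K : ℂ) * v x) ((memL2_cell hv hK).const_mul _) ?_
  filter_upwards [ae_restrict_mem (isOpen_cell K).measurableSet] with x hx
  rw [mulμ_apply hK hx]

theorem memL2Vec_mulA (hw : MemL2Vec S.Ω w) : MemL2Vec S.Ω (S.mulA w) := fun i => by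
  refine memL2_omega_iff.2 fun K hK => MemL2.congr (memLp_mulVec (S.Ac K) (memL2Vec_cell hw hK) i) ?_
  filter_upwards [ae_restrict_mem (isOpen_cell K).measurableSet] with x hx
  rw [mulA_apply hK hx]

theorem l2_mulμ_right (v f : E d → ℂ) : S.l2 v (S.mulμ f) = S.l2μ v f := by
  rw [l2, l2μ]
  refine Finset.sum_congr rfl fun K hK => ?_
  rw [← integral_const_mul]
  refine setIntegral_congr_fun (isOpen_cell K).measurableSet fun x hx => ?_
  rw [mulμ_apply hK hx, star_mul', star_ofReal_fun]
  ring

theorem l2R_mulγ_right (Φ Ψ : FaceFun d) : S.l2R Φ (S.mulγ Ψ) = S.l2γ Φ Ψ := by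
  rw [l2R, l2γ]
  refine Finset.sum_congr rfl fun F _ => ?_
  rw [← integral_const_mul]
  refine integral_congr_ae (.of_forall fun x => ?_)
  simp only [mulγ]
  rw [star_mul', star_ofReal_fun]
  ring

theorem l2Vec_mulA_right (w z : E d → Fin d → ℂ) : S.l2Vec w (S.mulA z) = S.l2A w z := by
  rw [l2Vec, l2A]
  refine Finset.sum_congr rfl fun K hK => ?_
  refine setIntegral_congr_fun (isOpen_cell K).measurableSet fun x hx => ?_
  rw [mulA_apply hK hx]
  exact (mulVec_dotProduct_star (S.A_posDef K hK) _ _).symm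

theorem memL2R_mulγ (hΨ : S.MemL2R Ψ) : S.MemL2R (S.mulγ Ψ) := fun F hF => (hΨ F hF).const_mul _

variable (S) in
/-- `z` solves the adjoint problem whose right-hand side has the densities `q` and `r`. -/
def IsAdjoint (q : E d → ℂ) (r : FaceFun d) (z : E d → ℂ) : Prop :=
  S.MemH1D z ∧ ∀ w, S.MemH1D w → S.b w z = S.l2 w q + S.l2R (S.extTrace w) r

variable (S) in
/-- The divergence of the flux of a solution of the adjoint problem. -/
def fluxDiv (q z : E d → ℂ) : E d → ℂ := (-(S.ω : ℂ) ^ 2) • S.mulμ z + (-1 : ℂ) • q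

variable (S) in
/-- The normal trace of the flux of a solution of the adjoint problem. -/
def fluxNormal (r : FaceFun d) (z : E d → ℂ) : FaceFun d :=
  r + (-(Complex.I * S.ω)) • S.mulγ (S.extTrace z)

theorem memL2_fluxDiv (hξ : S.MemH1D ξ) (hq : MemL2 S.Ω q) : MemL2 S.Ω (S.fluxDiv q ξ) :=
  ((memL2_mulμ hξ.1.1).const_smul _).add (hq.const_smul _)

theorem memL2R_fluxNormal (hd : 0 < d) (hξ : S.MemH1D ξ) (hr : S.MemL2R r) :
    S.MemL2R (S.fluxNormal r ξ) :=
  hr.add_smul (memL2R_mulγ (memL2R_extTrace hd hξ.memH1T)) _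

theorem l2_fluxDiv_right (hξ : S.MemH1D ξ) (hq : MemL2 S.Ω q) (hv : MemL2 S.Ω v) :
    S.l2 v (S.fluxDiv q ξ) = -(S.ω : ℂ) ^ 2 * S.l2μ v ξ - S.l2 v q := by
  have hm := memL2_mulμ (S := S) hξ.1.1
  have h0 : MemL2 S.Ω ((-(S.ω : ℂ) ^ 2) • S.mulμ ξ) := hm.const_smul _
  rw [← l2_conj, fluxDiv, l2_left (c := -1) h0 hq hv (ae_add_smul_apply _ _ _),
    l2_left (F := (-(S.ω : ℂ) ^ 2) • S.mulμ ξ) (f := (0 : E d → ℂ)) (c := -(S.ω : ℂ) ^ 2)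
      MemLp.zero hm hv (.of_forall fun x => by simp), star_add, star_add,
    star_mul', star_mul', l2_conj, l2_conj, l2_conj, l2_mulμ_right]
  have e : S.l2 v 0 = 0 := by simp [l2]
  rw [e]
  simp only [star_neg, star_pow, star_ofReal_fun, star_one]
  ring

theorem l2R_fluxNormal_right (hd : 0 < d) (hξ : S.MemH1D ξ) (hr : S.MemL2R r)
    (hΨ : S.MemL2R Ψ) : S.l2R Ψ (S.fluxNormal r ξ) =
      S.l2R Ψ r + Complex.I * S.ω * S.l2γ Ψ (S.extTrace ξ) := by
  rw [← l2R_conj, fluxNormal, l2R_left (Θ := r + (-(Complex.I * S.ω)) • S.mulγ (S.extTrace ξ))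
      (c := -(Complex.I * S.ω)) hr
    (memL2R_mulγ (memL2R_extTrace hd hξ.memH1T)) hΨ (fun _ _ => .of_forall fun _ => rfl),
    star_add, star_mul', l2R_conj, l2R_conj, l2R_mulγ_right]
  simp only [star_neg, star_mul', star_ofReal_fun]
  have : star Complex.I = -Complex.I := Complex.conj_I
  rw [this]
  ring

/-- This is the conjugated adjoint equation: the mass term and q are collected in the divergence,
the impedance term and r in the normal trace. The sign of iωγ in `fluxNormal` comes from conjugating
the second argument. -/
theorem flux_identity (hd : 0 < d) (hq : MemL2 S.Ω q) (hr : S.MemL2R r) (hξ : S.IsAdjoint q r ξ)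
    (hv : S.MemH1D v) :
    S.l2Vec (S.mulA (wgrad S.Ω ξ)) (wgrad S.Ω v) + S.l2 (S.fluxDiv q ξ) v =
      S.l2R (S.fluxNormal r ξ) (S.extTrace v) := by
  have h := hξ.2 v hv
  rw [← l2Vec_conj, ← l2_conj, ← l2R_conj, l2Vec_mulA_right, l2_fluxDiv_right hξ.1 hq hv.1.1,
    l2R_fluxNormal_right hd hξ.1 hr (memL2R_extTrace hd hv.memH1T), ← star_add]
  congr 1
  rw [b] at h
  linear_combination h

/-- A test function supported in Ω is an admissible conforming function, and the Robin term
disappears because almost no point of an exterior face lies in Ω. -/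
theorem isWeakDiv_flux (hd : 0 < d) (hq : MemL2 S.Ω q) (hr : S.MemL2R r)
    (hξ : S.IsAdjoint q r ξ) : IsWeakDiv S.Ω (S.mulA (wgrad S.Ω ξ)) (S.fluxDiv q ξ) := by
  intro φ hφ
  have hv := memH1D_of_isTest_omega (S := S) hd hφ
  have hσ := memL2Vec_mulA (S := S) (wgrad_spec hξ.1.1).1
  have hδ := memL2_fluxDiv hξ.1 hq
  have h := flux_identity hd hq hr hξ hv
  have e1 : S.l2R (S.fluxNormal r ξ) (S.extTrace fun x => (φ x : ℂ)) = 0 := by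
    rw [l2R]
    refine Finset.sum_eq_zero fun F hF => ?_
    rw [integral_congr_ae (g := fun _ => (0 : ℂ))]
    · simp
    filter_upwards [ae_notMem_omega hd (mem_extFaces_of_FR hF),
      extTrace_of_contDiff hd (mem_extFaces_of_FR hF) (contDiff_ofReal_comp hφ.1)] with x h1 h2
    rw [h2, hφ.eq_zero h1]; simp
  have e2 : S.l2Vec (S.mulA (wgrad S.Ω ξ)) (wgrad S.Ω fun x => (φ x : ℂ)) =
      ∫ x in S.Ω, ∑ i, ((pderiv i φ x : ℝ) : ℂ) * S.mulA (wgrad S.Ω ξ) x i := by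
    have hint : IntegrableOn (fun x => ∑ i, ((pderiv i φ x : ℝ) : ℂ) * S.mulA (wgrad S.Ω ξ) x i)
        S.Ω := integrable_finsetSum _ fun i _ => (hσ i).test_pderiv_mul hφ i
    rw [setIntegral_omega (fun K hK => hint.mono_set (cell_subset_omega hK)), l2Vec]
    refine Finset.sum_congr rfl fun K hK => integral_congr_ae ?_
    filter_upwards [ae_cell (wgrad_of_contDiff isBounded_omega isOpen_omega
      (contDiff_ofReal_comp hφ.contDiff_one)) hK] with x hx
    rw [hx, dotProduct]
    refine Finset.sum_congr rfl fun i _ => ?_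
    rw [Pi.star_apply, pderiv_ofReal (hφ.contDiff_one.differentiable (by simp) x),
      star_ofReal_fun, mul_comm]
  have e3 : S.l2 (S.fluxDiv q ξ) (fun x => (φ x : ℂ)) =
      ∫ x in S.Ω, (φ x : ℂ) * S.fluxDiv q ξ x := by
    rw [setIntegral_omega (fun K hK => (hδ.test_mul hφ).mono_set (cell_subset_omega hK)), l2]
    refine Finset.sum_congr rfl fun K hK => integral_congr_ae (.of_forall fun x => ?_)
    simp only
    rw [star_ofReal_fun, mul_comm]
  rw [e1, e2, e3] at h
  exact eq_neg_of_add_eq_zero_left h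

theorem wdiv_flux (hd : 0 < d) (hq : MemL2 S.Ω q) (hr : S.MemL2R r) (hξ : S.IsAdjoint q r ξ) :
    ∀ᵐ x ∂(volume.restrict S.Ω), wdiv S.Ω (S.mulA (wgrad S.Ω ξ)) x = S.fluxDiv q ξ x :=
  wdiv_ae_eq isOpen_omega (memL2_fluxDiv hξ.1 hq) (isWeakDiv_flux hd hq hr hξ)

theorem isNormalTrace_flux (hd : 0 < d) (hq : MemL2 S.Ω q) (hr : S.MemL2R r)
    (hξ : S.IsAdjoint q r ξ) :
    S.IsNormalTrace (S.mulA (wgrad S.Ω ξ)) (S.fluxNormal r ξ) := by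
  intro v hv
  rw [← flux_identity hd hq hr hξ hv, ← l2_conj v, l2_congr_right (wdiv_flux hd hq hr hξ), l2_conj]

theorem memX_flux (hd : 0 < d) (hq : MemL2 S.Ω q) (hr : S.MemL2R r)
    (hξ : S.IsAdjoint q r ξ) : S.MemX (S.mulA (wgrad S.Ω ξ)) :=
  ⟨⟨memL2Vec_mulA (wgrad_spec hξ.1.1).1, _, memL2_fluxDiv hξ.1 hq, isWeakDiv_flux hd hq hr hξ⟩,
    _, memL2R_fluxNormal hd hξ.1 hr, isNormalTrace_flux hd hq hr hξ⟩

variable (S) in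
/-- The form `b_h` without stabilization. -/
def bh₀ (φ v : E d → ℂ) : ℂ :=
  -(S.ω : ℂ) ^ 2 * S.l2μ φ v - Complex.I * S.ω * S.l2γ (S.extTrace φ) (S.extTrace v)
    + S.l2A (S.G φ) (S.G v)

/-- Insert the divergence and the normal trace of the flux, and use the symmetry of A to move it
onto 𝔊(φ). Since φ is only assumed to be broken, this replaces the adjoint equation, which may be
tested with conforming functions only; the defect is the price. -/
theorem defect_flux (hd : 0 < d) (hq : MemL2 S.Ω q) (hr : S.MemL2R r) (hξ : S.IsAdjoint q r ξ)
    (hφ : S.MemH1T φ) : S.defect φ (S.mulA (wgrad S.Ω ξ)) =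
      S.bh₀ φ ξ - (S.l2 φ q + S.l2R (S.extTrace φ) r) := by
  rw [defect, l2_congr_right (wdiv_flux hd hq hr hξ), l2_fluxDiv_right hξ.1 hq hφ.1,
    l2R_congr_right (normalTrace_ae_eq hd (memL2R_fluxNormal hd hξ.1 hr)
      (isNormalTrace_flux hd hq hr hξ)),
    l2R_fluxNormal_right hd hξ.1 hr (memL2R_extTrace hd hφ), l2Vec_mulA_right, bh₀,
    l2A_congr_right (G_ae_eq hd hξ.1)]
  ring

end Setting


/-! ### Discrete integration by parts: the defect vanishes for polynomial fields. -/

/-- Integration by parts on a simplex, against a function that is smooth up to the boundary. -/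
theorem IsSimplex.integral_by_parts_star {K : Finset (E d)} (h : IsSimplex K) (hd : 0 < d)
    {φ ψ Q : E d → ℂ} (hQ : ContDiff ℝ ((⊤ : ℕ∞) : WithTop ℕ∞) Q)
    (hψ : ∀ᵐ x ∂(volume.restrict (cell K)), ψ x = Q x) (hφ : MemH1 (cell K) φ) (i : Fin d) :
    (∫ x in cell K, wgrad (cell K) φ x i * star (ψ x)) +
      ∫ x in cell K, φ x * star (wgrad (cell K) ψ x i) =
      ∑ F ∈ facesOf K, ∫ x, trace K φ x * star (((nrm K F i : ℝ) : ℂ) * trace K ψ x) ∂(surf F) := by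
  have hb : Bornology.IsBounded (cell K) := (isCompact_body K).isBounded.subset (cell_subset_body K)
  have hQ1 := hQ.of_le one_le_infty
  have hc : ContDiff ℝ 1 (fun x => starRingEnd ℂ (Q x)) := Complex.conjCLE.contDiff.comp hQ1
  have hQm : MemH1 (cell K) Q := memH1_of_contDiff hb hQ1
  have hψ' : ∀ᵐ x ∂(volume.restrict (cell K)), Q x = ψ x := by
    filter_upwards [hψ] with x hx using hx.symm
  have key := h.integral_by_parts hd hc hφ i
  have e1 : ∫ x in cell K, φ x * star (wgrad (cell K) ψ x i) =
      ∫ x in cell K, pderiv i (fun x => starRingEnd ℂ (Q x)) x * φ x := by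
    refine integral_congr_ae ?_
    filter_upwards [wgrad_congr (isOpen_cell K) hQm hψ',
      wgrad_of_contDiff hb (isOpen_cell K) hQ1] with x h1 h2
    rw [h1, h2, pderiv_conj (hQ1.differentiable (by simp) x), mul_comm]
    rfl
  have e2 : ∫ x in cell K, wgrad (cell K) φ x i * star (ψ x) =
      ∫ x in cell K, starRingEnd ℂ (Q x) * wgrad (cell K) φ x i := by
    refine integral_congr_ae ?_
    filter_upwards [hψ] with x hx
    rw [hx, mul_comm]
    rfl
  rw [e1, e2, add_comm, key]
  refine Finset.sum_congr rfl fun F hF => ?_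
  rw [← integral_const_mul]
  refine integral_congr_ae ?_
  filter_upwards [h.trace_congr hd hQm hψ' hF, h.trace_of_contDiff hd hQ hF] with x h1 h2
  rw [h1, h2, star_mul', Setting.star_ofReal_fun, RCLike.star_def]
  ring

namespace Mesh

variable {T : Mesh d} {φ : E d → ℂ} {σ : E d → Fin d → ℂ} {K F : Finset (E d)} {p : ℕ}

/-- The outward normal component on the face `F` of the trace of `σ` from the element `K`. -/
def cellTrace (σ : E d → Fin d → ℂ) (K F : Finset (E d)) (x : E d) : ℂ :=
  ∑ i, ((nrm K F i : ℝ) : ℂ) * trace K (fun y => σ y i) x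

theorem memLp_cellTrace (hd : 0 < d) (hF : F ∈ T.faces) (hK : K ∈ T.cellsOf F)
    (hσ : ∀ i, T.MemH1T (fun x => σ x i)) : MemLp (cellTrace σ K F) 2 (surf F) :=
  memLp_finsetSum _ fun i _ => (memLp_trace hd hF hK (hσ i)).const_mul _

/-- Element-wise integration by parts against a piecewise polynomial vector field. -/
theorem l2Vec_bgrad_add (hd : 0 < d) (hφ : T.MemH1T φ) (hσ : T.MemPVec p σ) :
    T.l2Vec (T.bgrad φ) σ +
      ∑ K ∈ T.cells, ∫ x in cell K, φ x * star (∑ i, wgrad (cell K) (fun y => σ y i) x i) =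
    ∑ F ∈ T.faces, ∫ x, ∑ K ∈ T.cellsOf F, trace K φ x * star (cellTrace σ K F x) ∂(surf F) := by
  have hσH : ∀ i, T.MemH1T (fun x => σ x i) := fun i => memH1T_of_memP (hσ i)
  have e1 : ∀ F ∈ T.faces,
      ∫ x, ∑ K ∈ T.cellsOf F, trace K φ x * star (cellTrace σ K F x) ∂(surf F) =
      ∑ K ∈ T.cellsOf F, ∫ x, trace K φ x * star (cellTrace σ K F x) ∂(surf F) := fun F hF =>
    integral_finsetSum _ fun K hK => integrable_mul_star (memLp_trace hd hF hK hφ)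
      (memLp_cellTrace hd hF hK hσH)
  rw [Finset.sum_congr rfl e1, ← sum_cells_facesOf
    (fun K F => ∫ x, trace K φ x * star (cellTrace σ K F x) ∂(surf F)), l2Vec,
    ← Finset.sum_add_distrib]
  refine Finset.sum_congr rfl fun K hK => ?_
  have hs := T.isSimplex hK
  have e2 : ∫ x in cell K, T.bgrad φ x ⬝ᵥ star (σ x) =
      ∑ i, ∫ x in cell K, wgrad (cell K) φ x i * star (σ x i) := by
    rw [← integral_finsetSum _ fun i _ => integrable_mul_star ((wgrad_spec (hφ.2 K hK)).1 i)
      ((hσH i).2 K hK).1]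
    refine integral_congr_ae ?_
    filter_upwards [ae_bgrad hK φ] with x hx
    rw [hx]; rfl
  have e3 : ∫ x in cell K, φ x * star (∑ i, wgrad (cell K) (fun y => σ y i) x i) =
      ∑ i, ∫ x in cell K, φ x * star (wgrad (cell K) (fun y => σ y i) x i) := by
    rw [← integral_finsetSum _ fun i _ => integrable_mul_star (hφ.2 K hK).1
      ((wgrad_spec ((hσH i).2 K hK)).1 i)]
    refine integral_congr_ae (.of_forall fun x => ?_)
    simp only [star_sum, Finset.mul_sum]
  have e4 : ∀ F ∈ facesOf K, ∫ x, trace K φ x * star (cellTrace σ K F x) ∂(surf F) =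
      ∑ i, ∫ x, trace K φ x * star (((nrm K F i : ℝ) : ℂ) * trace K (fun y => σ y i) x)
        ∂(surf F) := fun F hF => by
    have hF' := mem_faces_of_mem_facesOf hK hF
    have hKF := mem_cellsOf_of_mem_facesOf hK hF
    rw [← integral_finsetSum _ fun i _ => integrable_mul_star (memLp_trace hd hF' hKF hφ)
      ((memLp_trace hd hF' hKF (hσH i)).const_mul _)]
    refine integral_congr_ae (.of_forall fun x => ?_)
    simp only [cellTrace, star_sum, Finset.mul_sum]
  rw [e2, e3, ← Finset.sum_add_distrib, Finset.sum_congr rfl e4, Finset.sum_comm]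
  refine Finset.sum_congr rfl fun i _ => ?_
  obtain ⟨Q, -, hQ⟩ := hσ i K hK
  exact hs.integral_by_parts_star hd (contDiff_polyFun Q) hQ (hφ.2 K hK) i

/-- Restricted to an element, both sides are weak divergences of the same field, and weak
divergences are unique. -/
theorem wdiv_ae_eq_sum (hσ : ∀ i, T.MemH1T (fun x => σ x i)) (h : MemHdiv T.Ω σ)
    (hK : K ∈ T.cells) : ∀ᵐ x ∂(volume.restrict (cell K)),
      wdiv T.Ω σ x = ∑ i, wgrad (cell K) (fun y => σ y i) x i := by
  have hs := fun i => wgrad_spec ((hσ i).2 K hK)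
  refine IsWeakDiv.unique (isOpen_cell K) ((wdiv_spec h).2.mono (cell_subset_omega hK)) ?_
    ((wdiv_spec h).1.mono (cell_subset_omega hK)) (memLp_finsetSum _ fun i _ => (hs i).1 i)
  intro φ hφ
  rw [integral_finsetSum _ fun i _ => ((hσ i).2 K hK).1.test_pderiv_mul hφ i,
    Finset.sum_congr rfl fun i _ => (hs i).2 φ hφ i, Finset.sum_neg_distrib,
    ← integral_finsetSum _ fun i _ => ((hs i).1 i).test_mul hφ]
  congr 1
  refine integral_congr_ae (.of_forall fun x => ?_)
  simp only [Finset.mul_sum]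

theorem l2Vec_bgrad_add_l2_wdiv (hd : 0 < d) (hφ : T.MemH1T φ) (hσ : T.MemPVec p σ)
    (h : MemHdiv T.Ω σ) : T.l2Vec (T.bgrad φ) σ + T.l2 φ (wdiv T.Ω σ) =
    ∑ F ∈ T.faces, ∫ x, ∑ K ∈ T.cellsOf F, trace K φ x * star (cellTrace σ K F x) ∂(surf F) := by
  rw [← l2Vec_bgrad_add hd hφ hσ, l2]
  congr 1
  refine Finset.sum_congr rfl fun K hK => integral_congr_ae ?_
  filter_upwards [wdiv_ae_eq_sum (fun i => memH1T_of_memP (hσ i)) h hK] with x hx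
  rw [hx]

end Mesh

namespace Setting

open Mesh

variable {S : Setting d} {φ : E d → ℂ} {σ τ : E d → Fin d → ℂ} {K F : Finset (E d)} {p : ℕ}

/-- On a face outside `Γ_D`, the sum of the normal traces of a piecewise polynomial field in
`X_{Γ_N}(div, Ω)` is its normal trace on `Γ_R`, and zero elsewhere. -/
theorem sum_cellTrace_ae_eq (hd : 0 < d) (hσ : S.MemPVec p σ) (h : S.MemX σ) (hF : F ∈ S.faces)
    (hFD : F ∉ S.FD) : ∀ᵐ x ∂(surf F), ∑ K ∈ S.cellsOf F, cellTrace σ K F x =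
      if F ∈ S.FR then S.normalTrace σ F x else 0 := by
  have hσH : ∀ i, S.MemH1T (fun x => σ x i) := memH1T_of_memPVec hσ
  have hfin := isFiniteMeasure_surf hd hF
  have m1 : MemLp (fun x => ∑ K ∈ S.cellsOf F, cellTrace σ K F x) 2 (surf F) :=
    memLp_finsetSum _ fun K hK => memLp_cellTrace hd hF hK hσH
  have m2 : MemLp (fun x => if F ∈ S.FR then S.normalTrace σ F x else 0) 2 (surf F) := by
    split_ifs with hR
    · exact h.normalTrace_spec.1 F hR
    · exact MemLp.zero
  have key : ∀ᵐ x ∂(surf F), (∑ K ∈ S.cellsOf F, cellTrace σ K F x) -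
      (if F ∈ S.FR then S.normalTrace σ F x else 0) = 0 := by
    refine ae_eq_zero_of_integral_surf hd hF isOpen_univ (.of_forall fun _ => Set.mem_univ _)
      (m1.sub m2) fun φ hφ => ?_
    have hφ' := hφ.mono Set.inter_subset_left
    have hv := memH1D_of_isTest_awayFrom (S := S) hd hφ' hFD
    have i : ∀ u : E d → ℂ, MemLp u 2 (surf F) → Integrable (fun x => (φ x : ℂ) * u x) (surf F) :=
      fun u hu => MemLp.integrable_mul (hφ'.memLp (surf F)) hu
    -- The pairing of σ with a test function localised at F is computed twice: by the weak normal
    -- trace, and by element-wise integration by parts, where F is the only remaining face.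
    have e0 := congrArg star (h.normalTrace_spec.2 _ hv)
    rw [l2R_extTrace_of_isTest hd hφ', star_add, l2Vec_conj, l2_conj,
      ← l2Vec_congr_left (bgrad_ae_eq hv.1), l2Vec_bgrad_add_l2_wdiv hd hv.memH1T hσ h.1] at e0
    have e1 : ∀ F' ∈ S.faces, ∫ x, ∑ K ∈ S.cellsOf F', trace K (fun x => (φ x : ℂ)) x *
        star (cellTrace σ K F' x) ∂(surf F') =
        ∫ x, (φ x : ℂ) * star (∑ K ∈ S.cellsOf F', cellTrace σ K F' x) ∂(surf F') := by
      intro F' hF'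
      refine integral_congr_ae ?_
      filter_upwards [trace_of_contDiff hd hF' (contDiff_ofReal_comp hφ.1)] with x hx
      rw [star_sum, Finset.mul_sum]
      exact Finset.sum_congr rfl fun K hK => by rw [hx K hK]
    rw [Finset.sum_congr rfl e1, Finset.sum_eq_single_of_mem F hF fun F' hF' hne =>
      integral_surf_eq_zero fun x hx => by
        rw [eq_zero_of_tsupport hF' hne hφ'.2.2 hx, Complex.ofReal_zero]] at e0
    have e2 := congrArg star e0
    rw [star_star, integral_mul_star_conj] at e2
    have e3 : ∫ x, (∑ K ∈ S.cellsOf F, cellTrace σ K F x) * star (φ x : ℂ) ∂(surf F) =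
        ∫ x, (φ x : ℂ) * ∑ K ∈ S.cellsOf F, cellTrace σ K F x ∂(surf F) :=
      integral_congr_ae (.of_forall fun x => by simp only [star_ofReal_fun, mul_comm])
    have e4 : ∫ x, (φ x : ℂ) * (if F ∈ S.FR then S.normalTrace σ F x else 0) ∂(surf F) =
        if F ∈ S.FR then ∫ x, (φ x : ℂ) * S.normalTrace σ F x ∂(surf F) else 0 := by
      split_ifs <;> simp
    simp only [mul_sub]
    rw [integral_sub (i _ m1) (i _ m2), e4, ← e2, e3, sub_self]
  filter_upwards [key] with x hx
  exact sub_eq_zero.1 hx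

/-- The integrand on a face in the discrete integration by parts formula. -/
theorem sum_trace_mul_cellTrace_ae_eq (hd : 0 < d) (hσ : S.MemPVec p σ) (h : S.MemX σ)
    (hF : F ∈ S.faces) (φ : E d → ℂ) : ∀ᵐ x ∂(surf F),
      ∑ K ∈ S.cellsOf F, trace K φ x * star (cellTrace σ K F x) =
        S.jump φ F x * star (S.avg σ F x ⬝ᵥ (fun i => ((S.nF F i : ℝ) : ℂ))) +
          if F ∈ S.FR then S.extTrace φ F x * star (S.normalTrace σ F x) else 0 := by
  obtain ⟨K, hK, hn⟩ := S.nF_spec F hF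
  by_cases hext : F ∈ S.extFaces
  · obtain ⟨L, hL⟩ := exists_cellsOf_eq_of_ext hext
    have hKL : K = L := by rw [hL] at hK; exact Finset.mem_singleton.1 hK
    subst hKL
    have e1 : ∀ x, S.extTrace φ F x = trace K φ x := fun x => by simp [extTrace, hL]
    have e2 : ∀ x, S.avg σ F x ⬝ᵥ (fun i => ((S.nF F i : ℝ) : ℂ)) = cellTrace σ K F x := fun x => by
      simp [avg, hL, hn, cellTrace, dotProduct, mul_comm]
    -- On a Dirichlet face the jump is the whole trace, so the product is matched with no condition
    -- on σ. On the other exterior faces the jump is zero by convention, and the normal component of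
    -- σ is the Robin trace or zero.
    by_cases hD : F ∈ S.FD
    · have hR : F ∉ S.FR := fun h => notMem_FD_of_FR h hD
      refine .of_forall fun x => ?_
      rw [if_neg hR, e2, jump, if_pos hext, if_pos hD, e1, hL, Finset.sum_singleton, add_zero]
    · filter_upwards [sum_cellTrace_ae_eq hd hσ h hF hD] with x hx
      rw [jump, if_pos hext, if_neg hD, zero_mul, zero_add, e1, hL, Finset.sum_singleton]
      rw [hL, Finset.sum_singleton] at hx
      rw [hx]
      split_ifs <;> simp
  · obtain ⟨K', L, hne, hc⟩ := exists_pair_of_notMem_extFaces hd hF hext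
    have hD : F ∉ S.FD := fun h => hext (mem_extFaces_of_FD h)
    have hR : F ∉ S.FR := fun h => hext (mem_extFaces_of_FR h)
    obtain ⟨L, hne, hc⟩ : ∃ L, K ≠ L ∧ S.cellsOf F = {K, L} := by
      rw [hc, Finset.mem_insert, Finset.mem_singleton] at hK
      rcases hK with rfl | rfl
      · exact ⟨L, hne, hc⟩
      · exact ⟨K', hne.symm, by rw [hc, Finset.pair_comm]⟩
    have hLF : L ∈ S.cellsOf F := by rw [hc]; simp
    have hnL := nrm_eq_neg hd hF hK hLF hne
    have hn1 : (inner ℝ (nrm K F) (nrm K F) : ℝ) = 1 := by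
      rw [real_inner_self_eq_norm_sq, norm_nrm hd hF hK]; norm_num
    filter_upwards [sum_cellTrace_ae_eq hd hσ h hF hD] with x hx
    rw [if_neg hR, hc, Finset.sum_pair hne] at hx
    have hj : S.jump φ F x = trace K φ x - trace L φ x := by
      rw [jump, if_neg hext, hc, Finset.sum_pair hne, hn, hnL, inner_neg_left, hn1]
      push_cast; ring
    have ha : S.avg σ F x ⬝ᵥ (fun i => ((S.nF F i : ℝ) : ℂ)) =
        (cellTrace σ K F x - cellTrace σ L F x) / 2 := by
      have hcard : ((({K, L} : Finset (Finset (E d))).card : ℕ) : ℂ) = 2 := by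
        rw [Finset.card_pair hne]; norm_num
      simp only [dotProduct, avg, hc, hcard, Finset.sum_pair hne, hn, cellTrace, hnL]
      rw [← Finset.sum_sub_distrib, Finset.sum_div]
      refine Finset.sum_congr rfl fun i _ => ?_
      simp only [PiLp.neg_apply]
      push_cast; ring
    -- The two outward normal components cancel, so of the usual splitting into [φ]{σ}·n and
    -- {φ}[σ]·n only the first product survives.
    have hL' : cellTrace σ L F x = -cellTrace σ K F x := by linear_combination hx
    rw [if_neg hR, hc, Finset.sum_pair hne, hj, ha, hL', star_neg, add_zero, sub_neg_eq_add,
      ← two_mul, mul_div_cancel_left₀ _ two_ne_zero]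
    ring

/-- The defect vanishes for piecewise polynomial fields. -/
theorem defect_eq_zero_of_memPVec (hd : 0 < d) (hφ : S.MemH1T φ) (hσ : S.MemPVec S.p σ)
    (h : S.MemX σ) : S.defect φ σ = 0 := by
  have hσH : ∀ i, S.MemH1T (fun x => σ x i) := memH1T_of_memPVec hσ
  have e1 : S.l2Vec (S.G φ) σ = S.l2Vec (S.bgrad φ) σ + (-1) * S.l2Vec (S.lift φ) σ :=
    l2Vec_left (memL2Vec_bgrad hφ) (memL2Vec_lift hd hφ) hσ.memL2Vec
      (.of_forall fun x => by rw [G, neg_one_smul, sub_eq_add_neg])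
  have e2 : S.l2R (S.extTrace φ) (S.normalTrace σ) = ∑ F ∈ S.faces,
      if F ∈ S.FR then ∫ x, S.extTrace φ F x * star (S.normalTrace σ F x) ∂(surf F) else 0 := by
    rw [Finset.sum_ite_mem, Finset.inter_eq_right.2 fun F hF => mem_faces_of_FR hF, l2R]
  rw [defect, e1, (isLift_lift hd hφ).2 σ hσ, e2]
  have e3 := l2Vec_bgrad_add_l2_wdiv hd hφ hσ h.1
  have e4 : ∀ F ∈ S.faces,
      ∫ x, ∑ K ∈ S.cellsOf F, trace K φ x * star (cellTrace σ K F x) ∂(surf F) =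
      (∫ x, S.jump φ F x * star (S.avg σ F x ⬝ᵥ (fun i => ((S.nF F i : ℝ) : ℂ))) ∂(surf F)) +
        if F ∈ S.FR then ∫ x, S.extTrace φ F x * star (S.normalTrace σ F x) ∂(surf F) else 0 := by
    intro F hF
    have i1 := integrable_mul_star (memLp_jump hd hF hφ) (memLp_avg_nF hd hF hσH)
    rw [integral_congr_ae (sum_trace_mul_cellTrace_ae_eq hd hσ h hF φ)]
    by_cases hR : F ∈ S.FR
    · simp only [if_pos hR]
      exact integral_add i1 (integrable_mul_star (memLp_extTrace hd hF hφ)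
        (h.normalTrace_spec.1 F hR))
    · simp only [if_neg hR, add_zero]
  rw [Finset.sum_congr rfl e4, Finset.sum_add_distrib] at e3
  linear_combination e3

end Setting


/-! ### Bounding the defect in the mesh-dependent norms. -/

theorem size_pos {K : Finset (E d)} (hK : 1 < K.card) : 0 < size K := by
  obtain ⟨a, ha, b, hb, hab⟩ := Finset.one_lt_card.1 hK
  exact (dist_pos.2 hab).trans_le (Metric.dist_le_diam_of_mem (isCompact_body K).isBounded
    (subset_convexHull ℝ _ ha) (subset_convexHull ℝ _ hb))

namespace Setting

open Mesh

variable {S : Setting d} {v v' φ φ' : E d → ℂ} {σ τ τ' : E d → Fin d → ℂ} {K F : Finset (E d)}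

theorem size_pos_of_cell (hd : 0 < d) (hK : K ∈ S.cells) : 0 < size K :=
  size_pos (by rw [S.card_cell K hK]; omega)

/-- For d = 1 a face would be a single point of diameter zero; with d > 1 it has two distinct
vertices, and the weights α_F / h_F are meaningful. -/
theorem size_pos_of_face (hd : 1 < d) (hF : F ∈ S.faces) : 0 < size F :=
  size_pos (by rw [card_face hF]; exact hd)

theorem αF_pos (hd : 0 < d) (hF : F ∈ S.faces) : 0 < S.αF F :=
  Finset.sum_pos (fun _ hK => α_pos hd (mem_cellsOf.1 hK).1) (cellsOf_nonempty hF)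

theorem dag1_sq (hd : 0 < d) (v : E d → ℂ) : S.dag1 v ^ 2 = ∑ K ∈ S.cells,
      (max 1 (S.ω ^ 2 * size K ^ 2 / S.ϑ K ^ 2) * (S.α K / size K ^ 2)
          * (∫ x in cell K, ‖v x‖ ^ 2)
        + ∫ x in cell K, ((S.Ac K *ᵥ S.G v x) ⬝ᵥ star (S.G v x)).re)
    + ∑ F ∈ S.FR, max 1 (S.ω * size F / S.ϑF F) * (S.αF F / size F)
        * ∫ x, ‖S.extTrace v F x‖ ^ 2 ∂(surf F) := by
  refine Real.sq_sqrt (add_nonneg (Finset.sum_nonneg fun K hK => add_nonneg (mul_nonneg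
    (mul_nonneg (by positivity) (div_nonneg (α_pos hd hK).le (by positivity)))
    (integral_nonneg fun _ => by positivity)) (integral_nonneg fun _ =>
      re_form_nonneg (S.A_posDef K hK) _)) (Finset.sum_nonneg fun F hF => mul_nonneg
    (mul_nonneg (by positivity) (div_nonneg (αF_pos hd (mem_faces_of_FR hF)).le
      Metric.diam_nonneg)) (integral_nonneg fun _ => by positivity)))

theorem dagDiv_sq (hd : 0 < d) (w : E d → Fin d → ℂ) : S.dagDiv w ^ 2 = ∑ K ∈ S.cells,
      ((∫ x in cell K, (((S.Ac K)⁻¹ *ᵥ w x) ⬝ᵥ star (w x)).re)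
        + size K ^ 2 / S.α K * ∫ x in cell K, ‖wdiv S.Ω w x‖ ^ 2)
    + ∑ F ∈ S.FR, size F / S.αF F * ∫ x, ‖S.normalTrace w F x‖ ^ 2 ∂(surf F) := by
  refine Real.sq_sqrt (add_nonneg (Finset.sum_nonneg fun K hK => add_nonneg
    (integral_nonneg fun _ => re_inv_form_nonneg (S.A_posDef K hK) _) (mul_nonneg
    (div_nonneg (by positivity) (α_pos hd hK).le)
    (integral_nonneg fun _ => by positivity))) (Finset.sum_nonneg fun F hF => mul_nonneg
    (div_nonneg Metric.diam_nonneg (αF_pos hd (mem_faces_of_FR hF)).le)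
    (integral_nonneg fun _ => by positivity)))

theorem dag1_nonneg (v : E d → ℂ) : 0 ≤ S.dag1 v := Real.sqrt_nonneg _

theorem dagDiv_nonneg (w : E d → Fin d → ℂ) : 0 ≤ S.dagDiv w := Real.sqrt_nonneg _

theorem norm_integral_dot_le (hσ : MemL2Vec S.Ω σ) (hτ : MemL2Vec S.Ω τ) (hK : K ∈ S.cells) {t : ℝ}
    (ht : 0 < t) : ‖∫ x in cell K, σ x ⬝ᵥ star (τ x)‖ ≤
      (t * (∫ x in cell K, ((S.Ac K *ᵥ σ x) ⬝ᵥ star (σ x)).re) +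
        t⁻¹ * ∫ x in cell K, (((S.Ac K)⁻¹ *ᵥ τ x) ⬝ᵥ star (τ x)).re) / 2 := by
  refine (norm_integral_le_integral_norm _).trans ?_
  have i1 := (integrable_re_form hσ (S.Ac K) hK).const_mul t
  have i2 := (integrable_re_form hτ (S.Ac K)⁻¹ hK).const_mul t⁻¹
  rw [← integral_const_mul, ← integral_const_mul, ← integral_add i1 i2, ← integral_div]
  exact integral_mono (integrable_dot (memL2Vec_cell hσ hK) (memL2Vec_cell hτ hK)).norm
    ((i1.add i2).div_const 2) fun x => norm_dotProduct_le (S.A_posDef K hK) _ _ ht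

/-- The duality defect is controlled by the mesh-dependent norms. -/
theorem norm_defect_le (hd : 1 < d) (hφ : S.MemH1T φ) (hτ : S.MemX τ) :
    ‖S.defect φ τ‖ ≤ S.dag1 φ * S.dagDiv τ := by
  have hd0 : 0 < d := by omega
  refine le_mul_of_forall_weight (dag1_nonneg _) (dagDiv_nonneg _) fun t ht => ?_
  rw [dag1_sq hd0, dagDiv_sq hd0, defect]
  refine (norm_sub_le _ _).trans ((add_le_add_left (norm_add_le _ _) _).trans ?_)
  have h1 : ‖S.l2Vec (S.G φ) τ‖ + ‖S.l2 φ (wdiv S.Ω τ)‖ ≤ ∑ K ∈ S.cells,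
      (t * (max 1 (S.ω ^ 2 * size K ^ 2 / S.ϑ K ^ 2) * (S.α K / size K ^ 2)
          * (∫ x in cell K, ‖φ x‖ ^ 2)
        + ∫ x in cell K, ((S.Ac K *ᵥ S.G φ x) ⬝ᵥ star (S.G φ x)).re) +
      t⁻¹ * ((∫ x in cell K, (((S.Ac K)⁻¹ *ᵥ τ x) ⬝ᵥ star (τ x)).re)
        + size K ^ 2 / S.α K * ∫ x in cell K, ‖wdiv S.Ω τ x‖ ^ 2)) / 2 := by
    rw [l2Vec, l2]
    refine (add_le_add (norm_sum_le _ _) (norm_sum_le _ _)).trans ?_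
    rw [← Finset.sum_add_distrib]
    refine Finset.sum_le_sum fun K hK => ?_
    have ha := α_pos hd0 hK
    have hs := size_pos_of_cell hd0 hK
    have e1 := norm_integral_dot_le (memL2Vec_G hd0 hφ) hτ.1.1 hK ht
    -- This weight distributes the factors as in the two norms: α_K/h_K² goes with φ and h_K²/α_K
    -- with the divergence. The maximum in the first norm is only used as being at least 1.
    have hc : 0 < t * (S.α K / size K ^ 2) := by positivity
    have e2 := norm_integral_mul_star_le (memL2_cell hφ.1 hK)
      (memL2_cell (wdiv_spec hτ.1).1 hK) hc
    have hI : 0 ≤ ∫ x in cell K, ‖φ x‖ ^ 2 := integral_nonneg fun _ => by positivity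
    have e3 : S.α K / size K ^ 2 * (∫ x in cell K, ‖φ x‖ ^ 2) ≤
        max 1 (S.ω ^ 2 * size K ^ 2 / S.ϑ K ^ 2) * (S.α K / size K ^ 2) *
          ∫ x in cell K, ‖φ x‖ ^ 2 := by
      refine mul_le_mul_of_nonneg_right ?_ hI
      exact le_mul_of_one_le_left (by positivity) (le_max_left _ _)
    have e4 := mul_le_mul_of_nonneg_left e3 ht.le
    have e5 : (t * (S.α K / size K ^ 2))⁻¹ = t⁻¹ * (size K ^ 2 / S.α K) := by
      rw [mul_inv, inv_div]
    rw [e5] at e2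
    linarith
  have h2 : ‖S.l2R (S.extTrace φ) (S.normalTrace τ)‖ ≤ ∑ F ∈ S.FR,
      (t * (max 1 (S.ω * size F / S.ϑF F) * (S.αF F / size F)
        * ∫ x, ‖S.extTrace φ F x‖ ^ 2 ∂(surf F)) +
      t⁻¹ * (size F / S.αF F * ∫ x, ‖S.normalTrace τ F x‖ ^ 2 ∂(surf F))) / 2 := by
    rw [l2R]
    refine (norm_sum_le _ _).trans (Finset.sum_le_sum fun F hF => ?_)
    have ha := αF_pos hd0 (mem_faces_of_FR hF)
    have hs := size_pos_of_face hd (mem_faces_of_FR hF)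
    have hc : 0 < t * (S.αF F / size F) := by positivity
    have e2 := norm_integral_mul_star_le (memL2R_extTrace hd0 hφ F hF)
      (hτ.normalTrace_spec.1 F hF) hc
    have hI : 0 ≤ ∫ x, ‖S.extTrace φ F x‖ ^ 2 ∂(surf F) := integral_nonneg fun _ => by positivity
    have e3 : S.αF F / size F * (∫ x, ‖S.extTrace φ F x‖ ^ 2 ∂(surf F)) ≤
        max 1 (S.ω * size F / S.ϑF F) * (S.αF F / size F) *
          ∫ x, ‖S.extTrace φ F x‖ ^ 2 ∂(surf F) := by
      refine mul_le_mul_of_nonneg_right ?_ hI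
      exact le_mul_of_one_le_left (by positivity) (le_max_left _ _)
    have e4 := mul_le_mul_of_nonneg_left e3 ht.le
    have e5 : (t * (S.αF F / size F))⁻¹ = t⁻¹ * (size F / S.αF F) := by
      rw [mul_inv, inv_div]
    rw [e5] at e2
    linarith
  refine (add_le_add h1 h2).trans (le_of_eq ?_)
  rw [← Finset.sum_div, ← Finset.sum_div, Finset.sum_add_distrib, Finset.sum_add_distrib,
    ← Finset.mul_sum, ← Finset.mul_sum, ← Finset.mul_sum, ← Finset.mul_sum]
  ring

end Setting


/-! ### Galerkin orthogonality, residual bounds and the duality argument. -/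

theorem le_mul_biInf {ι : Type*} {P : ι → Prop} {f : ι → ℝ≥0∞} {x a : ℝ≥0∞} (ha : a ≠ ∞)
    (hne : ∃ i, P i) (h : ∀ i, P i → x ≤ a * f i) : x ≤ a * ⨅ (i) (_ : P i), f i := by
  have hne' : Nonempty {i // P i} := let ⟨i, hi⟩ := hne; ⟨⟨i, hi⟩⟩
  rw [iInf_subtype', ENNReal.mul_iInf' (fun h => absurd h ha) (fun _ => hne')]
  exact le_iInf fun i => h i i.2

/-- The Cauchy-Schwarz inequality for pairs. -/
theorem mul_add_mul_le_rpow (a b a' b' : ℝ≥0∞) :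
    a * a' + b * b' ≤ (a ^ 2 + b ^ 2) ^ (1 / 2 : ℝ) * (a' ^ 2 + b' ^ 2) ^ (1 / 2 : ℝ) := by
  have h := ENNReal.inner_le_Lp_mul_Lq (Finset.univ : Finset (Fin 2)) ![a, b] ![a', b']
    Real.HolderConjugate.two_two
  simpa [Fin.sum_univ_two] using h

theorem sub_eq_add_smul (u v : E d → ℂ) : u - v = u + (-1 : ℂ) • v := by
  rw [neg_one_smul, sub_eq_add_neg]

theorem Mesh.MemH1T.sub {T : Mesh d} {v v' : E d → ℂ} (hv : T.MemH1T v) (hv' : T.MemH1T v') :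
    T.MemH1T (v - v') :=
  sub_eq_add_smul v v' ▸ hv.add_smul hv' (-1)

namespace Setting

open Mesh

variable {S : Setting d} {v v' φ φ' ξ f u uh e q : E d → ℂ} {σ τ τ' : E d → Fin d → ℂ}
  {K F : Finset (E d)} {r : FaceFun d} {s : (E d → ℂ) → (E d → ℂ) → ℂ}

/-- The second entries of the maxima are tuned for this: (ω²h_K²/ϑ_K²)(α_K/h_K²) = ω²μ_K and
(ωh_F/ϑ_F)(α_F/h_F) = ωγ_F. -/
theorem energy_le_dag1 (hd : 1 < d) (hv : S.MemH1D v) : S.energy v ≤ S.dag1 v := by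
  have hd0 : 0 < d := by omega
  have hω := S.ω_pos
  refine Real.sqrt_le_sqrt ?_
  rw [normμ_sq, normγ_sq, normA_sq, Finset.mul_sum, Finset.mul_sum, add_right_comm,
    ← Finset.sum_add_distrib]
  refine add_le_add (Finset.sum_le_sum fun K hK => add_le_add ?_ (le_of_eq ?_))
    (Finset.sum_le_sum fun F hF => ?_)
  · rw [← mul_assoc]
    refine mul_le_mul_of_nonneg_right ?_ (integral_nonneg fun _ => by positivity)
    have ha := α_pos hd0 hK
    have hμ := S.μ_pos K hK
    have hs := size_pos_of_cell hd0 hK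
    refine le_trans (le_of_eq ?_) (mul_le_mul_of_nonneg_right (le_max_right _ _) (by positivity))
    rw [ϑ, Real.sq_sqrt (by positivity)]
    field_simp
  · refine integral_congr_ae ?_
    filter_upwards [ae_cell (G_ae_eq hd0 hv) hK] with x hx
    rw [hx]
  · rw [← mul_assoc]
    refine mul_le_mul_of_nonneg_right ?_ (integral_nonneg fun _ => by positivity)
    have ha := αF_pos hd0 (mem_faces_of_FR hF)
    have hγ := S.γ_pos F hF
    have hs := size_pos_of_face hd (mem_faces_of_FR hF)
    refine le_trans (le_of_eq ?_) (mul_le_mul_of_nonneg_right (le_max_right _ _) (by positivity))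
    rw [ϑF]
    field_simp

theorem normA_le_energy (v : E d → ℂ) : S.normA (wgrad S.Ω v) ≤ S.energy v := by
  refine Real.le_sqrt_of_sq_le (le_add_of_nonneg_left ?_)
  have := S.ω_pos
  positivity

theorem norm_l2A_le_mul (hσ : MemL2Vec S.Ω σ) (hτ : MemL2Vec S.Ω τ) :
    ‖S.l2A σ τ‖ ≤ S.normA σ * S.normA τ :=
  le_mul_of_forall_weight (Real.sqrt_nonneg _) (Real.sqrt_nonneg _) fun _ ht =>
    norm_l2A_le hσ hτ ht

/-! #### The discrete form -/

theorem bh₀_left (hd : 0 < d) (hφ : S.MemH1T φ) (hφ' : S.MemH1T φ') (hv : S.MemH1T v) (c : ℂ) :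
    S.bh₀ (φ + c • φ') v = S.bh₀ φ v + c * S.bh₀ φ' v := by
  rw [bh₀, bh₀, bh₀,
    l2μ_left (c := c) hφ.1 hφ'.1 hv.1 (ae_add_smul_apply _ _ _),
    l2γ_left (memL2R_extTrace hd hφ) (memL2R_extTrace hd hφ')
      (memL2R_extTrace hd hv) (ae_extTrace_add_smul hd hφ hφ' c),
    l2A_left (memL2Vec_G hd hφ) (memL2Vec_G hd hφ') (memL2Vec_G hd hv) (G_add_smul hd hφ hφ' c)]
  ring

theorem bh₀_right (hd : 0 < d) (hφ : S.MemH1T φ) (hv : S.MemH1T v) (hv' : S.MemH1T v') (c : ℂ) :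
    S.bh₀ φ (v + c • v') = S.bh₀ φ v + star c * S.bh₀ φ v' := by
  rw [bh₀, bh₀, bh₀, ← l2μ_conj (v + c • v'), ← l2γ_conj (S.extTrace (v + c • v')),
    ← l2A_conj (S.G (v + c • v')),
    l2μ_left (c := c) hv.1 hv'.1 hφ.1 (ae_add_smul_apply _ _ _),
    l2γ_left (memL2R_extTrace hd hv) (memL2R_extTrace hd hv')
      (memL2R_extTrace hd hφ) (ae_extTrace_add_smul hd hv hv' c),
    l2A_left (memL2Vec_G hd hv) (memL2Vec_G hd hv') (memL2Vec_G hd hφ) (G_add_smul hd hv hv' c),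
    star_add, star_add, star_add, star_mul', star_mul', star_mul', l2μ_conj, l2μ_conj, l2γ_conj,
    l2γ_conj, l2A_conj, l2A_conj]
  ring

theorem bh_eq_bh₀ (hs : S.IsStabilization s) (hφ : S.MemH1T φ) (hv : S.MemH1D v) :
    S.bh s φ v = S.bh₀ φ v := by
  rw [bh, ah, hs.zero_right φ v hφ hv, add_zero, bh₀]

theorem bh₀_eq_b (hd : 0 < d) (hφ : S.MemH1D φ) (hv : S.MemH1D v) : S.bh₀ φ v = S.b φ v := by
  rw [bh₀, b, l2A_congr_left (G_ae_eq hd hφ), l2A_congr_right (G_ae_eq hd hv)]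

/-- A crude continuity bound with a finite constant depending on φ. It serves only to settle the
product ∞ · 0 when the residual norm is infinite. -/
theorem norm_bh₀_le (hd : 1 < d) (hφ : S.MemH1T φ) (hv : S.MemH1D v) :
    ‖S.bh₀ φ v‖ ≤ (S.ω * S.normμ φ + √S.ω * S.normγ (S.extTrace φ) + S.normA (S.G φ)) *
      S.dag1 v := by
  have hd0 : 0 < d := by omega
  have hω := S.ω_pos
  have hE := energy_le_dag1 hd hv
  have h1 := norm_l2μ_le_mul hφ.1 hv.1.1
  have h2 := norm_l2γ_le_mul (memL2R_extTrace hd0 hφ) (memL2R_extTrace hd0 hv.memH1T)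
  have h3 := norm_l2A_le_mul (memL2Vec_G hd0 hφ) (wgrad_spec hv.1).1
  have g1 := (ω_mul_normμ_le v).trans hE
  have g2 := (sqrt_ω_mul_normγ_le v).trans hE
  have g3 := (normA_le_energy v).trans hE
  have n1 : 0 ≤ S.normμ φ := Real.sqrt_nonneg _
  have n2 : 0 ≤ S.normγ (S.extTrace φ) := Real.sqrt_nonneg _
  have n3 : 0 ≤ S.normA (S.G φ) := Real.sqrt_nonneg _
  have k1 := mul_le_mul_of_nonneg_left g1 (mul_nonneg hω.le n1)
  have k2 := mul_le_mul_of_nonneg_left g2 (mul_nonneg (Real.sqrt_nonneg S.ω) n2)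
  have k3 := mul_le_mul_of_nonneg_left g3 n3
  have hsq := Real.mul_self_sqrt hω.le
  rw [bh₀, l2A_congr_right (G_ae_eq hd0 hv)]
  refine (norm_add_le _ _).trans ((add_le_add_left (norm_sub_le _ _) _).trans ?_)
  rw [norm_mul, norm_mul, norm_mul, norm_neg, norm_pow, Complex.norm_I, Complex.norm_real,
    Real.norm_of_nonneg hω.le, one_mul]
  have m1 := mul_le_mul_of_nonneg_left h1 (sq_nonneg S.ω)
  have m2 := mul_le_mul_of_nonneg_left h2 hω.le
  have e2 : √S.ω * S.normγ (S.extTrace φ) * (√S.ω * S.normγ (S.extTrace v)) =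
    S.ω * (S.normγ (S.extTrace φ) * S.normγ (S.extTrace v)) := by
    linear_combination (S.normγ (S.extTrace φ) * S.normγ (S.extTrace v)) * hsq
  rw [e2] at k2
  nlinarith

/-! #### The error -/

theorem MemH1D.sub (hd : 0 < d) (hv : S.MemH1D v) (hv' : S.MemH1D v') : S.MemH1D (v - v') :=
  sub_eq_add_smul v v' ▸ hv.add_smul hd hv' (-1)

/-- A conforming piecewise polynomial is a test function of both problems. There b_h agrees with b
on u, the stabilization is zero, and the right-hand sides cancel. -/
theorem bh₀_error_eq_zero (hd : 0 < d) (hs : S.IsStabilization s) (hu : S.IsSolution f u)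
    (huh : S.IsDiscreteSolution s f uh) (hv : S.MemP S.p v) (hv' : S.MemH1D v) :
    S.bh₀ (u - uh) v = 0 := by
  have hT : S.MemH1T uh := memH1T_of_memP huh.1
  rw [sub_eq_add_smul, bh₀_left hd hu.1.memH1T hT hv'.memH1T, bh₀_eq_b hd hu.1 hv', hu.2 v hv',
    ← bh_eq_bh₀ hs hT hv', huh.2 v hv]
  ring

/-- Weak gradients are chosen representatives, so homogeneity holds almost everywhere only; it is
read off from the rule for v + c v' with v' = v and c = t - 1. -/
theorem normA_wgrad_smul (hv : MemH1 S.Ω v) {t : ℝ} (ht : 0 ≤ t) :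
    S.normA (wgrad S.Ω ((t : ℂ) • v)) = t * S.normA (wgrad S.Ω v) := by
  have e : (t : ℂ) • v = v + ((t : ℂ) - 1) • v := by rw [sub_smul, one_smul]; abel
  have h := wgrad_add_smul isOpen_omega hv hv ((t : ℂ) - 1)
  rw [← e] at h
  rw [normA, normA, ← Real.sqrt_sq ht, ← Real.sqrt_mul (sq_nonneg t), Finset.mul_sum,
    Real.sqrt_sq ht]
  congr 1
  refine Finset.sum_congr rfl fun K hK => ?_
  rw [← integral_const_mul]
  refine integral_congr_ae ?_
  filter_upwards [ae_cell h hK] with x hx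
  have hx' : wgrad S.Ω ((t : ℂ) • v) x = (t : ℂ) • wgrad S.Ω v x := by
    rw [hx, sub_smul, one_smul]; abel
  rw [hx', Matrix.mulVec_smul, smul_dotProduct, star_smul, dotProduct_smul, smul_smul,
    star_ofReal_fun, smul_eq_mul, ← Complex.ofReal_mul, Complex.re_ofReal_mul, sq]

theorem wgrad_eq_zero_of_normA (hd : 0 < d) (hσ : MemL2Vec S.Ω σ) (h : S.normA σ = 0) :
    ∀ K ∈ S.cells, ∀ᵐ x ∂(volume.restrict (cell K)), σ x = 0 := by
  have h0 := normA_sq (S := S) σ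
  rw [h, zero_pow two_ne_zero] at h0
  have h1 := (Finset.sum_eq_zero_iff_of_nonneg fun K hK =>
    integral_nonneg fun x => re_form_nonneg (S.A_posDef K hK) (σ x)).1 h0.symm
  intro K hK
  have h2 := (integral_eq_zero_iff_of_nonneg (fun x => re_form_nonneg (S.A_posDef K hK) (σ x))
    (integrable_re_form hσ (S.Ac K) hK)).1 (h1 K hK)
  filter_upwards [h2] with x hx
  have h3 := α_mul_le_re_form hK (σ x)
  have h4 : ((S.Ac K *ᵥ σ x) ⬝ᵥ star (σ x)).re = 0 := hx
  rw [h4] at h3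
  have h5 : ∑ i, ‖σ x i‖ ^ 2 ≤ 0 := nonpos_of_mul_nonpos_right h3 (α_pos hd hK)
  have h6 := (Finset.sum_eq_zero_iff_of_nonneg fun i _ => sq_nonneg ‖σ x i‖).1
    (le_antisymm h5 (Finset.sum_nonneg fun i _ => sq_nonneg _))
  ext i
  simpa using h6 i (Finset.mem_univ i)

/-- Such a function is constant on each element, hence a polynomial of degree 0 there. -/
theorem memP_of_normA_wgrad_eq_zero (hd : 0 < d) (hv : MemH1 S.Ω v)
    (h : S.normA (wgrad S.Ω v) = 0) (p : ℕ) : S.MemP p v := by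
  intro K hK
  have h1 := wgrad_eq_zero_of_normA hd (wgrad_spec hv).1 h K hK
  obtain ⟨c, hc⟩ := (S.isSimplex hK).ae_const_of_wgrad (hv.mono (cell_subset_omega hK)) (by
    filter_upwards [h1, wgrad_mono (isOpen_cell K) (cell_subset_omega hK) hv] with x hx hx'
    rw [hx', hx])
  refine ⟨MvPolynomial.C c, by simp, ?_⟩
  filter_upwards [hc] with x hx
  simp [hx]

/-- The residual norm is a supremum over functions with unit gradient, so v is rescaled. If its
gradient vanishes, rescaling is impossible, but then v is piecewise constant and Galerkin
orthogonality makes the left side zero; no Poincaré inequality is needed. -/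
theorem norm_bh₀_error_le (hd : 1 < d) (hs : S.IsStabilization s) (hu : S.IsSolution f u)
    (huh : S.IsDiscreteSolution s f uh) (hv : S.MemH1D v) :
    ENNReal.ofReal ‖S.bh₀ (u - uh) v‖ ≤ S.Rr s (u - uh) * ENNReal.ofReal (S.dag1 v) := by
  have hd0 : 0 < d := by omega
  have hT : S.MemH1T (u - uh) := hu.1.memH1T.sub (memH1T_of_memP huh.1)
  set a := S.normA (wgrad S.Ω v) with ha
  have ha0 : 0 ≤ a := Real.sqrt_nonneg _
  rcases ha0.eq_or_lt with h0 | h0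
  · rw [bh₀_error_eq_zero hd0 hs hu huh (memP_of_normA_wgrad_eq_zero hd0 hv.1 h0.symm _) hv]
    simp
  · have hw : S.MemH1D (((a⁻¹ : ℝ) : ℂ) • v) := by
      have := (memH1D_zero (S := S) hd0).add_smul hd0 hv ((a⁻¹ : ℝ) : ℂ)
      rwa [zero_add] at this
    have h1 : S.normA (wgrad S.Ω (((a⁻¹ : ℝ) : ℂ) • v)) = 1 := by
      rw [normA_wgrad_smul hv.1 (by positivity), ← ha, inv_mul_cancel₀ h0.ne']
    have h2 : ENNReal.ofReal ‖S.bh s (u - uh) (((a⁻¹ : ℝ) : ℂ) • v)‖ ≤ S.Rr s (u - uh) :=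
      le_iSup₂_of_le (((a⁻¹ : ℝ) : ℂ) • v) ⟨hw, h1⟩ le_rfl
    have e0 : v + (((a⁻¹ : ℝ) : ℂ) - 1) • v = ((a⁻¹ : ℝ) : ℂ) • v := by
      rw [sub_smul, one_smul]; abel
    have h3 : S.bh₀ (u - uh) (((a⁻¹ : ℝ) : ℂ) • v) = ((a⁻¹ : ℝ) : ℂ) * S.bh₀ (u - uh) v := by
      rw [← e0, bh₀_right hd0 hT hv.memH1T hv.memH1T, star_sub, star_one, star_ofReal_fun]
      ring
    rw [bh_eq_bh₀ hs hT hw, h3, norm_mul, Complex.norm_real, Real.norm_of_nonneg (by positivity)]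
      at h2
    have h4 : ‖S.bh₀ (u - uh) v‖ = (a⁻¹ * ‖S.bh₀ (u - uh) v‖) * a := by field_simp
    rw [h4, ENNReal.ofReal_mul (by positivity)]
    exact mul_le_mul' h2 (ENNReal.ofReal_le_ofReal
      ((normA_le_energy v).trans (energy_le_dag1 hd hv)))

/-- By Galerkin orthogonality any conforming discrete function may be subtracted from ξ before the
residual bound is applied. Passing to the infimum requires a finite factor, so an infinite residual
norm is treated separately. -/
theorem norm_bh₀_error_le_errhg (hd : 1 < d) (hs : S.IsStabilization s) (hu : S.IsSolution f u)
    (huh : S.IsDiscreteSolution s f uh) (hξ : S.MemH1D ξ) :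
    ENNReal.ofReal ‖S.bh₀ (u - uh) ξ‖ ≤ S.Rr s (u - uh) * S.errhg ξ := by
  have hd0 : 0 < d := by omega
  have hT : S.MemH1T (u - uh) := hu.1.memH1T.sub (memH1T_of_memP huh.1)
  have hne : ∃ vh, S.MemP S.p vh ∧ S.MemH1D vh := ⟨0, memP_zero, memH1D_zero hd0⟩
  have hG : ∀ vh, S.MemP S.p vh ∧ S.MemH1D vh → S.bh₀ (u - uh) (ξ - vh) = S.bh₀ (u - uh) ξ := by
    intro vh h
    rw [sub_eq_add_smul ξ, bh₀_right hd0 hT hξ.memH1T h.2.memH1T,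
      bh₀_error_eq_zero hd0 hs hu huh h.1 h.2, mul_zero, add_zero]
  by_cases hR : S.Rr s (u - uh) = ∞
  -- Because ∞ · 0 = 0 here, the left side must really be shown to vanish when ξ is a limit of
  -- discrete conforming functions; continuity in the mesh-dependent norm does this.
  · by_cases h0 : S.errhg ξ = 0
    · set C := S.ω * S.normμ (u - uh) + √S.ω * S.normγ (S.extTrace (u - uh)) +
        S.normA (S.G (u - uh)) with hC
      have hC0 : 0 ≤ C := by
        have := S.ω_pos
        have n1 : 0 ≤ S.normμ (u - uh) := Real.sqrt_nonneg _
        have n2 : 0 ≤ S.normγ (S.extTrace (u - uh)) := Real.sqrt_nonneg _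
        have n3 : 0 ≤ S.normA (S.G (u - uh)) := Real.sqrt_nonneg _
        positivity
      have := le_mul_biInf (a := ENNReal.ofReal C) (x := ENNReal.ofReal ‖S.bh₀ (u - uh) ξ‖)
        ENNReal.ofReal_ne_top hne
        (f := fun vh => ENNReal.ofReal (S.dag1 (ξ - vh))) fun vh h => by
          rw [← hG vh h, ← ENNReal.ofReal_mul hC0]
          exact ENNReal.ofReal_le_ofReal (norm_bh₀_le hd hT (hξ.sub hd0 h.2))
      have h1 : (⨅ (vh) (_ : S.MemP S.p vh ∧ S.MemH1D vh),
        ENNReal.ofReal (S.dag1 (ξ - vh))) = 0 := h0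
      rw [h1, mul_zero] at this
      exact this.trans zero_le
    · rw [hR, ENNReal.top_mul h0]
      exact le_top
  · refine le_mul_biInf hR hne fun vh h => ?_
    rw [← hG vh h]
    exact norm_bh₀_error_le hd hs hu huh (hξ.sub hd0 h.2)

theorem memX_zero : S.MemX 0 := by
  have h0 : IsWeakDiv S.Ω (0 : E d → Fin d → ℂ) 0 := fun φ _ => by simp
  have h1 : MemL2 S.Ω (0 : E d → ℂ) := MemLp.zero
  refine ⟨⟨fun _ => MemLp.zero, 0, h1, h0⟩, 0, fun _ _ => MemLp.zero, fun v _ => ?_⟩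
  rw [← l2_conj, l2_congr_right (wdiv_ae_eq isOpen_omega h1 h0)]
  simp [l2Vec, l2, l2R]

/-- The defect vanishes when its first argument is conforming or its second is a discrete field of
X_{Γ_N}. So u may be dropped, a conforming z subtracted from u_h and a discrete σ from τ,
independently of each other, before the product bound is applied. -/
theorem norm_defect_error_le (hd : 1 < d) (hu : S.MemH1D u) (huh : S.MemH1T uh) (hτ : S.MemX τ) :
    ENNReal.ofReal ‖S.defect (u - uh) τ‖ ≤ S.errg uh * S.errhd τ := by
  have hd0 : 0 < d := by omega
  have key : ∀ z, S.MemH1D z → ∀ σ, S.MemPVec S.p σ ∧ S.MemX σ →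
      ‖S.defect (u - uh) τ‖ ≤ S.dag1 (uh - z) * S.dagDiv (τ - σ) := by
    intro z hz σ hσ
    have hT : S.MemH1T (uh - z) := huh.sub hz.memH1T
    have e1 : τ - σ = τ + (-1 : ℂ) • σ := by rw [neg_one_smul, sub_eq_add_neg]
    have hX : S.MemX (τ - σ) := e1 ▸ hτ.add_smul hd0 hσ.2 (-1)
    have e2 : S.defect (uh - z) (τ - σ) = S.defect uh τ := by
      rw [e1, defect_right hd0 hT hτ hσ.2, defect_eq_zero_of_memPVec hd0 hT hσ.1 hσ.2, mul_zero,
        add_zero, sub_eq_add_smul, defect_left hd0 huh hz.memH1T hτ,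
        defect_eq_zero_of_memH1D hd0 hz hτ, mul_zero, add_zero]
    have e3 : S.defect (u - uh) τ = -S.defect uh τ := by
      rw [sub_eq_add_smul, defect_left hd0 hu.memH1T huh hτ, defect_eq_zero_of_memH1D hd0 hu hτ]
      ring
    rw [e3, norm_neg, ← e2]
    exact norm_defect_le hd hT hX
  -- The distance is finite because z = 0 is admissible; this justifies moving the infimum over σ
  -- out of the product.
  have hz : S.errg uh ≠ ∞ := ne_top_of_le_ne_top ENNReal.ofReal_ne_top
    (iInf₂_le (0 : E d → ℂ) (memH1D_zero hd0))
  refine le_mul_biInf hz ⟨0, fun _ => memP_zero, memX_zero⟩ fun σ hσ => ?_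
  rw [mul_comm]
  refine le_mul_biInf ENNReal.ofReal_ne_top ⟨0, memH1D_zero hd0⟩ fun z hz => ?_
  rw [mul_comm, ← ENNReal.ofReal_mul (dag1_nonneg _)]
  exact ENNReal.ofReal_le_ofReal (key z hz σ hσ)

/-- The duality argument. -/
theorem norm_dual_le (hd : 1 < d) (hs : S.IsStabilization s) (hu : S.IsSolution f u)
    (huh : S.IsDiscreteSolution s f uh) (hq : MemL2 S.Ω q) (hr : S.MemL2R r)
    (hξ : S.IsAdjoint q r ξ) :
    ENNReal.ofReal ‖S.l2 (u - uh) q + S.l2R (S.extTrace (u - uh)) r‖ ≤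
      S.errhg ξ * S.Rr s (u - uh) + S.errhd (S.mulA (wgrad S.Ω ξ)) * S.errg uh := by
  have hd0 : 0 < d := by omega
  have hTh : S.MemH1T uh := memH1T_of_memP huh.1
  have hT : S.MemH1T (u - uh) := hu.1.memH1T.sub hTh
  have h := defect_flux hd0 hq hr hξ hT
  have e : S.l2 (u - uh) q + S.l2R (S.extTrace (u - uh)) r =
      S.bh₀ (u - uh) ξ - S.defect (u - uh) (S.mulA (wgrad S.Ω ξ)) := by
    rw [h]; ring
  rw [e, mul_comm (S.errhg ξ), mul_comm (S.errhd _)]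
  refine (ENNReal.ofReal_le_ofReal (norm_sub_le _ _)).trans ?_
  rw [ENNReal.ofReal_add (norm_nonneg _) (norm_nonneg _)]
  exact add_le_add (norm_bh₀_error_le_errhg hd hs hu huh hξ.1)
    (norm_defect_error_le hd hu.1 hTh (memX_flux hd0 hq hr hξ))

theorem normμ_smul (v : E d → ℂ) {t : ℝ} (ht : 0 ≤ t) :
    S.normμ ((t : ℂ) • v) = t * S.normμ v := by
  rw [normμ, normμ]
  conv_rhs => rw [← Real.sqrt_sq ht]
  rw [← Real.sqrt_mul (sq_nonneg t), Finset.mul_sum]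
  congr 1
  refine Finset.sum_congr rfl fun K _ => ?_
  simp only [Pi.smul_apply, smul_eq_mul, norm_mul, mul_pow, Complex.norm_real, Real.norm_eq_abs,
    sq_abs]
  rw [integral_const_mul]
  ring

theorem normγ_smul (Ψ : FaceFun d) {t : ℝ} (ht : 0 ≤ t) :
    S.normγ ((t : ℂ) • Ψ) = t * S.normγ Ψ := by
  rw [normγ, normγ]
  conv_rhs => rw [← Real.sqrt_sq ht]
  rw [← Real.sqrt_mul (sq_nonneg t), Finset.mul_sum]
  congr 1
  refine Finset.sum_congr rfl fun K _ => ?_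
  simp only [Pi.smul_apply, smul_eq_mul, norm_mul, mul_pow, Complex.norm_real, Real.norm_eq_abs,
    sq_abs]
  rw [integral_const_mul]
  ring

theorem l2μ_smul_right (φ v : E d → ℂ) (t : ℝ) : S.l2μ φ ((t : ℂ) • v) = t * S.l2μ φ v := by
  rw [l2μ, l2μ, Finset.mul_sum]
  refine Finset.sum_congr rfl fun K _ => ?_
  rw [mul_left_comm, ← integral_const_mul (t : ℂ)]
  congr 1
  refine integral_congr_ae (.of_forall fun x => ?_)
  simp only [Pi.smul_apply, smul_eq_mul, star_mul', star_ofReal_fun]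
  ring

theorem l2γ_smul_right (Φ Ψ : FaceFun d) (t : ℝ) : S.l2γ Φ ((t : ℂ) • Ψ) = t * S.l2γ Φ Ψ := by
  rw [l2γ, l2γ, Finset.mul_sum]
  refine Finset.sum_congr rfl fun K _ => ?_
  rw [mul_left_comm, ← integral_const_mul (t : ℂ)]
  congr 1
  refine integral_congr_ae (.of_forall fun x => ?_)
  simp only [Pi.smul_apply, smul_eq_mul, star_mul', star_ofReal_fun]
  ring

/-- The energy norm controls ω‖v‖_μ, so the functional ω(μ ·, ψ) is bounded with constant ‖ψ‖_μ.
Existence matters: without an adjoint solution the supremum in the approximation factor would say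
nothing about ψ. -/
theorem exists_dualVol (hd : 0 < d) (hwp : S.WellPosed) {ψ : E d → ℂ} (hψ : MemL2 S.Ω ψ) :
    ∃ z, S.IsDualVol ψ z := by
  refine exists_adjoint_solution hd hwp (fun w => S.ω * S.l2μ w ψ) ?_ (S.normμ ψ) ?_
  · intro v v' c hv hv'
    rw [l2μ_left (c := c) hv.1.1 hv'.1.1 hψ (ae_add_smul_apply _ _ _)]
    ring
  · intro v hv
    have h1 := norm_l2μ_le_mul hv.1.1 hψ
    have h2 := ω_mul_normμ_le (S := S) v
    have h3 : 0 ≤ S.normμ ψ := Real.sqrt_nonneg _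
    rw [norm_mul, Complex.norm_real, Real.norm_of_nonneg S.ω_pos.le]
    nlinarith [mul_le_mul_of_nonneg_left h1 S.ω_pos.le, mul_le_mul_of_nonneg_left h2 h3]

/-- The energy norm controls ω^{1/2}‖v‖_γ on the Robin faces, which bounds the boundary functional
by ‖Ψ‖_γ. -/
theorem exists_dualBd (hd : 0 < d) (hwp : S.WellPosed) {Ψ : FaceFun d} (hΨ : S.MemL2R Ψ) :
    ∃ z, S.IsDualBd Ψ z := by
  refine exists_adjoint_solution hd hwp (fun w => (√S.ω : ℝ) * S.l2γ (S.extTrace w) Ψ) ?_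
    (S.normγ Ψ) ?_
  · intro v v' c hv hv'
    rw [l2γ_left (memL2R_extTrace hd hv.memH1T) (memL2R_extTrace hd hv'.memH1T) hΨ
      (ae_extTrace_add_smul hd hv.memH1T hv'.memH1T c)]
    ring
  · intro v hv
    have h1 := norm_l2γ_le_mul (memL2R_extTrace hd hv.memH1T) hΨ
    have h2 := sqrt_ω_mul_normγ_le (S := S) v
    have h3 : 0 ≤ S.normγ Ψ := Real.sqrt_nonneg _
    rw [norm_mul, Complex.norm_real, Real.norm_of_nonneg (Real.sqrt_nonneg _)]
    nlinarith [mul_le_mul_of_nonneg_left h1 (Real.sqrt_nonneg S.ω),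
      mul_le_mul_of_nonneg_left h2 h3]

/-- Use the adjoint solution for the normalised error ψ = e/‖e‖_μ, that is, with volume density q =
ωμψ and Robin density 0. If the error norm is zero, nothing is to be proved. -/
theorem norm_error_vol_le (hd : 1 < d) (hwp : S.WellPosed) (hs : S.IsStabilization s)
    (hu : S.IsSolution f u) (huh : S.IsDiscreteSolution s f uh) :
    ENNReal.ofReal (S.ω * S.normμ (u - uh)) ≤ S.γbaVol * S.R s u uh := by
  have hd0 : 0 < d := by omega
  have hT : S.MemH1T (u - uh) := hu.1.memH1T.sub (memH1T_of_memP huh.1)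
  have hN : 0 ≤ S.normμ (u - uh) := Real.sqrt_nonneg _
  rcases hN.eq_or_lt with h0 | h0
  · rw [← h0]; simp
  set N := S.normμ (u - uh) with hNdef
  have hψ : MemL2 S.Ω (((N⁻¹ : ℝ) : ℂ) • (u - uh)) := hT.1.const_smul _
  have hψ1 : S.normμ (((N⁻¹ : ℝ) : ℂ) • (u - uh)) = 1 := by
    rw [normμ_smul _ (by positivity), ← hNdef, inv_mul_cancel₀ h0.ne']
  obtain ⟨z, hz⟩ := exists_dualVol hd0 hwp hψ
  set ψ := ((N⁻¹ : ℝ) : ℂ) • (u - uh) with hψdef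
  have hq : MemL2 S.Ω (S.mulμ ((S.ω : ℂ) • ψ)) := memL2_mulμ (hψ.const_smul _)
  have hl : ∀ w, S.l2 w (S.mulμ ((S.ω : ℂ) • ψ)) + S.l2R (S.extTrace w) 0 = S.ω * S.l2μ w ψ :=
    fun w => by rw [l2_mulμ_right, l2μ_smul_right]; simp [l2R]
  have hadj : S.IsAdjoint (S.mulμ ((S.ω : ℂ) • ψ)) 0 z :=
    ⟨hz.1, fun w hw => (hz.2 w hw).trans (hl w).symm⟩
  have h0R : S.MemL2R 0 := fun _ _ => MemLp.zero
  have h := norm_dual_le hd hs hu huh hq h0R hadj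
  have e : S.ω * S.l2μ (u - uh) ψ = ((S.ω * N : ℝ) : ℂ) := by
    rw [hψdef, l2μ_smul_right, l2μ_self, ← hNdef, ← Complex.ofReal_mul, ← Complex.ofReal_mul]
    congr 1
    field_simp
  rw [hl, e, Complex.norm_real, Real.norm_of_nonneg (mul_nonneg S.ω_pos.le hN)] at h
  -- The two best-approximation errors are bounded by their suprema over normalised data before the
  -- Cauchy–Schwarz inequality in ℝ² combines them with R_r and R_c.
  refine h.trans (le_trans (add_le_add (mul_le_mul_left ?_ _) (mul_le_mul_left ?_ _))
    (mul_add_mul_le_rpow _ _ _ _))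
  · exact le_iSup₂_of_le ψ z (le_iSup_of_le ⟨hψ, hψ1, hz⟩ le_rfl)
  · exact le_iSup₂_of_le ψ z (le_iSup_of_le ⟨hψ, hψ1, hz⟩ le_rfl)

/-- The same argument with the normalised Robin trace of the error as datum: volume density 0 and
Robin density ω^{1/2}γΨ. -/
theorem norm_error_bd_le (hd : 1 < d) (hwp : S.WellPosed) (hs : S.IsStabilization s)
    (hu : S.IsSolution f u) (huh : S.IsDiscreteSolution s f uh) :
    ENNReal.ofReal (√S.ω * S.normγ (S.extTrace (u - uh))) ≤ S.γbaBd * S.R s u uh := by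
  have hd0 : 0 < d := by omega
  have hT : S.MemH1T (u - uh) := hu.1.memH1T.sub (memH1T_of_memP huh.1)
  have hN : 0 ≤ S.normγ (S.extTrace (u - uh)) := Real.sqrt_nonneg _
  rcases hN.eq_or_lt with h0 | h0
  · rw [← h0]; simp
  set N := S.normγ (S.extTrace (u - uh)) with hNdef
  have hΨ : S.MemL2R (((N⁻¹ : ℝ) : ℂ) • S.extTrace (u - uh)) := fun F hF =>
    (memL2R_extTrace hd0 hT F hF).const_smul ((N⁻¹ : ℝ) : ℂ)
  have hΨ1 : S.normγ (((N⁻¹ : ℝ) : ℂ) • S.extTrace (u - uh)) = 1 := by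
    rw [normγ_smul _ (by positivity), ← hNdef, inv_mul_cancel₀ h0.ne']
  obtain ⟨z, hz⟩ := exists_dualBd hd0 hwp hΨ
  set Ψ := ((N⁻¹ : ℝ) : ℂ) • S.extTrace (u - uh) with hΨdef
  have hr : S.MemL2R (S.mulγ (((√S.ω : ℝ) : ℂ) • Ψ)) :=
    memL2R_mulγ fun F hF => (hΨ F hF).const_smul ((√S.ω : ℝ) : ℂ)
  have hl : ∀ w, S.l2 w 0 + S.l2R (S.extTrace w) (S.mulγ (((√S.ω : ℝ) : ℂ) • Ψ)) =
      (√S.ω : ℝ) * S.l2γ (S.extTrace w) Ψ :=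
    fun w => by rw [l2R_mulγ_right, l2γ_smul_right]; simp [l2]
  have hadj : S.IsAdjoint 0 (S.mulγ (((√S.ω : ℝ) : ℂ) • Ψ)) z :=
    ⟨hz.1, fun w hw => (hz.2 w hw).trans (hl w).symm⟩
  have h0L : MemL2 S.Ω (0 : E d → ℂ) := MemLp.zero
  have h := norm_dual_le hd hs hu huh h0L hr hadj
  have e : (√S.ω : ℝ) * S.l2γ (S.extTrace (u - uh)) Ψ = ((√S.ω * N : ℝ) : ℂ) := by
    rw [hΨdef, l2γ_smul_right, l2γ_self, ← hNdef, ← Complex.ofReal_mul, ← Complex.ofReal_mul]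
    congr 1
    field_simp
  rw [hl, e, Complex.norm_real, Real.norm_of_nonneg (mul_nonneg (Real.sqrt_nonneg _) hN)] at h
  refine h.trans (le_trans (add_le_add (mul_le_mul_left ?_ _) (mul_le_mul_left ?_ _))
    (mul_add_mul_le_rpow _ _ _ _))
  · exact le_iSup₂_of_le Ψ z (le_iSup_of_le ⟨hΨ, hΨ1, hz⟩ le_rfl)
  · exact le_iSup₂_of_le Ψ z (le_iSup_of_le ⟨hΨ, hΨ1, hz⟩ le_rfl)

end Setting

end

end IPDG

theorem lemma5p1 {d : ℕ} (hd : d = 2 ∨ d = 3) (S : IPDG.Setting d) (hwp : S.WellPosed)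
    (s : (IPDG.E d → ℂ) → (IPDG.E d → ℂ) → ℂ) (hs : S.IsStabilization s)
    (f : IPDG.E d → ℂ) (hf : IPDG.MemL2 S.Ω f)
    (u : IPDG.E d → ℂ) (hu : S.IsSolution f u)
    (uh : IPDG.E d → ℂ) (huh : S.IsDiscreteSolution s f uh) :
    ENNReal.ofReal (S.ω * S.normμ (u - uh)) ≤ S.γbaVol * S.R s u uh ∧
    ENNReal.ofReal (√S.ω * S.normγ (S.extTrace (u - uh))) ≤ S.γbaBd * S.R s u uh := by
  have hd1 : 1 < d := by omega
  exact ⟨IPDG.Setting.norm_error_vol_le hd1 hwp hs hu huh,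
    IPDG.Setting.norm_error_bd_le hd1 hwp hs hu huh⟩
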